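/- **Setting.** Let $N\ge 1$, let $m>N+1$ be an integer, let $\mathbb T^N=\mathbb R^N/\mathbb Z^N$, and let $F=H^{2m}(\mathbb T^N;\mathbb R^N)$ with norm $\|\mathbf e\|_F=\big(\sum_{|\alpha|\le 2m}\sum_i\|\partial^\alpha\mathbf e_i\|_{L^2}^2\big)^{1/2}$; elements of $F$ are identified with their continuous representatives. Let $D=D([0,\infty);F)$ be the set of càdlàg paths, with the $\sigma$-algebra generated by the coordinates $E_t(\omega)=\omega(t)$, and let $\mathcal F_t=\sigma(E_s,\,s\le t)$. A *transition function* on a space $S$ is a family $(P_t)_{t\ge0}$ of probability kernels on $S$ with $P_0=\mathrm{Id}$, measurable in $(t,x)$, and with $P_{t+s}(x,B)=\int P_s(y,B)P_t(x,dy)$. An adapted process $X$ is a *time-homogeneous Markov process* with transition function $P$ with respect to a filtration $(\mathcal F_t)$ if $\mathbb P(X_{t+s}\in B\mid\mathcal F_t)=P_s(X_t,B)$ a.s. for all $s,t\ge 0$ and all measurable $B$. **Mixing force field.** Let $(\bar E_t)_{t\ge0}$ be a càdlàg stationary Markov process on $F$ (with respect to its own filtration) with transition function $P$, and for $\mathbf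 e\in F$ let $\mathbb P_{\mathbf e}$ be a probability measure on $D$, depending measurably on $\mathbf e$, under which $(E_t)$ is Markov with respect to $(\mathcal F_t)$, with transition function $P$, and $E_0=\mathbf e$ a.s. We write $E_t(\mathbf e)$ for $(E_t)$ under $\mathbb P_{\mathbf e}$. Then $(\bar E_t)$ is a mixing force field if there is $R\ge 0$ such that, with $\bar B_R$ the closed ball of radius $R$ in $F$: 1. for every $\mathbf e\in\bar B_R$, a.s. $\|E_t(\mathbf e)\|_F\le R$ for all $t\ge 0$; 2. the law of $\bar E_t$ is supported in $\bar B_R$ and $\mathbb E[\bar E_t]=0$; 3. there is a continuous, non-increasing, positive $\gamma$ on $[0,\infty)$ with $\int_0^\infty\gamma=1$ such that, for all probability measures $\mu,\mu'$ on $F$ supported in $\bar B_R$, the processes $E_t(\mathbf e_0)$, $E_t(\mathbf e_0')$ with initial laws $\mu,\mu'$ admit a coupling with $\mathbb E\|E^*_t(\mathbf e_0)-E^*_t(\mathbf e_0')\|_F\le R\,\gamma(t)$ for all $t\ge 0$; 4. let $R_0(\mathbf e)=\int_0^\infty\mathbb E[E_t(\mathbf e)]\,dt$ and let $A$ be the generator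 of $(P_t)$ on $\bar B_R$: $A\varphi=\psi$ if $\varphi,\psi$ are continuous and bounded on $\bar B_R$, the quotients $t^{-1}(P_t\varphi-\varphi)$, $0<t<1$, are uniformly bounded on $\bar B_R$, and they converge pointwise to $\psi$ as $t\to0^+$. There is $C\ge0$ such that for every continuous linear form $\Lambda$ on $F$, with $\varphi_\Lambda=\Lambda\circ R_0$, both $\varphi_\Lambda$ and $|\varphi_\Lambda|^2$ are in the domain of $A$, and $|A|\varphi_\Lambda|^2|\le C\|\Lambda\|^2$, $|A\varphi_\Lambda|\le C\|\Lambda\|$ on $\bar B_R$. **Mild solutions.** Consider $\partial_t f+v\cdot\nabla_x f+E(t,x)\cdot\nabla_v f=Qf$ on $\mathbb T^N\times\mathbb R^N$, where $t\mapsto E(t)\in F$ is càdlàg and $Q$ is either $Q_{\mathrm{LB}}f=\rho(f)M-f$, with $\rho(f)=\int f\,dv$ and $M(v)=(2\pi)^{-N/2}e^{-|v|^2/2}$, or $Q_{\mathrm{FP}}f=\mathrm{div}_v(\nabla_vf+vf)$. A mild solution with initial datum $f\in L^1(\mathbb T^N\times\mathbb R^N)$ is a continuous map $t\mapsto f_t$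 from $[0,\infty)$ to $L^1(\mathbb T^N\times\mathbb R^N)$ such that, for all $t\ge0$, * (LB) $f_t=e^{-t}f\circ\Phi_{0,t}^{-1}+\int_0^te^{-(t-s)}[\rho(f_s)M]\circ\Phi_{s,t}^{-1}\,ds$, where $\Phi_{s,t}$ is the flow from time $s$ to time $t$ of $\dot X=V$, $\dot V=E(t,X)$; * (FP) $f_t=K_tf+\int_0^t\nabla_wK_{t-s}[E(s)f_s]\,ds$, where $K_t(x,v;y,w)$ is the transition density on $\mathbb T^N\times\mathbb R^N$, from $(y,w)$ to $(x,v)$, of $dX=V\,dt$, $dV=-V\,dt+\sqrt2\,dB$, where $K_tf=\iint K_t(\cdot;y,w)f(y,w)\,dy\,dw$ for $t>0$ and $K_0f=f$, and where $\nabla_wK_t[\mathbf e f]=\iint\nabla_wK_t(\cdot;y,w)\cdot\mathbf e(y)f(y,w)\,dy\,dw$. **Theorem (Markov property).** Let $(\bar E_t)$ be a mixing force field, let $Q$ be $Q_{\mathrm{LB}}$ or $Q_{\mathrm{FP}}$, and let $\mathcal X=L^1(\mathbb T^N\times\mathbb R^N)\times F$. For every $f\in L^1(\mathbb T^N\times\mathbb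 R^N)$ and every càdlàg path $E$ with values in $F$ there is exactly one mild solution with initial datum $f$ and forcing $E$. For $(f,\mathbf e)\in\mathcal X$ let $f_t$ be the mild solution with initial datum $f$ and forcing $E_t(\mathbf e)$. Then $(f_t,E_t(\mathbf e))_{t\ge0}$ is a time-homogeneous Markov process over $\mathcal X$: there is a transition function on $\mathcal X$ such that, for every $(f,\mathbf e)\in\mathcal X$, the process $(f_t,E_t(\mathbf e))_{t\ge0}$ starts from $(f,\mathbf e)$ a.s. and is Markov with respect to $(\mathcal F_t)$ under $\mathbb P_{\mathbf e}$ with this transition function. -/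

import Mathlib

open MeasureTheory ProbabilityTheory Set Filter Topology
open scoped NNReal ENNReal

noncomputable section

namespace StochKinetic

/-! ### The torus, the phase space and the Sobolev space of force fields -/

/-- The torus `𝕋ᴺ = ℝᴺ / ℤᴺ`, with its Lebesgue measure `volume` of total mass one. -/
abbrev Torus (N : ℕ) : Type := UnitAddTorus (Fin N)

/-- Euclidean space `ℝᴺ`. -/
abbrev Vel (N : ℕ) : Type := EuclideanSpace ℝ (Fin N)

/-- The phase space `𝕋ᴺ × ℝᴺ`, with its Lebesgue measure `volume`. -/
abbrev Phase (N : ℕ) : Type := Torus N × Vel N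

/-- The canonical projection `ℝᴺ → 𝕋ᴺ`. -/
def torusProj {N : ℕ} (y : Vel N) : Torus N := fun i => ((y i : ℝ) : UnitAddCircle)

/-- Smoothness of a real function on the torus: its periodic lift to `ℝᴺ` is smooth. -/
def IsSmoothOnTorus {N : ℕ} (φ : Torus N → ℝ) : Prop :=
  ContDiff ℝ (⊤ : ℕ∞) (fun y : Vel N => φ (torusProj y))

/-- The partial derivative `∂ᵢφ` of a function on the torus. -/
def torusPartial {N : ℕ} (i : Fin N) (φ : Torus N → ℝ) (x : Torus N) : ℝ :=
  deriv (fun h : ℝ => φ (x + Pi.single i (h : UnitAddCircle))) 0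

/-- `L²(𝕋ᴺ; ℝᴺ)`. -/
abbrev L2Field (N : ℕ) : Type := Lp (Vel N) 2 (volume : Measure (Torus N))

/-- `g' = ∂ᵢ g` in the weak sense on `𝕋ᴺ`. -/
def IsWeakPartial {N : ℕ} (i : Fin N) (g g' : L2Field N) : Prop :=
  ∀ φ : Torus N → ℝ, IsSmoothOnTorus φ →
    ∫ x, torusPartial i φ x • g x = - ∫ x, φ x • g' x

/-- Multi-indices `α ∈ ℕᴺ` with `|α| ≤ k`. -/
abbrev MultiIndex (N k : ℕ) : Type :=
  {α : Fin N → Fin (k + 1) // ∑ i, (α i : ℕ) ≤ k}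

/-- The multi-index `0`. -/
def MultiIndex.zero (N k : ℕ) : MultiIndex N k := ⟨fun _ => 0, by simp⟩

/-- `β = α + eᵢ`. -/
def MultiIndex.IsSucc {N k : ℕ} (i : Fin N) (α β : MultiIndex N k) : Prop :=
  ∀ j, (β.1 j : ℕ) = (α.1 j : ℕ) + if j = i then 1 else 0

theorem continuous_torusProj (N : ℕ) : Continuous (torusProj (N := N)) := by
  refine continuous_pi fun i => ?_
  exact (AddCircle.continuous_mk' (1 : ℝ)).comp (by fun_prop)

theorem isOpenQuotientMap_torusProj (N : ℕ) : IsOpenQuotientMap (torusProj (N := N)) := by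
  have h1 : IsOpenQuotientMap (Pi.map (fun (_ : Fin N) (y : ℝ) => (y : UnitAddCircle))) :=
    IsOpenQuotientMap.piMap fun _ => QuotientAddGroup.isOpenQuotientMap_mk
  exact h1.comp (EuclideanSpace.equiv (Fin N) ℝ).toHomeomorph.isOpenQuotientMap

theorem IsSmoothOnTorus.continuous {N : ℕ} {φ : Torus N → ℝ} (h : IsSmoothOnTorus φ) :
    Continuous φ :=
  (isOpenQuotientMap_torusProj N).isQuotientMap.continuous_iff.2 (ContDiff.continuous h)

theorem torusPartial_torusProj {N : ℕ} {φ : Torus N → ℝ} (h : IsSmoothOnTorus φ) (i : Fin N)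
    (y : Vel N) : torusPartial i φ (torusProj y) =
      fderiv ℝ (fun y : Vel N => φ (torusProj y)) y (EuclideanSpace.single i 1) := by
  have hd : DifferentiableAt ℝ (fun y : Vel N => φ (torusProj y)) y :=
    (ContDiff.differentiable h (by simp)) y
  have hl := hd.hasFDerivAt.hasLineDerivAt (EuclideanSpace.single i (1 : ℝ))
  rw [← hl.lineDeriv, lineDeriv, torusPartial]
  congr 1
  funext s
  congr 1
  funext j
  by_cases hj : j = i
  · subst hj; simp [torusProj]
  · simp [torusProj, hj]

theorem IsSmoothOnTorus.continuous_torusPartial {N : ℕ} {φ : Torus N → ℝ}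
    (h : IsSmoothOnTorus φ) (i : Fin N) : Continuous (torusPartial i φ) := by
  refine (isOpenQuotientMap_torusProj N).isQuotientMap.continuous_iff.2 ?_
  have : torusPartial i φ ∘ torusProj = fun y =>
      fderiv ℝ (fun y : Vel N => φ (torusProj y)) y (EuclideanSpace.single i 1) := by
    funext y; exact torusPartial_torusProj h i y
  rw [this]
  exact (ContDiff.continuous_fderiv h (by simp)).clm_apply continuous_const

/-- Integration of an `L²` field against a continuous weight, as a continuous linear map. -/
theorem exists_clm_integral_smul {N : ℕ} {ψ : Torus N → ℝ} (hψ : Continuous ψ) :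
    ∃ L : L2Field N →L[ℝ] Vel N, ∀ g, L g = ∫ x, ψ x • g x := by
  let q : Lp ℝ 2 (volume : Measure (Torus N)) :=
    ContinuousMap.toLp 2 volume ℝ (⟨ψ, hψ⟩ : C(Torus N, ℝ))
  have hq : q =ᵐ[volume] ψ := ContinuousMap.coeFn_toLp (𝕜 := ℝ) volume ⟨ψ, hψ⟩
  refine ⟨(ContinuousLinearMap.lsmul ℝ ℝ).lpPairing volume 2 2 q, fun g => ?_⟩
  rw [ContinuousLinearMap.lpPairing_eq_integral]
  refine integral_congr_ae ?_
  filter_upwards [hq] with x hx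
  simp [hx]

/-- The subspace of those families `(g_α)_{|α| ≤ k}` in `L²(𝕋ᴺ; ℝᴺ)` with `g_{α + eᵢ} = ∂ᵢ g_α`
weakly, that is, `g_α = ∂^α g_0` for all `|α| ≤ k`. It is the graph of `e ↦ (∂^α e)_{|α| ≤ k}`,
and its norm is `(∑_{|α| ≤ k} ∑ᵢ ‖∂^α eᵢ‖²_{L²})^{1/2}`. -/
def sobolevSubmodule (N k : ℕ) : Submodule ℝ (PiLp 2 fun _ : MultiIndex N k => L2Field N) where
  carrier := {g | ∀ (i : Fin N) (α β : MultiIndex N k), α.IsSucc i β → IsWeakPartial i (g α) (g β)}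
  zero_mem' := by
    intro i α β _ φ hφ
    obtain ⟨L, hL⟩ := exists_clm_integral_smul (hφ.continuous_torusPartial i)
    obtain ⟨L', hL'⟩ := exists_clm_integral_smul hφ.continuous
    rw [← hL, ← hL']
    simp
  add_mem' := by
    intro g h hg hh i α β hαβ φ hφ
    have h1 := hg i α β hαβ φ hφ
    have h2 := hh i α β hαβ φ hφ
    obtain ⟨L, hL⟩ := exists_clm_integral_smul (hφ.continuous_torusPartial i)
    obtain ⟨L', hL'⟩ := exists_clm_integral_smul hφ.continuous
    rw [← hL, ← hL'] at h1 h2 ⊢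
    simp only [PiLp.add_apply, map_add, h1, h2]
    abel
  smul_mem' := by
    intro c g hg i α β hαβ φ hφ
    have h1 := hg i α β hαβ φ hφ
    obtain ⟨L, hL⟩ := exists_clm_integral_smul (hφ.continuous_torusPartial i)
    obtain ⟨L', hL'⟩ := exists_clm_integral_smul hφ.continuous
    rw [← hL, ← hL'] at h1 ⊢
    simp only [PiLp.smul_apply, map_smul, h1, smul_neg]

theorem isClosed_sobolevSubmodule (N k : ℕ) :
    IsClosed (sobolevSubmodule N k : Set (PiLp 2 fun _ : MultiIndex N k => L2Field N)) := by
  have : (sobolevSubmodule N k : Set (PiLp 2 fun _ : MultiIndex N k => L2Field N)) =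
      ⋂ (i : Fin N) (α : MultiIndex N k) (β : MultiIndex N k) (_ : α.IsSucc i β)
        (φ : Torus N → ℝ) (_ : IsSmoothOnTorus φ),
        {g | ∫ x, torusPartial i φ x • g α x = - ∫ x, φ x • g β x} := by
    ext g
    simp only [mem_iInter]
    rfl
  rw [this]
  refine isClosed_iInter fun i => isClosed_iInter fun α => isClosed_iInter fun β =>
    isClosed_iInter fun _ => isClosed_iInter fun φ => isClosed_iInter fun hφ => ?_
  obtain ⟨L, hL⟩ := exists_clm_integral_smul (hφ.continuous_torusPartial i)
  obtain ⟨L', hL'⟩ := exists_clm_integral_smul hφ.continuous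
  simp only [← hL, ← hL']
  exact isClosed_eq (by fun_prop) (by fun_prop)

/-- The state space `F = H^{2m}(𝕋ᴺ; ℝᴺ)`. -/
abbrev Force (N m : ℕ) : Type := sobolevSubmodule N (2 * m)

instance (N m : ℕ) : CompleteSpace (Force N m) :=
  (isClosed_sobolevSubmodule N (2 * m)).completeSpace_coe

instance (N m : ℕ) : MeasurableSpace (Force N m) := borel _

instance (N m : ℕ) : BorelSpace (Force N m) := ⟨rfl⟩

open Classical in
/-- The continuous vector field represented by `e ∈ H^{2m}(𝕋ᴺ; ℝᴺ)`. It exists, by Sobolev's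
embedding, whenever `2m > N/2`, and it is unique. -/
def Force.field {N m : ℕ} (e : Force N m) : C(Torus N, Vel N) :=
  if h : ∃ u : C(Torus N, Vel N), u =ᵐ[volume] (e.1 (MultiIndex.zero N (2 * m)) : Torus N → Vel N)
  then h.choose else 0

/-- `L¹(𝕋ᴺ × ℝᴺ)`. -/
abbrev L1 (N : ℕ) : Type := Lp ℝ 1 (volume : Measure (Phase N))

instance (N : ℕ) : MeasurableSpace (L1 N) := borel _

instance (N : ℕ) : BorelSpace (L1 N) := ⟨rfl⟩

open Classical in
/-- The class in `L¹(𝕋ᴺ × ℝᴺ)` of an integrable function. -/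
def classOf {N : ℕ} (g : Phase N → ℝ) : L1 N :=
  if h : MemLp g 1 volume then h.toLp g else 0

/-! ### Mild solutions of `∂ₜf + v·∇ₓf + E(t,x)·∇ᵥf = Qf` -/

/-- The linear Boltzmann and the Fokker-Planck collision operators,
`Q f = ρ(f) M - f` and `Q f = divᵥ (∇ᵥ f + v f)`. -/
inductive Collision
  | linearBoltzmann
  | fokkerPlanck

/-- Right-continuous with left limits. -/
def IsCadlag {S : Type*} [TopologicalSpace S] (ω : ℝ≥0 → S) : Prop :=
  ∀ t, ContinuousWithinAt ω (Ici t) t ∧ ∃ l, Tendsto ω (𝓝[<] t) (𝓝 l)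

/-- The Maxwellian `M(v) = (2π)^{-N/2} exp(-|v|²/2)`. -/
def maxwellian {N : ℕ} (v : Vel N) : ℝ :=
  (2 * Real.pi) ^ (-(N : ℝ) / 2) * Real.exp (-‖v‖ ^ 2 / 2)

/-- `ρ(f) M`, where `ρ(f)(x) = ∫ f(x,v) dv`. -/
def rhoMaxwellian {N : ℕ} (f : L1 N) : L1 N :=
  classOf fun z => (∫ v : Vel N, f (z.1, v)) * maxwellian z.2

/-- The flow of the characteristic system `Ẋ = V`, `V̇ = E(t,X)`: the point `Φ s t z` is the
position at time `t` of the characteristic that is at `z` at time `s`. Times `t < s` are allowed,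
so that `Φ t s` is the inverse of `Φ s t`. -/
def IsCharacteristicFlow {N m : ℕ} (E : ℝ≥0 → Force N m)
    (Φ : ℝ≥0 → ℝ≥0 → Phase N → Phase N) : Prop :=
  ∀ s z, Continuous (fun t => Φ s t z) ∧ ∀ t,
    (Φ s t z).1 = z.1 + torusProj (∫ r in (s : ℝ)..t, (Φ s r.toNNReal z).2) ∧
    (Φ s t z).2 = z.2 + ∫ r in (s : ℝ)..t, (E r.toNNReal).field (Φ s r.toNNReal z).1

open Classical in
/-- `f ∘ T` for a map `T` that preserves the Lebesgue measure of `𝕋ᴺ × ℝᴺ`. -/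
def compFlow {N : ℕ} (T : Phase N → Phase N) (f : L1 N) : L1 N :=
  if h : MeasurePreserving T volume volume then Lp.compMeasurePreserving T h f else 0

/-- Mild solution on `[0,∞)` with initial datum `f` and forcing `E`, linear Boltzmann case:
`u(t) = e^{-t} f ∘ Φ_{0,t}⁻¹ + ∫₀ᵗ e^{-(t-s)} [ρ(u(s)) M] ∘ Φ_{s,t}⁻¹ ds`. -/
def IsMildLB {N m : ℕ} (E : ℝ≥0 → Force N m) (f : L1 N) (u : ℝ≥0 → L1 N) : Prop :=
  Continuous u ∧ ∃ Φ, IsCharacteristicFlow E Φ ∧ ∀ t : ℝ≥0,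
    u t = Real.exp (-(t : ℝ)) • compFlow (Φ t 0) f +
      ∫ s in (0 : ℝ)..t, Real.exp (-(t - s)) •
        compFlow (Φ t s.toNNReal) (rhoMaxwellian (u s.toNNReal))

/-- Density at `(x,v) ∈ ℝ²` of the centred Gaussian law with covariance matrix
`[[a, b], [b, c]]`. -/
def gaussian₂ (a b c x v : ℝ) : ℝ :=
  (2 * Real.pi * √(a * c - b ^ 2))⁻¹ *
    Real.exp (-(c * x ^ 2 - 2 * b * x * v + a * v ^ 2) / (2 * (a * c - b ^ 2)))

/-- Density at `(x,v) ∈ ℝ²` of the solution at time `t` of the one-dimensional system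
`dX = V dt`, `dV = -V dt + √2 dB`, started from `(0,w)`, namely of
`X_t = (1-e^{-t}) w + √2 ∫₀ᵗ (1-e^{-(t-s)}) dB_s`, `V_t = e^{-t} w + √2 ∫₀ᵗ e^{-(t-s)} dB_s`. -/
def kineticDensity (t w x v : ℝ) : ℝ :=
  gaussian₂ (2 * ∫ s in (0 : ℝ)..t, (1 - Real.exp (-s)) ^ 2)
    (2 * ∫ s in (0 : ℝ)..t, Real.exp (-s) * (1 - Real.exp (-s)))
    (2 * ∫ s in (0 : ℝ)..t, Real.exp (-s) ^ 2)
    (x - (1 - Real.exp (-t)) * w) (v - Real.exp (-t) * w)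

/-- The representative in `[0,1)` of a point of the circle `ℝ/ℤ`. -/
def circleLift (x : UnitAddCircle) : ℝ := (AddCircle.equivIco 1 0 x : ℝ)

/-- The kernel `K_t(x,v;y,w)` of `∂ₜf = divᵥ(∇ᵥf + vf) - v·∇ₓf` on `𝕋ᴺ × ℝᴺ`, for `t > 0`: the
density at `(x,v)` of the solution at time `t` of `dX = V dt`, `dV = -V dt + √2 dB` started from
`(y,w)`. The `N` coordinates of this process are independent, and the sum over `ℤ` wraps the law
of a position in `ℝ` around the circle. -/
def kineticKernel {N : ℕ} (t : ℝ) (z : Phase N) (y : Torus N) (w : Vel N) : ℝ :=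
  ∏ i, ∑' k : ℤ, kineticDensity t (w i) (circleLift (z.1 i - y i) + k) (z.2 i)

open Classical in
/-- `K_t f (x,v) = ∬ K_t(x,v;y,w) f(y,w) dy dw` for `t > 0`, and `K_0 f = f`. -/
def kineticOp {N : ℕ} (t : ℝ) (f : L1 N) : L1 N :=
  if t = 0 then f
  else classOf fun z => ∫ p : Phase N, kineticKernel t z p.1 p.2 * f p

/-- `∇_w K_t [e f] (x,v) = ∬ ∇_w K_t(x,v;y,w) · e(y) f(y,w) dy dw`. -/
def gradKineticOp {N m : ℕ} (t : ℝ) (e : Force N m) (f : L1 N) : L1 N :=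
  classOf fun z => ∫ p : Phase N,
    fderiv ℝ (fun w : Vel N => kineticKernel t z p.1 w) p.2 (e.field p.1) * f p

/-- Mild solution on `[0,∞)` in `L¹` with initial datum `f` and forcing `E`, Fokker-Planck case:
`u(t) = K_t f + ∫₀ᵗ ∇_w K_{t-s} [E(s) u(s)] ds`. -/
def IsMildFP {N m : ℕ} (E : ℝ≥0 → Force N m) (f : L1 N) (u : ℝ≥0 → L1 N) : Prop :=
  Continuous u ∧ ∀ t : ℝ≥0,
    u t = kineticOp t f +
      ∫ s in (0 : ℝ)..t, gradKineticOp (t - s) (E s.toNNReal) (u s.toNNReal)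

/-- Mild solution of `∂ₜf + v·∇ₓf + E(t,x)·∇ᵥf = Qf` with initial datum `f`. -/
def IsMildSolution {N m : ℕ} (Q : Collision) (E : ℝ≥0 → Force N m) (f : L1 N)
    (u : ℝ≥0 → L1 N) : Prop :=
  match Q with
  | .linearBoltzmann => IsMildLB E f u
  | .fokkerPlanck => IsMildFP E f u

/-! ### Markov processes -/

/-- The filtration `σ(X_s, s ≤ t)` generated by a process. -/
def generatedFiltration {Ω S : Type*} [mΩ : MeasurableSpace Ω] [mS : MeasurableSpace S]
    (X : ℝ≥0 → Ω → S) (hX : ∀ t, Measurable (X t)) : Filtration ℝ≥0 mΩ where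
  seq t := ⨆ s : Iic t, mS.comap (X s)
  mono' _ _ hst := iSup_le fun r => le_iSup_of_le ⟨r.1, le_trans r.2 hst⟩ le_rfl
  le' _ := iSup_le fun r => (hX r).comap_le

/-- A time-homogeneous transition function on `S`: probability kernels `P_t` with `P_0 = Id`,
measurable in `(t, x)`, satisfying the Chapman-Kolmogorov relation
`P_{t+s}(x,B) = ∫ P_s(y,B) P_t(x,dy)`. -/
structure IsTransitionFunction {S : Type*} [MeasurableSpace S] (P : ℝ≥0 → Kernel S S) : Prop where
  isMarkovKernel : ∀ t, IsMarkovKernel (P t)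
  measurable : ∀ B, MeasurableSet B → Measurable fun q : ℝ≥0 × S => P q.1 q.2 B
  zero : P 0 = Kernel.id
  chapmanKolmogorov : ∀ t s, P (t + s) = P s ∘ₖ P t

/-- `X` is a time-homogeneous Markov process with respect to the filtration `ℱ`, with transition
function `P`: it is adapted and `ℙ(X_{t+s} ∈ B | ℱ_t) = P_s(X_t, B)` almost surely. -/
structure IsMarkovProcess {Ω S : Type*} [mΩ : MeasurableSpace Ω] [MeasurableSpace S]
    (μ : Measure Ω) (ℱ : Filtration ℝ≥0 mΩ) (X : ℝ≥0 → Ω → S) (P : ℝ≥0 → Kernel S S) :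
    Prop where
  adapted : ∀ t, Measurable[ℱ t] (X t)
  markov : ∀ t s B, MeasurableSet B →
    μ⟦X (t + s) ⁻¹' B | ℱ t⟧ =ᵐ[μ] fun ω => (P s (X t ω)).real B

/-- The space `D([0,∞); F)` of càdlàg paths, with the trace of the product `σ`-algebra. -/
abbrev PathSpace (N m : ℕ) : Type := {ω : ℝ≥0 → Force N m // IsCadlag ω}

/-- The coordinate process `E_t(ω) = ω(t)` on the path space. -/
def coord {N m : ℕ} (t : ℝ≥0) (ω : PathSpace N m) : Force N m := ω.1 t

theorem measurable_coord {N m : ℕ} (t : ℝ≥0) : Measurable (coord (N := N) (m := m) t) :=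
  (measurable_pi_apply t).comp measurable_subtype_coe

/-- The canonical filtration of the path space, generated by the coordinate process. -/
def pathFiltration (N m : ℕ) : Filtration ℝ≥0 (inferInstance : MeasurableSpace (PathSpace N m)) :=
  generatedFiltration coord measurable_coord

/-- `φ` belongs to the domain of the generator `A` of the transition function `P` on the stable
set `S`, and `Aφ = ψ`: `φ` and `ψ` are continuous and bounded on `S`, the difference quotients
`(P_t φ - φ)/t`, `0 < t < 1`, are uniformly bounded on `S`, and they converge to `ψ` pointwise on
`S` as `t → 0⁺`. -/
structure HasGeneratorOn {N m : ℕ} (P : ℝ≥0 → Kernel (Force N m) (Force N m))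
    (S : Set (Force N m)) (φ ψ : Force N m → ℝ) : Prop where
  continuousOn : ContinuousOn φ S
  bounded : ∃ C, ∀ e ∈ S, |φ e| ≤ C
  continuousOn' : ContinuousOn ψ S
  bounded' : ∃ C, ∀ e ∈ S, |ψ e| ≤ C
  quotient_bounded : ∃ C, ∀ t : ℝ≥0, 0 < t → t < 1 → ∀ e ∈ S,
    |(t : ℝ)⁻¹ * ((∫ e', φ e' ∂(P t e)) - φ e)| ≤ C
  tendsto : ∀ e ∈ S,
    Tendsto (fun t : ℝ≥0 => (t : ℝ)⁻¹ * ((∫ e', φ e' ∂(P t e)) - φ e)) (𝓝[>] 0) (𝓝 (ψ e))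

/-- The resolvent at `0`, `R_0(e) = ∫₀^∞ 𝔼[E_t(e)] dt ∈ F`. -/
def resolventZero {N m : ℕ} (P : ℝ≥0 → Kernel (Force N m) (Force N m)) (e : Force N m) :
    Force N m :=
  ∫ t in Ioi (0 : ℝ), ∫ e', e' ∂(P t.toNNReal e)

/-- A mixing force field. `Ebar` is a càdlàg stationary Markov process over `F` on the
probability space `(Ω, μ)`, with transition function `P`; `Law e` is the law on the path space of
the process `(E_t(e))` with transition function `P` that starts from `e`; and `R` is the radius of
the stable ball. -/
structure IsMixingForceField {N m : ℕ} {Ω : Type*} [MeasurableSpace Ω] (μ : Measure Ω)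
    (Ebar : ℝ≥0 → Ω → Force N m) (P : ℝ≥0 → Kernel (Force N m) (Force N m))
    (Law : Kernel (Force N m) (PathSpace N m)) (R : ℝ) : Prop where
  /-- `(Ebar t)` is a càdlàg stationary homogeneous Markov process. -/
  isProbabilityMeasure : IsProbabilityMeasure μ
  measurable : ∀ t, Measurable (Ebar t)
  cadlag : ∀ ω, IsCadlag fun t => Ebar t ω
  stationary : ∀ s, μ.map (fun ω t => Ebar (s + t) ω) = μ.map (fun ω t => Ebar t ω)
  transition : IsTransitionFunction P
  markov : IsMarkovProcess μ (generatedFiltration Ebar measurable) Ebar P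
  /-- Under `Law e` the coordinate process is Markov, with the same `P`, and starts from `e`. -/
  path_isMarkovKernel : IsMarkovKernel Law
  path_start : ∀ e, ∀ᵐ ω ∂(Law e), coord 0 ω = e
  path_markov : ∀ e, IsMarkovProcess (Law e) (pathFiltration N m) coord P
  /-- The ball of radius `R` is stable. -/
  radius_nonneg : 0 ≤ R
  stable_ball : ∀ e : Force N m, ‖e‖ ≤ R → ∀ᵐ ω ∂(Law e), ∀ t, ‖coord t ω‖ ≤ R
  /-- The invariant law is supported in this ball and centred. -/
  supported : ∀ t, ∀ᵐ ω ∂μ, ‖Ebar t ω‖ ≤ R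
  centred : ∀ t, ∫ ω, Ebar t ω ∂μ = 0
  /-- Mixing: for initial laws `ν`, `ν'` on the ball, `(E_t(e₀))` and `(E_t(e₀'))` have a coupling
  `Γ` with `𝔼‖E_t^*(e₀) - E_t^*(e₀')‖ ≤ R γ(t)`, where `γ` has integral one. -/
  mixing : ∃ γ : ℝ≥0 → ℝ, Continuous γ ∧ Antitone γ ∧ (∀ t, 0 < γ t) ∧
    IntegrableOn (fun t : ℝ => γ t.toNNReal) (Ioi 0) ∧ ∫ t in Ioi (0 : ℝ), γ t.toNNReal = 1 ∧
    ∀ ν ν' : Measure (Force N m), IsProbabilityMeasure ν → IsProbabilityMeasure ν' →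
      (∀ᵐ e ∂ν, ‖e‖ ≤ R) → (∀ᵐ e ∂ν', ‖e‖ ≤ R) →
      ∃ Γ : Measure (PathSpace N m × PathSpace N m),
        Γ.map Prod.fst = Law ∘ₘ ν ∧ Γ.map Prod.snd = Law ∘ₘ ν' ∧
        ∀ t, ∫⁻ q, ‖coord t q.1 - coord t q.2‖ₑ ∂Γ ≤ ENNReal.ofReal (R * γ t)
  /-- For continuous linear forms `Λ`, the functions `Λ ∘ R_0` and `|Λ ∘ R_0|²` are in the domain
  of the generator on the stable ball, with bounds. -/
  generator_bound : ∃ C : ℝ, 0 ≤ C ∧ ∀ Λ : Force N m →L[ℝ] ℝ, ∃ ψ₁ ψ₂ : Force N m → ℝ,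
    HasGeneratorOn P {e | ‖e‖ ≤ R} (fun e => Λ (resolventZero P e)) ψ₁ ∧
    HasGeneratorOn P {e | ‖e‖ ≤ R} (fun e => |Λ (resolventZero P e)| ^ 2) ψ₂ ∧
    ∀ e : Force N m, ‖e‖ ≤ R → |ψ₂ e| ≤ C * ‖Λ‖ ^ 2 ∧ |ψ₁ e| ≤ C * ‖Λ‖

end StochKinetic

end

noncomputable section

namespace StochKinetic

/-! ### Instances -/

/-! Both equations have the form u(t) = G(t,0) f + ∫₀ᵗ H(t,s) u(s) ds in L¹, where G is an evolution
family of contractions, G(t,r) H(r,s) = H(t,s), and ‖H(t,s)‖ ≤ κ (t-s)^{-1/2} locally in time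
(`IsEvolution`). This singularity is integrable, so Picard iteration contracts in a norm with weight
e^{lt}: the mild solution exists, is unique, and depends continuously on the datum and on the pair
(G, H). By uniqueness and the composition rules, restarting at time c from the value reached gives
the mild solution for the shifted forcing (`IsEvolution.mildSol_add`).

For the linear Boltzmann equation, G is damped transport along backward characteristics and H is G
after f ↦ ρ(f) M. Since m > N + 1, the Fourier coefficients of a force decay fast enough for its
field to be bounded and Lipschitz, with constants controlled by the Sobolev norm, so the
characteristics are well posed. Liouville's theorem follows by approximating the flow by the
symplectic Euler scheme, whose steps are compositions of shears.

For the Fokker-Planck equation, G is an average of affine transports over a Gaussian noise, and H is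
the velocity derivative of G after multiplication by the force. A velocity translation of the datum
amounts to a translation of the normalized noise by a vector of size t^{-1/2}; the derivative
therefore falls on the Gaussian density and costs only t^{-1/2}. Unfolding the torus identifies
these averages with the integral operators of the explicit kernel (`ouAvg_ae_eq`).

The solution at time T depends causally on the forcing, and continuously under bounded pointwise
convergence. Approximating a càdlàg path by step paths sampled at grid times cut off at T shows that
the solution at T is measurable with respect to the past up to T
(`IsForcedEvolution.measurable_mildSol_path`). On the other side, the Markov property for single
times extends to the whole future: given the past up to t, the shifted path has law `Law (X t ω)`,
also jointly with a variable known at time t (`IsMarkovFamily.measure_inter_prod`). Let T_t(f,e) be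
the law under `Law e` of the pair (solution from f at time t, force at time t). By the cocycle
identity the pair at time t + s is the time-s map evaluated at the solution at time t and the
shifted path, which is the Markov property; taking the whole space as the past event gives the
Chapman-Kolmogorov relation. -/

instance isProbabilityMeasure_torus (N : ℕ) :
    IsProbabilityMeasure (volume : Measure (Torus N)) := by
  have : IsProbabilityMeasure (volume : Measure UnitAddCircle) := ⟨by simp⟩
  exact inferInstanceAs
    (IsProbabilityMeasure (Measure.pi fun _ : Fin N => (volume : Measure UnitAddCircle)))

/-- Regularity provides the approximation by compactly supported continuous functions in
`tendsto_transport` and the reduction to open sets in Liouville's theorem. -/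
instance regular_phase (N : ℕ) : (volume : Measure (Phase N)).Regular :=
  Measure.Regular.of_sigmaCompactSpace_of_isLocallyFiniteMeasure _

instance isSeparable_torus (N : ℕ) :
    MeasureTheory.IsSeparable (volume : Measure (Torus N)) :=
  MeasureTheory.instIsSeparableOfCountablyGeneratedOfSFinite _

instance isSeparable_phase (N : ℕ) :
    MeasureTheory.IsSeparable (volume : Measure (Phase N)) :=
  MeasureTheory.instIsSeparableOfCountablyGeneratedOfSFinite _

/-- In separable metric spaces the Borel σ-algebra of a product is the product σ-algebra, so
continuous maps of several variables are measurable, and measurable maps are strongly measurable. -/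
instance secondCountable_L1 (N : ℕ) : SecondCountableTopology (L1 N) :=
  have : Fact ((1 : ℝ≥0∞) ≠ ∞) := ⟨ENNReal.one_ne_top⟩
  Lp.SecondCountableTopology

instance secondCountable_L2Field (N : ℕ) : SecondCountableTopology (L2Field N) :=
  have : Fact ((2 : ℝ≥0∞) ≠ ∞) := ⟨ENNReal.ofNat_ne_top⟩
  Lp.SecondCountableTopology

instance secondCountable_force (N m : ℕ) : SecondCountableTopology (Force N m) :=
  have : SecondCountableTopology (PiLp 2 fun _ : MultiIndex N (2 * m) => L2Field N) :=
    PiLp.secondCountableTopology 2 _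
  TopologicalSpace.Subtype.secondCountableTopology _

/-! ### Fourier series on the torus -/

open UnitAddTorus

/-- Lets Fubini's theorem for product measures act on sums over ℤᴺ. -/
theorem pi_count_eq_count (ι : Type*) [Fintype ι] :
    Measure.pi (fun _ : ι => (Measure.count : Measure ℤ)) = Measure.count := by
  refine Measure.ext_of_singleton fun x => ?_
  rw [Measure.pi_singleton]
  simp

theorem summable_prod_pi {ι : Type*} [Fintype ι] {f : ι → ℤ → ℝ}
    (hf : ∀ i, Summable (f i)) : Summable fun n : ι → ℤ => ∏ i, f i (n i) := by
  have h := Integrable.fintype_prod (𝕜 := ℝ) (μ := fun _ : ι => (Measure.count : Measure ℤ))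
    (f := f) fun i => by
      rw [integrable_count_iff]; exact (hf i).norm
  rw [pi_count_eq_count, integrable_count_iff] at h
  exact h.of_norm

theorem volume_torus_eq (N : ℕ) : (volume : Measure (Torus N)) =
    Measure.pi fun _ : Fin N => AddCircle.haarAddCircle := by
  have h : (volume : Measure UnitAddCircle) = AddCircle.haarAddCircle := by
    rw [AddCircle.volume_eq_smul_haarAddCircle]; simp
  change Measure.pi (fun _ : Fin N => (volume : Measure UnitAddCircle)) = _
  rw [h]

/-- The uniformly convergent series, mapped into L², has the same terms as the L² Fourier series of
`f`; sums in L² are unique. -/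
theorem ae_eq_fourier_of_summable {N : ℕ} {f : Torus N → ℂ} (hf : MemLp f 2 volume)
    (hs : Summable fun n => ∫ x, mFourier (-n) x * f x) :
    f =ᵐ[volume] ⇑(∑' n, (∫ x, mFourier (-n) x * f x) • mFourier n : C(Torus N, ℂ)) := by
  rw [volume_torus_eq] at hf hs ⊢
  have h1 := hasSum_mFourier_series_L2 (hf.toLp f)
  have hc : ∀ n, mFourierCoeff (hf.toLp f) n =
      ∫ x, mFourier (-n) x * f x ∂(Measure.pi fun _ : Fin N => AddCircle.haarAddCircle) := by
    intro n
    refine integral_congr_ae ?_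
    filter_upwards [hf.coeFn_toLp] with x hx
    rw [smul_eq_mul, hx]
  simp_rw [hc] at h1
  have h2 : Summable fun n => (∫ x, mFourier (-n) x * f x
      ∂(Measure.pi fun _ : Fin N => AddCircle.haarAddCircle)) • (mFourier n : C(Torus N, ℂ)) := by
    refine .of_norm ?_
    simpa only [norm_smul, mFourier_norm, mul_one] using hs.norm
  have h3 := h2.hasSum.map (ContinuousMap.toLp (E := ℂ) 2
    (Measure.pi fun _ : Fin N => AddCircle.haarAddCircle) ℂ)
    (ContinuousLinearMap.continuous _)
  simp only [Function.comp_def, map_smul] at h3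
  have h4 := h1.unique h3
  have h5 := ContinuousMap.coeFn_toLp (𝕜 := ℂ) (p := 2)
    (Measure.pi fun _ : Fin N => AddCircle.haarAddCircle)
    (∑' n, (∫ x, mFourier (-n) x * f x
      ∂(Measure.pi fun _ : Fin N => AddCircle.haarAddCircle)) • mFourier n : C(Torus N, ℂ))
  rw [← h4] at h5
  exact hf.coeFn_toLp.symm.trans h5

theorem mFourier_torus_add {N : ℕ} (n : Fin N → ℤ) (x y : Torus N) :
    mFourier n (x + y) = mFourier n x * mFourier n y := by
  simp only [mFourier, ContinuousMap.coe_mk, Pi.add_apply, fourier_apply, smul_add,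
    AddCircle.toCircle_add, Circle.coe_mul, Finset.prod_mul_distrib]

theorem mFourier_torus_single {N : ℕ} (n : Fin N → ℤ) (i : Fin N) (h : UnitAddCircle) :
    mFourier n (Pi.single i h : Torus N) = fourier (n i) h := by
  simp only [mFourier, ContinuousMap.coe_mk]
  rw [Finset.prod_eq_single i]
  · simp
  · intro j _ hj
    simp [Pi.single_eq_of_ne hj]
  · simp

theorem hasDerivAt_mFourier_single {N : ℕ} (n : Fin N → ℤ) (i : Fin N) (x : Torus N) :
    HasDerivAt (fun h : ℝ => mFourier n (x + Pi.single i (h : UnitAddCircle)))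
      (2 * Real.pi * Complex.I * n i * mFourier n x) 0 := by
  simp_rw [mFourier_torus_add, mFourier_torus_single]
  have := (hasDerivAt_fourier 1 (n i) 0).const_mul (mFourier n x)
  refine this.congr_deriv ?_
  have h0 : ((0 : ℝ) : UnitAddCircle) = 0 := rfl
  rw [h0]
  simp
  ring

theorem contDiff_mFourier_torusProj {N : ℕ} (n : Fin N → ℤ) :
    ContDiff ℝ (⊤ : ℕ∞) fun y : Vel N => mFourier n (torusProj y) := by
  simp only [mFourier, ContinuousMap.coe_mk, torusProj, fourier_coe_apply]
  refine contDiff_prod fun i _ => ContDiff.cexp ?_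
  have : ContDiff ℝ (⊤ : ℕ∞) fun y : Vel N => ((y i : ℝ) : ℂ) :=
    Complex.ofRealCLM.contDiff.comp (EuclideanSpace.proj (𝕜 := ℝ) i).contDiff
  fun_prop

theorem memLp_component {N : ℕ} (g : L2Field N) (j : Fin N) :
    MemLp (fun x => ((g x j : ℝ) : ℂ)) 2 (volume : Measure (Torus N)) :=
  ((Lp.memLp g).continuousLinearMap_comp
    (Complex.ofRealCLM.comp (EuclideanSpace.proj (𝕜 := ℝ) j)))

/-- Fourier coefficients of the components of a square-integrable field. -/
def fieldCoeff {N : ℕ} (g : L2Field N) (j : Fin N) (n : Fin N → ℤ) : ℂ :=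
  ∫ x, mFourier (-n) x * ((g x j : ℝ) : ℂ)

theorem norm_fieldCoeff_le {N : ℕ} (g : L2Field N) (j : Fin N) (n : Fin N → ℤ) :
    ‖fieldCoeff g j n‖ ≤ ‖g‖ := by
  have h1 : ‖fieldCoeff g j n‖ ≤ ∫ x, ‖g x‖ := by
    refine norm_integral_le_of_norm_le ((Lp.memLp g).integrable (by norm_num)).norm ?_
    refine Eventually.of_forall fun x => ?_
    rw [norm_mul]
    have h2 : ‖mFourier (-n) x‖ ≤ 1 :=
      ((mFourier (-n)).norm_coe_le_norm x).trans mFourier_norm.le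
    have h3 : ‖((g x j : ℝ) : ℂ)‖ ≤ ‖g x‖ := by
      rw [Complex.norm_real]; exact PiLp.norm_apply_le _ _
    calc _ ≤ 1 * ‖g x‖ := by gcongr
      _ = _ := one_mul _
  refine h1.trans ?_
  have h4 := eLpNorm_le_eLpNorm_of_exponent_le (p := 1) (q := 2) (by norm_num)
    (Lp.memLp g).1
  rw [integral_norm_eq_lintegral_enorm (Lp.memLp g).1, Lp.norm_def,
    ← eLpNorm_one_eq_lintegral_enorm]
  exact ENNReal.toReal_mono (Lp.memLp g).2.ne h4

theorem integral_smul_component {N : ℕ} {ψ : Torus N → ℝ} (hψ : Continuous ψ) (g : L2Field N)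
    (j : Fin N) : (∫ x, ψ x • g x) j = ∫ x, ψ x * g x j := by
  have hi : Integrable (fun x => ψ x • g x) (volume : Measure (Torus N)) := by
    obtain ⟨C, hC⟩ := isCompact_range hψ |>.isBounded.exists_norm_le
    refine ((Lp.memLp g).integrable (by norm_num)).bdd_smul C hψ.aestronglyMeasurable ?_
    exact Eventually.of_forall fun x => hC _ ⟨x, rfl⟩
  have := (EuclideanSpace.proj (𝕜 := ℝ) j).integral_comp_comm hi
  simpa using this.symm

theorem IsWeakPartial.component {N : ℕ} {i : Fin N} {g g' : L2Field N} (h : IsWeakPartial i g g')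
    {φ : Torus N → ℝ} (hφ : IsSmoothOnTorus φ) (j : Fin N) :
    ∫ x, torusPartial i φ x * g x j = - ∫ x, φ x * g' x j := by
  have := congrArg (fun v : Vel N => v j) (h φ hφ)
  simp only [PiLp.neg_apply] at this
  rwa [integral_smul_component (hφ.continuous_torusPartial i),
    integral_smul_component hφ.continuous] at this

theorem integrable_mFourier_mul {N : ℕ} (n : Fin N → ℤ) (c : ℂ) (g : L2Field N) (j : Fin N) :
    Integrable (fun x => c * mFourier n x * ((g x j : ℝ) : ℂ)) (volume : Measure (Torus N)) := by
  refine ((memLp_component g j).integrable (by norm_num)).bdd_mul (c := ‖c‖)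
    (by fun_prop) (Eventually.of_forall fun x => ?_)
  rw [norm_mul]
  exact mul_le_of_le_one_right (norm_nonneg _)
    (((mFourier n).norm_coe_le_norm x).trans mFourier_norm.le)

theorem torusPartial_clm_mFourier {N : ℕ} (L : ℂ →L[ℝ] ℝ) (n : Fin N → ℤ) (i : Fin N)
    (x : Torus N) : torusPartial i (fun x => L (mFourier n x)) x =
      L (2 * Real.pi * Complex.I * n i * mFourier n x) :=
  (L.hasFDerivAt.comp_hasDerivAt (0 : ℝ) (hasDerivAt_mFourier_single n i x)).deriv

theorem fieldCoeff_of_isWeakPartial {N : ℕ} {i : Fin N} {g g' : L2Field N}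
    (h : IsWeakPartial i g g') (j : Fin N) (n : Fin N → ℤ) :
    fieldCoeff g' j n = 2 * Real.pi * Complex.I * n i * fieldCoeff g j n := by
  -- Test functions are real, so the character is tested through real-linear functionals; the real
  -- and the imaginary part are the two instances used below.
  have key : ∀ L : ℂ →L[ℝ] ℝ, (∀ (z : ℂ) (r : ℝ), L (z * r) = L z * r) →
      L (∫ x, (2 * Real.pi * Complex.I * (-n) i) * mFourier (-n) x * ((g x j : ℝ) : ℂ)) =
        - L (∫ x, mFourier (-n) x * ((g' x j : ℝ) : ℂ)) := by
    intro L hL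
    have hs : IsSmoothOnTorus fun x : Torus N => L (mFourier (-n) x) :=
      L.contDiff.comp (contDiff_mFourier_torusProj (-n))
    have h1 := h.component hs j
    simp_rw [torusPartial_clm_mFourier] at h1
    have i2 := integrable_mFourier_mul (-n) 1 g' j
    simp only [one_mul] at i2
    rw [← L.integral_comp_comm (integrable_mFourier_mul _ _ _ _), ← L.integral_comp_comm i2]
    simp_rw [hL]
    exact h1
  have hc : ∫ x, (2 * Real.pi * Complex.I * (-n) i) * mFourier (-n) x * ((g x j : ℝ) : ℂ) =
      - (2 * Real.pi * Complex.I * n i * fieldCoeff g j n) := by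
    simp_rw [mul_assoc _ (mFourier (-n) _) _]
    rw [integral_const_mul, fieldCoeff]
    simp
  rw [hc] at key
  have hre := key Complex.reCLM (by intro z r; simp)
  have him := key Complex.imCLM (by intro z r; simp)
  rw [map_neg, neg_inj] at hre him
  exact (Complex.ext hre him).symm

/-! ### Sobolev's embedding -/

/-- Induction on |α|: a nonzero entry of α is lowered by one, so only the first-order weak relations
between neighbouring indices are needed. -/
theorem fieldCoeff_eq_prod {N k : ℕ} (e : sobolevSubmodule N k) (α : MultiIndex N k) (j : Fin N)
    (n : Fin N → ℤ) : fieldCoeff (e.1 α) j n =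
      (∏ i, (2 * Real.pi * Complex.I * n i) ^ (α.1 i : ℕ)) *
        fieldCoeff (e.1 (MultiIndex.zero N k)) j n := by
  induction hs : ∑ i, (α.1 i : ℕ) generalizing α with
  | zero =>
    have h0 : ∀ i, (α.1 i : ℕ) = 0 := by simpa using hs
    have : α = MultiIndex.zero N k := by
      refine Subtype.ext (funext fun i => Fin.ext ?_)
      rw [h0 i]; simp [MultiIndex.zero]
    subst this
    simp [h0]
  | succ s ih =>
    obtain ⟨i, -, hi⟩ : ∃ i ∈ Finset.univ, (α.1 i : ℕ) ≠ 0 :=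
      Finset.exists_ne_zero_of_sum_ne_zero (by omega)
    have hlt := (α.1 i).2
    let β : Fin N → Fin (k + 1) :=
      Function.update α.1 i ⟨(α.1 i : ℕ) - 1, by omega⟩
    have hβ : ∀ l, (α.1 l : ℕ) = (β l : ℕ) + if l = i then 1 else 0 := by
      intro l
      by_cases hl : l = i
      · subst hl; simp [β]; omega
      · simp [β, hl]
    have hsum : ∑ l, (β l : ℕ) = s := by
      have : ∑ l, (α.1 l : ℕ) = ∑ l, (β l : ℕ) + 1 := by
        simp_rw [hβ, Finset.sum_add_distrib]
        simp
      omega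
    have hα := α.2
    have hsucc : MultiIndex.IsSucc i (⟨β, by omega⟩ : MultiIndex N k) α := hβ
    rw [fieldCoeff_of_isWeakPartial (e.2 i _ _ hsucc), ih ⟨β, by omega⟩ hsum]
    simp_rw [hβ, pow_add, Finset.prod_mul_distrib]
    rw [Finset.prod_eq_single (f := fun l => (2 * Real.pi * Complex.I * n l) ^
      (if l = i then 1 else 0)) i (fun b _ hb => by simp [hb]) (by simp)]
    simp only [if_true, pow_one]
    ring

theorem norm_component_le {N k : ℕ} (e : sobolevSubmodule N k) (α : MultiIndex N k) :
    ‖e.1 α‖ ≤ ‖e‖ := PiLp.norm_apply_le e.1 α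

/-- The weights `∏ᵢ (1 + nᵢ²)⁻¹`. -/
def fourierWeight {N : ℕ} (n : Fin N → ℤ) : ℝ := ∏ i, (1 + (n i : ℝ) ^ 2)⁻¹

theorem fourierWeight_nonneg {N : ℕ} (n : Fin N → ℤ) : 0 ≤ fourierWeight n :=
  Finset.prod_nonneg fun _ _ => by positivity

theorem summable_fourierWeight (N : ℕ) : Summable (fourierWeight (N := N)) := by
  refine summable_prod_pi (f := fun _ (k : ℤ) => (1 + (k : ℝ) ^ 2)⁻¹) fun _ => ?_
  have h : Summable fun k : ℤ => 1 / (k : ℝ) ^ 2 := Real.summable_one_div_int_pow.2 (by norm_num)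
  have h1 : Summable fun k : ℤ => if k = 0 then (1 : ℝ) else 0 :=
    summable_of_ne_finset_zero (s := {0}) fun k hk => by simp_all
  refine (h.add h1).of_nonneg_of_le (fun k => by positivity) fun k => ?_
  by_cases hk : k = 0
  · subst hk; simp
  · have : (0 : ℝ) < (k : ℝ) ^ 2 := by positivity
    rw [if_neg hk, add_zero, one_div]
    exact inv_anti₀ this (by linarith)

theorem norm_prod_mul_fieldCoeff_le {N k : ℕ} (e : sobolevSubmodule N k) (α : MultiIndex N k)
    (j : Fin N) (n : Fin N → ℤ) :
    (∏ i, (2 * Real.pi * |(n i : ℝ)|) ^ (α.1 i : ℕ)) *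
      ‖fieldCoeff (e.1 (MultiIndex.zero N k)) j n‖ ≤ ‖e‖ := by
  have h := (norm_fieldCoeff_le (e.1 α) j n).trans (norm_component_le e α)
  rw [fieldCoeff_eq_prod, norm_mul, norm_prod] at h
  refine le_of_eq_of_le (congrArg (· * _) (Finset.prod_congr rfl fun i _ => ?_)) h
  rw [norm_pow, norm_mul, norm_mul, norm_mul]
  simp [abs_of_pos Real.pi_pos]

theorem one_add_sq_le_of_ne_zero {k : ℤ} (hk : k ≠ 0) :
    1 + (k : ℝ) ^ 2 ≤ (2 * Real.pi * |(k : ℝ)|) ^ 2 := by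
  have h1 : (1 : ℝ) ≤ |(k : ℝ)| := by exact_mod_cast Int.one_le_abs hk
  have h2 := Real.pi_gt_three
  have h3 : 6 * |(k : ℝ)| ≤ 2 * Real.pi * |(k : ℝ)| := by nlinarith
  have h4 : (6 * |(k : ℝ)|) ^ 2 ≤ (2 * Real.pi * |(k : ℝ)|) ^ 2 := by gcongr
  have h5 : (k : ℝ) ^ 2 = |(k : ℝ)| ^ 2 := (sq_abs _).symm
  nlinarith

/-- Two derivatives in each direction with nᵢ ≠ 0 produce (2π|nᵢ|)² ≥ 1 + nᵢ²; where nᵢ = 0 the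
weight is already 1 and no derivative is spent. The exponent δ is kept for further factors of |nᵢ|.
-/
theorem inv_fourierWeight_mul_le {N : ℕ} (n : Fin N → ℤ) (δ : Fin N → ℕ) :
    (fourierWeight n)⁻¹ * ∏ i, |(n i : ℝ)| ^ δ i ≤
      ∏ i, (2 * Real.pi * |(n i : ℝ)|) ^ ((if n i = 0 then 0 else 2) + δ i) := by
  rw [fourierWeight, ← Finset.prod_inv_distrib, ← Finset.prod_mul_distrib]
  refine Finset.prod_le_prod (fun i _ => by positivity) fun i _ => ?_
  rw [inv_inv]
  by_cases h : n i = 0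
  · simp [h]
  · rw [if_neg h, pow_add]
    have h2 := Real.pi_gt_three
    have h3 : |(n i : ℝ)| ≤ 2 * Real.pi * |(n i : ℝ)| := by nlinarith [abs_nonneg (n i : ℝ)]
    gcongr
    exact one_add_sq_le_of_ne_zero h

theorem fourierWeight_pos {N : ℕ} (n : Fin N → ℤ) : 0 < fourierWeight n :=
  Finset.prod_pos fun _ _ => by positivity

/-- The multi-index that takes two derivatives in each nonzero direction and one more through δ has
order at most 2N + 1 ≤ 2m. The case δ = 0 bounds the field, the case |δ| = 1 its Lipschitz constant.
-/
theorem abs_pow_mul_norm_fieldCoeff_le {N m : ℕ} (hm : N + 1 < m) (e : Force N m) (j : Fin N)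
    (n : Fin N → ℤ) (δ : Fin N → ℕ) (hδ : ∑ i, δ i ≤ 1) :
    (∏ i, |(n i : ℝ)| ^ δ i) * ‖fieldCoeff (e.1 (MultiIndex.zero N (2 * m))) j n‖ ≤
      ‖e‖ * fourierWeight n := by
  have hδ' : ∀ i, δ i ≤ 1 := fun i =>
    (Finset.single_le_sum (fun _ _ => Nat.zero_le _) (Finset.mem_univ i)).trans hδ
  have hα : ∀ i, (if n i = 0 then 0 else 2) + δ i < 2 * m + 1 := by
    intro i; have := hδ' i; split_ifs <;> omega
  have hs : ∑ i, ((if n i = 0 then 0 else 2) + δ i) ≤ 2 * m := by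
    rw [Finset.sum_add_distrib]
    have : ∑ i, (if n i = 0 then 0 else 2) ≤ ∑ _i : Fin N, 2 :=
      Finset.sum_le_sum fun i _ => by split_ifs <;> omega
    simp at this
    omega
  have h := norm_prod_mul_fieldCoeff_le e ⟨fun i => ⟨_, hα i⟩, hs⟩ j n
  have h1 := (mul_le_mul_of_nonneg_right (inv_fourierWeight_mul_le n δ) (norm_nonneg
    (fieldCoeff (e.1 (MultiIndex.zero N (2 * m))) j n))).trans h
  have h2 := fourierWeight_pos n
  rw [mul_assoc, inv_mul_le_iff₀ h2] at h1
  rwa [mul_comm ‖e‖]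

theorem norm_fieldCoeff_zero_le {N m : ℕ} (hm : N + 1 < m) (e : Force N m) (j : Fin N)
    (n : Fin N → ℤ) :
    ‖fieldCoeff (e.1 (MultiIndex.zero N (2 * m))) j n‖ ≤ ‖e‖ * fourierWeight n := by
  simpa using abs_pow_mul_norm_fieldCoeff_le hm e j n 0 (by simp)

theorem abs_mul_norm_fieldCoeff_zero_le {N m : ℕ} (hm : N + 1 < m) (e : Force N m) (j : Fin N)
    (n : Fin N → ℤ) (i : Fin N) :
    |(n i : ℝ)| * ‖fieldCoeff (e.1 (MultiIndex.zero N (2 * m))) j n‖ ≤ ‖e‖ * fourierWeight n := by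
  have h := abs_pow_mul_norm_fieldCoeff_le hm e j n (Pi.single i 1) (by simp)
  rwa [Finset.prod_eq_single i (fun b _ hb => by simp [hb]) (by simp), Pi.single_eq_same,
    pow_one] at h

/-- The Fourier series of a component of an element of the Sobolev space. -/
def fieldSeries {N m : ℕ} (e : Force N m) (j : Fin N) : C(Torus N, ℂ) :=
  ∑' n, fieldCoeff (e.1 (MultiIndex.zero N (2 * m))) j n • mFourier n

theorem hasSum_fieldSeries {N m : ℕ} (hm : N + 1 < m) (e : Force N m) (j : Fin N) (x : Torus N) :
    HasSum (fun n => fieldCoeff (e.1 (MultiIndex.zero N (2 * m))) j n * mFourier n x)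
      (fieldSeries e j x) := by
  have h : Summable fun n =>
      fieldCoeff (e.1 (MultiIndex.zero N (2 * m))) j n • (mFourier n : C(Torus N, ℂ)) := by
    refine .of_norm (((summable_fourierWeight N).mul_left ‖e‖).of_nonneg_of_le
      (fun n => norm_nonneg _) fun n => ?_)
    rw [norm_smul, mFourier_norm, mul_one]
    exact norm_fieldCoeff_zero_le hm e j n
  simpa using! h.hasSum.map (ContinuousMap.evalCLM ℂ x) (ContinuousLinearMap.continuous _)

theorem norm_fourier_sub_le (k : ℤ) (a b : UnitAddCircle) :
    ‖(fourier k a : ℂ) - fourier k b‖ ≤ 2 * Real.pi * |(k : ℝ)| * ‖a - b‖ := by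
  have h1 : (fourier k a : ℂ) - fourier k b = fourier k b * (fourier k (a - b) - 1) := by
    have : (fourier k a : ℂ) = fourier k b * fourier k (a - b) := by
      simp only [fourier_apply]
      rw [← Circle.coe_mul, ← AddCircle.toCircle_add, ← smul_add, add_sub_cancel]
    rw [this]; ring
  have h2 : ‖(fourier k b : ℂ)‖ = 1 := by
    rw [fourier_apply]; exact Circle.norm_coe _
  rw [h1, norm_mul, h2, one_mul]
  obtain ⟨r, hr⟩ := QuotientAddGroup.mk_surjective (a - b)
  -- The representative nearest to 0 realizes the norm on the circle, and then |e^{ix} - 1| ≤ |x|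
  -- applies.
  have hr' : a - b = ((r - round r : ℝ) : UnitAddCircle) := by
    rw [← hr]
    have : ((round r : ℝ) : UnitAddCircle) = 0 := by
      rw [AddCircle.coe_eq_zero_iff]; exact ⟨round r, by simp⟩
    rw [AddCircle.coe_sub, this, sub_zero]
  have hn : ‖a - b‖ = |r - round r| := by
    rw [← hr]; exact UnitAddCircle.norm_eq
  rw [hn, hr', fourier_coe_apply]
  have h3 := Real.norm_exp_I_mul_ofReal_sub_one_le (x := 2 * Real.pi * k * (r - round r))
  refine le_trans (le_of_eq ?_) (h3.trans (le_of_eq ?_))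
  · congr 3
    push_cast; ring
  · rw [Real.norm_eq_abs, abs_mul, abs_mul, abs_mul, abs_two, abs_of_pos Real.pi_pos]

/-- Telescoping of a product of factors of modulus one. -/
theorem norm_mFourier_sub_le {N : ℕ} (n : Fin N → ℤ) (x y : Torus N) :
    ‖mFourier n x - mFourier n y‖ ≤ 2 * Real.pi * (∑ i, |(n i : ℝ)|) * ‖x - y‖ := by
  have key : ∀ s : Finset (Fin N), ‖∏ i ∈ s, (fourier (n i) (x i) : ℂ)
      - ∏ i ∈ s, (fourier (n i) (y i) : ℂ)‖ ≤ ∑ i ∈ s, 2 * Real.pi * |(n i : ℝ)| * ‖x - y‖ := by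
    intro s
    induction s using Finset.induction_on with
    | empty => simp
    | insert a s ha ih =>
      rw [Finset.prod_insert ha, Finset.prod_insert ha, Finset.sum_insert ha]
      have e1 : ∀ p q r t : ℂ, p * q - r * t = (p - r) * q + r * (q - t) := by intros; ring
      have hone : ∀ (k : ℤ) (z : UnitAddCircle), ‖(fourier k z : ℂ)‖ = 1 := by
        intro k z; rw [fourier_apply]; exact Circle.norm_coe _
      rw [e1]
      refine (norm_add_le _ _).trans (add_le_add ?_ ?_)
      · rw [norm_mul, norm_prod]
        simp only [hone, Finset.prod_const_one, mul_one]
        refine (norm_fourier_sub_le _ _ _).trans ?_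
        gcongr
        exact norm_le_pi_norm (x - y) a
      · rw [norm_mul, hone, one_mul]; exact ih
  have h := key Finset.univ
  rw [← Finset.sum_mul, ← Finset.mul_sum] at h
  exact h

theorem norm_fieldSeries_apply_le {N m : ℕ} (hm : N + 1 < m) (e : Force N m) (j : Fin N)
    (x : Torus N) : ‖fieldSeries e j x‖ ≤ ‖e‖ * ∑' n, fourierWeight (N := N) n := by
  rw [← tsum_mul_left, ← (hasSum_fieldSeries hm e j x).tsum_eq]
  refine tsum_of_norm_bounded ((summable_fourierWeight N).mul_left ‖e‖).hasSum fun n => ?_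
  rw [norm_mul]
  exact (mul_le_of_le_one_right (norm_nonneg _)
    (((mFourier n).norm_coe_le_norm x).trans mFourier_norm.le)).trans
      (norm_fieldCoeff_zero_le hm e j n)

theorem norm_fieldSeries_sub_le {N m : ℕ} (hm : N + 1 < m) (e : Force N m) (j : Fin N)
    (x y : Torus N) : ‖fieldSeries e j x - fieldSeries e j y‖ ≤
      2 * Real.pi * N * (‖e‖ * ∑' n, fourierWeight (N := N) n) * ‖x - y‖ := by
  have h := (hasSum_fieldSeries hm e j x).sub (hasSum_fieldSeries hm e j y)
  rw [← h.tsum_eq]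
  have hs := (((summable_fourierWeight N).mul_left ‖e‖).hasSum.mul_left
    (2 * Real.pi * N)).mul_right ‖x - y‖
  rw [tsum_mul_left] at hs
  refine tsum_of_norm_bounded hs fun n => ?_
  rw [← mul_sub, norm_mul]
  have h1 : ‖fieldCoeff (e.1 (MultiIndex.zero N (2 * m))) j n‖ * ∑ i, |(n i : ℝ)| ≤
      N * (‖e‖ * fourierWeight n) := by
    rw [Finset.mul_sum]
    refine (Finset.sum_le_card_nsmul _ _ (‖e‖ * fourierWeight n) fun i _ => ?_).trans (by simp)
    rw [mul_comm]
    exact abs_mul_norm_fieldCoeff_zero_le hm e j n i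
  calc _ ≤ ‖fieldCoeff (e.1 (MultiIndex.zero N (2 * m))) j n‖ *
        (2 * Real.pi * (∑ i, |(n i : ℝ)|) * ‖x - y‖) := by
        gcongr; exact norm_mFourier_sub_le n x y
    _ = 2 * Real.pi * (‖fieldCoeff (e.1 (MultiIndex.zero N (2 * m))) j n‖ * ∑ i, |(n i : ℝ)|)
        * ‖x - y‖ := by ring
    _ ≤ 2 * Real.pi * (N * (‖e‖ * fourierWeight n)) * ‖x - y‖ := by
        gcongr
    _ = _ := by ring

theorem fieldSeries_ae_eq {N m : ℕ} (hm : N + 1 < m) (e : Force N m) (j : Fin N) :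
    (fun x => ((e.1 (MultiIndex.zero N (2 * m)) x j : ℝ) : ℂ)) =ᵐ[volume] fieldSeries e j :=
  ae_eq_fourier_of_summable (memLp_component _ j) <| .of_norm <|
    ((summable_fourierWeight N).mul_left ‖e‖).of_nonneg_of_le (fun _ => norm_nonneg _)
      fun n => norm_fieldCoeff_zero_le hm e j n

/-- The real parts of the Fourier series form a continuous representative, so `Force.field` never
takes its default value 0. -/
theorem Force.field_ae_eq {N m : ℕ} (hm : N + 1 < m) (e : Force N m) :
    e.field =ᵐ[volume] (e.1 (MultiIndex.zero N (2 * m)) : Torus N → Vel N) := by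
  have h : ∃ u : C(Torus N, Vel N),
      u =ᵐ[volume] (e.1 (MultiIndex.zero N (2 * m)) : Torus N → Vel N) := by
    refine ⟨⟨fun x => WithLp.toLp 2 fun j => (fieldSeries e j x).re, by fun_prop⟩, ?_⟩
    filter_upwards [ae_all_iff.2 fun j => fieldSeries_ae_eq hm e j] with x hx
    ext j
    simp [← hx j]
  rw [Force.field, dif_pos h]
  exact h.choose_spec

theorem Force.field_eq_of_ae_eq {N m : ℕ} (hm : N + 1 < m) (e : Force N m) {u : Torus N → Vel N}
    (hu : Continuous u) (h : u =ᵐ[volume] (e.1 (MultiIndex.zero N (2 * m)) : Torus N → Vel N)) :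
    ⇑e.field = u :=
  Continuous.ae_eq_iff_eq volume e.field.continuous hu |>.1 ((e.field_ae_eq hm).trans h.symm)

theorem Force.field_apply {N m : ℕ} (hm : N + 1 < m) (e : Force N m) (x : Torus N) (j : Fin N) :
    e.field x j = (fieldSeries e j x).re := by
  have := e.field_eq_of_ae_eq hm (u := fun x => WithLp.toLp 2 fun j => (fieldSeries e j x).re)
    (by fun_prop) (by
      filter_upwards [ae_all_iff.2 fun j => fieldSeries_ae_eq hm e j] with x hx
      ext j
      simp [← hx j])
  rw [this]

theorem Force.field_add {N m : ℕ} (hm : N + 1 < m) (e e' : Force N m) :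
    (e + e').field = e.field + e'.field := by
  refine DFunLike.coe_injective (Force.field_eq_of_ae_eq hm _ (by fun_prop) ?_)
  filter_upwards [e.field_ae_eq hm, e'.field_ae_eq hm, Lp.coeFn_add
    (e.1 (MultiIndex.zero N (2 * m))) (e'.1 (MultiIndex.zero N (2 * m)))] with x h1 h2 h3
  rw [ContinuousMap.coe_add, Pi.add_apply, h1, h2]
  exact h3.symm

theorem Force.field_smul {N m : ℕ} (hm : N + 1 < m) (c : ℝ) (e : Force N m) :
    (c • e).field = c • e.field := by
  refine DFunLike.coe_injective (Force.field_eq_of_ae_eq hm _ (by fun_prop) ?_)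
  filter_upwards [e.field_ae_eq hm, Lp.coeFn_smul c (e.1 (MultiIndex.zero N (2 * m)))]
    with x h1 h3
  rw [ContinuousMap.coe_smul, Pi.smul_apply, h1]
  exact h3.symm

theorem norm_vel_le_sum {N : ℕ} (v : Vel N) : ‖v‖ ≤ ∑ j, |v j| := by
  have h := EuclideanSpace.basisFun (Fin N) ℝ |>.sum_repr v
  calc ‖v‖ = ‖∑ j, v j • EuclideanSpace.basisFun (Fin N) ℝ j‖ := by
        conv_lhs => rw [← h]
        simp
    _ ≤ _ := by
        refine (norm_sum_le _ _).trans (Finset.sum_le_sum fun j _ => ?_)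
        simp [norm_smul]

/-- A constant for Sobolev's embedding into the Lipschitz functions. -/
def sobolevConst (N : ℕ) : ℝ≥0 :=
  ((1 + 2 * Real.pi * N) * N * ∑' n, fourierWeight (N := N) n).toNNReal

theorem coe_sobolevConst (N : ℕ) :
    (sobolevConst N : ℝ) = (1 + 2 * Real.pi * N) * N * ∑' n, fourierWeight (N := N) n :=
  Real.coe_toNNReal _ (mul_nonneg (by positivity) (tsum_nonneg fun n => fourierWeight_nonneg n))

theorem Force.norm_field_apply_le {N m : ℕ} (hm : N + 1 < m) (e : Force N m) (x : Torus N) :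
    ‖e.field x‖ ≤ sobolevConst N * ‖e‖ := by
  have hW : 0 ≤ ∑' n, fourierWeight (N := N) n := tsum_nonneg fun n => fourierWeight_nonneg n
  refine (norm_vel_le_sum _).trans ?_
  have h1 : ∀ j ∈ Finset.univ, |e.field x j| ≤ ‖e‖ * ∑' n, fourierWeight (N := N) n := by
    intro j _
    rw [e.field_apply hm]
    exact (Complex.abs_re_le_norm _).trans (norm_fieldSeries_apply_le hm e j x)
  refine (Finset.sum_le_card_nsmul _ _ _ h1).trans ?_
  rw [coe_sobolevConst]
  simp only [Finset.card_univ, Fintype.card_fin, nsmul_eq_mul]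
  have : (N : ℝ) * (‖e‖ * ∑' n, fourierWeight (N := N) n) =
    1 * N * (∑' n, fourierWeight (N := N) n) * ‖e‖ := by ring
  rw [this]
  gcongr
  have := Real.pi_pos
  linarith [show (0:ℝ) ≤ 2 * Real.pi * N by positivity]

theorem Force.norm_field_sub_le {N m : ℕ} (hm : N + 1 < m) (e : Force N m) (x y : Torus N) :
    ‖e.field x - e.field y‖ ≤ sobolevConst N * ‖e‖ * ‖x - y‖ := by
  have hW : 0 ≤ ∑' n, fourierWeight (N := N) n := tsum_nonneg fun n => fourierWeight_nonneg n
  refine (norm_vel_le_sum _).trans ?_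
  have h1 : ∀ j ∈ Finset.univ, |(e.field x - e.field y) j| ≤
      2 * Real.pi * N * (‖e‖ * ∑' n, fourierWeight (N := N) n) * ‖x - y‖ := by
    intro j _
    rw [PiLp.sub_apply, e.field_apply hm, e.field_apply hm, ← Complex.sub_re]
    exact (Complex.abs_re_le_norm _).trans (norm_fieldSeries_sub_le hm e j x y)
  refine (Finset.sum_le_card_nsmul _ _ _ h1).trans ?_
  rw [coe_sobolevConst]
  simp only [Finset.card_univ, Fintype.card_fin, nsmul_eq_mul]
  have : (N : ℝ) * (2 * Real.pi * N * (‖e‖ * ∑' n, fourierWeight (N := N) n) * ‖x - y‖) =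
    (2 * Real.pi * N) * N * (∑' n, fourierWeight (N := N) n) * ‖e‖ * ‖x - y‖ := by ring
  rw [this]
  gcongr
  linarith

/-- Sobolev's embedding of the force fields into the continuous vector fields. -/
def fieldCLM {N m : ℕ} (hm : N + 1 < m) : Force N m →L[ℝ] C(Torus N, Vel N) :=
  LinearMap.mkContinuous
    { toFun := Force.field
      map_add' := Force.field_add hm
      map_smul' := Force.field_smul hm }
    (sobolevConst N) fun e => (ContinuousMap.norm_le _ (by positivity)).2
      fun x => e.norm_field_apply_le hm x

/-! ### Weakly singular Volterra equations -/

section Volterra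

set_option linter.unusedSectionVars false

variable {X : Type*} [NormedAddCommGroup X] [NormedSpace ℝ X]

/-- The singular weight `(t - s)^{-1/2}`. -/
def singWeight (t s : ℝ) : ℝ := (t - s) ^ (-(1 / 2) : ℝ)

theorem singWeight_nonneg {t s : ℝ} (h : s ≤ t) : 0 ≤ singWeight t s :=
  Real.rpow_nonneg (by linarith) _

theorem intervalIntegrable_singWeight (t r : ℝ) :
    IntervalIntegrable (singWeight t) volume r t := by
  have h := (intervalIntegral.intervalIntegrable_rpow' (r := -(1 / 2)) (a := t - r) (b := 0)
    (by norm_num)).comp_sub_left t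
  rw [sub_sub_cancel, sub_zero] at h
  exact h

theorem intervalIntegrable_singWeight_mul (t r : ℝ) {a : ℝ → ℝ} (ha : Continuous a) :
    IntervalIntegrable (fun s => singWeight t s * a s) volume r t :=
  (intervalIntegrable_singWeight t r).mul_continuousOn ha.continuousOn

theorem integral_singWeight (t r : ℝ) :
    ∫ s in r..t, singWeight t s = 2 * √(t - r) := by
  simp only [singWeight]
  rw [intervalIntegral.integral_comp_sub_left (fun x => x ^ (-(1 / 2) : ℝ)) t, sub_self,
    integral_rpow (Or.inl (by norm_num)), Real.sqrt_eq_rpow]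
  norm_num
  ring

/-- `exp (l s)` is a weight for which the operator with kernel `κ (t-s)^{-1/2}` is a contraction. -/
def IsExpWeight (κ l : ℝ) : Prop :=
  0 ≤ l ∧ ∀ t : ℝ, 0 ≤ t →
    κ * ∫ s in (0 : ℝ)..t, singWeight t s * Real.exp (l * s) ≤ Real.exp (l * t) / 2

theorem exists_isExpWeight {κ : ℝ} (hκ : 0 ≤ κ) : ∃ l, IsExpWeight κ l := by
  set c := Real.Gamma (1 / 2) with hc
  have hc0 : 0 < c := Real.Gamma_pos_of_pos (by norm_num)
  have hp : 0 < 2 * κ * c + 1 := by positivity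
  -- Since ∫₀^∞ s^{-1/2} e^{-ls} ds = Γ(1/2) l^{-1/2}, this l makes κ Γ(1/2) / √l at most 1/2.
  refine ⟨(2 * κ * c + 1) ^ 2, by positivity, fun t ht => ?_⟩
  set l := (2 * κ * c + 1) ^ 2 with hl
  have hl0 : 0 < l := by positivity
  have h1 : ∫ s in (0 : ℝ)..t, singWeight t s * Real.exp (l * s) =
      Real.exp (l * t) * ∫ s in (0 : ℝ)..t, s ^ (-(1 / 2) : ℝ) * Real.exp (-(l * s)) := by
    have := intervalIntegral.integral_comp_sub_left (a := 0) (b := t)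
      (fun x => x ^ (-(1 / 2) : ℝ) * Real.exp (-(l * x))) t
    rw [sub_self, sub_zero] at this
    rw [← this, ← intervalIntegral.integral_const_mul]
    refine intervalIntegral.integral_congr fun s _ => ?_
    simp only [singWeight]
    rw [mul_left_comm, ← Real.exp_add]
    congr 2
    ring
  have h2 := Real.integral_rpow_mul_exp_neg_mul_Ioi (a := 1 / 2) (r := l) (by norm_num) hl0
  have e1 : (1 / 2 - 1 : ℝ) = -(1 / 2) := by norm_num
  rw [e1] at h2
  have h3 : ((1 / l) ^ (1 / 2 : ℝ)) = 1 / (2 * κ * c + 1) := by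
    rw [← Real.sqrt_eq_rpow, hl, Real.sqrt_div zero_le_one, Real.sqrt_sq hp.le, Real.sqrt_one]
  rw [h3] at h2
  have h4 : ∫ s in (0 : ℝ)..t, s ^ (-(1 / 2) : ℝ) * Real.exp (-(l * s)) ≤
      1 / (2 * κ * c + 1) * c := by
    rw [← h2, intervalIntegral.integral_of_le ht]
    refine setIntegral_mono_set ?_ ?_ (Ioc_subset_Ioi_self.eventuallyLE)
    · by_contra hn
      rw [integral_undef hn] at h2
      exact absurd h2.symm (by positivity)
    · filter_upwards [self_mem_ae_restrict measurableSet_Ioi] with s hs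
      exact mul_nonneg (Real.rpow_nonneg (le_of_lt hs) _) (Real.exp_nonneg _)
  rw [h1, mul_left_comm]
  have h5 : κ * ∫ s in (0 : ℝ)..t, s ^ (-(1 / 2) : ℝ) * Real.exp (-(l * s)) ≤ 1 / 2 := by
    refine (mul_le_mul_of_nonneg_left h4 hκ).trans ?_
    rw [one_div_mul_eq_div, mul_div_assoc', div_le_div_iff₀ hp two_pos]
    linarith
  have := Real.exp_pos (l * t)
  nlinarith

theorem IsExpWeight.one_le {κ l : ℝ} (h : IsExpWeight κ l) {t : ℝ} (ht : 0 ≤ t) :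
    1 ≤ Real.exp (l * t) := Real.one_le_exp (mul_nonneg h.1 ht)

theorem continuous_comp_toNNReal {Y : Type*} [TopologicalSpace Y] {u : ℝ≥0 → Y}
    (hu : Continuous u) : Continuous fun s : ℝ => u s.toNNReal :=
  hu.comp continuous_real_toNNReal

/-- At a point of [0,T] where e^{-lt} d(t) attains its maximum M, the integral term contributes at
most M/2, whence M ≤ 2|δ|. -/
theorem IsExpWeight.gronwall {κ l δ : ℝ} (hl : IsExpWeight κ l) (hκ : 0 ≤ κ) {T : ℝ≥0}
    {d : ℝ≥0 → ℝ} (hd : Continuous d)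
    (h : ∀ t ≤ T, d t ≤ δ + κ * ∫ s in (0 : ℝ)..t, singWeight t s * d s.toNNReal) :
    ∀ t ≤ T, d t ≤ 2 * |δ| * Real.exp (l * t) := by
  have hcont : Continuous fun t : ℝ≥0 => Real.exp (-(l * t)) * d t := by fun_prop
  obtain ⟨t₀, ht₀, hmax⟩ := (isCompact_Icc (a := (0 : ℝ≥0)) (b := T)).exists_isMaxOn
    ⟨0, by simp⟩ hcont.continuousOn
  set M := Real.exp (-(l * t₀)) * d t₀ with hM
  have hle : ∀ t ≤ T, d t ≤ M * Real.exp (l * t) := by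
    intro t ht
    have h1 : Real.exp (-(l * t)) * d t ≤ M := hmax (show t ∈ Icc 0 T from ⟨zero_le, ht⟩)
    have h2 := mul_le_mul_of_nonneg_right h1 (Real.exp_nonneg (l * t))
    rwa [mul_right_comm, ← Real.exp_add, neg_add_cancel, Real.exp_zero, one_mul] at h2
  have hMle : M ≤ |δ| + M / 2 := by
    have h1 : ∫ s in (0 : ℝ)..t₀, singWeight t₀ s * d s.toNNReal ≤
        ∫ s in (0 : ℝ)..t₀, M * (singWeight t₀ s * Real.exp (l * s)) := by
      refine intervalIntegral.integral_mono_on t₀.coe_nonneg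
        (intervalIntegrable_singWeight_mul _ _ (continuous_comp_toNNReal hd))
        ((intervalIntegrable_singWeight_mul _ _ (by fun_prop)).const_mul _) fun s hs => ?_
      have h2 := hle s.toNNReal (Real.toNNReal_le_iff_le_coe.2 (hs.2.trans (NNReal.coe_le_coe.2 ht₀.2)))
      rw [Real.coe_toNNReal _ hs.1] at h2
      calc _ ≤ singWeight t₀ s * (M * Real.exp (l * s)) :=
            mul_le_mul_of_nonneg_left h2 (singWeight_nonneg hs.2)
        _ = _ := by ring
    rw [intervalIntegral.integral_const_mul] at h1
    have h3 := hl.2 t₀ t₀.coe_nonneg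
    have h4 := h t₀ ht₀.2
    -- The bound of `IsExpWeight` gets multiplied by M, which requires M > 0; for M ≤ 0 the claim is
    -- a matter of signs.
    rcases le_or_gt M 0 with hM0 | hM0
    · have := abs_nonneg δ
      have h6 : d t₀ ≤ |δ| + M * (Real.exp (l * t₀) / 2) ∨ True := Or.inr trivial
      by_contra hcon
      push Not at hcon
      nlinarith [hM, h6]
    · have h5 : d t₀ ≤ |δ| + M * (Real.exp (l * t₀) / 2) := by
        have := le_abs_self δ
        have h7 := mul_le_mul_of_nonneg_left h1 hκ
        have h8 := mul_le_mul_of_nonneg_left h3 hM0.le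
        rw [mul_left_comm] at h7
        linarith
      have h6 := mul_le_mul_of_nonneg_left h5 (Real.exp_nonneg (-(l * t₀)))
      rw [← hM, mul_add, ← mul_assoc _ M, mul_comm _ M, mul_assoc, mul_div_assoc',
        ← Real.exp_add, neg_add_cancel, Real.exp_zero] at h6
      have h9 : Real.exp (-(l * t₀)) * |δ| ≤ |δ| :=
        mul_le_of_le_one_left (abs_nonneg _) (Real.exp_le_one_iff.2 (by
          have := mul_nonneg hl.1 t₀.coe_nonneg; simpa using this))
      linarith
  intro t ht
  refine (hle t ht).trans ?_
  have := Real.exp_nonneg (l * t)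
  nlinarith

/-- Kernels `h t s x` that are Lipschitz in `x` with a constant of order `(t - s)^{-1/2}`, for
`s < t ≤ T`. -/
structure IsVolterra (h : ℝ≥0 → ℝ≥0 → X → X) (T : ℝ≥0) (κ : ℝ) : Prop where
  nonneg : 0 ≤ κ
  lip : ∀ s t, s < t → t ≤ T → ∀ x y, ‖h t s x - h t s y‖ ≤ κ * singWeight t s * ‖x - y‖
  zero : ∀ s t, s < t → t ≤ T → ‖h t s 0‖ ≤ κ * singWeight t s
  meas : ∀ t ≤ T, ∀ u : ℝ≥0 → X, Continuous u →
    AEStronglyMeasurable (fun s : ℝ => h t s.toNNReal (u s.toNNReal))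
      (volume.restrict (Ioc (0 : ℝ) t))

/-- The Volterra operator with kernel `h`. -/
def volterraInt (h : ℝ≥0 → ℝ≥0 → X → X) (u : ℝ≥0 → X) (t : ℝ≥0) : X :=
  ∫ s in (0 : ℝ)..t, h t s.toNNReal (u s.toNNReal)

theorem toNNReal_lt_of_mem_Ioo {s : ℝ} {t : ℝ≥0} (h : s ∈ Ioo (0 : ℝ) t) : s.toNNReal < t := by
  rw [Real.toNNReal_lt_iff_lt_coe h.1.le]; exact h.2

theorem ae_mem_Ioo (t : ℝ) : ∀ᵐ s ∂(volume.restrict (Ioc (0 : ℝ) t)), s ∈ Ioo (0 : ℝ) t := by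
  rw [← restrict_Ioo_eq_restrict_Ioc]
  exact self_mem_ae_restrict measurableSet_Ioo

variable {h : ℝ≥0 → ℝ≥0 → X → X} {T : ℝ≥0} {κ : ℝ}

theorem IsVolterra.norm_le (hh : IsVolterra h T κ) {s t : ℝ≥0} (hst : s < t) (ht : t ≤ T) (x : X) :
    ‖h t s x‖ ≤ κ * singWeight t s * (1 + ‖x‖) := by
  have h1 := hh.lip s t hst ht x 0
  have h2 := hh.zero s t hst ht
  calc ‖h t s x‖ = ‖(h t s x - h t s 0) + h t s 0‖ := by rw [sub_add_cancel]
    _ ≤ _ := norm_add_le _ _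
    _ ≤ κ * singWeight t s * ‖x - 0‖ + κ * singWeight t s := add_le_add h1 h2
    _ = _ := by rw [sub_zero]; ring

theorem IsVolterra.intervalIntegrable (hh : IsVolterra h T κ) {t : ℝ≥0} (ht : t ≤ T)
    {u : ℝ≥0 → X} (hu : Continuous u) :
    IntervalIntegrable (fun s : ℝ => h t s.toNNReal (u s.toNNReal)) volume 0 t := by
  rw [intervalIntegrable_iff_integrableOn_Ioc_of_le t.coe_nonneg]
  have hi := (intervalIntegrable_singWeight_mul t 0 (a := fun s => 1 + ‖u s.toNNReal‖)
    (by have := continuous_comp_toNNReal hu; fun_prop)).const_mul κ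
  rw [intervalIntegrable_iff_integrableOn_Ioc_of_le t.coe_nonneg] at hi
  refine Integrable.mono' hi (hh.meas t ht u hu) ?_
  filter_upwards [ae_mem_Ioo t] with s hs
  have := hh.norm_le (toNNReal_lt_of_mem_Ioo hs) ht (u s.toNNReal)
  rwa [Real.coe_toNNReal _ hs.1.le, mul_assoc] at this

theorem IsVolterra.norm_volterraInt_sub_le (hh : IsVolterra h T κ) {t : ℝ≥0} (ht : t ≤ T)
    {u v : ℝ≥0 → X} (hu : Continuous u) (hv : Continuous v) :
    ‖volterraInt h u t - volterraInt h v t‖ ≤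
      κ * ∫ s in (0 : ℝ)..t, singWeight t s * ‖u s.toNNReal - v s.toNNReal‖ := by
  rw [volterraInt, volterraInt, ← intervalIntegral.integral_sub (hh.intervalIntegrable ht hu)
    (hh.intervalIntegrable ht hv), ← intervalIntegral.integral_const_mul]
  refine intervalIntegral.norm_integral_le_of_norm_le t.coe_nonneg ?_ ((intervalIntegrable_singWeight_mul
    _ _ (by
      have := continuous_comp_toNNReal hu; have := continuous_comp_toNNReal hv
      fun_prop)).const_mul _)
  have := ae_mem_Ioo t
  rw [ae_restrict_iff' measurableSet_Ioc] at this
  filter_upwards [this] with s hs hs'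
  have := hh.lip _ _ (toNNReal_lt_of_mem_Ioo (hs hs')) ht (u s.toNNReal) (v s.toNNReal)
  rwa [Real.coe_toNNReal _ hs'.1.le, mul_assoc] at this

theorem IsVolterra.norm_volterraInt_zero_le (hh : IsVolterra h T κ) {t : ℝ≥0} (ht : t ≤ T) :
    ‖volterraInt h 0 t‖ ≤ κ * ∫ s in (0 : ℝ)..t, singWeight t s := by
  rw [volterraInt, ← intervalIntegral.integral_const_mul]
  refine intervalIntegral.norm_integral_le_of_norm_le t.coe_nonneg ?_
    ((intervalIntegrable_singWeight _ _).const_mul _)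
  have := ae_mem_Ioo t
  rw [ae_restrict_iff' measurableSet_Ioc] at this
  filter_upwards [this] with s hs hs'
  have := hh.zero _ _ (toNNReal_lt_of_mem_Ioo (hs hs')) ht
  rwa [Real.coe_toNNReal _ hs'.1.le] at this

/-- Stability of the Volterra equation under a perturbation of the inhomogeneity. -/
theorem IsVolterra.norm_sub_le (hh : IsVolterra h T κ) {l δ : ℝ} (hl : IsExpWeight κ l)
    {g g' u v : ℝ≥0 → X} (hu : Continuous u) (hv : Continuous v)
    (hg : ∀ t ≤ T, ‖g t - g' t‖ ≤ δ)
    (eu : ∀ t ≤ T, u t = g t + volterraInt h u t) (ev : ∀ t ≤ T, v t = g' t + volterraInt h v t) :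
    ∀ t ≤ T, ‖u t - v t‖ ≤ 2 * |δ| * Real.exp (l * t) := by
  refine hl.gronwall hh.nonneg (by fun_prop) fun t ht => ?_
  rw [eu t ht, ev t ht, add_sub_add_comm]
  exact (norm_add_le _ _).trans (add_le_add (hg t ht) (hh.norm_volterraInt_sub_le ht hu hv))

theorem IsVolterra.eq_of_eq (hh : IsVolterra h T κ) {g u v : ℝ≥0 → X} (hu : Continuous u)
    (hv : Continuous v) (eu : ∀ t ≤ T, u t = g t + volterraInt h u t)
    (ev : ∀ t ≤ T, v t = g t + volterraInt h v t) : ∀ t ≤ T, u t = v t := by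
  obtain ⟨l, hl⟩ := exists_isExpWeight hh.nonneg
  intro t ht
  have := hh.norm_sub_le hl (δ := 0) hu hv (fun t _ => by simp) eu ev t ht
  simpa [sub_eq_zero] using this

/-- Picard iterates. -/
def picard (g : ℝ≥0 → X) (h : ℝ≥0 → ℝ≥0 → X → X) : ℕ → ℝ≥0 → X
  | 0 => 0
  | k + 1 => fun t => g t + volterraInt h (picard g h k) t

/-- The solution of the Volterra equation. -/
def volterraSol (g : ℝ≥0 → X) (h : ℝ≥0 → ℝ≥0 → X → X) (t : ℝ≥0) : X :=
  limUnder atTop fun k => picard g h k t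

theorem continuous_picard {g : ℝ≥0 → X} (hg : Continuous g)
    (hc : ∀ u : ℝ≥0 → X, Continuous u → Continuous (volterraInt h u)) (k : ℕ) :
    Continuous (picard g h k) := by
  induction k with
  | zero => exact continuous_const
  | succ k ih => exact hg.add (hc _ ih)

/-- Each iteration halves the distance in the norm with weight e^{lt}. The first increment is at
most M + e^{lt}/2, which explains the factor M + 1. -/
theorem IsVolterra.norm_picard_sub_le (hh : IsVolterra h T κ) {l M : ℝ} (hl : IsExpWeight κ l)
    {g : ℝ≥0 → X} (hg : Continuous g) (hgM : ∀ t ≤ T, ‖g t‖ ≤ M)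
    (hc : ∀ u : ℝ≥0 → X, Continuous u → Continuous (volterraInt h u)) (k : ℕ) :
    ∀ t ≤ T, ‖picard g h (k + 1) t - picard g h k t‖ ≤
      (1 / 2) ^ k * ((M + 1) * Real.exp (l * t)) := by
  have hM : 0 ≤ M := (norm_nonneg _).trans (hgM 0 zero_le)
  induction k with
  | zero =>
    intro t ht
    simp only [picard, Pi.zero_apply, sub_zero, pow_zero, one_mul]
    have h1 := hh.norm_volterraInt_zero_le ht
    have h2 : ∫ s in (0 : ℝ)..t, singWeight t s ≤
        ∫ s in (0 : ℝ)..t, singWeight t s * Real.exp (l * s) :=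
      intervalIntegral.integral_mono_on t.coe_nonneg (intervalIntegrable_singWeight _ _)
        (intervalIntegrable_singWeight_mul _ _ (by fun_prop)) fun s hs =>
          le_mul_of_one_le_right (singWeight_nonneg hs.2) (hl.one_le hs.1)
    have h3 := hl.2 t t.coe_nonneg
    have h4 := mul_le_mul_of_nonneg_left h2 hh.nonneg
    have h5 := hl.one_le t.coe_nonneg
    have h6 := hgM t ht
    have h7 := mul_le_mul_of_nonneg_left h5 hM
    refine (norm_add_le _ _).trans ?_
    linarith
  | succ k ih =>
    intro t ht
    simp only [picard, add_sub_add_left_eq_sub]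
    have c1 := continuous_picard hg hc (k + 1)
    have c0 := continuous_picard hg hc k
    refine (hh.norm_volterraInt_sub_le ht c1 c0).trans ?_
    have h1 : ∫ s in (0 : ℝ)..t, singWeight t s *
        ‖picard g h (k + 1) s.toNNReal - picard g h k s.toNNReal‖ ≤
        ∫ s in (0 : ℝ)..t, ((1 / 2) ^ k * (M + 1)) * (singWeight t s * Real.exp (l * s)) := by
      refine intervalIntegral.integral_mono_on t.coe_nonneg
        (intervalIntegrable_singWeight_mul _ _ (by
          have := continuous_comp_toNNReal c1; have := continuous_comp_toNNReal c0; fun_prop))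
        ((intervalIntegrable_singWeight_mul _ _ (by fun_prop)).const_mul _) fun s hs => ?_
      have h2 := ih s.toNNReal (Real.toNNReal_le_iff_le_coe.2 (hs.2.trans (NNReal.coe_le_coe.2 ht)))
      rw [Real.coe_toNNReal _ hs.1] at h2
      calc _ ≤ singWeight t s * ((1 / 2) ^ k * ((M + 1) * Real.exp (l * s))) :=
            mul_le_mul_of_nonneg_left h2 (singWeight_nonneg hs.2)
        _ = _ := by ring
    rw [intervalIntegral.integral_const_mul] at h1
    have h3 := hl.2 t t.coe_nonneg
    calc _ ≤ κ * (((1 / 2) ^ k * (M + 1)) *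
          ∫ s in (0 : ℝ)..t, singWeight t s * Real.exp (l * s)) :=
          mul_le_mul_of_nonneg_left h1 hh.nonneg
      _ = ((1 / 2) ^ k * (M + 1)) *
          (κ * ∫ s in (0 : ℝ)..t, singWeight t s * Real.exp (l * s)) := by ring
      _ ≤ ((1 / 2) ^ k * (M + 1)) * (Real.exp (l * t) / 2) := by gcongr
      _ = _ := by ring

section Complete

variable [CompleteSpace X]

theorem IsVolterra.tendsto_picard (hh : IsVolterra h T κ) {g : ℝ≥0 → X} (hg : Continuous g)
    (hc : ∀ u : ℝ≥0 → X, Continuous u → Continuous (volterraInt h u)) {t : ℝ≥0} (ht : t ≤ T) :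
    Tendsto (fun k => picard g h k t) atTop (𝓝 (volterraSol g h t)) := by
  obtain ⟨l, hl⟩ := exists_isExpWeight hh.nonneg
  obtain ⟨M, hM⟩ := (isCompact_Icc (a := (0 : ℝ≥0)) (b := T)).exists_bound_of_continuousOn
    hg.continuousOn
  refine CauchySeq.tendsto_limUnder (cauchySeq_of_le_geometric (1 / 2)
    ((M + 1) * Real.exp (l * t)) (by norm_num) fun k => ?_)
  rw [dist_comm, dist_eq_norm, mul_comm]
  exact hh.norm_picard_sub_le hl hg (fun s hs => hM s ⟨zero_le, hs⟩) hc k t ht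

theorem IsVolterra.norm_picard_sub_sol_le (hh : IsVolterra h T κ) {l M : ℝ}
    (hl : IsExpWeight κ l) {g : ℝ≥0 → X} (hg : Continuous g) (hgM : ∀ t ≤ T, ‖g t‖ ≤ M)
    (hc : ∀ u : ℝ≥0 → X, Continuous u → Continuous (volterraInt h u)) (k : ℕ) :
    ∀ t ≤ T, ‖picard g h k t - volterraSol g h t‖ ≤
      (1 / 2) ^ k * (2 * ((M + 1) * Real.exp (l * T))) := by
  intro t ht
  have hM : 0 ≤ M := (norm_nonneg _).trans (hgM 0 zero_le)
  have h1 := dist_le_of_le_geometric_of_tendsto (1 / 2) ((M + 1) * Real.exp (l * T))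
    (by norm_num) (f := fun k => picard g h k t) (fun k => ?_) (hh.tendsto_picard hg hc ht) k
  · rw [dist_eq_norm] at h1
    refine h1.trans (le_of_eq ?_)
    ring
  · rw [dist_comm, dist_eq_norm, mul_comm]
    refine (hh.norm_picard_sub_le hl hg hgM hc k t ht).trans ?_
    have := hl.1
    gcongr

/-- Picard iterates converge locally uniformly. Continuity of t ↦ `volterraInt h u t` has to be
assumed, because `IsVolterra` does not control how the kernel varies with its upper time. -/
theorem continuous_volterraSol (hh : ∀ T, ∃ κ, IsVolterra h T κ) {g : ℝ≥0 → X}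
    (hg : Continuous g) (hc : ∀ u : ℝ≥0 → X, Continuous u → Continuous (volterraInt h u)) :
    Continuous (volterraSol g h) := by
  refine TendstoLocallyUniformly.continuous (F := picard g h) (p := atTop) ?_
    (Eventually.of_forall (continuous_picard hg hc)).frequently
  rw [tendstoLocallyUniformly_iff_forall_isCompact]
  intro K hK
  obtain ⟨T, hT⟩ := hK.bddAbove
  obtain ⟨κ, hh⟩ := hh T
  obtain ⟨l, hl⟩ := exists_isExpWeight hh.nonneg
  obtain ⟨M, hM⟩ := (isCompact_Icc (a := (0 : ℝ≥0)) (b := T)).exists_bound_of_continuousOn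
    hg.continuousOn
  rw [Metric.tendstoUniformlyOn_iff]
  intro ε hε
  have ht : Tendsto (fun k : ℕ => (1 / 2 : ℝ) ^ k * (2 * ((M + 1) * Real.exp (l * T)))) atTop
      (𝓝 (0 * _)) :=
    (tendsto_pow_atTop_nhds_zero_of_lt_one (by norm_num) (by norm_num)).mul_const _
  rw [zero_mul] at ht
  filter_upwards [ht.eventually (gt_mem_nhds hε)] with k hk t htK
  rw [dist_comm, dist_eq_norm]
  exact (hh.norm_picard_sub_sol_le hl hg (fun s hs => hM s ⟨zero_le, hs⟩) hc k t
    (hT htK)).trans_lt hk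

theorem volterraSol_eq (hh : ∀ T, ∃ κ, IsVolterra h T κ) {g : ℝ≥0 → X}
    (hg : Continuous g) (hc : ∀ u : ℝ≥0 → X, Continuous u → Continuous (volterraInt h u))
    (t : ℝ≥0) : volterraSol g h t = g t + volterraInt h (volterraSol g h) t := by
  obtain ⟨κ, hv⟩ := hh t
  obtain ⟨l, hl⟩ := exists_isExpWeight hv.nonneg
  obtain ⟨M, hM⟩ := (isCompact_Icc (a := (0 : ℝ≥0)) (b := t)).exists_bound_of_continuousOn
    hg.continuousOn
  have hs := continuous_volterraSol hh hg hc
  have h1 := (hv.tendsto_picard hg hc le_rfl).comp (tendsto_add_atTop_nat 1)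
  refine tendsto_nhds_unique h1 ?_
  refine Tendsto.add tendsto_const_nhds ?_
  rw [tendsto_iff_norm_sub_tendsto_zero]
  set C := 2 * ((M + 1) * Real.exp (l * t))
  have ht : Tendsto (fun k : ℕ => (1 / 2 : ℝ) ^ k * (C * (κ * (2 * √t)))) atTop (𝓝 (0 * _)) :=
    (tendsto_pow_atTop_nhds_zero_of_lt_one (by norm_num) (by norm_num)).mul_const _
  rw [zero_mul] at ht
  refine squeeze_zero (fun _ => norm_nonneg _) (fun k => ?_) ht
  have c0 := continuous_picard hg hc k
  refine (hv.norm_volterraInt_sub_le le_rfl c0 hs).trans ?_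
  have h2 : ∫ s in (0 : ℝ)..t, singWeight t s *
      ‖picard g h k s.toNNReal - volterraSol g h s.toNNReal‖ ≤
      ∫ s in (0 : ℝ)..t, singWeight t s * ((1 / 2) ^ k * C) := by
    refine intervalIntegral.integral_mono_on t.coe_nonneg
      (intervalIntegrable_singWeight_mul _ _ (by
        have := continuous_comp_toNNReal hs; have := continuous_comp_toNNReal c0; fun_prop))
      (intervalIntegrable_singWeight_mul _ _ (by fun_prop)) fun s hs => ?_
    exact mul_le_mul_of_nonneg_left (hv.norm_picard_sub_sol_le hl hg
      (fun s hs => hM s ⟨zero_le, hs⟩) hc k s.toNNReal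
      (Real.toNNReal_le_iff_le_coe.2 hs.2)) (singWeight_nonneg hs.2)
  rw [intervalIntegral.integral_mul_const, integral_singWeight, sub_zero] at h2
  calc _ ≤ κ * (2 * √t * ((1 / 2) ^ k * C)) := mul_le_mul_of_nonneg_left h2 hv.nonneg
    _ = _ := by ring

/-- Continuous dependence of the solution on the kernel and the inhomogeneity. -/
theorem tendsto_volterraSol {ι : Type*} {L : Filter ι} [L.IsCountablyGenerated]
    {g : ℝ≥0 → X} {gn : ι → ℝ≥0 → X} {hn : ι → ℝ≥0 → ℝ≥0 → X → X} {M : ℝ}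
    (hh : IsVolterra h T κ) (hhn : ∀ n, IsVolterra (hn n) T κ)
    (hg : Continuous g) (hgn : ∀ n, Continuous (gn n))
    (hc : ∀ u : ℝ≥0 → X, Continuous u → Continuous (volterraInt h u))
    (hcn : ∀ n, ∀ u : ℝ≥0 → X, Continuous u → Continuous (volterraInt (hn n) u))
    (hgM : ∀ t ≤ T, ‖g t‖ ≤ M) (hgnM : ∀ n, ∀ t ≤ T, ‖gn n t‖ ≤ M)
    (hgt : ∀ t ≤ T, Tendsto (fun n => gn n t) L (𝓝 (g t)))
    (hht : ∀ s t, s < t → t ≤ T → ∀ x, Tendsto (fun n => hn n t s x) L (𝓝 (h t s x))) :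
    ∀ t ≤ T, Tendsto (fun n => volterraSol (gn n) (hn n) t) L (𝓝 (volterraSol g h t)) := by
  obtain ⟨l, hl⟩ := exists_isExpWeight hh.nonneg
  have hM : 0 ≤ M := (norm_nonneg _).trans (hgM 0 zero_le)
  set C := 2 * ((M + 1) * Real.exp (l * T)) with hC
  have hC0 : 0 ≤ C := by positivity
  -- The rate of convergence of the iteration does not depend on n, so the iterates are bounded
  -- uniformly in n and k. This bound dominates the integrands in the passage to the limit.
  have hpb : ∀ n k, ∀ t ≤ T, ‖picard (gn n) (hn n) k t‖ ≤ C + C := by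
    intro n k t ht
    have h1 := (hhn n).norm_picard_sub_sol_le hl (hgn n) (hgnM n) (hcn n) k t ht
    have h2 := (hhn n).norm_picard_sub_sol_le hl (hgn n) (hgnM n) (hcn n) 0 t ht
    simp only [picard, Pi.zero_apply, zero_sub, norm_neg, pow_zero, one_mul] at h2
    rw [← hC] at h1 h2
    have h3 : (1 / 2 : ℝ) ^ k ≤ 1 := pow_le_one₀ (by norm_num) (by norm_num)
    have h4 : ‖picard (gn n) (hn n) k t‖ ≤ ‖picard (gn n) (hn n) k t
        - volterraSol (gn n) (hn n) t‖ + ‖volterraSol (gn n) (hn n) t‖ := by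
      simpa using norm_add_le (picard (gn n) (hn n) k t - volterraSol (gn n) (hn n) t)
        (volterraSol (gn n) (hn n) t)
    nlinarith
  have hpic : ∀ k, ∀ t ≤ T, Tendsto (fun n => picard (gn n) (hn n) k t) L
      (𝓝 (picard g h k t)) := by
    intro k
    induction k with
    | zero => intro t _; exact tendsto_const_nhds
    | succ k ih =>
      intro t ht
      refine (hgt t ht).add ?_
      have cn := fun n => continuous_picard (hgn n) (hcn n) k
      refine intervalIntegral.tendsto_integral_filter_of_dominated_convergence
        (fun s => κ * (singWeight t s * (1 + (C + C)))) ?_ ?_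
        ((intervalIntegrable_singWeight_mul _ _ (by fun_prop)).const_mul _) ?_
      · refine Eventually.of_forall fun n => ?_
        rw [uIoc_of_le t.coe_nonneg]
        exact (hhn n).meas t ht _ (cn n)
      · refine Eventually.of_forall fun n => ?_
        rw [uIoc_of_le t.coe_nonneg]
        have := ae_mem_Ioo t
        rw [ae_restrict_iff' measurableSet_Ioc] at this
        filter_upwards [this] with s hs hs'
        have hlt := toNNReal_lt_of_mem_Ioo (hs hs')
        have h1 := (hhn n).norm_le hlt ht (picard (gn n) (hn n) k s.toNNReal)
        rw [Real.coe_toNNReal _ hs'.1.le, mul_assoc] at h1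
        refine h1.trans (mul_le_mul_of_nonneg_left (mul_le_mul_of_nonneg_left ?_
          (singWeight_nonneg hs'.2)) hh.nonneg)
        linarith [hpb n k s.toNNReal (hlt.le.trans ht)]
      · rw [uIoc_of_le t.coe_nonneg]
        have := ae_mem_Ioo t
        rw [ae_restrict_iff' measurableSet_Ioc] at this
        filter_upwards [this] with s hs hs'
        have hlt := toNNReal_lt_of_mem_Ioo (hs hs')
        have h1 := hht _ _ hlt ht (picard g h k s.toNNReal)
        have h2 : Tendsto (fun n => hn n t s.toNNReal (picard (gn n) (hn n) k s.toNNReal)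
            - hn n t s.toNNReal (picard g h k s.toNNReal)) L (𝓝 0) := by
          rw [tendsto_zero_iff_norm_tendsto_zero]
          have h3 := tendsto_iff_norm_sub_tendsto_zero.1 (ih s.toNNReal (hlt.le.trans ht))
          have h4 := h3.const_mul (κ * singWeight t s.toNNReal)
          rw [mul_zero] at h4
          exact squeeze_zero (fun _ => norm_nonneg _)
            (fun n => (hhn n).lip _ _ hlt ht _ _) h4
        simpa using h2.add h1
  intro t ht
  -- Three-ε argument: the iterates approach the solutions uniformly in n, and each fixed iterate
  -- converges along `L`.
  rw [Metric.tendsto_nhds]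
  intro ε hε
  have htz : Tendsto (fun k : ℕ => (1 / 2 : ℝ) ^ k * C) atTop (𝓝 (0 * _)) :=
    (tendsto_pow_atTop_nhds_zero_of_lt_one (by norm_num) (by norm_num)).mul_const _
  rw [zero_mul] at htz
  obtain ⟨k, hk⟩ := (htz.eventually (gt_mem_nhds (show 0 < ε / 3 by positivity))).exists
  filter_upwards [Metric.tendsto_nhds.1 (hpic k t ht) (ε / 3) (by positivity)] with n hn'
  have h1 := (hhn n).norm_picard_sub_sol_le hl (hgn n) (hgnM n) (hcn n) k t ht
  have h2 := hh.norm_picard_sub_sol_le hl hg hgM hc k t ht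
  rw [← dist_eq_norm, ← hC] at h1 h2
  have := dist_triangle4 (volterraSol (gn n) (hn n) t) (picard (gn n) (hn n) k t)
    (picard g h k t) (volterraSol g h t)
  rw [dist_comm (picard (gn n) (hn n) k t)] at h1
  linarith

end Complete

end Volterra

/-! ### Evolution families -/

section Evolution

variable {X : Type*} [NormedAddCommGroup X] [NormedSpace ℝ X]

/-- An evolution family `G` of contractions together with weakly singular operators `H` such that
`G t r ∘ H r s = H t s`. -/
structure IsEvolution (G H : ℝ≥0 → ℝ≥0 → X →L[ℝ] X) : Prop where
  norm_le : ∀ s t, s ≤ t → ∀ x, ‖G t s x‖ ≤ ‖x‖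
  refl : ∀ t x, G t t x = x
  trans : ∀ s r t, s ≤ r → r ≤ t → ∀ x, G t r (G r s x) = G t s x
  trans' : ∀ s r t, s < r → r ≤ t → ∀ x, G t r (H r s x) = H t s x
  continuousOn : ∀ s x, ContinuousOn (fun t => G t s x) (Ici s)
  bound : ∀ T : ℝ≥0, ∃ κ, 0 ≤ κ ∧ ∀ s t, s < t → t ≤ T → ∀ x,
    ‖H t s x‖ ≤ κ * singWeight t s * ‖x‖
  meas : ∀ (t : ℝ≥0) (u : ℝ≥0 → X), Continuous u →
    AEStronglyMeasurable (fun s : ℝ => H t s.toNNReal (u s.toNNReal))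
      (volume.restrict (Ioc (0 : ℝ) t))

variable {G H : ℝ≥0 → ℝ≥0 → X →L[ℝ] X}

theorem isVolterra_of_bound {t : ℝ≥0} {κ : ℝ} (hκ : 0 ≤ κ)
    (hb : ∀ r s, r < s → s ≤ t → ∀ x, ‖H s r x‖ ≤ κ * singWeight s r * ‖x‖)
    (hm : ∀ (t : ℝ≥0) (u : ℝ≥0 → X), Continuous u →
      AEStronglyMeasurable (fun s : ℝ => H t s.toNNReal (u s.toNNReal))
        (volume.restrict (Ioc (0 : ℝ) t))) :
    IsVolterra (fun t s x => H t s x) t κ where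
  nonneg := hκ
  lip s t hst ht x y := by rw [← map_sub]; exact hb s t hst ht _
  zero s t hst ht := by
    rw [map_zero, norm_zero]
    exact mul_nonneg hκ (singWeight_nonneg (NNReal.coe_le_coe.2 hst.le))
  meas t _ u hu := hm t u hu

theorem IsEvolution.isVolterra (hG : IsEvolution G H) (T : ℝ≥0) :
    ∃ κ, IsVolterra (fun t s x => H t s x) T κ := by
  obtain ⟨κ, hκ, hb⟩ := hG.bound T
  exact ⟨κ, isVolterra_of_bound hκ hb hG.meas⟩

theorem IsEvolution.intervalIntegrable (hG : IsEvolution G H) (t : ℝ≥0) {u : ℝ≥0 → X}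
    (hu : Continuous u) :
    IntervalIntegrable (fun s : ℝ => H t s.toNNReal (u s.toNNReal)) volume 0 t := by
  obtain ⟨κ, hκ⟩ := hG.isVolterra t
  exact hκ.intervalIntegrable le_rfl hu

variable [CompleteSpace X]

/-- On [0,r] the rule H(t,s) = G(t,r) H(r,s) lets G(t,r) be pulled out of the integral. Continuity
in time and the restart property both rest on this. -/
theorem IsEvolution.volterraInt_split (hG : IsEvolution G H) {r t : ℝ≥0} (hrt : r ≤ t)
    {u : ℝ≥0 → X} (hu : Continuous u) :
    volterraInt (fun t s x => H t s x) u t =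
      G t r (volterraInt (fun t s x => H t s x) u r) +
        ∫ s in (r : ℝ)..t, H t s.toNNReal (u s.toNNReal) := by
  have hi := hG.intervalIntegrable t hu
  have hrt' := NNReal.coe_le_coe.2 hrt
  have h1 : volterraInt (fun t s x => H t s x) u t =
      (∫ s in (0 : ℝ)..r, H t s.toNNReal (u s.toNNReal)) +
        ∫ s in (r : ℝ)..t, H t s.toNNReal (u s.toNNReal) :=
    (intervalIntegral.integral_add_adjacent_intervals
      (hi.mono_set (by rw [uIcc_of_le r.coe_nonneg, uIcc_of_le t.coe_nonneg]; gcongr))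
      (hi.mono_set (by
        rw [uIcc_of_le hrt', uIcc_of_le t.coe_nonneg]; gcongr; exact r.coe_nonneg))).symm
  rw [h1]
  congr 1
  simp only [volterraInt]
  rw [← ContinuousLinearMap.intervalIntegral_comp_comm _ (hG.intervalIntegrable r hu)]
  refine intervalIntegral.integral_congr_ae ?_
  have := ae_mem_Ioo r
  rw [ae_restrict_iff' measurableSet_Ioc] at this
  rw [uIoc_of_le r.coe_nonneg]
  filter_upwards [this] with s hs hs'
  exact (hG.trans' _ _ _ (toNNReal_lt_of_mem_Ioo (hs hs')) hrt _).symm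

theorem norm_integral_singular_le {t r : ℝ≥0} (hrt : r ≤ t) {κ U : ℝ} (hκ : 0 ≤ κ)
    (hb : ∀ s, s < t → ∀ x, ‖H t s x‖ ≤ κ * singWeight t s * ‖x‖) {u : ℝ≥0 → X}
    (hU : ∀ s ≤ t, ‖u s‖ ≤ U) :
    ‖∫ s in (r : ℝ)..t, H t s.toNNReal (u s.toNNReal)‖ ≤ κ * U * (2 * √(t - r)) := by
  rw [← integral_singWeight, ← intervalIntegral.integral_const_mul]
  refine intervalIntegral.norm_integral_le_of_norm_le (NNReal.coe_le_coe.2 hrt) ?_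
    ((intervalIntegrable_singWeight _ _).const_mul _)
  have := ae_mem_Ioo t
  rw [ae_restrict_iff' measurableSet_Ioc] at this
  filter_upwards [this] with s hs hs'
  have hlt := toNNReal_lt_of_mem_Ioo (hs ⟨lt_of_le_of_lt r.coe_nonneg hs'.1, hs'.2⟩)
  have h0 : 0 ≤ s := r.coe_nonneg.trans hs'.1.le
  refine (hb _ hlt _).trans ?_
  rw [Real.coe_toNNReal _ h0]
  have := hU s.toNNReal hlt.le
  have h2 := singWeight_nonneg hs'.2
  calc _ ≤ κ * singWeight t s * U := by gcongr
    _ = _ := by ring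

/-- Split at a time r slightly before t₀. The part after r is of order √(t - r), and the part before
r is G(t,r) applied to a fixed vector, which is continuous in t. No continuity of H in time is
needed. -/
theorem IsEvolution.continuous_volterraInt (hG : IsEvolution G H) {u : ℝ≥0 → X}
    (hu : Continuous u) : Continuous (volterraInt (fun t s x => H t s x) u) := by
  rw [continuous_iff_continuousAt]
  intro t₀
  rw [Metric.continuousAt_iff']
  intro ε hε
  obtain ⟨κ, hκ, hb⟩ := hG.bound (t₀ + 1)
  obtain ⟨U, hU⟩ := (isCompact_Icc (a := (0 : ℝ≥0)) (b := t₀ + 1)).exists_bound_of_continuousOn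
    hu.continuousOn
  have hU0 : 0 ≤ U := (norm_nonneg _).trans (hU 0 ⟨le_rfl, zero_le⟩)
  have hU' : ∀ s ≤ t₀ + 1, ‖u s‖ ≤ U := fun s hs => hU s ⟨zero_le, hs⟩
  have hlim : Tendsto (fun r : ℝ≥0 => κ * U * (2 * √((t₀ : ℝ) - r))) (𝓝 t₀)
      (𝓝 (κ * U * (2 * √((t₀ : ℝ) - t₀)))) := by
    refine Continuous.tendsto ?_ t₀
    fun_prop
  rw [sub_self, Real.sqrt_zero, mul_zero, mul_zero] at hlim
  have hev := hlim.eventually (gt_mem_nhds (show 0 < ε / 4 by positivity))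
  -- At t₀ = 0 there is no earlier time and r = 0 works, since [0,∞) is then the whole time axis.
  obtain ⟨r, hrt, hr, hnhds⟩ : ∃ r ≤ t₀, κ * U * (2 * √((t₀ : ℝ) - r)) < ε / 4 ∧
      Ici r ∈ 𝓝 t₀ := by
    rcases eq_or_ne t₀ 0 with h0 | h0
    · refine ⟨t₀, le_rfl, by simp; positivity, ?_⟩
      rw [h0]
      exact Filter.mem_of_superset univ_mem fun x _ => mem_Ici.2 zero_le
    · have hne : (𝓝[<] t₀).NeBot := nhdsLT_neBot_of_exists_lt ⟨0, pos_iff_ne_zero.2 h0⟩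
      obtain ⟨r, hr, hrlt⟩ := ((hev.filter_mono nhdsWithin_le_nhds).and
        (self_mem_nhdsWithin : Iio t₀ ∈ 𝓝[<] t₀)).exists
      exact ⟨r, le_of_lt hrlt, hr, Ici_mem_nhds hrlt⟩
  set x := volterraInt (fun t s x => H t s x) u r
  have hc : ContinuousAt (fun t => G t r x) t₀ := (hG.continuousOn r x).continuousAt hnhds
  have hlim2 : Tendsto (fun t : ℝ≥0 => κ * U * (2 * √((t : ℝ) - r))) (𝓝 t₀)
      (𝓝 (κ * U * (2 * √((t₀ : ℝ) - r)))) := by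
    refine Continuous.tendsto ?_ t₀
    fun_prop
  filter_upwards [hnhds, Metric.continuousAt_iff'.1 hc (ε / 4) (by positivity),
    hlim2.eventually (gt_mem_nhds hr), Iic_mem_nhds (show t₀ < t₀ + 1 by simp)]
    with t ht1 ht2 ht3 ht4
  rw [hG.volterraInt_split ht1 hu, hG.volterraInt_split hrt hu]
  have b1 := norm_integral_singular_le ht1 hκ (H := H)
    (fun s hs x => hb s t hs ht4 x) (fun s hs => hU' s (hs.trans ht4))
  have b2 := norm_integral_singular_le hrt hκ (H := H)
    (fun s hs x => hb s t₀ hs (by simp) x) (fun s hs => hU' s (hs.trans (by simp)))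
  rw [dist_eq_norm] at ht2 ⊢
  rw [add_sub_add_comm]
  refine (norm_add_le _ _).trans_lt ?_
  have := norm_sub_le (∫ s in (r : ℝ)..t, H t s.toNNReal (u s.toNNReal))
    (∫ s in (r : ℝ)..t₀, H t₀ s.toNNReal (u s.toNNReal))
  linarith

/-- `u` solves `u(t) = G(t,0) f + ∫₀ᵗ H(t,s) u(s) ds`. -/
def IsMild (G H : ℝ≥0 → ℝ≥0 → X →L[ℝ] X) (f : X) (u : ℝ≥0 → X) : Prop :=
  Continuous u ∧ ∀ t : ℝ≥0, u t = G t 0 f + ∫ s in (0 : ℝ)..t, H t s.toNNReal (u s.toNNReal)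

/-- The mild solution. -/
def mildSol (G H : ℝ≥0 → ℝ≥0 → X →L[ℝ] X) (f : X) : ℝ≥0 → X :=
  volterraSol (fun t => G t 0 f) (fun t s x => H t s x)

theorem IsEvolution.continuous_left (hG : IsEvolution G H) (f : X) :
    Continuous fun t => G t 0 f := by
  have := hG.continuousOn 0 f
  rwa [show Ici (0 : ℝ≥0) = univ from eq_univ_of_forall fun _ => mem_Ici.2 zero_le,
    continuousOn_univ] at this

theorem IsEvolution.isMild_mildSol (hG : IsEvolution G H) (f : X) :
    IsMild G H f (mildSol G H f) :=
  ⟨continuous_volterraSol hG.isVolterra (hG.continuous_left f)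
      fun _ hu => hG.continuous_volterraInt hu,
    fun t => volterraSol_eq hG.isVolterra (hG.continuous_left f)
      (fun _ hu => hG.continuous_volterraInt hu) t⟩

theorem IsEvolution.eq_mildSol (hG : IsEvolution G H) {f : X} {u : ℝ≥0 → X}
    (hu : IsMild G H f u) : u = mildSol G H f := by
  have hs := hG.isMild_mildSol f
  funext t
  obtain ⟨κ, hκ⟩ := hG.isVolterra t
  exact hκ.eq_of_eq hu.1 hs.1 (fun t _ => hu.2 t) (fun t _ => hs.2 t) t le_rfl

theorem IsEvolution.continuous_mildSol_datum (hG : IsEvolution G H) (t : ℝ≥0) :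
    ∃ C : ℝ, ∀ s ≤ t, ∀ f g, ‖mildSol G H f s - mildSol G H g s‖ ≤ C * ‖f - g‖ := by
  obtain ⟨κ, hκ⟩ := hG.isVolterra t
  obtain ⟨l, hl⟩ := exists_isExpWeight hκ.nonneg
  refine ⟨2 * Real.exp (l * t), fun s hs f g => ?_⟩
  have hf := hG.isMild_mildSol f
  have hg := hG.isMild_mildSol g
  have := hκ.norm_sub_le hl (δ := ‖f - g‖) hf.1 hg.1 (fun r _ => by
    rw [← map_sub]; exact hG.norm_le _ _ zero_le _) (fun r _ => hf.2 r) (fun r _ => hg.2 r) s hs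
  rw [abs_norm] at this
  refine this.trans ?_
  have h1 : Real.exp (l * s) ≤ Real.exp (l * t) := by
    have := hl.1
    gcongr
  have := norm_nonneg (f - g)
  nlinarith

/-- A mild solution restarted at time `c` is a mild solution. -/
theorem IsEvolution.mildSol_add (hG : IsEvolution G H) (f : X) (c : ℝ≥0)
    (hG' : IsEvolution (fun t s => G (c + t) (c + s)) (fun t s => H (c + t) (c + s))) (t : ℝ≥0) :
    mildSol G H f (c + t) = mildSol (fun t s => G (c + t) (c + s))
      (fun t s => H (c + t) (c + s)) (mildSol G H f c) t := by
  have hs := hG.isMild_mildSol f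
  have : IsMild (fun t s => G (c + t) (c + s)) (fun t s => H (c + t) (c + s))
      (mildSol G H f c) (fun t => mildSol G H f (c + t)) := by
    refine ⟨hs.1.comp (by fun_prop), fun t => ?_⟩
    have h1 := hG.volterraInt_split (r := c) (t := c + t) (by simp) hs.1
    have h2 := hs.2 c
    have h3 := hs.2 (c + t)
    have h4 := hG.trans 0 c (c + t) zero_le (by simp) f
    have h5 : ∫ s in (c : ℝ)..(c + t : ℝ≥0), H (c + t) s.toNNReal (mildSol G H f s.toNNReal) =
        ∫ s in (0 : ℝ)..t, H (c + t) (c + s.toNNReal) (mildSol G H f (c + s.toNNReal)) := by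
      have := intervalIntegral.integral_comp_add_left (a := 0) (b := t)
        (fun s : ℝ => H (c + t) s.toNNReal (mildSol G H f s.toNNReal)) (c : ℝ)
      rw [add_zero] at this
      rw [NNReal.coe_add, ← this]
      refine intervalIntegral.integral_congr fun s hs => ?_
      rw [uIcc_of_le t.coe_nonneg] at hs
      rw [Real.toNNReal_add c.coe_nonneg hs.1, Real.toNNReal_coe]
    simp only [volterraInt] at h1
    beta_reduce
    rw [h3, h1, h5, add_zero, h2, map_add, h4, add_assoc]
  exact congrFun (hG'.eq_mildSol this) t

/-- Continuous dependence of the mild solution on the evolution family. -/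
theorem tendsto_mildSol {ι : Type*} {L : Filter ι} [L.IsCountablyGenerated]
    {Gn Hn : ι → ℝ≥0 → ℝ≥0 → X →L[ℝ] X} {T : ℝ≥0} {κ : ℝ} (hκ : 0 ≤ κ)
    (hG : IsEvolution G H) (hGn : ∀ n, IsEvolution (Gn n) (Hn n))
    (hb : ∀ s t, s < t → t ≤ T → ∀ x, ‖H t s x‖ ≤ κ * singWeight t s * ‖x‖)
    (hbn : ∀ n s t, s < t → t ≤ T → ∀ x, ‖Hn n t s x‖ ≤ κ * singWeight t s * ‖x‖)
    (hGt : ∀ t ≤ T, ∀ x, Tendsto (fun n => Gn n t 0 x) L (𝓝 (G t 0 x)))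
    (hHt : ∀ s t, s < t → t ≤ T → ∀ x, Tendsto (fun n => Hn n t s x) L (𝓝 (H t s x))) (f : X) :
    Tendsto (fun n => mildSol (Gn n) (Hn n) f T) L (𝓝 (mildSol G H f T)) :=
  tendsto_volterraSol (M := ‖f‖) (isVolterra_of_bound hκ hb hG.meas)
    (fun n => isVolterra_of_bound hκ (hbn n) (hGn n).meas)
    (hG.continuous_left f) (fun n => (hGn n).continuous_left f)
    (fun _ hu => hG.continuous_volterraInt hu) (fun n _ hu => (hGn n).continuous_volterraInt hu)
    (fun t _ => hG.norm_le _ _ zero_le _) (fun n t _ => (hGn n).norm_le _ _ zero_le _)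
    (fun t ht => hGt t ht f) hHt T le_rfl

end Evolution

/-! ### Transport operators on `L¹` -/

section Transport

variable {N : ℕ}

theorem classOf_ae_eq {g : Phase N → ℝ} (h : Integrable g volume) : classOf g =ᵐ[volume] g := by
  rw [classOf, dif_pos (memLp_one_iff_integrable.2 h)]
  exact MemLp.coeFn_toLp _

theorem classOf_eq_of_ae_eq {g : Phase N → ℝ} {f : L1 N} (h : g =ᵐ[volume] f) :
    classOf g = f := by
  have hg : Integrable g volume := (integrable_congr h).2 (L1.integrable_coeFn f)
  exact Lp.ext ((classOf_ae_eq hg).trans h)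

/-- The map `S` multiplies Lebesgue measure by `c⁻¹`. -/
structure IsTransport (c : ℝ) (S : Phase N → Phase N) : Prop where
  pos : 0 < c
  measurable : Measurable S
  map_eq : Measure.map S volume = ENNReal.ofReal c⁻¹ • volume

variable {c : ℝ} {S : Phase N → Phase N}

theorem IsTransport.quasi (h : IsTransport c S) :
    Measure.QuasiMeasurePreserving S volume volume :=
  ⟨h.measurable, by rw [h.map_eq]; exact Measure.smul_absolutelyContinuous⟩

theorem IsTransport.integral_comp (h : IsTransport c S) (g : Phase N → ℝ)
    (hg : AEStronglyMeasurable g volume) : ∫ z, c * g (S z) = ∫ z, g z := by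
  have hg' : AEStronglyMeasurable g (Measure.map S volume) := hg.mono_ac h.quasi.2
  rw [integral_const_mul, ← integral_map h.measurable.aemeasurable hg', h.map_eq,
    integral_smul_measure, ENNReal.toReal_ofReal (inv_nonneg.2 h.pos.le), smul_eq_mul,
    mul_inv_cancel_left₀ h.pos.ne']

theorem IsTransport.integrable_comp (h : IsTransport c S) {g : Phase N → ℝ}
    (hg : Integrable g volume) : Integrable (fun z => c * g (S z)) volume := by
  refine Integrable.const_mul ?_ c
  have : Integrable g (Measure.map S volume) := by
    rw [h.map_eq]; exact hg.smul_measure ENNReal.ofReal_ne_top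
  exact this.comp_measurable h.measurable

open Classical in
/-- The operator `f ↦ c • f ∘ S`. -/
def transport (c : ℝ) (S : Phase N → Phase N) : L1 N →L[ℝ] L1 N :=
  if h : IsTransport c S then
    LinearMap.mkContinuous
      { toFun := fun f => classOf fun z => c * f (S z)
        map_add' := fun f g => by
          refine classOf_eq_of_ae_eq ?_
          filter_upwards [Lp.coeFn_add (classOf fun z => c * f (S z))
            (classOf fun z => c * g (S z)), classOf_ae_eq (h.integrable_comp
              (L1.integrable_coeFn f)), classOf_ae_eq (h.integrable_comp
              (L1.integrable_coeFn g)), h.quasi.ae (Lp.coeFn_add f g)] with z h1 h2 h3 h4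
          rw [h1, Pi.add_apply, h2, h3, h4, Pi.add_apply, mul_add]
        map_smul' := fun a f => by
          refine classOf_eq_of_ae_eq ?_
          filter_upwards [Lp.coeFn_smul a (classOf fun z => c * f (S z)),
            classOf_ae_eq (h.integrable_comp (L1.integrable_coeFn f)),
            h.quasi.ae (Lp.coeFn_smul a f)] with z h1 h2 h4
          simp only [RingHom.id_apply]
          rw [h1, Pi.smul_apply, h2, h4, Pi.smul_apply, smul_eq_mul, smul_eq_mul]
          ring } 1 fun f => by
        rw [one_mul, L1.norm_eq_integral_norm, L1.norm_eq_integral_norm,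
          ← h.integral_comp _ (L1.integrable_coeFn f).norm.1]
        refine le_of_eq (integral_congr_ae ?_)
        filter_upwards [classOf_ae_eq (h.integrable_comp (L1.integrable_coeFn f))] with z hz
        refine (congrArg norm hz).trans ?_
        rw [norm_mul, Real.norm_of_nonneg h.pos.le]
  else 0

theorem transport_ae_eq (h : IsTransport c S) (f : L1 N) :
    transport c S f =ᵐ[volume] fun z => c * f (S z) := by
  rw [transport, dif_pos h]
  exact classOf_ae_eq (h.integrable_comp (L1.integrable_coeFn f))

theorem norm_transport (h : IsTransport c S) (f : L1 N) : ‖transport c S f‖ = ‖f‖ := by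
  rw [L1.norm_eq_integral_norm, L1.norm_eq_integral_norm,
    ← h.integral_comp _ (L1.integrable_coeFn f).norm.1]
  refine integral_congr_ae ?_
  filter_upwards [transport_ae_eq h f] with z hz
  rw [hz, norm_mul, Real.norm_of_nonneg h.pos.le]

theorem IsTransport.comp {c' : ℝ} {S' : Phase N → Phase N} (h : IsTransport c S)
    (h' : IsTransport c' S') : IsTransport (c * c') (S' ∘ S) where
  pos := mul_pos h.pos h'.pos
  measurable := h'.measurable.comp h.measurable
  map_eq := by
    rw [← Measure.map_map h'.measurable h.measurable, h.map_eq, Measure.map_smul, h'.map_eq,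
      smul_smul, ← ENNReal.ofReal_mul (inv_nonneg.2 h.pos.le), ← mul_inv]

theorem transport_transport {c' : ℝ} {S' : Phase N → Phase N} (h : IsTransport c S)
    (h' : IsTransport c' S') (f : L1 N) :
    transport c S (transport c' S' f) = transport (c * c') (S' ∘ S) f := by
  refine Lp.ext ?_
  filter_upwards [transport_ae_eq h (transport c' S' f), transport_ae_eq (h.comp h') f,
    h.quasi.ae (transport_ae_eq h' f)] with z h1 h2 h3
  rw [h1, h2, h3, Function.comp_apply, mul_assoc]

theorem IsTransport.of_measurePreserving (h : MeasurePreserving S volume volume) :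
    IsTransport 1 S := ⟨one_pos, h.measurable, by rw [h.map_eq]; simp⟩

theorem compFlow_eq_transport (h : MeasurePreserving S volume volume) (f : L1 N) :
    compFlow S f = transport 1 S f := by
  rw [compFlow, dif_pos h]
  refine Lp.ext ?_
  filter_upwards [transport_ae_eq (.of_measurePreserving h) f,
    Lp.coeFn_compMeasurePreserving f h] with z h1 h2
  rw [h1, h2, one_mul, Function.comp_apply]

theorem transport_id (f : L1 N) : transport 1 id f = f := by
  refine Lp.ext ?_
  filter_upwards [transport_ae_eq (.of_measurePreserving (MeasurePreserving.id _)) f] with z h1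
  rw [h1, one_mul, id]

/-- Change of variables p = S z: `transport c S` is the push-forward of densities along the left
inverse of S. -/
theorem integral_mul_transport (h : IsTransport c S) {S' : Phase N → Phase N}
    (hS' : Measurable S') (hinv : ∀ z, S' (S z) = z) {φ : Phase N → ℝ} (hφ : Measurable φ)
    (f : L1 N) : ∫ z, φ z * transport c S f z = ∫ p, φ (S' p) * f p := by
  rw [← h.integral_comp (fun p => φ (S' p) * f p) ((hφ.comp hS').aestronglyMeasurable.mul
    (L1.integrable_coeFn f).1)]
  refine integral_congr_ae ?_
  filter_upwards [transport_ae_eq h f] with z hz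
  rw [hz, hinv]
  ring

theorem isCompact_tube (r : ℝ) : IsCompact {z : Phase N | ‖z.2‖ ≤ r} := by
  have : {z : Phase N | ‖z.2‖ ≤ r} = univ ×ˢ Metric.closedBall (0 : Vel N) r := by
    ext z; simp
  rw [this]
  exact isCompact_univ.prod (isCompact_closedBall _ _)

/-- Strong convergence of transport operators. -/
theorem tendsto_transport {ι : Type*} {L : Filter ι} [L.IsCountablyGenerated]
    {cn : ι → ℝ} {Sn : ι → Phase N → Phase N} (hn : ∀ n, IsTransport (cn n) (Sn n))
    (h : IsTransport c S) (hc : Tendsto cn L (𝓝 c))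
    (hS : ∀ z, Tendsto (fun n => Sn n z) L (𝓝 (S z)))
    (hp : ∀ r, ∃ r', ∀ᶠ n in L, ∀ z, ‖(Sn n z).2‖ ≤ r → ‖z.2‖ ≤ r') (f : L1 N) :
    Tendsto (fun n => transport (cn n) (Sn n) f) L (𝓝 (transport c S f)) := by
  rcases L.eq_or_neBot with rfl | hL
  · exact tendsto_bot
  rw [Metric.tendsto_nhds]
  intro ε hε
  -- Transport operators are isometries, so strong convergence may be tested on compactly supported
  -- continuous functions.
  obtain ⟨g, hgs, hgf, hgc, hgi⟩ := (L1.integrable_coeFn f).exists_hasCompactSupport_integral_sub_le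
    (show 0 < ε / 3 by positivity)
  obtain ⟨G, hG⟩ : ∃ G : L1 N, G =ᵐ[volume] g := ⟨hgi.toL1 g, hgi.coeFn_toL1⟩
  have hfG : ‖f - G‖ ≤ ε / 3 := by
    rw [L1.norm_eq_integral_norm]
    refine le_trans (le_of_eq (integral_congr_ae ?_)) hgf
    filter_upwards [Lp.coeFn_sub f G, hG] with z h1 h2
    rw [h1, Pi.sub_apply, h2]
  obtain ⟨r, hr⟩ : ∃ r, ∀ z, g z ≠ 0 → ‖z.2‖ ≤ r := by
    have hK : IsCompact (Prod.snd '' tsupport g) := hgs.image continuous_snd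
    obtain ⟨r, hr⟩ := hK.isBounded.exists_norm_le
    exact ⟨r, fun z hz => hr _ ⟨z, subset_tsupport _ hz, rfl⟩⟩
  obtain ⟨B, hB⟩ := hgs.exists_bound_of_continuous hgc
  have hB0 : 0 ≤ B := (norm_nonneg _).trans (hB (0 : Phase N))
  -- Points carried into the support of g come from one compact tube, on which the dominating
  -- function lives. The radius r + 1 instead of r lets the same tube serve for the limit map S.
  obtain ⟨r', hr'⟩ := hp (r + 1)
  have hlim : Tendsto (fun n => ∫ z, ‖cn n * g (Sn n z) - c * g (S z)‖) L (𝓝 0) := by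
    rw [← integral_zero (Phase N) ℝ (μ := volume)]
    refine tendsto_integral_filter_of_dominated_convergence
      ({z : Phase N | ‖z.2‖ ≤ r'}.indicator fun _ => (c + 1) * B + c * B) ?_ ?_ ?_ ?_
    · refine Eventually.of_forall fun n => ?_
      exact (((hgc.measurable.comp (hn n).measurable).const_mul _).sub
        ((hgc.measurable.comp h.measurable).const_mul _)).norm.aestronglyMeasurable
    · filter_upwards [hr', hc.eventually (gt_mem_nhds (lt_add_one c))] with n h1 h2
      refine Eventually.of_forall fun z => ?_
      rw [norm_norm]
      by_cases hz : ‖z.2‖ ≤ r'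
      · rw [indicator_of_mem (show z ∈ {z : Phase N | ‖z.2‖ ≤ r'} from hz)]
        refine (norm_sub_le _ _).trans (add_le_add ?_ ?_)
        · rw [norm_mul, Real.norm_of_nonneg (hn n).pos.le]
          have := (hn n).pos
          exact mul_le_mul h2.le (hB _) (norm_nonneg _) (by linarith)
        · rw [norm_mul, Real.norm_of_nonneg h.pos.le]
          exact mul_le_mul_of_nonneg_left (hB _) h.pos.le
      · rw [indicator_of_notMem (show z ∉ {z : Phase N | ‖z.2‖ ≤ r'} from hz)]
        have h3 : g (Sn n z) = 0 := by
          by_contra h0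
          exact hz (h1 z ((hr _ h0).trans (by linarith)))
        have h4 : g (S z) = 0 := by
          by_contra h0
          have h5 := ((continuous_snd.norm.tendsto _).comp (hS z)).eventually
            (gt_mem_nhds (lt_of_le_of_lt (hr _ h0) (lt_add_one r)))
          obtain ⟨k, hk1, hk2⟩ := (h5.and hr').exists
          exact hz (hk2 z (le_of_lt hk1))
        simp [h3, h4]
    · rw [integrable_indicator_iff (isCompact_tube r').measurableSet]
      exact integrableOn_const (isCompact_tube r').measure_lt_top.ne
    · refine Eventually.of_forall fun z => ?_
      have h1 := (hc.mul ((hgc.tendsto _).comp (hS z))).sub_const (c * g (S z))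
      rw [sub_self] at h1
      simpa using h1.norm
  filter_upwards [hlim.eventually (gt_mem_nhds (show 0 < ε / 3 by positivity))] with n hn'
  have e1 : ‖transport (cn n) (Sn n) G - transport c S G‖ < ε / 3 := by
    refine lt_of_eq_of_lt ?_ hn'
    rw [L1.norm_eq_integral_norm]
    refine integral_congr_ae ?_
    filter_upwards [Lp.coeFn_sub (transport (cn n) (Sn n) G) (transport c S G),
      transport_ae_eq (hn n) G, transport_ae_eq h G, (hn n).quasi.ae hG, h.quasi.ae hG]
      with z h1 h2 h3 h4 h5
    rw [h1, Pi.sub_apply, h2, h3, h4, h5]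
  have e2 : transport (cn n) (Sn n) f - transport c S f =
      transport (cn n) (Sn n) (f - G) + (transport (cn n) (Sn n) G - transport c S G)
        - transport c S (f - G) := by
    rw [map_sub, map_sub]; abel
  rw [dist_eq_norm, e2]
  refine (norm_sub_le _ _).trans_lt ?_
  have := norm_add_le (transport (cn n) (Sn n) (f - G))
    (transport (cn n) (Sn n) G - transport c S G)
  rw [norm_transport (hn n)] at this
  rw [norm_transport h]
  linarith

end Transport

/-! ### The operator `f ↦ ρ(f) M` -/

theorem integral_maxwellian (N : ℕ) : ∫ v : Vel N, maxwellian v = 1 := by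
  have h := GaussianFourier.integral_rexp_neg_mul_sq_norm (V := Vel N) (b := 1 / 2) (by norm_num)
  have e : ∀ v : Vel N, maxwellian v =
      (2 * Real.pi) ^ (-(N : ℝ) / 2) * Real.exp (-(1 / 2) * ‖v‖ ^ 2) := by
    intro v
    rw [maxwellian]
    congr 2
    ring
  simp_rw [e]
  rw [integral_const_mul, h, finrank_euclideanSpace_fin,
    show Real.pi / (1 / 2) = 2 * Real.pi by ring, ← Real.rpow_add (by positivity),
    show -(N : ℝ) / 2 + N / 2 = 0 by ring, Real.rpow_zero]

theorem integrable_maxwellian (N : ℕ) : Integrable (maxwellian (N := N)) volume :=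
  .of_integral_ne_zero (by rw [integral_maxwellian]; exact one_ne_zero)

theorem maxwellian_nonneg {N : ℕ} (v : Vel N) : 0 ≤ maxwellian v := by
  unfold maxwellian; positivity

theorem integrable_rhoMaxwellian {N : ℕ} (f : L1 N) :
    Integrable (fun z : Phase N => (∫ v : Vel N, f (z.1, v)) * maxwellian z.2) volume :=
  (L1.integrable_coeFn f).integral_prod_left.mul_prod (integrable_maxwellian N)

theorem ae_fst {N : ℕ} {p : Torus N → Prop} (h : ∀ᵐ x, p x) : ∀ᵐ z : Phase N, p z.1 :=
  Measure.quasiMeasurePreserving_fst.ae h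

/-- The operator `f ↦ ρ(f) M` on `L¹`. -/
def rhoCLM (N : ℕ) : L1 N →L[ℝ] L1 N :=
  LinearMap.mkContinuous
    { toFun := rhoMaxwellian
      map_add' := fun f g => by
        refine classOf_eq_of_ae_eq ?_
        have hi : ∀ f : L1 N, ∀ᵐ x : Torus N, Integrable (fun v => f (x, v)) :=
          fun f => (L1.integrable_coeFn f).prod_right_ae
        have hadd := Measure.ae_ae_of_ae_prod (Lp.coeFn_add f g)
        filter_upwards [Lp.coeFn_add (rhoMaxwellian f) (rhoMaxwellian g),
          classOf_ae_eq (integrable_rhoMaxwellian f), classOf_ae_eq (integrable_rhoMaxwellian g),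
          ae_fst (hi f), ae_fst (hi g), ae_fst hadd] with z h1 h2 h3 h4 h5 h6
        rw [h1, Pi.add_apply, rhoMaxwellian, rhoMaxwellian, h2, h3, ← add_mul,
          ← integral_add h4 h5]
        congr 1
        exact integral_congr_ae h6
      map_smul' := fun a f => by
        refine classOf_eq_of_ae_eq ?_
        have hs := Measure.ae_ae_of_ae_prod (Lp.coeFn_smul a f)
        filter_upwards [Lp.coeFn_smul a (rhoMaxwellian f),
          classOf_ae_eq (integrable_rhoMaxwellian f), ae_fst hs] with z h1 h2 h6
        simp only [RingHom.id_apply]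
        rw [h1, Pi.smul_apply, rhoMaxwellian, h2, smul_eq_mul, ← mul_assoc,
          ← integral_const_mul]
        congr 1
        exact integral_congr_ae h6 } 1 fun f => by
      rw [one_mul, L1.norm_eq_integral_norm, L1.norm_eq_integral_norm]
      have h1 : ∫ z, ‖rhoMaxwellian f z‖ =
          ∫ z : Phase N, ‖∫ v : Vel N, f (z.1, v)‖ * maxwellian z.2 := by
        refine integral_congr_ae ?_
        filter_upwards [classOf_ae_eq (integrable_rhoMaxwellian f)] with z hz
        rw [rhoMaxwellian, hz, norm_mul, Real.norm_of_nonneg (maxwellian_nonneg _)]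
      have h2 := integral_prod_mul (μ := (volume : Measure (Torus N)))
        (ν := (volume : Measure (Vel N))) (fun x => ‖∫ v : Vel N, f (x, v)‖) maxwellian
      rw [integral_maxwellian, mul_one] at h2
      refine (h1.trans h2).trans_le ?_
      refine (integral_mono (L1.integrable_coeFn f).integral_prod_left.norm
        (L1.integrable_coeFn f).norm.integral_prod_left
        fun x => norm_integral_le_integral_norm _).trans (le_of_eq ?_)
      exact (integral_prod _ (L1.integrable_coeFn f).norm).symm

@[simp]
theorem rhoCLM_apply {N : ℕ} (f : L1 N) : rhoCLM N f = rhoMaxwellian f := rfl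

theorem norm_rhoMaxwellian_le {N : ℕ} (f : L1 N) : ‖rhoMaxwellian f‖ ≤ ‖f‖ := by
  have : ‖rhoCLM N‖ ≤ 1 := LinearMap.mkContinuous_norm_le _ zero_le_one _
  exact ((rhoCLM N).le_of_opNorm_le this f).trans_eq (one_mul _)

/-! ### Admissible forcings -/

variable {N m : ℕ}

/-- Measurable and locally bounded forcings. -/
structure IsForcing (E : ℝ≥0 → Force N m) : Prop where
  measurable : Measurable E
  bounded : ∀ T, ∃ B, 0 ≤ B ∧ ∀ t ≤ T, ‖E t‖ ≤ B

theorem IsForcing.comp_add {E : ℝ≥0 → Force N m} (hE : IsForcing E) (c : ℝ≥0) :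
    IsForcing fun t => E (c + t) where
  measurable := hE.measurable.comp (by fun_prop)
  bounded T := by
    obtain ⟨B, hB, h⟩ := hE.bounded (c + T)
    exact ⟨B, hB, fun t ht => h _ (by gcongr)⟩

/-- Backward characteristics use reversed forcings. Reversal can destroy right-continuity, while
measurability and local boundedness survive it. -/
theorem IsForcing.comp_sub {E : ℝ≥0 → Force N m} (hE : IsForcing E) (c : ℝ≥0) :
    IsForcing fun t => E (c - t) where
  measurable := hE.measurable.comp (by fun_prop)
  bounded T := by
    obtain ⟨B, hB, h⟩ := hE.bounded c
    exact ⟨B, hB, fun t _ => h _ tsub_le_self⟩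

theorem intervalIntegrable_of_bounded {X : Type*} [NormedAddCommGroup X]
    {f : ℝ → X} (hf : AEStronglyMeasurable f volume) (hb : ∀ T : ℝ, ∃ B, ∀ s ≤ T, ‖f s‖ ≤ B)
    (a b : ℝ) : IntervalIntegrable f volume a b := by
  obtain ⟨B, hB⟩ := hb (max a b)
  rw [intervalIntegrable_iff]
  refine Measure.integrableOn_of_bounded (M := B) ?_ hf ?_
  · simp [uIoc]
  · filter_upwards [self_mem_ae_restrict measurableSet_uIoc] with s hs
    exact hB s (by simpa using hs.2)

theorem continuous_field_eval (hm : N + 1 < m) :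
    Continuous fun p : Force N m × Torus N => p.1.field p.2 := by
  have h1 : Continuous fun p : Force N m × Torus N => fieldCLM hm p.1 := by fun_prop
  exact h1.eval continuous_snd

theorem IsForcing.intervalIntegrable_field (hm : N + 1 < m) {E : ℝ≥0 → Force N m}
    (hE : IsForcing E) {ξ : ℝ≥0 → Torus N} (hξ : Continuous ξ) (a b : ℝ) :
    IntervalIntegrable (fun s : ℝ => (E s.toNNReal).field (ξ s.toNNReal)) volume a b := by
  refine intervalIntegrable_of_bounded ?_ (fun T => ?_) a b
  · exact ((continuous_field_eval hm).measurable.comp ((hE.measurable.comp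
      measurable_real_toNNReal).prodMk
        (hξ.measurable.comp measurable_real_toNNReal))).aestronglyMeasurable
  · obtain ⟨B, hB, h⟩ := hE.bounded T.toNNReal
    refine ⟨sobolevConst N * B, fun s hs => (Force.norm_field_apply_le hm _ _).trans ?_⟩
    gcongr
    exact h _ (Real.toNNReal_le_toNNReal hs)

theorem IsForcing.intervalIntegrable {E : ℝ≥0 → Force N m}
    (hE : IsForcing E) (a b : ℝ) :
    IntervalIntegrable (fun s : ℝ => E s.toNNReal) volume a b := by
  refine intervalIntegrable_of_bounded ?_ (fun T => ?_) a b
  · exact (hE.measurable.comp measurable_real_toNNReal).aestronglyMeasurable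
  · obtain ⟨B, hB, h⟩ := hE.bounded T.toNNReal
    exact ⟨B, fun s hs => h _ (Real.toNNReal_le_toNNReal hs)⟩

/-! ### Characteristics -/

theorem torusProj_add (y y' : Vel N) : torusProj (y + y') = torusProj y + torusProj y' := rfl

theorem torusProj_sub (y y' : Vel N) : torusProj (y - y') = torusProj y - torusProj y' := rfl

theorem torusProj_neg (y : Vel N) : torusProj (-y) = -torusProj y := rfl

theorem torusProj_zero : torusProj (0 : Vel N) = 0 := rfl

theorem norm_torusProj_le (y : Vel N) : ‖torusProj y‖ ≤ ‖y‖ := by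
  refine (pi_norm_le_iff_of_nonneg (norm_nonneg _)).2 fun i => ?_
  refine le_trans ?_ (PiLp.norm_apply_le y i)
  exact QuotientAddGroup.norm_mk_le_norm

/-- A solution on `[0,T]` of the characteristic system. -/
structure IsChar (E : ℝ≥0 → Force N m) (T : ℝ≥0) (ζ : ℝ≥0 → Phase N) : Prop where
  cont : Continuous ζ
  fst : ∀ t ≤ T, (ζ t).1 = (ζ 0).1 + torusProj (∫ s in (0 : ℝ)..t, (ζ s.toNNReal).2)
  snd : ∀ t ≤ T, (ζ t).2 = (ζ 0).2 + ∫ s in (0 : ℝ)..t, (E s.toNNReal).field (ζ s.toNNReal).1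

variable {E : ℝ≥0 → Force N m} {T : ℝ≥0} {ζ ζ' : ℝ≥0 → Phase N}

theorem intervalIntegrable_snd (hζ : Continuous ζ) (a b : ℝ) :
    IntervalIntegrable (fun s : ℝ => (ζ s.toNNReal).2) volume a b :=
  (continuous_snd.comp (continuous_comp_toNNReal hζ)).intervalIntegrable _ _

theorem IsChar.fst_incr (h : IsChar E T ζ) {a b : ℝ≥0} (ha : a ≤ T) (hb : b ≤ T) :
    (ζ b).1 = (ζ a).1 + torusProj (∫ s in (a : ℝ)..b, (ζ s.toNNReal).2) := by
  rw [h.fst a ha, h.fst b hb, add_assoc, ← torusProj_add,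
    intervalIntegral.integral_add_adjacent_intervals (intervalIntegrable_snd h.cont _ _)
      (intervalIntegrable_snd h.cont _ _)]

theorem IsChar.snd_incr (hm : N + 1 < m) (hE : IsForcing E) (h : IsChar E T ζ) {a b : ℝ≥0}
    (ha : a ≤ T) (hb : b ≤ T) :
    (ζ b).2 = (ζ a).2 + ∫ s in (a : ℝ)..b, (E s.toNNReal).field (ζ s.toNNReal).1 := by
  have hi := fun a b => hE.intervalIntegrable_field hm (ξ := fun s => (ζ s).1) (continuous_fst.comp h.cont) a b
  rw [h.snd a ha, h.snd b hb, add_assoc,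
    intervalIntegral.integral_add_adjacent_intervals (hi _ _) (hi _ _)]

theorem IsChar.shift (hm : N + 1 < m) (hE : IsForcing E) (h : IsChar E T ζ) {c S : ℝ≥0}
    (hc : c + S ≤ T) : IsChar (fun t => E (c + t)) S (fun t => ζ (c + t)) := by
  have hcT : c ≤ T := le_self_add.trans hc
  have key : ∀ {X : Type} [NormedAddCommGroup X] [NormedSpace ℝ X] (f : ℝ≥0 → X) (t : ℝ≥0),
      ∫ s in (c : ℝ)..(c + t : ℝ≥0), f s.toNNReal = ∫ s in (0 : ℝ)..t, f (c + s.toNNReal) := by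
    intro X _ _ f t
    have := intervalIntegral.integral_comp_add_left (a := 0) (b := t)
      (fun s : ℝ => f s.toNNReal) (c : ℝ)
    rw [add_zero] at this
    rw [NNReal.coe_add, ← this]
    refine intervalIntegral.integral_congr fun s hs => ?_
    rw [uIcc_of_le t.coe_nonneg] at hs
    rw [Real.toNNReal_add c.coe_nonneg hs.1, Real.toNNReal_coe]
  refine ⟨h.cont.comp (by fun_prop), fun t ht => ?_, fun t ht => ?_⟩
  · have htT : c + t ≤ T := (by gcongr : c + t ≤ c + S).trans hc
    rw [h.fst_incr hcT htT, key (fun s => (ζ s).2), add_zero]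
  · have htT : c + t ≤ T := (by gcongr : c + t ≤ c + S).trans hc
    rw [h.snd_incr hm hE hcT htT, key (fun s => (E s).field (ζ s).1), add_zero]

theorem IsChar.congr {E' : ℝ≥0 → Force N m} (h : IsChar E T ζ) (he : ∀ t ≤ T, E' t = E t) :
    IsChar E' T ζ := by
  refine ⟨h.cont, h.fst, fun t ht => ?_⟩
  rw [h.snd t ht]
  congr 1
  refine intervalIntegral.integral_congr fun s hs => ?_
  rw [uIcc_of_le t.coe_nonneg] at hs
  rw [he _ ((Real.toNNReal_le_iff_le_coe.2 hs.2).trans ht)]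

/-- Reversal of velocities. -/
def velFlip (z : Phase N) : Phase N := (z.1, -z.2)

theorem velFlip_velFlip (z : Phase N) : velFlip (velFlip z) = z := by
  simp [velFlip]

theorem continuous_velFlip : Continuous (velFlip (N := N)) := by
  unfold velFlip; fun_prop

theorem measurePreserving_velFlip : MeasurePreserving (velFlip (N := N)) volume volume :=
  (MeasurePreserving.id (volume : Measure (Torus N))).prod
    (Measure.measurePreserving_neg (volume : Measure (Vel N)))

theorem integral_reverse {X : Type*} [NormedAddCommGroup X] [NormedSpace ℝ X] (f : ℝ≥0 → X)
    {t T : ℝ≥0} (ht : t ≤ T) : ∫ s in (0 : ℝ)..t, f (T - s.toNNReal) =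
      ∫ s in ((T - t : ℝ≥0) : ℝ)..T, f s.toNNReal := by
  have := intervalIntegral.integral_comp_sub_left (a := 0) (b := t)
    (fun s : ℝ => f s.toNNReal) (T : ℝ)
  rw [sub_zero] at this
  rw [NNReal.coe_sub ht, ← this]
  refine intervalIntegral.integral_congr fun s hs => ?_
  rw [uIcc_of_le t.coe_nonneg] at hs
  congr 1
  have hs' : s.toNNReal ≤ T := (Real.toNNReal_le_iff_le_coe.2 hs.2).trans ht
  rw [← NNReal.coe_inj, NNReal.coe_sub hs', Real.coe_toNNReal _ hs.1, Real.coe_toNNReal]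
  have := NNReal.coe_le_coe.2 ht
  linarith [hs.2]

/-- Under time reversal the sign in Ẋ = V is absorbed by flipping the velocity; in the equation for
V the two signs cancel. -/
theorem IsChar.reverse (hm : N + 1 < m) (hE : IsForcing E) (h : IsChar E T ζ) :
    IsChar (fun t => E (T - t)) T (fun t => velFlip (ζ (T - t))) := by
  refine ⟨continuous_velFlip.comp (h.cont.comp (by fun_prop)), fun t ht => ?_, fun t ht => ?_⟩
  · simp only [velFlip, tsub_zero]
    rw [h.fst_incr (a := T - t) (b := T) tsub_le_self le_rfl,
      intervalIntegral.integral_neg, torusProj_neg, integral_reverse (fun s => (ζ s).2) ht,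
      add_neg_cancel_right]
  · simp only [velFlip, tsub_zero]
    rw [h.snd_incr hm hE (a := T - t) (b := T) tsub_le_self le_rfl,
      integral_reverse (fun s => (E s).field (ζ s).1) ht, neg_add, neg_add_cancel_right]

/-- Bounded kernels become weakly singular ones at the price of a factor √T, so a single Volterra
theory covers the characteristics and both equations. -/
theorem one_le_sqrt_mul_singWeight {s t T : ℝ} (hst : s < t) (hs : 0 ≤ s) (ht : t ≤ T) :
    1 ≤ √T * singWeight t s := by
  have h0 : 0 < t - s := by linarith
  rw [singWeight, Real.rpow_neg h0.le, ← Real.sqrt_eq_rpow, ← div_eq_mul_inv,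
    one_le_div (Real.sqrt_pos.2 h0)]
  exact Real.sqrt_le_sqrt (by linarith)

theorem IsChar.norm_snd_sub_le (hm : N + 1 < m) (h : IsChar E T ζ) {B : ℝ}
    (hB : ∀ t ≤ T, ‖E t‖ ≤ B) {t : ℝ≥0} (ht : t ≤ T) :
    ‖(ζ t).2 - (ζ 0).2‖ ≤ sobolevConst N * B * t := by
  rw [h.snd t ht, add_sub_cancel_left]
  refine (intervalIntegral.norm_integral_le_of_norm_le_const (C := sobolevConst N * B)
    fun s hs => ?_).trans (by simp)
  rw [uIoc_of_le t.coe_nonneg] at hs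
  refine (Force.norm_field_apply_le hm _ _).trans ?_
  gcongr
  exact hB _ ((Real.toNNReal_le_iff_le_coe.2 hs.2).trans ht)

theorem IsChar.norm_fst_sub_le (hm : N + 1 < m) (h : IsChar E T ζ) {B : ℝ} (hB0 : 0 ≤ B)
    (hB : ∀ t ≤ T, ‖E t‖ ≤ B) {t : ℝ≥0} (ht : t ≤ T) :
    ‖(ζ t).1 - (ζ 0).1‖ ≤ (‖(ζ 0).2‖ + sobolevConst N * B * T) * t := by
  rw [h.fst t ht, add_sub_cancel_left]
  refine (norm_torusProj_le _).trans ?_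
  refine (intervalIntegral.norm_integral_le_of_norm_le_const
    (C := ‖(ζ 0).2‖ + sobolevConst N * B * T) fun s hs => ?_).trans (by simp)
  rw [uIoc_of_le t.coe_nonneg] at hs
  have hsT := (Real.toNNReal_le_iff_le_coe.2 hs.2).trans ht
  have h1 := h.norm_snd_sub_le hm hB hsT
  have h2 : ‖(ζ s.toNNReal).2‖ ≤ ‖(ζ 0).2‖ + ‖(ζ s.toNNReal).2 - (ζ 0).2‖ :=
    norm_le_norm_add_norm_sub' _ _
  have h3 : sobolevConst N * B * (s.toNNReal : ℝ) ≤ sobolevConst N * B * T := by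
    have := NNReal.coe_le_coe.2 hsT
    gcongr
  linarith

/-- Two characteristics stay close to each other. -/
theorem exists_dist_char_le (hm : N + 1 < m) {B : ℝ} (hB0 : 0 ≤ B) (T : ℝ≥0) :
    ∃ C : ℝ, 0 ≤ C ∧ ∀ (E : ℝ≥0 → Force N m), IsForcing E → (∀ t ≤ T, ‖E t‖ ≤ B) →
      ∀ S ≤ T, ∀ ζ ζ' : ℝ≥0 → Phase N, IsChar E S ζ → IsChar E S ζ' →
      ∀ t ≤ S, dist (ζ t) (ζ' t) ≤ C * dist (ζ 0) (ζ' 0) := by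
  -- A Lipschitz constant of (x, v) ↦ (v, E(x)) for the maximum distance.
  set A := 1 + sobolevConst N * B with hA
  have hA1 : 1 ≤ A := by rw [hA]; have : 0 ≤ sobolevConst N * B := by positivity
                         linarith
  have hA2 : sobolevConst N * B ≤ A := by rw [hA]; linarith
  have hκ : 0 ≤ A * √T := by positivity
  obtain ⟨l, hl⟩ := exists_isExpWeight hκ
  refine ⟨2 * Real.exp (l * T), by positivity, fun E hE hB S hS ζ ζ' h h' t ht => ?_⟩
  have hd : Continuous fun t => dist (ζ t) (ζ' t) := h.cont.dist h'.cont
  have := hl.gronwall (δ := dist (ζ 0) (ζ' 0)) hκ (T := S) hd (fun t ht => ?_) t ht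
  · rw [abs_of_nonneg dist_nonneg] at this
    refine this.trans ?_
    have h1 : Real.exp (l * t) ≤ Real.exp (l * T) := by
      have := hl.1
      have := NNReal.coe_le_coe.2 (ht.trans hS)
      gcongr
    nlinarith [dist_nonneg (x := ζ 0) (y := ζ' 0)]
  have hint : IntervalIntegrable (fun s : ℝ => A * dist (ζ s.toNNReal) (ζ' s.toNNReal))
      volume 0 t := ((continuous_comp_toNNReal hd).const_mul A).intervalIntegrable _ _
  have hbd : ∫ s in (0 : ℝ)..t, A * dist (ζ s.toNNReal) (ζ' s.toNNReal) ≤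
      A * √T * ∫ s in (0 : ℝ)..t, singWeight t s * dist (ζ s.toNNReal) (ζ' s.toNNReal) := by
    rw [← intervalIntegral.integral_const_mul]
    refine intervalIntegral.integral_mono_on_of_le_Ioo t.coe_nonneg hint
      ((intervalIntegrable_singWeight_mul _ _ (continuous_comp_toNNReal hd)).const_mul _)
      fun s hs => ?_
    have h1 := one_le_sqrt_mul_singWeight hs.2 hs.1.le (NNReal.coe_le_coe.2 (ht.trans hS))
    have h2 : 0 ≤ dist (ζ s.toNNReal) (ζ' s.toNNReal) := dist_nonneg
    calc A * dist (ζ s.toNNReal) (ζ' s.toNNReal)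
        = A * (1 * dist (ζ s.toNNReal) (ζ' s.toNNReal)) := by ring
      _ ≤ A * ((√T * singWeight t s) * dist (ζ s.toNNReal) (ζ' s.toNNReal)) := by gcongr
      _ = _ := by ring
  refine le_trans ?_ (add_le_add_right hbd _)
  rw [Prod.dist_eq]
  refine max_le ?_ ?_
  · rw [dist_eq_norm, h.fst t ht, h'.fst t ht, add_sub_add_comm, ← torusProj_sub,
      ← intervalIntegral.integral_sub (intervalIntegrable_snd h.cont _ _)
        (intervalIntegrable_snd h'.cont _ _)]
    refine (norm_add_le _ _).trans (add_le_add ?_ ((norm_torusProj_le _).trans ?_))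
    · rw [← dist_eq_norm, Prod.dist_eq]; exact le_max_left _ _
    · refine intervalIntegral.norm_integral_le_of_norm_le t.coe_nonneg
        (Eventually.of_forall fun s _ => ?_) hint
      rw [← dist_eq_norm]
      refine le_trans ?_ (le_mul_of_one_le_left dist_nonneg hA1)
      rw [Prod.dist_eq]; exact le_max_right _ _
  · rw [dist_eq_norm, h.snd t ht, h'.snd t ht, add_sub_add_comm,
      ← intervalIntegral.integral_sub (hE.intervalIntegrable_field hm (ξ := fun s => (ζ s).1)
        (continuous_fst.comp h.cont) _ _) (hE.intervalIntegrable_field hm (ξ := fun s => (ζ' s).1)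
        (continuous_fst.comp h'.cont) _ _)]
    refine (norm_add_le _ _).trans (add_le_add ?_ ?_)
    · rw [← dist_eq_norm, Prod.dist_eq]; exact le_max_right _ _
    · refine intervalIntegral.norm_integral_le_of_norm_le t.coe_nonneg
        (Eventually.of_forall fun s hs => ?_) hint
      refine (Force.norm_field_sub_le hm _ _ _).trans ?_
      have h1 := hB s.toNNReal (((Real.toNNReal_le_iff_le_coe.2 hs.2).trans ht).trans hS)
      have h2 : ‖(ζ s.toNNReal).1 - (ζ' s.toNNReal).1‖ ≤ dist (ζ s.toNNReal) (ζ' s.toNNReal) := by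
        rw [← dist_eq_norm, Prod.dist_eq]; exact le_max_left _ _
      calc _ ≤ sobolevConst N * B * dist (ζ s.toNNReal) (ζ' s.toNNReal) := by
            gcongr
        _ ≤ _ := by gcongr

theorem IsChar.unique (hm : N + 1 < m) (hE : IsForcing E) (h : IsChar E T ζ) (h' : IsChar E T ζ')
    (h0 : ζ 0 = ζ' 0) {t : ℝ≥0} (ht : t ≤ T) : ζ t = ζ' t := by
  obtain ⟨B, hB0, hB⟩ := hE.bounded T
  obtain ⟨C, -, hC⟩ := exists_dist_char_le hm hB0 T
  have := hC E hE hB T le_rfl ζ ζ' h h' t ht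
  rw [h0, dist_self, mul_zero] at this
  exact dist_le_zero.1 this

/-! ### Existence of characteristics -/

/-- The vector field of the characteristic system, in terms of the displacement. -/
def charKernel (E : ℝ≥0 → Force N m) (x : Torus N) (_ s : ℝ≥0) (p : Vel N × Vel N) :
    Vel N × Vel N := (p.2, (E s).field (x + torusProj p.1))

/-- The displacement is taken in ℝᴺ, so that the equation lives in a vector space and not on the
torus. The Lipschitz field then counts as a weakly singular kernel. -/
theorem isVolterra_charKernel (hm : N + 1 < m) (hE : IsForcing E) (x : Torus N) {T : ℝ≥0} {B : ℝ}
    (hB0 : 0 ≤ B) (hB : ∀ t ≤ T, ‖E t‖ ≤ B) :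
    IsVolterra (charKernel E x) T ((1 + sobolevConst N * B) * √T) where
  nonneg := by positivity
  lip s t hst ht p q := by
    have h1 := one_le_sqrt_mul_singWeight (NNReal.coe_lt_coe.2 hst) s.coe_nonneg
      (NNReal.coe_le_coe.2 ht)
    have h0 : 0 ≤ sobolevConst N * B := by positivity
    have h2 : ‖charKernel E x t s p - charKernel E x t s q‖ ≤
        (1 + sobolevConst N * B) * ‖p - q‖ := by
      rw [Prod.norm_def]
      refine max_le ?_ ?_
      · refine (norm_snd_le (p - q)).trans ?_
        exact le_mul_of_one_le_left (norm_nonneg _) (by linarith)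
      · refine (Force.norm_field_sub_le hm _ _ _).trans ?_
        rw [add_sub_add_left_eq_sub, ← torusProj_sub]
        have h3 := (norm_torusProj_le (p.1 - q.1)).trans (norm_fst_le (p - q))
        have h4 := hB s (hst.le.trans ht)
        calc _ ≤ sobolevConst N * B * ‖p - q‖ := by gcongr
          _ ≤ _ := by gcongr; linarith
    calc _ ≤ _ := h2
      _ = (1 + sobolevConst N * B) * (1 * ‖p - q‖) := by ring
      _ ≤ (1 + sobolevConst N * B) * ((√T * singWeight t s) * ‖p - q‖) := by gcongr
      _ = _ := by ring
  zero s t hst ht := by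
    have h1 := one_le_sqrt_mul_singWeight (NNReal.coe_lt_coe.2 hst) s.coe_nonneg
      (NNReal.coe_le_coe.2 ht)
    have h0 : 0 ≤ sobolevConst N * B := by positivity
    have h2 : ‖charKernel E x t s 0‖ ≤ 1 + sobolevConst N * B := by
      rw [Prod.norm_def]
      refine max_le ?_ ?_
      · simp only [charKernel, Prod.snd_zero, norm_zero]; positivity
      · refine (Force.norm_field_apply_le hm _ _).trans ?_
        have h4 := hB s (hst.le.trans ht)
        calc _ ≤ sobolevConst N * B := by gcongr
          _ ≤ _ := by linarith
    calc _ ≤ _ := h2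
      _ = (1 + sobolevConst N * B) * 1 := by ring
      _ ≤ (1 + sobolevConst N * B) * (√T * singWeight t s) := by gcongr
      _ = _ := by ring
  meas t _ u hu := by
    have hu' := continuous_comp_toNNReal hu
    refine (Measurable.prodMk (measurable_snd.comp hu'.measurable)
      ((continuous_field_eval hm).measurable.comp ((hE.measurable.comp
      measurable_real_toNNReal).prodMk (Continuous.measurable ?_)))).aestronglyMeasurable
    exact continuous_const.add ((continuous_torusProj N).comp (continuous_fst.comp hu'))

theorem exists_isVolterra_charKernel (hm : N + 1 < m) (hE : IsForcing E) (x : Torus N)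
    (T : ℝ≥0) : ∃ κ, IsVolterra (charKernel E x) T κ := by
  obtain ⟨B, hB0, hB⟩ := hE.bounded T
  exact ⟨_, isVolterra_charKernel hm hE x hB0 hB⟩

theorem intervalIntegrable_charKernel (hm : N + 1 < m) (hE : IsForcing E) (x : Torus N)
    {u : ℝ≥0 → Vel N × Vel N} (hu : Continuous u) (t : ℝ≥0) (a b : ℝ) :
    IntervalIntegrable (fun s : ℝ => charKernel E x t s.toNNReal (u s.toNNReal)) volume a b := by
  have h1 := (continuous_snd.comp (continuous_comp_toNNReal hu)).intervalIntegrable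
    (μ := volume) a b
  have h2 := hE.intervalIntegrable_field hm (ξ := fun s => x + torusProj (u s).1)
    (continuous_const.add ((continuous_torusProj N).comp (continuous_fst.comp hu))) a b
  exact ⟨h1.1.prodMk h2.1, h1.2.prodMk h2.2⟩

theorem continuous_volterraInt_charKernel (hm : N + 1 < m) (hE : IsForcing E) (x : Torus N)
    (u : ℝ≥0 → Vel N × Vel N) (hu : Continuous u) : Continuous (volterraInt (charKernel E x) u) :=
  (intervalIntegral.continuous_primitive
    (fun a b => intervalIntegrable_charKernel hm hE x hu 0 a b) 0).comp NNReal.continuous_coe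

/-- Displacement and velocity along the characteristic that starts from `z`. -/
def charSol (E : ℝ≥0 → Force N m) (z : Phase N) : ℝ≥0 → Vel N × Vel N :=
  volterraSol (fun _ => (0, z.2)) (charKernel E z.1)

/-- The solution at time `t` of the characteristic system started from `z`. -/
def semiflow (E : ℝ≥0 → Force N m) (t : ℝ≥0) (z : Phase N) : Phase N :=
  (z.1 + torusProj (charSol E z t).1, (charSol E z t).2)

theorem isChar_semiflow (hm : N + 1 < m) (hE : IsForcing E) (z : Phase N) (T : ℝ≥0) :
    IsChar E T fun t => semiflow E t z := by
  have hc : Continuous (charSol E z) := continuous_volterraSol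
    (exists_isVolterra_charKernel hm hE z.1) continuous_const
    (continuous_volterraInt_charKernel hm hE z.1)
  have heq := volterraSol_eq (g := fun _ => ((0 : Vel N), z.2))
    (exists_isVolterra_charKernel hm hE z.1) continuous_const
    (continuous_volterraInt_charKernel hm hE z.1)
  change ∀ t, charSol E z t = _ + volterraInt _ (charSol E z) t at heq
  have h1 : ∀ t, (charSol E z t).1 = ∫ s in (0 : ℝ)..t, (charSol E z s.toNNReal).2 := by
    intro t
    have h2 := (ContinuousLinearMap.fst ℝ (Vel N) (Vel N)).intervalIntegral_comp_comm
      (intervalIntegrable_charKernel hm hE z.1 hc t 0 t)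
    have h3 := congrArg Prod.fst (heq t)
    rw [Prod.fst_add, zero_add] at h3
    exact h3.trans h2.symm
  have h2 : ∀ t, (charSol E z t).2 = z.2 + ∫ s in (0 : ℝ)..t,
      (E s.toNNReal).field (z.1 + torusProj (charSol E z s.toNNReal).1) := by
    intro t
    have h2 := (ContinuousLinearMap.snd ℝ (Vel N) (Vel N)).intervalIntegral_comp_comm
      (intervalIntegrable_charKernel hm hE z.1 hc t 0 t)
    have h3 := congrArg Prod.snd (heq t)
    rw [Prod.snd_add] at h3
    exact h3.trans (congrArg _ h2.symm)
  have h0 : semiflow E 0 z = z := by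
    refine Prod.ext ?_ ?_
    · simp only [semiflow]; rw [h1]; simp [torusProj_zero]
    · simp only [semiflow]; rw [h2]; simp
  refine ⟨?_, fun t _ => ?_, fun t _ => ?_⟩
  · exact (continuous_const.add ((continuous_torusProj N).comp (continuous_fst.comp hc))).prodMk
      (continuous_snd.comp hc)
  · rw [h0]
    exact congrArg (z.1 + torusProj ·) (h1 t)
  · rw [h0]
    exact h2 t

theorem semiflow_zero (hm : N + 1 < m) (hE : IsForcing E) (z : Phase N) :
    semiflow E 0 z = z := by
  have heq := volterraSol_eq (g := fun _ => ((0 : Vel N), z.2))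
    (exists_isVolterra_charKernel hm hE z.1) continuous_const
    (continuous_volterraInt_charKernel hm hE z.1) 0
  change charSol E z 0 = _ + volterraInt _ (charSol E z) 0 at heq
  have h0 : volterraInt (charKernel E z.1) (charSol E z) 0 = 0 := by simp [volterraInt]
  rw [h0, add_zero] at heq
  refine Prod.ext ?_ ?_
  · simp only [semiflow, heq, torusProj_zero, add_zero]
  · simp only [semiflow, heq]

theorem IsChar.eq_semiflow (hm : N + 1 < m) (hE : IsForcing E) (h : IsChar E T ζ) {t : ℝ≥0}
    (ht : t ≤ T) : ζ t = semiflow E t (ζ 0) :=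
  h.unique hm hE (isChar_semiflow hm hE (ζ 0) T) (semiflow_zero hm hE _).symm ht

/-- Causality, by uniqueness of characteristics. It is what lets truncated subtraction be used in
reversed forcings, whose values after the final time are irrelevant. -/
theorem semiflow_congr (hm : N + 1 < m) (hE : IsForcing E) {E' : ℝ≥0 → Force N m}
    (hE' : IsForcing E') {T : ℝ≥0} (he : ∀ t ≤ T, E' t = E t) (z : Phase N) :
    semiflow E' T z = semiflow E T z := by
  have h := ((isChar_semiflow hm hE z T).congr he).eq_semiflow hm hE' le_rfl
  rw [semiflow_zero hm hE] at h
  exact h.symm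

theorem semiflow_add (hm : N + 1 < m) (hE : IsForcing E) (s t : ℝ≥0) (z : Phase N) :
    semiflow E (s + t) z = semiflow (fun r => E (s + r)) t (semiflow E s z) := by
  have := ((isChar_semiflow hm hE z (s + t)).shift hm hE (c := s) (S := t) le_rfl).eq_semiflow
    hm (hE.comp_add s) le_rfl
  simpa using this

/-- The time-reversed characteristic. -/
theorem semiflow_reverse (hm : N + 1 < m) (hE : IsForcing E) (T : ℝ≥0) (z : Phase N) :
    velFlip (semiflow (fun t => E (T - t)) T (velFlip (semiflow E T z))) = z := by
  have := ((isChar_semiflow hm hE z T).reverse hm hE).eq_semiflow hm (hE.comp_sub T) le_rfl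
  simp only [tsub_self, tsub_zero] at this
  rw [← this, velFlip_velFlip, semiflow_zero hm hE]

/-- The other composition comes from reversing the reversed forcing: T - (T - t) = t holds on [0,T],
which suffices by causality. -/
theorem semiflow_reverse' (hm : N + 1 < m) (hE : IsForcing E) (T : ℝ≥0) (z : Phase N) :
    semiflow E T (velFlip (semiflow (fun t => E (T - t)) T (velFlip z))) = z := by
  have h := semiflow_reverse hm (hE.comp_sub T) T (velFlip z)
  rw [semiflow_congr hm hE ((hE.comp_sub T).comp_sub T)
    (fun t ht => by rw [tsub_tsub_cancel_of_le ht])] at h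
  rw [← velFlip_velFlip (semiflow E T _), h, velFlip_velFlip]

theorem tendsto_charKernel (hm : N + 1 < m) {ι : Type*} {L : Filter ι}
    {En : ι → ℝ≥0 → Force N m} (x : Torus N) (t : ℝ≥0) {s : ℝ≥0}
    (hlim : Tendsto (fun n => En n s) L (𝓝 (E s))) (p : Vel N × Vel N) :
    Tendsto (fun n => charKernel (En n) x t s p) L (𝓝 (charKernel E x t s p)) := by
  have h1 : Tendsto (fun n => (En n s, x + torusProj p.1)) L (𝓝 (E s, x + torusProj p.1)) :=
    hlim.prodMk_nhds tendsto_const_nhds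
  have h2 := ((continuous_field_eval hm).tendsto (E s, x + torusProj p.1)).comp h1
  exact tendsto_const_nhds.prodMk_nhds h2

/-- Dominated convergence in the Volterra equation: bounded pointwise convergence of the forcings is
enough, as is needed for step approximations of paths with jumps. -/
theorem tendsto_semiflow (hm : N + 1 < m) {ι : Type*} {L : Filter ι} [L.IsCountablyGenerated]
    (hE : IsForcing E) {En : ι → ℝ≥0 → Force N m} (hEn : ∀ n, IsForcing (En n)) {T : ℝ≥0} {B : ℝ}
    (hB0 : 0 ≤ B) (hB : ∀ t ≤ T, ‖E t‖ ≤ B) (hBn : ∀ n, ∀ t ≤ T, ‖En n t‖ ≤ B)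
    (hlim : ∀ t ≤ T, Tendsto (fun n => En n t) L (𝓝 (E t))) (z : Phase N) :
    Tendsto (fun n => semiflow (En n) T z) L (𝓝 (semiflow E T z)) := by
  have h : Tendsto (fun n => charSol (En n) z T) L (𝓝 (charSol E z T)) :=
    tendsto_volterraSol (isVolterra_charKernel hm hE z.1 hB0 hB)
      (fun n => isVolterra_charKernel hm (hEn n) z.1 hB0 (hBn n))
      continuous_const (fun _ => continuous_const)
      (continuous_volterraInt_charKernel hm hE z.1)
      (fun n => continuous_volterraInt_charKernel hm (hEn n) z.1)
      (M := ‖((0 : Vel N), z.2)‖) (fun _ _ => le_rfl) (fun _ _ _ => le_rfl)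
      (fun _ _ => tendsto_const_nhds) (fun s t hst ht p =>
        tendsto_charKernel hm z.1 t (hlim s (hst.le.trans ht)) p) T le_rfl
  refine Tendsto.prodMk_nhds ?_ ((continuous_snd.tendsto _).comp h)
  exact tendsto_const_nhds.add (((continuous_torusProj N).tendsto _).comp
    ((continuous_fst.tendsto _).comp h))

theorem exists_dist_semiflow_le (hm : N + 1 < m) {B : ℝ} (hB0 : 0 ≤ B) (T : ℝ≥0) :
    ∃ C : ℝ, 0 ≤ C ∧ ∀ (E : ℝ≥0 → Force N m), IsForcing E → (∀ t ≤ T, ‖E t‖ ≤ B) →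
      ∀ t ≤ T, ∀ z z', dist (semiflow E t z) (semiflow E t z') ≤ C * dist z z' := by
  obtain ⟨C, hC0, hC⟩ := exists_dist_char_le hm hB0 T
  refine ⟨C, hC0, fun E hE hB t ht z z' => ?_⟩
  have := hC E hE hB T le_rfl _ _ (isChar_semiflow hm hE z T) (isChar_semiflow hm hE z' T) t ht
  simpa only [semiflow_zero hm hE] using this

theorem continuous_semiflow (hm : N + 1 < m) (hE : IsForcing E) (T : ℝ≥0) :
    Continuous (semiflow E T) := by
  obtain ⟨B, hB0, hB⟩ := hE.bounded T
  obtain ⟨C, hC0, hC⟩ := exists_dist_semiflow_le hm hB0 T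
  exact (LipschitzWith.of_dist_le_mul (K := ⟨C, hC0⟩) fun z z' =>
    hC E hE hB T le_rfl z z').continuous

/-! ### Liouville's theorem -/

variable {N m : ℕ} {E : ℝ≥0 → Force N m} {T : ℝ≥0} {ζ : ℝ≥0 → Phase N}

/-- The shear `(x, v) ↦ (x, v + e(x))`. -/
def kick (e : Force N m) (z : Phase N) : Phase N := (z.1, z.2 + e.field z.1)

/-- The shear `(x, v) ↦ (x + h v, v)`. -/
def drift (h : ℝ) (z : Phase N) : Phase N := (z.1 + torusProj (h • z.2), z.2)

theorem measurePreserving_kick (e : Force N m) :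
    MeasurePreserving (kick e) volume volume := by
  refine (MeasurePreserving.id (volume : Measure (Torus N))).skew_product
    (g := fun x v => v + e.field x) (by fun_prop) (Eventually.of_forall fun x => ?_)
  exact map_add_right_eq_self _ _

theorem measurePreserving_drift (h : ℝ) : MeasurePreserving (drift (N := N) h) volume volume := by
  have h1 : MeasurePreserving (fun p : Vel N × Torus N => (p.1, p.2 + torusProj (h • p.1)))
      (volume.prod volume) (volume.prod volume) := by
    refine (MeasurePreserving.id (volume : Measure (Vel N))).skew_product
      (g := fun v x => x + torusProj (h • v)) ?_ (Eventually.of_forall fun v => ?_)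
    · exact (continuous_snd.add ((continuous_torusProj N).comp (by fun_prop))).measurable
    · exact map_add_right_eq_self _ _
  exact (Measure.measurePreserving_swap.comp h1).comp Measure.measurePreserving_swap

/-- The iterates of the symplectic Euler scheme with step `h`. -/
def eulerMap (E : ℝ≥0 → Force N m) (h : ℝ) : ℕ → Phase N → Phase N
  | 0 => id
  | j + 1 => fun z => drift h (kick (∫ s in (j * h : ℝ)..((j + 1 : ℕ) * h : ℝ), E s.toNNReal)
      (eulerMap E h j z))

theorem measurePreserving_eulerMap (E : ℝ≥0 → Force N m) (h : ℝ) (j : ℕ) :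
    MeasurePreserving (eulerMap E h j) volume volume := by
  induction j with
  | zero => exact MeasurePreserving.id _
  | succ j ih => exact (measurePreserving_drift h).comp ((measurePreserving_kick _).comp ih)

/-- Evaluation at x is continuous and linear in the force. A kick by the time-integrated force
therefore has the exact impulse at a frozen position, and the scheme needs no regularity of E in
time. -/
theorem field_intervalIntegral (hm : N + 1 < m) (hE : IsForcing E) (a b : ℝ) (x : Torus N) :
    (∫ s in a..b, E s.toNNReal : Force N m).field x =
      ∫ s in a..b, (E s.toNNReal).field x :=
  (((ContinuousMap.evalCLM ℝ x).comp (fieldCLM hm)).intervalIntegral_comp_comm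
    (hE.intervalIntegrable a b)).symm

/-- Stability of one step of the scheme: the kick has Lipschitz constant 1 + b, and the drift moves
the position by h times the kicked velocity. -/
theorem dist_drift_kick_le (hm : N + 1 < m) (e : Force N m) {h b : ℝ} (hh : 0 ≤ h)
    (he : sobolevConst N * ‖e‖ ≤ b) (p q : Phase N) :
    dist (drift h (kick e p)) (drift h (kick e q)) ≤ (1 + b + h * (1 + b)) * dist p q := by
  have hb : 0 ≤ b := le_trans (by positivity) he
  have h1 : ‖p.1 - q.1‖ ≤ dist p q := by
    rw [← dist_eq_norm, Prod.dist_eq]; exact le_max_left _ _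
  have h2 : ‖p.2 - q.2‖ ≤ dist p q := by
    rw [← dist_eq_norm, Prod.dist_eq]; exact le_max_right _ _
  have h3 : ‖(p.2 + e.field p.1) - (q.2 + e.field q.1)‖ ≤ (1 + b) * dist p q := by
    rw [add_sub_add_comm]
    refine (norm_add_le _ _).trans ?_
    have := Force.norm_field_sub_le hm e p.1 q.1
    have h4 : sobolevConst N * ‖e‖ * ‖p.1 - q.1‖ ≤ b * dist p q := by gcongr
    linarith
  have hd : 0 ≤ dist p q := dist_nonneg
  rw [Prod.dist_eq]
  refine max_le ?_ ?_
  · rw [dist_eq_norm]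
    simp only [drift, kick]
    rw [add_sub_add_comm, ← torusProj_sub, ← smul_sub]
    refine (norm_add_le _ _).trans ?_
    have := norm_torusProj_le (h • ((p.2 + e.field p.1) - (q.2 + e.field q.1)))
    rw [norm_smul, Real.norm_of_nonneg hh] at this
    have h5 : h * ‖(p.2 + e.field p.1) - (q.2 + e.field q.1)‖ ≤ h * ((1 + b) * dist p q) := by
      gcongr
    have h6 : 0 ≤ b * dist p q := by positivity
    linarith
  · rw [dist_eq_norm]
    have : 0 ≤ h * (1 + b) := by positivity
    exact h3.trans (mul_le_mul_of_nonneg_right (by linarith) hd)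

/-- Consistency of the symplectic Euler scheme. -/
theorem dist_drift_kick_char_le (hm : N + 1 < m) (hE : IsForcing E) (h : IsChar E T ζ)
    {B V : ℝ} (hB0 : 0 ≤ B) (hB : ∀ t ≤ T, ‖E t‖ ≤ B) (hV : ∀ t ≤ T, ‖(ζ t).2‖ ≤ V)
    {a b : ℝ≥0} (hab : a ≤ b) (hb : b ≤ T) :
    dist (drift ((b : ℝ) - a) (kick (∫ s in (a : ℝ)..b, E s.toNNReal) (ζ a))) (ζ b) ≤
      (sobolevConst N * B * V + 2 * (sobolevConst N * B)) * ((b : ℝ) - a) ^ 2 := by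
  have hab' := NNReal.coe_le_coe.2 hab
  have hV0 : 0 ≤ V := (norm_nonneg _).trans (hV 0 zero_le)
  set K := sobolevConst N * B with hK
  have hK0 : 0 ≤ K := by positivity
  have haT := hab.trans hb
  have hmem : ∀ s ∈ uIoc (a : ℝ) b, s.toNNReal ≤ T ∧ a ≤ s.toNNReal ∧
      (s.toNNReal : ℝ) = s ∧ (a : ℝ) < s ∧ s ≤ b := by
    intro s hs
    rw [uIoc_of_le hab'] at hs
    have h0 := a.coe_nonneg.trans hs.1.le
    refine ⟨(Real.toNNReal_le_iff_le_coe.2 hs.2).trans hb, ?_, Real.coe_toNNReal _ h0, hs.1, hs.2⟩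
    rw [← NNReal.coe_le_coe, Real.coe_toNNReal _ h0]; exact hs.1.le
  have hfield : ∀ t ≤ T, ∀ x, ‖(E t).field x‖ ≤ K := by
    intro t ht x
    refine (Force.norm_field_apply_le hm _ _).trans ?_
    rw [hK]
    gcongr
    exact hB t ht
  -- Within a step, position and velocity change by O(b - a); the local error integrates such
  -- differences over the step and is O((b - a)²).
  have hpos : ∀ s ∈ uIoc (a : ℝ) b, ‖(ζ a).1 - (ζ s.toNNReal).1‖ ≤ V * (b - a) := by
    intro s hs
    obtain ⟨h1, h2, h3, h4, h5⟩ := hmem s hs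
    rw [h.fst_incr haT h1, sub_add_cancel_left, ← torusProj_neg]
    refine (norm_torusProj_le _).trans ?_
    rw [norm_neg]
    refine (intervalIntegral.norm_integral_le_of_norm_le_const (C := V) fun r hr => ?_).trans ?_
    · rw [h3, uIoc_of_le h4.le] at hr
      exact hV _ ((Real.toNNReal_le_iff_le_coe.2 (hr.2.trans h5)).trans hb)
    · rw [h3, abs_of_nonneg (by linarith)]
      gcongr
  have hvel : ∀ s ∈ uIoc (a : ℝ) b, ‖(ζ s.toNNReal).2 - (ζ a).2‖ ≤ K * (b - a) := by
    intro s hs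
    obtain ⟨h1, h2, h3, h4, h5⟩ := hmem s hs
    rw [h.snd_incr hm hE haT h1, add_sub_cancel_left]
    refine (intervalIntegral.norm_integral_le_of_norm_le_const (C := K) fun r hr => ?_).trans ?_
    · rw [h3, uIoc_of_le h4.le] at hr
      exact hfield _ ((Real.toNNReal_le_iff_le_coe.2 (hr.2.trans h5)).trans hb) _
    · rw [h3, abs_of_nonneg (by linarith)]
      gcongr
  have hconst := hE.intervalIntegrable_field hm (ξ := fun _ => (ζ a).1) continuous_const a b
  have hcurve := hE.intervalIntegrable_field hm (ξ := fun s => (ζ s).1)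
    (continuous_fst.comp h.cont) a b
  set w := (ζ a).2 + (∫ s in (a : ℝ)..b, E s.toNNReal : Force N m).field (ζ a).1 with hw
  have hwa : ‖w - (ζ a).2‖ ≤ K * (b - a) := by
    rw [hw, add_sub_cancel_left, field_intervalIntegral hm hE]
    refine (intervalIntegral.norm_integral_le_of_norm_le_const (C := K) fun r hr => ?_).trans ?_
    · exact hfield _ (hmem r hr).1 _
    · rw [abs_of_nonneg (by linarith)]
  rw [Prod.dist_eq]
  refine max_le ?_ ?_
  · rw [dist_eq_norm, h.fst_incr haT hb]
    simp only [drift, kick]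
    rw [add_sub_add_left_eq_sub, ← torusProj_sub, ← hw]
    refine (norm_torusProj_le _).trans ?_
    have e1 : ((b : ℝ) - a) • w - ∫ s in (a : ℝ)..b, (ζ s.toNNReal).2 =
        ∫ s in (a : ℝ)..b, (w - (ζ s.toNNReal).2) := by
      rw [intervalIntegral.integral_sub intervalIntegrable_const
        (intervalIntegrable_snd h.cont _ _), intervalIntegral.integral_const]
    rw [e1]
    refine (intervalIntegral.norm_integral_le_of_norm_le_const
      (C := 2 * K * (b - a)) fun r hr => ?_).trans ?_
    · have := hvel r hr
      calc ‖w - (ζ r.toNNReal).2‖ = ‖(w - (ζ a).2) - ((ζ r.toNNReal).2 - (ζ a).2)‖ := by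
            rw [sub_sub_sub_cancel_right]
        _ ≤ _ := norm_sub_le _ _
        _ ≤ _ := by linarith
    · rw [abs_of_nonneg (by linarith)]
      have : 0 ≤ K * V * ((b : ℝ) - a) ^ 2 := by positivity
      nlinarith
  · rw [dist_eq_norm, h.snd_incr hm hE haT hb]
    simp only [drift, kick]
    rw [add_sub_add_left_eq_sub, field_intervalIntegral hm hE,
      ← intervalIntegral.integral_sub hconst hcurve]
    refine (intervalIntegral.norm_integral_le_of_norm_le_const
      (C := K * (V * (b - a))) fun r hr => ?_).trans ?_
    · refine (Force.norm_field_sub_le hm _ _ _).trans ?_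
      have h1 := hpos r hr
      have h2 : sobolevConst N * ‖E r.toNNReal‖ ≤ K := by
        rw [hK]; gcongr; exact hB _ (hmem r hr).1
      gcongr
    · rw [abs_of_nonneg (by linarith)]
      have : 0 ≤ 2 * K * ((b : ℝ) - a) ^ 2 := by positivity
      nlinarith

/-- Consistency and stability give convergence: after j steps the error is at most j M h² (1 + A
h)^j. With n + 1 steps of size h = T/(n + 1) this is at most M T² e^{AT} / (n + 1). -/
theorem tendsto_eulerMap (hm : N + 1 < m) (hE : IsForcing E) (T : ℝ≥0) (z : Phase N) :
    Tendsto (fun n : ℕ => eulerMap E (T / (n + 1)) (n + 1) z) atTop (𝓝 (semiflow E T z)) := by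
  obtain ⟨B, hB0, hB⟩ := hE.bounded T
  have hζ := isChar_semiflow hm hE z T
  set ζ := fun t => semiflow E t z with hζd
  obtain ⟨V, hV⟩ := (isCompact_Icc (a := (0 : ℝ≥0)) (b := T)).exists_bound_of_continuousOn
    (continuous_snd.comp hζ.cont).continuousOn
  have hV' : ∀ t ≤ T, ‖(ζ t).2‖ ≤ V := fun t ht => hV t ⟨zero_le, ht⟩
  set K := sobolevConst N * B with hK
  have hK0 : 0 ≤ K := by positivity
  have hV0 : 0 ≤ V := (norm_nonneg _).trans (hV' 0 zero_le)
  -- Chosen so that the one-step Lipschitz constant 1 + K h + h (1 + K h) is at most 1 + A h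
  -- whenever h ≤ T.
  set A := K + 1 + K * T with hA
  have hA0 : 0 ≤ A := by positivity
  set M := K * V + 2 * K with hM
  have hM0 : 0 ≤ M := by positivity
  have key : ∀ n : ℕ, dist (eulerMap E (T / (n + 1)) (n + 1) z) (ζ T) ≤
      (M * (T : ℝ) ^ 2 * Real.exp (A * T)) * (1 / ((n : ℝ) + 1)) := by
    intro n
    have hn : (0 : ℝ) < (n : ℝ) + 1 := by positivity
    set h : ℝ≥0 := T / (n + 1) with hh
    have hh' : (h : ℝ) = T / (n + 1) := by rw [hh]; push_cast; rfl
    have hhT : (h : ℝ) ≤ T := by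
      rw [hh']; exact div_le_self T.coe_nonneg (by linarith [n.cast_nonneg (α := ℝ)])
    rw [← hh']
    have hind : ∀ j : ℕ, j ≤ n + 1 → dist (eulerMap E h j z) (ζ (j * h)) ≤
        j * (M * (h : ℝ) ^ 2) * (1 + A * h) ^ j := by
      intro j
      induction j with
      | zero =>
        intro _
        simp [eulerMap, hζd, semiflow_zero hm hE]
      | succ j ih =>
        intro hj
        have hjT : ((j + 1 : ℕ) : ℝ≥0) * h ≤ T := by
          rw [← NNReal.coe_le_coe, NNReal.coe_mul, hh']
          rw [NNReal.coe_natCast, mul_div_assoc', div_le_iff₀ hn, mul_comm]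
          gcongr
          exact_mod_cast hj
        have hle : (j : ℝ≥0) * h ≤ ((j + 1 : ℕ) : ℝ≥0) * h := by gcongr; simp
        have hstep : ((((j + 1 : ℕ) : ℝ≥0) * h : ℝ≥0) : ℝ) - ((j : ℝ≥0) * h : ℝ≥0) = h := by
          push_cast; ring
        have c1 := dist_drift_kick_char_le hm hE hζ hB0 hB hV' hle hjT
        rw [hstep, ← hK] at c1
        set e : Force N m := ∫ s in (j * h : ℝ)..((j + 1 : ℕ) * h : ℝ), E s.toNNReal with he
        have he' : (∫ s in (((j : ℝ≥0) * h : ℝ≥0) : ℝ)..(((j + 1 : ℕ) : ℝ≥0) * h : ℝ≥0),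
            E s.toNNReal) = e := by
          rw [he]; push_cast; rfl
        rw [he'] at c1
        have hen : sobolevConst N * ‖e‖ ≤ K * h := by
          rw [hK, mul_assoc]
          refine mul_le_mul_of_nonneg_left ?_ (by positivity)
          rw [← he']
          refine (intervalIntegral.norm_integral_le_of_norm_le_const (C := B)
            fun s hs => ?_).trans ?_
          · rw [uIoc_of_le (NNReal.coe_le_coe.2 hle)] at hs
            exact hB _ ((Real.toNNReal_le_iff_le_coe.2 hs.2).trans hjT)
          · rw [hstep, abs_of_nonneg h.coe_nonneg]
        have c2 := dist_drift_kick_le hm e h.coe_nonneg hen (eulerMap E h j z) (ζ (j * h))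
        have c3 := ih (by omega)
        have hcoef : 1 + K * h + h * (1 + K * h) ≤ 1 + A * h := by
          have : (h : ℝ) * (K * h) ≤ h * (K * T) := by gcongr
          rw [hA]; nlinarith
        have c4 : dist (eulerMap E h (j + 1) z) (ζ ((j + 1 : ℕ) * h)) ≤
            (1 + K * h + h * (1 + K * h)) * dist (eulerMap E h j z) (ζ (j * h)) +
              M * (h : ℝ) ^ 2 :=
          (dist_triangle _ _ _).trans (add_le_add c2 c1)
        refine c4.trans ?_
        have hq : 1 ≤ (1 + A * h) ^ (j + 1) :=
          one_le_pow₀ (by have : 0 ≤ A * h := by positivity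
                          linarith)
        calc (1 + K * h + h * (1 + K * h)) * dist (eulerMap E h j z) (ζ (j * h)) +
              M * (h : ℝ) ^ 2
            ≤ (1 + A * h) * (j * (M * (h : ℝ) ^ 2) * (1 + A * h) ^ j) +
              M * (h : ℝ) ^ 2 * (1 + A * h) ^ (j + 1) := by
              refine add_le_add (mul_le_mul hcoef c3 dist_nonneg (by positivity)) ?_
              exact le_mul_of_one_le_right (by positivity) hq
          _ = _ := by push_cast; ring
    have h1 := hind (n + 1) le_rfl
    have hTn : ((n + 1 : ℕ) : ℝ≥0) * h = T := by
      rw [hh]; push_cast; field_simp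
    rw [hTn] at h1
    refine h1.trans ?_
    have h2 : (1 + A * (h : ℝ)) ^ (n + 1) ≤ Real.exp (A * T) := by
      have h3 : 1 + A * (h : ℝ) ≤ Real.exp (A * h) := by
        linarith [Real.add_one_le_exp (A * h)]
      calc (1 + A * (h : ℝ)) ^ (n + 1) ≤ Real.exp (A * h) ^ (n + 1) := by gcongr
        _ = Real.exp (A * T) := by
          rw [← Real.exp_nat_mul]
          congr 1
          have := congrArg NNReal.toReal hTn
          push_cast at this ⊢
          rw [← this]; ring
    calc _ ≤ ((n + 1 : ℕ) : ℝ) * (M * (h : ℝ) ^ 2) * Real.exp (A * T) := by gcongr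
      _ = _ := by
        rw [hh']; push_cast; field_simp
  rw [tendsto_iff_dist_tendsto_zero]
  refine squeeze_zero (fun _ => dist_nonneg) key ?_
  have := (tendsto_one_div_add_atTop_nhds_zero_nat (𝕜 := ℝ)).const_mul
    (M * (T : ℝ) ^ 2 * Real.exp (A * T))
  rwa [mul_zero] at this

/-- A pointwise limit of measure preserving maps does not increase the measure. -/
theorem measure_preimage_le_of_tendsto {Sn : ℕ → Phase N → Phase N} {S : Phase N → Phase N}
    (hn : ∀ n, MeasurePreserving (Sn n) volume volume)
    (hlim : ∀ z, Tendsto (fun n => Sn n z) atTop (𝓝 (S z))) (A : Set (Phase N)) :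
    volume (S ⁻¹' A) ≤ volume A := by
  have hopen : ∀ U : Set (Phase N), IsOpen U → volume (S ⁻¹' U) ≤ volume U := by
    intro U hU
    have h1 : ∀ n, volume (Sn n ⁻¹' U) = volume U :=
      fun n => (hn n).measure_preimage hU.measurableSet.nullMeasurableSet
    -- For open U, a point that S sends into U is sent there by all late Sn, so the preimage lies in
    -- a lower limit of sets of measure |U|.
    calc volume (S ⁻¹' U) ≤ volume (⋃ k, ⋂ n ≥ k, Sn n ⁻¹' U) := by
          refine measure_mono fun z hz => ?_
          obtain ⟨k, hk⟩ := eventually_atTop.1 ((hlim z).eventually (hU.mem_nhds hz))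
          simp only [mem_iUnion, mem_iInter]
          exact ⟨k, hk⟩
      _ = ⨆ k, volume (⋂ n ≥ k, Sn n ⁻¹' U) := by
          refine Monotone.measure_iUnion fun a b hab => ?_
          exact biInter_subset_biInter_left fun n hn => le_trans hab hn
      _ ≤ volume U := iSup_le fun k => by
          rw [← h1 k]
          exact measure_mono (biInter_subset_of_mem (show k ∈ {n | n ≥ k} from le_refl k))
  rw [Set.measure_eq_iInf_isOpen A]
  refine le_iInf₂ fun U hAU => le_iInf fun hU => ?_
  exact (measure_mono (preimage_mono hAU)).trans (hopen U hU)

/-- Liouville's theorem. -/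
theorem measurePreserving_semiflow (hm : N + 1 < m) (hE : IsForcing E) (T : ℝ≥0) :
    MeasurePreserving (semiflow E T) volume volume := by
  have hmeas := (continuous_semiflow hm hE T).measurable
  refine ⟨hmeas, Measure.ext fun A hA => ?_⟩
  rw [Measure.map_apply hmeas hA]
  refine le_antisymm (measure_preimage_le_of_tendsto
    (fun n => measurePreserving_eulerMap E (T / (n + 1)) (n + 1)) (tendsto_eulerMap hm hE T) A) ?_
  -- The opposite inequality is the same bound for the inverse flow, itself a limit of measure
  -- preserving maps.
  set R : Phase N → Phase N := fun z => velFlip (semiflow (fun t => E (T - t)) T (velFlip z))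
  have hR : ∀ A, volume (R ⁻¹' A) ≤ volume A := by
    refine measure_preimage_le_of_tendsto (Sn := fun n : ℕ => velFlip ∘
      (eulerMap (fun t => E (T - t)) (T / (n + 1)) (n + 1)) ∘ velFlip) (fun n =>
      measurePreserving_velFlip.comp ((measurePreserving_eulerMap _ _ _).comp
        measurePreserving_velFlip)) fun z => ?_
    exact (continuous_velFlip.tendsto _).comp (tendsto_eulerMap hm (hE.comp_sub T) T (velFlip z))
  have h1 : R ⁻¹' (semiflow E T ⁻¹' A) = A := by
    ext z
    simp only [mem_preimage, R, semiflow_reverse' hm hE]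
  calc volume A = volume (R ⁻¹' (semiflow E T ⁻¹' A)) := by rw [h1]
    _ ≤ _ := hR _

/-! ### The characteristic flow -/

variable {N m : ℕ} {E : ℝ≥0 → Force N m}

/-- The backward characteristic map from time `t` to time `s ≤ t`. -/
def backFlow (E : ℝ≥0 → Force N m) (t s : ℝ≥0) (z : Phase N) : Phase N :=
  velFlip (semiflow (fun r => E (t - r)) (t - s) (velFlip z))

theorem measurePreserving_backFlow (hm : N + 1 < m) (hE : IsForcing E) (t s : ℝ≥0) :
    MeasurePreserving (backFlow E t s) volume volume :=
  measurePreserving_velFlip.comp ((measurePreserving_semiflow hm (hE.comp_sub t) _).comp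
    measurePreserving_velFlip)

theorem backFlow_of_le (hm : N + 1 < m) (hE : IsForcing E) {t s : ℝ≥0} (h : t ≤ s) (z : Phase N) :
    backFlow E t s z = z := by
  rw [backFlow, tsub_eq_zero_of_le h, semiflow_zero hm (hE.comp_sub t), velFlip_velFlip]

theorem backFlow_backFlow (hm : N + 1 < m) (hE : IsForcing E) {s r t : ℝ≥0} (hsr : s ≤ r)
    (hrt : r ≤ t) (z : Phase N) : backFlow E r s (backFlow E t r z) = backFlow E t s z := by
  have h1 : t - s = (t - r) + (r - s) := (tsub_add_tsub_cancel hrt hsr).symm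
  have h2 : (fun x => E (t - (t - r + x))) = fun x => E (r - x) := by
    funext x
    rw [← tsub_tsub, tsub_tsub_cancel_of_le hrt]
  rw [backFlow, backFlow, backFlow, velFlip_velFlip, h1, semiflow_add hm (hE.comp_sub t), h2]

theorem backFlow_shift (hm : N + 1 < m) (hE : IsForcing E) (c t s : ℝ≥0) :
    backFlow (fun r => E (c + r)) t s = backFlow E (c + t) (c + s) := by
  funext z
  rw [backFlow, backFlow, add_tsub_add_eq_tsub_left]
  congr 1
  refine semiflow_congr hm (hE.comp_sub (c + t)) ((hE.comp_add c).comp_sub t) (fun r hr => ?_) _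
  rw [add_tsub_assoc_of_le (hr.trans tsub_le_self)]

theorem norm_backFlow_snd_sub_le (hm : N + 1 < m) (hE : IsForcing E) {B : ℝ} {t s : ℝ≥0}
    (hB : ∀ r ≤ t, ‖E r‖ ≤ B) (z : Phase N) :
    ‖(backFlow E t s z).2 - z.2‖ ≤ sobolevConst N * B * (t - s : ℝ≥0) := by
  have h := (isChar_semiflow hm (hE.comp_sub t) (velFlip z) (t - s)).norm_snd_sub_le hm
    (fun r _ => hB (t - r) tsub_le_self) le_rfl
  rw [semiflow_zero hm (hE.comp_sub t)] at h
  refine le_of_eq_of_le ?_ h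
  rw [← norm_neg]
  congr 1
  change -(-_ - z.2) = _ - -z.2
  abel

theorem norm_backFlow_fst_sub_le (hm : N + 1 < m) (hE : IsForcing E) {B : ℝ} (hB0 : 0 ≤ B)
    {t s : ℝ≥0} (hB : ∀ r ≤ t, ‖E r‖ ≤ B) (z : Phase N) :
    ‖(backFlow E t s z).1 - z.1‖ ≤ (‖z.2‖ + sobolevConst N * B * (t - s : ℝ≥0)) *
      (t - s : ℝ≥0) := by
  have h := (isChar_semiflow hm (hE.comp_sub t) (velFlip z) (t - s)).norm_fst_sub_le hm hB0
    (fun r _ => hB (t - r) tsub_le_self) le_rfl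
  rw [semiflow_zero hm (hE.comp_sub t)] at h
  simpa only [backFlow, velFlip, norm_neg] using h

theorem exists_dist_backFlow_le (hm : N + 1 < m) (hE : IsForcing E) (T : ℝ≥0) :
    ∃ C : ℝ, 0 ≤ C ∧ ∀ t ≤ T, ∀ s z z',
      dist (backFlow E t s z) (backFlow E t s z') ≤ C * dist z z' := by
  obtain ⟨B, hB0, hB⟩ := hE.bounded T
  obtain ⟨C, hC0, hC⟩ := exists_dist_semiflow_le hm hB0 T
  have hflip : ∀ z z' : Phase N, dist (velFlip z) (velFlip z') = dist z z' := fun z z' => by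
    simp [velFlip, Prod.dist_eq]
  refine ⟨C, hC0, fun t ht s z z' => ?_⟩
  rw [backFlow, backFlow, hflip, ← hflip z z']
  exact hC _ (hE.comp_sub t) (fun r _ => hB _ (tsub_le_self.trans ht)) _ (tsub_le_self.trans ht) _ _

theorem exists_dist_backFlow_self_le (hm : N + 1 < m) (hE : IsForcing E) (T : ℝ≥0) (z : Phase N) :
    ∃ C : ℝ, ∀ t ≤ T, ∀ s, dist (backFlow E t s z) z ≤ C * (t - s : ℝ≥0) := by
  obtain ⟨B, hB0, hB⟩ := hE.bounded T
  refine ⟨max (‖z.2‖ + sobolevConst N * B * T) (sobolevConst N * B), fun t ht s => ?_⟩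
  have h1 := norm_backFlow_fst_sub_le hm hE hB0 (fun r hr => hB r (hr.trans ht)) z (s := s)
  have h2 := norm_backFlow_snd_sub_le hm hE (fun r hr => hB r (hr.trans ht)) z (s := s)
  have h3 : ((t - s : ℝ≥0) : ℝ) ≤ T := NNReal.coe_le_coe.2 (tsub_le_self.trans ht)
  rw [Prod.dist_eq, dist_eq_norm, dist_eq_norm]
  refine max_le (h1.trans ?_) (h2.trans ?_)
  · refine mul_le_mul_of_nonneg_right (le_trans ?_ (le_max_left _ _)) (NNReal.coe_nonneg _)
    gcongr
  · exact mul_le_mul_of_nonneg_right (le_max_right _ _) (NNReal.coe_nonneg _)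

/-- Going back from the later of t and τ passes through the earlier one. The short excursion between
them is of order |t - τ|, and the remaining backward map is Lipschitz uniformly. -/
theorem tendsto_backFlow_left (hm : N + 1 < m) (hE : IsForcing E) {s t : ℝ≥0} (hst : s ≤ t)
    (z : Phase N) : Tendsto (fun τ => backFlow E τ s z) (𝓝[Ici s] t) (𝓝 (backFlow E t s z)) := by
  obtain ⟨C, hC0, hC⟩ := exists_dist_backFlow_le hm hE (t + 1)
  obtain ⟨K, hK⟩ := exists_dist_backFlow_self_le hm hE (t + 1) z
  rw [tendsto_iff_dist_tendsto_zero]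
  have hlim : Tendsto (fun τ : ℝ≥0 => C * (K * (τ - t : ℝ≥0)) + C * (K * (t - τ : ℝ≥0)))
      (𝓝[Ici s] t) (𝓝 0) := by
    have : Continuous (fun τ : ℝ≥0 => C * (K * (τ - t : ℝ≥0)) + C * (K * (t - τ : ℝ≥0))) := by
      fun_prop
    have := this.tendsto t
    simp only [tsub_self, NNReal.coe_zero, mul_zero, add_zero] at this
    exact this.mono_left nhdsWithin_le_nhds
  refine squeeze_zero' (Eventually.of_forall fun _ => dist_nonneg) ?_ hlim
  filter_upwards [self_mem_nhdsWithin, nhdsWithin_le_nhds (gt_mem_nhds (lt_add_one t))] with τ h1 h2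
  rcases le_total t τ with h | h
  · rw [← backFlow_backFlow hm hE hst h, tsub_eq_zero_of_le h, NNReal.coe_zero, mul_zero, mul_zero,
      add_zero]
    refine (hC t (by simp) s _ _).trans ?_
    gcongr
    exact hK τ h2.le t
  · rw [← backFlow_backFlow hm hE h1 h, tsub_eq_zero_of_le h, NNReal.coe_zero, mul_zero, mul_zero,
      zero_add, dist_comm]
    refine (hC τ h2.le s _ _).trans ?_
    gcongr
    exact hK t (by simp) τ

theorem continuous_backFlow_right (hm : N + 1 < m) (hE : IsForcing E) (t : ℝ≥0) (z : Phase N) :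
    Continuous fun s => backFlow E t s z :=
  continuous_velFlip.comp
    ((isChar_semiflow hm (hE.comp_sub t) (velFlip z) t).cont.comp (by fun_prop))

/-- Velocities change by a bounded amount on [0,T]; this is the confinement hypothesis of
`tendsto_transport`. -/
theorem norm_snd_le_of_backFlow (hm : N + 1 < m) (hE : IsForcing E) {B : ℝ} (hB0 : 0 ≤ B)
    {T t s : ℝ≥0} (ht : t ≤ T) (hB : ∀ r ≤ T, ‖E r‖ ≤ B) {r : ℝ} {z : Phase N}
    (hz : ‖(backFlow E t s z).2‖ ≤ r) : ‖z.2‖ ≤ r + sobolevConst N * B * T := by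
  have h1 := norm_backFlow_snd_sub_le hm hE (fun r hr => hB r (hr.trans ht)) z (s := s)
  have h3 : ((t - s : ℝ≥0) : ℝ) ≤ T := NNReal.coe_le_coe.2 (tsub_le_self.trans ht)
  have h4 : sobolevConst N * B * (t - s : ℝ≥0) ≤ sobolevConst N * B * T := by gcongr
  have h5 := norm_sub_norm_le z.2 (backFlow E t s z).2
  rw [norm_sub_rev] at h5
  linarith

/-- The characteristic flow. -/
def charFlow (E : ℝ≥0 → Force N m) (s t : ℝ≥0) (z : Phase N) : Phase N :=
  semiflow E t (backFlow E s 0 z)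

theorem isCharacteristicFlow_charFlow (hm : N + 1 < m) (hE : IsForcing E) :
    IsCharacteristicFlow E (charFlow E) := by
  intro s z
  have h := fun T => isChar_semiflow hm hE (backFlow E s 0 z) T
  have hz : semiflow E s (backFlow E s 0 z) = z := by
    rw [backFlow, tsub_zero]; exact semiflow_reverse' hm hE s z
  refine ⟨(h 0).cont, fun t => ⟨?_, ?_⟩⟩
  · have := (h (max s t)).fst_incr (le_max_left s t) (le_max_right s t)
    rwa [hz] at this
  · have := (h (max s t)).snd_incr hm hE (le_max_left s t) (le_max_right s t)
    rwa [hz] at this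

/-- By uniqueness after time reversal, all characteristic flows agree on the values that enter the
mild formulation, so the choice of Φ in `IsMildLB` is immaterial. -/
theorem IsCharacteristicFlow.eq_backFlow (hm : N + 1 < m) (hE : IsForcing E)
    {Φ : ℝ≥0 → ℝ≥0 → Phase N → Phase N} (hΦ : IsCharacteristicFlow E Φ) {s t : ℝ≥0} (hst : s ≤ t) :
    Φ t s = backFlow E t s := by
  funext z
  obtain ⟨hc, hr⟩ := hΦ t z
  have hchar : IsChar E t fun r => Φ t r z := by
    refine ⟨hc, fun r _ => ?_, fun r _ => ?_⟩
    · have hi := intervalIntegrable_snd hc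
      rw [(hr r).1, (hr 0).1, add_assoc, ← torusProj_add, NNReal.coe_zero,
        intervalIntegral.integral_add_adjacent_intervals (hi _ _) (hi _ _)]
    · have hi := fun a b => hE.intervalIntegrable_field hm (ξ := fun s => (Φ t s z).1)
        (continuous_fst.comp hc) a b
      rw [(hr r).2, (hr 0).2, add_assoc, NNReal.coe_zero,
        intervalIntegral.integral_add_adjacent_intervals (hi _ _) (hi _ _)]
  have htt : Φ t t z = z := by
    refine Prod.ext ?_ ?_
    · rw [(hr t).1, intervalIntegral.integral_same, torusProj_zero, add_zero]
    · rw [(hr t).2, intervalIntegral.integral_same, add_zero]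
  have := (hchar.reverse hm hE).eq_semiflow hm (hE.comp_sub t) (t := t - s) tsub_le_self
  simp only [tsub_zero, htt, tsub_tsub_cancel_of_le hst] at this
  rw [backFlow, ← this, velFlip_velFlip]

/-! ### Families of evolution operators that depend on the forcing -/

/-- Evolution operators that depend causally and continuously on the forcing. -/
structure IsForcedEvolution (G H : (ℝ≥0 → Force N m) → ℝ≥0 → ℝ≥0 → L1 N →L[ℝ] L1 N) : Prop where
  evolution : ∀ E, IsForcing E → IsEvolution (G E) (H E)
  shift : ∀ E, IsForcing E → ∀ c t s, G (fun r => E (c + r)) t s = G E (c + t) (c + s)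
  shift' : ∀ E, IsForcing E → ∀ c t s, H (fun r => E (c + r)) t s = H E (c + t) (c + s)
  bound : ∀ (B : ℝ) (T : ℝ≥0), 0 ≤ B → ∃ κ, 0 ≤ κ ∧ ∀ E, IsForcing E → (∀ t ≤ T, ‖E t‖ ≤ B) →
    ∀ s t, s < t → t ≤ T → ∀ x, ‖H E t s x‖ ≤ κ * singWeight t s * ‖x‖
  tendsto : ∀ (En : ℕ → ℝ≥0 → Force N m) (E : ℝ≥0 → Force N m) (B : ℝ) (T : ℝ≥0), 0 ≤ B →
    IsForcing E → (∀ n, IsForcing (En n)) → (∀ t ≤ T, ‖E t‖ ≤ B) → (∀ n, ∀ t ≤ T, ‖En n t‖ ≤ B) →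
    (∀ t ≤ T, Tendsto (fun n => En n t) atTop (𝓝 (E t))) → ∀ s t, s ≤ t → t ≤ T → ∀ x,
    Tendsto (fun n => G (En n) t s x) atTop (𝓝 (G E t s x)) ∧
    (s < t → Tendsto (fun n => H (En n) t s x) atTop (𝓝 (H E t s x)))

/-- Strongly continuous contractions along a continuous path. -/
theorem continuous_apply_of_norm_le {Y X : Type*} [TopologicalSpace Y] [NormedAddCommGroup X]
    [NormedSpace ℝ X] {A : Y → X →L[ℝ] X} {C : ℝ} (hA : ∀ x, Continuous fun y => A y x)
    (hC : ∀ y x, ‖A y x‖ ≤ C * ‖x‖) {u : Y → X} (hu : Continuous u) :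
    Continuous fun y => A y (u y) := by
  rw [continuous_iff_continuousAt]
  intro y₀
  have h1 : Tendsto (fun y => A y (u y₀)) (𝓝 y₀) (𝓝 (A y₀ (u y₀))) := (hA (u y₀)).tendsto y₀
  have h2 : Tendsto (fun y => A y (u y - u y₀)) (𝓝 y₀) (𝓝 0) := by
    have h3 : Tendsto (fun y => C * ‖u y - u y₀‖) (𝓝 y₀) (𝓝 0) := by
      have h4 : Continuous fun y => C * ‖u y - u y₀‖ := by fun_prop
      simpa using h4.tendsto y₀
    exact squeeze_zero_norm (fun y => hC y _) h3
  have := h2.add h1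
  rw [zero_add] at this
  refine this.congr fun y => ?_
  rw [← map_add, sub_add_cancel]

/-! ### The linear Boltzmann equation -/

/-- Damped free transport. -/
def boltzmannFree (E : ℝ≥0 → Force N m) (t s : ℝ≥0) : L1 N →L[ℝ] L1 N :=
  Real.exp (-((t : ℝ) - s)) • transport 1 (backFlow E t s)

/-- Gain term. -/
def boltzmannGain (E : ℝ≥0 → Force N m) (t s : ℝ≥0) : L1 N →L[ℝ] L1 N :=
  (boltzmannFree E t s).comp (rhoCLM N)

theorem isTransport_backFlow (hm : N + 1 < m) (hE : IsForcing E) (t s : ℝ≥0) :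
    IsTransport 1 (backFlow E t s) := .of_measurePreserving (measurePreserving_backFlow hm hE t s)

theorem norm_boltzmannFree_le (hm : N + 1 < m) (hE : IsForcing E) {t s : ℝ≥0} (hst : s ≤ t)
    (f : L1 N) : ‖boltzmannFree E t s f‖ ≤ ‖f‖ := by
  rw [boltzmannFree, smul_apply, norm_smul, norm_transport (isTransport_backFlow hm hE t s),
    Real.norm_of_nonneg (Real.exp_pos _).le]
  refine mul_le_of_le_one_left (norm_nonneg _) (Real.exp_le_one_iff.2 ?_)
  have : (s : ℝ) ≤ t := hst
  linarith

theorem boltzmannFree_boltzmannFree (hm : N + 1 < m) (hE : IsForcing E) {s r t : ℝ≥0}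
    (hsr : s ≤ r) (hrt : r ≤ t) (f : L1 N) :
    boltzmannFree E t r (boltzmannFree E r s f) = boltzmannFree E t s f := by
  simp only [boltzmannFree, smul_apply, map_smul]
  rw [smul_smul, transport_transport (isTransport_backFlow hm hE t r)
    (isTransport_backFlow hm hE r s), ← Real.exp_add, mul_one]
  congr 2
  · ring_nf
  · congr 1
    funext z
    exact backFlow_backFlow hm hE hsr hrt z

theorem continuous_transport_backFlow_right (hm : N + 1 < m) (hE : IsForcing E) (t : ℝ≥0)
    (f : L1 N) : Continuous fun s => transport 1 (backFlow E t s) f := by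
  obtain ⟨B, hB0, hB⟩ := hE.bounded t
  rw [continuous_iff_continuousAt]
  intro s₀
  exact tendsto_transport (fun s => isTransport_backFlow hm hE t s)
    (isTransport_backFlow hm hE t s₀) tendsto_const_nhds
    (fun z => (continuous_backFlow_right hm hE t z).tendsto s₀)
    (fun r => ⟨_, Eventually.of_forall fun s z hz =>
      norm_snd_le_of_backFlow hm hE hB0 le_rfl hB hz⟩) f

/-- The gain operator applies f ↦ ρ(f) M first and free transport afterwards, so its composition
rule is the one of free transport. Its norm is at most one, which the weight √T (t - s)^{-1/2}
dominates. -/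
theorem isForcedEvolution_boltzmann (hm : N + 1 < m) :
    IsForcedEvolution (boltzmannFree (N := N) (m := m)) boltzmannGain where
  evolution E hE :=
    { norm_le s t hst f := norm_boltzmannFree_le hm hE hst f
      refl t f := by
        have h : backFlow E t t = id := funext fun z => backFlow_of_le hm hE le_rfl z
        simp [boltzmannFree, h, transport_id]
      trans s r t hsr hrt f := boltzmannFree_boltzmannFree hm hE hsr hrt f
      trans' s r t hsr hrt f := boltzmannFree_boltzmannFree hm hE hsr.le hrt _
      continuousOn s f t hst := by
        obtain ⟨B, hB0, hB⟩ := hE.bounded (t + 1)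
        have h1 : Tendsto (fun τ => transport 1 (backFlow E τ s) f) (𝓝[Ici s] t)
            (𝓝 (transport 1 (backFlow E t s) f)) := by
          refine tendsto_transport (fun τ => isTransport_backFlow hm hE τ s)
            (isTransport_backFlow hm hE t s) tendsto_const_nhds
            (fun z => tendsto_backFlow_left hm hE hst z) (fun r =>
              ⟨r + sobolevConst N * B * (t + 1 : ℝ≥0), ?_⟩) f
          filter_upwards [nhdsWithin_le_nhds (gt_mem_nhds (lt_add_one t))] with τ h2 z hz
          exact norm_snd_le_of_backFlow hm hE hB0 h2.le hB hz
        have h2 : Continuous fun τ : ℝ≥0 => Real.exp (-((τ : ℝ) - s)) := by fun_prop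
        exact (h2.continuousWithinAt.tendsto.smul h1)
      bound T := by
        refine ⟨√T, Real.sqrt_nonneg _, fun s t hst ht f => ?_⟩
        have h1 := one_le_sqrt_mul_singWeight (NNReal.coe_lt_coe.2 hst) s.coe_nonneg
          (NNReal.coe_le_coe.2 ht)
        refine (norm_boltzmannFree_le hm hE hst.le _).trans ?_
        exact (norm_rhoMaxwellian_le f).trans (le_mul_of_one_le_left (norm_nonneg _) h1)
      meas t u hu := by
        have h1 : Continuous fun s => transport 1 (backFlow E t s) (rhoCLM N (u s)) :=
          continuous_apply_of_norm_le (C := 1) (continuous_transport_backFlow_right hm hE t)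
            (fun s x => by rw [norm_transport (isTransport_backFlow hm hE t s), one_mul])
            ((rhoCLM N).continuous.comp hu)
        have h2 : Continuous fun s : ℝ≥0 => Real.exp (-((t : ℝ) - s)) := by fun_prop
        exact ((h2.smul h1).comp continuous_real_toNNReal).aestronglyMeasurable }
  shift E hE c t s := by
    rw [boltzmannFree, boltzmannFree, backFlow_shift hm hE]
    push_cast
    congr 2
    ring
  shift' E hE c t s := by
    rw [boltzmannGain, boltzmannGain, boltzmannFree, boltzmannFree, backFlow_shift hm hE]
    push_cast
    congr 3
    ring
  bound B T _ := by
    refine ⟨√T, Real.sqrt_nonneg _, fun E hE _ s t hst ht f => ?_⟩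
    have h1 := one_le_sqrt_mul_singWeight (NNReal.coe_lt_coe.2 hst) s.coe_nonneg
      (NNReal.coe_le_coe.2 ht)
    refine (norm_boltzmannFree_le hm hE hst.le _).trans ?_
    exact (norm_rhoMaxwellian_le f).trans (le_mul_of_one_le_left (norm_nonneg _) h1)
  tendsto En E B T hB0 hE hEn hB hBn hlim s t hst ht f := by
    have key : ∀ g, Tendsto (fun n => boltzmannFree (En n) t s g) atTop
        (𝓝 (boltzmannFree E t s g)) := by
      intro g
      refine Tendsto.const_smul (c := Real.exp (-((t : ℝ) - s))) (tendsto_transport (fun n => isTransport_backFlow hm (hEn n) t s)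
        (isTransport_backFlow hm hE t s) tendsto_const_nhds (fun z => ?_)
        (fun r => ⟨_, Eventually.of_forall fun n z hz =>
          norm_snd_le_of_backFlow hm (hEn n) hB0 ht (hBn n) hz⟩) g)
      refine (continuous_velFlip.tendsto _).comp (tendsto_semiflow hm (hE.comp_sub t)
        (fun n => (hEn n).comp_sub t) hB0 (fun r _ => hB _ (tsub_le_self.trans ht))
        (fun n r _ => hBn n _ (tsub_le_self.trans ht)) (fun r _ => ?_) _)
      exact hlim _ (tsub_le_self.trans ht)
    exact ⟨key f, fun _ => key _⟩

theorem isMildLB_iff (hm : N + 1 < m) (hE : IsForcing E) (f : L1 N) (u : ℝ≥0 → L1 N) :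
    IsMildLB E f u ↔ IsMild (boltzmannFree E) (boltzmannGain E) f u := by
  have key : ∀ {Φ}, IsCharacteristicFlow E Φ → ∀ t : ℝ≥0,
      Real.exp (-(t : ℝ)) • compFlow (Φ t 0) f + (∫ s in (0 : ℝ)..t, Real.exp (-(t - s)) •
        compFlow (Φ t s.toNNReal) (rhoMaxwellian (u s.toNNReal))) =
      boltzmannFree E t 0 f +
        ∫ s in (0 : ℝ)..t, boltzmannGain E t s.toNNReal (u s.toNNReal) := by
    intro Φ hΦ t
    congr 1
    · rw [hΦ.eq_backFlow hm hE zero_le,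
        compFlow_eq_transport (measurePreserving_backFlow hm hE t 0), boltzmannFree]
      simp
    · refine intervalIntegral.integral_congr fun s hs => ?_
      rw [uIcc_of_le t.coe_nonneg] at hs
      beta_reduce
      rw [hΦ.eq_backFlow hm hE (Real.toNNReal_le_iff_le_coe.2 hs.2),
        compFlow_eq_transport (measurePreserving_backFlow hm hE t _), boltzmannGain, boltzmannFree,
        ContinuousLinearMap.comp_apply, smul_apply, rhoCLM_apply,
        Real.coe_toNNReal s hs.1]
  constructor
  · rintro ⟨hc, Φ, hΦ, h⟩
    exact ⟨hc, fun t => (h t).trans (key hΦ t)⟩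
  · rintro ⟨hc, h⟩
    exact ⟨hc, charFlow E, isCharacteristicFlow_charFlow hm hE,
      fun t => (h t).trans (key (isCharacteristicFlow_charFlow hm hE) t).symm⟩

/-! ### Coefficients of the Gaussian kernel of the kinetic Fokker-Planck operator -/

/-- `e^{-t}`. -/
def ouDecay (t : ℝ) : ℝ := Real.exp (-t)

/-- `(1 - e^{-t})⁻¹` times half the determinant of the covariance matrix. -/
def ouDet (t : ℝ) : ℝ := t * (1 + ouDecay t) - 2 * (1 - ouDecay t)

/-- The variance of the velocity, `V = √c η₂`. -/
def ouVar (t : ℝ) : ℝ := 1 - ouDecay t ^ 2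

/-- `X = β η₂ + σ η₁`. -/
def ouBeta (t : ℝ) : ℝ := (1 - ouDecay t) * √((1 - ouDecay t) / (1 + ouDecay t))

/-- `X = β η₂ + σ η₁`. -/
def ouSigma (t : ℝ) : ℝ := √(2 * ouDet t / (1 + ouDecay t))

/-- First component of the direction `θ` with `L_t θ = (1 - e^{-t}, e^{-t})`. -/
def ouTheta₁ (t : ℝ) : ℝ := (1 - ouDecay t) / √(2 * (1 + ouDecay t) * ouDet t)

/-- Second component of the direction `θ` with `L_t θ = (1 - e^{-t}, e^{-t})`. -/
def ouTheta₂ (t : ℝ) : ℝ := ouDecay t / √(ouVar t)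

theorem ouDecay_pos (t : ℝ) : 0 < ouDecay t := Real.exp_pos _

theorem ouDecay_zero : ouDecay 0 = 1 := by simp [ouDecay]

theorem ouDecay_add (t s : ℝ) : ouDecay (t + s) = ouDecay t * ouDecay s := by
  rw [ouDecay, neg_add, Real.exp_add]; rfl

theorem ouDecay_lt_one {t : ℝ} (ht : 0 < t) : ouDecay t < 1 := by
  rw [ouDecay, Real.exp_lt_one_iff]; linarith

theorem ouDecay_le_one {t : ℝ} (ht : 0 ≤ t) : ouDecay t ≤ 1 := Real.exp_le_one_iff.2 (by linarith)

theorem one_sub_ouDecay_le (t : ℝ) : 1 - ouDecay t ≤ t := by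
  have := Real.add_one_le_exp (-t)
  rw [ouDecay]; linarith

theorem le_one_sub_ouDecay {t T : ℝ} (h0 : 0 ≤ t) (hT : t ≤ T) :
    t * Real.exp (-T) ≤ 1 - ouDecay t := by
  have h1 := Real.add_one_le_exp t
  have h2 : Real.exp (-T) ≤ Real.exp (-t) := Real.exp_le_exp.2 (by linarith)
  have h3 : Real.exp t * Real.exp (-t) = 1 := by rw [← Real.exp_add]; simp
  have h4 := Real.exp_pos (-t)
  rw [ouDecay]
  nlinarith

@[fun_prop]
theorem continuous_ouDecay : Continuous ouDecay := by unfold ouDecay; fun_prop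

/-- Position is an integral of the velocity, so the quantity degenerates like t³. After
multiplication by e^t the claim reads (t - 2) e^t + t + 2 ≥ t³/6, and differentiating twice reduces
it to t e^t ≥ t. -/
theorem pow_three_le_ouDet {t : ℝ} (ht : 0 ≤ t) : ouDecay t * t ^ 3 / 6 ≤ ouDet t := by
  have hmono : ∀ f f' : ℝ → ℝ, (∀ x, HasDerivAt f (f' x) x) → (∀ x, 0 ≤ x → 0 ≤ f' x) →
      f 0 = 0 → ∀ x, 0 ≤ x → 0 ≤ f x := by
    intro f f' hf hf' h0 x hx
    have : MonotoneOn f (Ici 0) := monotoneOn_of_hasDerivWithinAt_nonneg (convex_Ici 0)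
      (fun x _ => (hf x).continuousAt.continuousWithinAt)
      (fun x _ => (hf x).hasDerivWithinAt)
      (fun x hx => hf' x (by rw [interior_Ici] at hx; exact (mem_Ioi.1 hx).le))
    rw [← h0]
    exact this self_mem_Ici (mem_Ici.2 hx) hx
  have h1 : ∀ x : ℝ, 0 ≤ x → 0 ≤ (x - 1) * Real.exp x + 1 - x ^ 2 / 2 := by
    refine hmono _ (fun x => x * Real.exp x - x) (fun x => ?_) (fun x hx => ?_) (by simp)
    · have := (((((hasDerivAt_id x).sub_const 1).mul (Real.hasDerivAt_exp x)).add_const 1).sub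
        (((hasDerivAt_id x).pow 2).div_const 2))
      refine this.congr_deriv ?_
      simp; ring
    · have := Real.one_le_exp hx
      nlinarith
  have h2 : ∀ x : ℝ, 0 ≤ x → 0 ≤ (x - 2) * Real.exp x + x + 2 - x ^ 3 / 6 := by
    refine hmono _ (fun x => (x - 1) * Real.exp x + 1 - x ^ 2 / 2) (fun x => ?_) h1 (by norm_num)
    have := ((((((hasDerivAt_id x).sub_const 2).mul (Real.hasDerivAt_exp x)).add
      (hasDerivAt_id x)).add_const 2).sub (((hasDerivAt_id x).pow 3).div_const 6))
    refine this.congr_deriv ?_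
    simp; ring
  have h3 : Real.exp t * ouDecay t = 1 := by rw [ouDecay, ← Real.exp_add]; simp
  have h4 := mul_nonneg (ouDecay_pos t).le (h2 t ht)
  have h5 : ouDecay t * ((t - 2) * Real.exp t + t + 2 - t ^ 3 / 6) =
      (t - 2) * (Real.exp t * ouDecay t) + (t + 2) * ouDecay t - ouDecay t * t ^ 3 / 6 := by ring
  rw [h5, h3] at h4
  rw [ouDet]
  linarith

theorem ouDet_nonneg {t : ℝ} (ht : 0 ≤ t) : 0 ≤ ouDet t :=
  le_trans (by have := ouDecay_pos t; positivity) (pow_three_le_ouDet ht)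

theorem ouDet_pos {t : ℝ} (ht : 0 < t) : 0 < ouDet t :=
  lt_of_lt_of_le (by have := ouDecay_pos t; positivity) (pow_three_le_ouDet ht.le)

theorem ouVar_pos {t : ℝ} (ht : 0 < t) : 0 < ouVar t := by
  have h1 := ouDecay_pos t
  have h2 := ouDecay_lt_one ht
  rw [ouVar]; nlinarith

theorem ouVar_nonneg {t : ℝ} (ht : 0 ≤ t) : 0 ≤ ouVar t := by
  have h1 := ouDecay_pos t
  have h2 := ouDecay_le_one ht
  rw [ouVar]; nlinarith

theorem ouSigma_pos {t : ℝ} (ht : 0 < t) : 0 < ouSigma t := by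
  have h1 := ouDecay_pos t
  have h2 := ouDet_pos ht
  rw [ouSigma]; positivity

@[fun_prop]
theorem continuous_ouVar : Continuous ouVar := by unfold ouVar; fun_prop

@[fun_prop]
theorem continuous_ouDet : Continuous ouDet := by unfold ouDet; fun_prop

@[fun_prop]
theorem continuous_ouBeta : Continuous ouBeta := by
  have h : ∀ t, 1 + ouDecay t ≠ 0 := fun t => by have := ouDecay_pos t; positivity
  unfold ouBeta
  fun_prop (disch := exact h _)

@[fun_prop]
theorem continuous_ouSigma : Continuous ouSigma := by
  have h : ∀ t, 1 + ouDecay t ≠ 0 := fun t => by have := ouDecay_pos t; positivity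
  unfold ouSigma
  fun_prop (disch := exact h _)

/-- The covariance of position and velocity. With `ouBeta_sq_add`, it says that the noise map is a
triangular square root of the covariance matrix of the process. -/
theorem ouBeta_mul_sqrt {t : ℝ} (ht : 0 ≤ t) : ouBeta t * √(ouVar t) = (1 - ouDecay t) ^ 2 := by
  have h1 := ouDecay_pos t
  have h2 : 0 ≤ 1 - ouDecay t := by have := ouDecay_le_one ht; linarith
  have h3 : (1 - ouDecay t) / (1 + ouDecay t) * ouVar t = (1 - ouDecay t) ^ 2 := by
    rw [ouVar]; field_simp; ring
  rw [ouBeta, mul_assoc, ← Real.sqrt_mul (by positivity), h3, Real.sqrt_sq h2, sq]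

theorem ouBeta_sq_add {t : ℝ} (ht : 0 ≤ t) :
    ouBeta t ^ 2 + ouSigma t ^ 2 = 2 * t - 3 + 4 * ouDecay t - ouDecay t ^ 2 := by
  have h1 := ouDecay_pos t
  have h2 : 0 ≤ 1 - ouDecay t := by have := ouDecay_le_one ht; linarith
  have h3 := ouDet_nonneg ht
  rw [ouBeta, ouSigma, mul_pow, Real.sq_sqrt (by positivity), Real.sq_sqrt (by positivity), ouDet]
  field_simp
  ring

theorem ouSigma_mul_theta {t : ℝ} (ht : 0 < t) :
    ouBeta t * ouTheta₂ t + ouSigma t * ouTheta₁ t = 1 - ouDecay t := by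
  have h1 := ouDecay_pos t
  have h2 : 0 < 1 - ouDecay t := by have := ouDecay_lt_one ht; linarith
  have h3 := ouDet_pos ht
  have h4 := ouVar_pos ht
  have e1 : ouBeta t * ouTheta₂ t = (1 - ouDecay t) * ouDecay t / (1 + ouDecay t) := by
    have := ouBeta_mul_sqrt ht.le
    have h5 : √(ouVar t) ^ 2 = ouVar t := Real.sq_sqrt h4.le
    have h6 : 0 < √(ouVar t) := Real.sqrt_pos.2 h4
    have h7 : ouVar t = (1 - ouDecay t) * (1 + ouDecay t) := by rw [ouVar]; ring
    have h8 : ouBeta t = (1 - ouDecay t) ^ 2 / √(ouVar t) := by field_simp; exact this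
    rw [h8, ouTheta₂, div_mul_div_comm, ← sq, h5, h7]
    field_simp
  have e2 : ouSigma t * ouTheta₁ t = (1 - ouDecay t) / (1 + ouDecay t) := by
    have h5 : √(2 * (1 + ouDecay t) * ouDet t) = (1 + ouDecay t) * ouSigma t := by
      rw [ouSigma, ← Real.sqrt_sq (show 0 ≤ 1 + ouDecay t by positivity), ← Real.sqrt_mul
        (by positivity), Real.sqrt_sq (show 0 ≤ 1 + ouDecay t by positivity)]
      congr 1
      field_simp
    have h6 := ouSigma_pos ht
    rw [ouTheta₁, h5]
    field_simp
  rw [e1, e2]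
  field_simp
  ring

theorem sqrt_ouVar_mul_theta {t : ℝ} (ht : 0 < t) : √(ouVar t) * ouTheta₂ t = ouDecay t := by
  have : 0 < √(ouVar t) := Real.sqrt_pos.2 (ouVar_pos ht)
  rw [ouTheta₂]; field_simp

/-- A velocity shift u displaces the endpoint by ((1 - e^{-t}) u, e^{-t} u). Its position part is of
order t against a normalized spread t^{3/2}, its velocity part of order 1 against t^{1/2}: both
ratios are t^{-1/2}. -/
theorem exists_ouTheta_le (T : ℝ) : ∃ C, 0 ≤ C ∧ ∀ t, 0 < t → t ≤ T →
    |ouTheta₁ t| ≤ C * (√t)⁻¹ ∧ |ouTheta₂ t| ≤ C * (√t)⁻¹ := by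
  set k := Real.exp (-T)
  have hk : 0 < k := Real.exp_pos _
  -- With q = e^{-t} ≥ k, the two entries come from 2 (1 + q) `ouDet t` ≥ k t³/3 and 1 - q² ≥ k t.
  refine ⟨max (√(k / 3))⁻¹ (√k)⁻¹, by positivity, fun t ht hT => ?_⟩
  have h1 := ouDecay_pos t
  have h2 : 0 < 1 - ouDecay t := by have := ouDecay_lt_one ht; linarith
  have h3 := ouDet_pos ht
  have h4 := ouVar_pos ht
  have hq : k ≤ ouDecay t := Real.exp_le_exp.2 (by linarith)
  have hst : 0 < √t := Real.sqrt_pos.2 ht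
  constructor
  · refine le_trans ?_ (mul_le_mul_of_nonneg_right (le_max_left _ _) (by positivity))
    rw [ouTheta₁, abs_of_nonneg (by positivity), ← mul_inv, ← Real.sqrt_mul (by positivity),
      div_le_iff₀ (by positivity), inv_mul_eq_div, le_div_iff₀ (by positivity)]
    calc (1 - ouDecay t) * √(k / 3 * t) ≤ t * √(k / 3 * t) := by
          gcongr; exact one_sub_ouDecay_le t
      _ = √(k * t ^ 3 / 3) := by
          rw [show k * t ^ 3 / 3 = t ^ 2 * (k / 3 * t) by ring,
            Real.sqrt_mul (sq_nonneg t), Real.sqrt_sq ht.le]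
      _ ≤ √(2 * (1 + ouDecay t) * ouDet t) := by
          refine Real.sqrt_le_sqrt ?_
          have h5 := pow_three_le_ouDet ht.le
          have h6 : k * t ^ 3 / 6 ≤ ouDecay t * t ^ 3 / 6 := by gcongr
          nlinarith
  · refine le_trans ?_ (mul_le_mul_of_nonneg_right (le_max_right _ _) (by positivity))
    rw [ouTheta₂, abs_of_nonneg (by positivity), ← mul_inv, ← Real.sqrt_mul (by positivity),
      div_le_iff₀ (by positivity), inv_mul_eq_div, le_div_iff₀ (by positivity)]
    calc ouDecay t * √(k * t) ≤ 1 * √(k * t) := by gcongr; exact ouDecay_le_one ht.le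
      _ ≤ √(ouVar t) := by
          rw [one_mul]
          refine Real.sqrt_le_sqrt ?_
          have h5 := le_one_sub_ouDecay ht.le hT
          rw [ouVar]
          change t * k ≤ _ at h5
          nlinarith

/-! ### The standard Gaussian density on `ℝᴺ × ℝᴺ` -/

variable {N : ℕ}

instance isAddHaarMeasure_vel_prod (N : ℕ) :
    (volume : Measure (Vel N × Vel N)).IsAddHaarMeasure :=
  inferInstanceAs ((volume : Measure (Vel N)).prod (volume : Measure (Vel N))).IsAddHaarMeasure

/-- The standard Gaussian density on `ℝᴺ × ℝᴺ`. -/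
def gaussW (η : Vel N × Vel N) : ℝ := maxwellian η.1 * maxwellian η.2

/-- The pairing on `ℝᴺ × ℝᴺ`. -/
def pairing (ζ η : Vel N × Vel N) : ℝ := inner ℝ ζ.1 η.1 + inner ℝ ζ.2 η.2

theorem continuous_maxwellian : Continuous (maxwellian (N := N)) := by unfold maxwellian; fun_prop

theorem gaussW_nonneg (η : Vel N × Vel N) : 0 ≤ gaussW η :=
  mul_nonneg (maxwellian_nonneg _) (maxwellian_nonneg _)

@[fun_prop]
theorem continuous_gaussW : Continuous (gaussW (N := N)) :=
  (continuous_maxwellian.comp continuous_fst).mul (continuous_maxwellian.comp continuous_snd)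

@[fun_prop]
theorem continuous_pairing (ζ : Vel N × Vel N) : Continuous (pairing ζ) := by
  unfold pairing; fun_prop

theorem integrable_gaussW : Integrable (gaussW (N := N)) volume :=
  (integrable_maxwellian N).mul_prod (integrable_maxwellian N)

theorem integral_gaussW : ∫ η : Vel N × Vel N, gaussW η = 1 := by
  have := integral_prod_mul (μ := (volume : Measure (Vel N))) (ν := (volume : Measure (Vel N)))
    (maxwellian (N := N)) (maxwellian (N := N))
  rw [integral_maxwellian, one_mul] at this
  exact this

theorem maxwellian_sub (v z : Vel N) : maxwellian (v - z) =
    maxwellian v * Real.exp (inner ℝ z v - ‖z‖ ^ 2 / 2) := by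
  rw [maxwellian, maxwellian, mul_assoc, ← Real.exp_add, norm_sub_sq_real, real_inner_comm]
  congr 2
  ring

/-- The Cameron-Martin formula. Exponential integrability and the derivative in the shift are read
off from it. -/
theorem gaussW_sub (η ζ : Vel N × Vel N) : gaussW (η - ζ) =
    gaussW η * Real.exp (pairing ζ η - (‖ζ.1‖ ^ 2 + ‖ζ.2‖ ^ 2) / 2) := by
  rw [gaussW, Prod.fst_sub, Prod.snd_sub, maxwellian_sub, maxwellian_sub, gaussW, mul_mul_mul_comm,
    ← Real.exp_add, pairing]
  congr 2
  ring

theorem integrable_exp_pairing (ζ : Vel N × Vel N) :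
    Integrable (fun η => Real.exp (pairing ζ η) * gaussW η) volume := by
  have h := (integrable_gaussW.comp_sub_right ζ).mul_const
    (Real.exp ((‖ζ.1‖ ^ 2 + ‖ζ.2‖ ^ 2) / 2))
  refine h.congr (Eventually.of_forall fun η => ?_)
  beta_reduce
  rw [gaussW_sub, mul_assoc, ← Real.exp_add, sub_add_cancel, mul_comm]

theorem pairing_smul (c : ℝ) (ζ η : Vel N × Vel N) : pairing (c • ζ) η = c * pairing ζ η := by
  simp [pairing, real_inner_smul_left]; ring

theorem pairing_sub_right (ζ η η' : Vel N × Vel N) :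
    pairing ζ (η - η') = pairing ζ η - pairing ζ η' := by
  simp [pairing, inner_sub_right]; ring

theorem exp_abs_le (s : ℝ) : Real.exp |s| ≤ Real.exp s + Real.exp (-s) := by
  rcases abs_cases s with ⟨h, _⟩ | ⟨h, _⟩ <;> rw [h] <;>
    linarith [Real.exp_pos s, Real.exp_pos (-s)]

theorem integrable_exp_abs_pairing (ζ : Vel N × Vel N) :
    Integrable (fun η => Real.exp |pairing ζ η| * gaussW η) volume := by
  refine ((integrable_exp_pairing ζ).add (integrable_exp_pairing ((-1 : ℝ) • ζ))).mono'
    (by fun_prop) (Eventually.of_forall fun η => ?_)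
  rw [Real.norm_of_nonneg (mul_nonneg (Real.exp_pos _).le (gaussW_nonneg η)), Pi.add_apply,
    ← add_mul, pairing_smul, neg_one_mul]
  exact mul_le_mul_of_nonneg_right (exp_abs_le _) (gaussW_nonneg η)

theorem integrable_pairing_mul (ζ : Vel N × Vel N) :
    Integrable (fun η => pairing ζ η * gaussW η) volume := by
  refine (integrable_exp_abs_pairing ζ).mono' (by fun_prop) (Eventually.of_forall fun η => ?_)
  rw [norm_mul, Real.norm_of_nonneg (gaussW_nonneg η), Real.norm_eq_abs]
  refine mul_le_mul_of_nonneg_right ?_ (gaussW_nonneg η)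
  linarith [Real.add_one_le_exp |pairing ζ η|]

theorem hasDerivAt_gaussW_sub (ζ η : Vel N × Vel N) (h : ℝ) :
    HasDerivAt (fun h : ℝ => gaussW (η - h • ζ))
      (pairing ζ (η - h • ζ) * gaussW (η - h • ζ)) h := by
  have e : ∀ h : ℝ, gaussW (η - h • ζ) = gaussW η *
      Real.exp (h * pairing ζ η - h ^ 2 * (‖ζ.1‖ ^ 2 + ‖ζ.2‖ ^ 2) / 2) := by
    intro h
    rw [gaussW_sub, pairing_smul, Prod.smul_fst, Prod.smul_snd, norm_smul, norm_smul, mul_pow,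
      mul_pow, Real.norm_eq_abs, sq_abs, ← mul_add]
  have hp : pairing ζ ζ = ‖ζ.1‖ ^ 2 + ‖ζ.2‖ ^ 2 := by simp [pairing]
  have hp' : pairing ζ (h • ζ) = h * pairing ζ ζ := by
    simp [pairing, real_inner_smul_right]; ring
  simp_rw [e]
  have h1 : HasDerivAt (fun h : ℝ => h * pairing ζ η - h ^ 2 * (‖ζ.1‖ ^ 2 + ‖ζ.2‖ ^ 2) / 2)
      (pairing ζ η - h * (‖ζ.1‖ ^ 2 + ‖ζ.2‖ ^ 2)) h := by
    refine (((hasDerivAt_id h).mul_const _).sub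
      ((((hasDerivAt_id h).pow 2).mul_const (‖ζ.1‖ ^ 2 + ‖ζ.2‖ ^ 2)).div_const 2)).congr_deriv ?_
    simp; ring
  refine (h1.exp.const_mul (gaussW η)).congr_deriv ?_
  rw [pairing_sub_right, hp', hp]
  ring

/-- The dominating function for differentiation under the integral. One factor exp|⟨ζ,η⟩| absorbs
the linear term and a second one the shift of the density, hence the vector 2ζ. -/
theorem exists_bound_deriv_gaussW (ζ : Vel N × Vel N) : ∃ b : Vel N × Vel N → ℝ,
    Integrable b volume ∧ ∀ η, ∀ h ∈ Metric.ball (0 : ℝ) 1,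
      ‖pairing ζ (η - h • ζ) * gaussW (η - h • ζ)‖ ≤ b η := by
  refine ⟨fun η => (1 + pairing ζ ζ) * (Real.exp |pairing ((2 : ℝ) • ζ) η| * gaussW η),
    (integrable_exp_abs_pairing _).const_mul _, fun η h hh => ?_⟩
  have hh' : |h| ≤ 1 := by
    rw [mem_ball_zero_iff, Real.norm_eq_abs] at hh; exact hh.le
  have hp : pairing ζ ζ = ‖ζ.1‖ ^ 2 + ‖ζ.2‖ ^ 2 := by simp [pairing]
  have hp0 : 0 ≤ pairing ζ ζ := by rw [hp]; positivity
  have hp' : pairing ζ (h • ζ) = h * pairing ζ ζ := by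
    simp [pairing, real_inner_smul_right]; ring
  have h1 : |pairing ζ (η - h • ζ)| ≤ (1 + pairing ζ ζ) * Real.exp |pairing ζ η| := by
    rw [pairing_sub_right, hp']
    have h2 := abs_sub (pairing ζ η) (h * pairing ζ ζ)
    rw [abs_mul, abs_of_nonneg hp0] at h2
    have h3 := Real.add_one_le_exp |pairing ζ η|
    have h4 := abs_nonneg (pairing ζ η)
    have h5 : |h| * pairing ζ ζ ≤ pairing ζ ζ := mul_le_of_le_one_left hp0 hh'
    nlinarith
  have h2 : gaussW (η - h • ζ) ≤ gaussW η * Real.exp |pairing ζ η| := by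
    rw [gaussW_sub, pairing_smul]
    refine mul_le_mul_of_nonneg_left (Real.exp_le_exp.2 ?_) (gaussW_nonneg η)
    have h3 : h * pairing ζ η ≤ |pairing ζ η| := by
      refine (le_abs_self _).trans ?_
      rw [abs_mul]
      exact mul_le_of_le_one_left (abs_nonneg _) hh'
    have : 0 ≤ (‖(h • ζ).1‖ ^ 2 + ‖(h • ζ).2‖ ^ 2) / 2 := by positivity
    linarith
  have h3 : Real.exp |pairing ((2 : ℝ) • ζ) η| =
      Real.exp |pairing ζ η| * Real.exp |pairing ζ η| := by
    rw [pairing_smul, abs_mul, ← Real.exp_add]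
    congr 1
    norm_num
    ring
  beta_reduce
  rw [norm_mul, Real.norm_eq_abs, Real.norm_of_nonneg (gaussW_nonneg _), h3]
  calc _ ≤ ((1 + pairing ζ ζ) * Real.exp |pairing ζ η|) * (gaussW η * Real.exp |pairing ζ η|) := by
        gcongr
        exact gaussW_nonneg _
    _ = _ := by ring

/-- The standard Gaussian measure on `ℝᴺ × ℝᴺ`. -/
def gaussMeasure (N : ℕ) : Measure (Vel N × Vel N) :=
  volume.withDensity fun η => ENNReal.ofReal (gaussW η)

theorem integral_gaussMeasure {X : Type*} [NormedAddCommGroup X] [NormedSpace ℝ X]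
    (F : Vel N × Vel N → X) : ∫ η, F η ∂(gaussMeasure N) = ∫ η, gaussW η • F η := by
  rw [gaussMeasure, integral_withDensity_eq_integral_toReal_smul
    (by fun_prop) (Eventually.of_forall fun _ => ENNReal.ofReal_lt_top)]
  simp_rw [ENNReal.toReal_ofReal (gaussW_nonneg _)]

instance : IsProbabilityMeasure (gaussMeasure N) where
  measure_univ := by
    rw [gaussMeasure, withDensity_apply _ MeasurableSet.univ, Measure.restrict_univ,
      ← ofReal_integral_eq_lintegral_ofReal integrable_gaussW
        (Eventually.of_forall gaussW_nonneg), integral_gaussW, ENNReal.ofReal_one]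

theorem integral_cexp_maxwellian (l : Vel N) :
    ∫ v : Vel N, (maxwellian v : ℂ) * Complex.exp ((inner ℝ l v : ℝ) * Complex.I) =
      Complex.exp (-(‖l‖ : ℂ) ^ 2 / 2) := by
  have h := GaussianFourier.integral_cexp_neg_mul_sq_norm_add (V := Vel N) (b := 1 / 2)
    (by norm_num) Complex.I l
  have e : ∀ v : Vel N, (maxwellian v : ℂ) * Complex.exp ((inner ℝ l v : ℝ) * Complex.I) =
      (((2 * Real.pi) ^ (-(N : ℝ) / 2) : ℝ) : ℂ) *
        Complex.exp (-(1 / 2) * ‖v‖ ^ 2 + Complex.I * (inner ℝ l v : ℝ)) := by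
    intro v
    rw [maxwellian, Complex.ofReal_mul, Complex.ofReal_exp, mul_assoc, ← Complex.exp_add]
    congr 2
    push_cast
    ring
  simp_rw [e]
  rw [integral_const_mul, h, finrank_euclideanSpace_fin, ← mul_assoc]
  have h1 : (((2 * Real.pi) ^ (-(N : ℝ) / 2) : ℝ) : ℂ) *
      ((Real.pi : ℂ) / (1 / 2)) ^ ((N : ℂ) / 2) = 1 := by
    have : ((Real.pi : ℂ) / (1 / 2)) ^ ((N : ℂ) / 2) =
        (((2 * Real.pi) ^ ((N : ℝ) / 2) : ℝ) : ℂ) := by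
      rw [Complex.ofReal_cpow (by positivity)]
      push_cast
      congr 1
      ring
    rw [this, ← Complex.ofReal_mul, ← Real.rpow_add (by positivity),
      show -(N : ℝ) / 2 + N / 2 = 0 by ring, Real.rpow_zero, Complex.ofReal_one]
  rw [h1, one_mul]
  congr 1
  rw [Complex.I_sq]
  ring

theorem integral_cexp_gaussMeasure (l : Vel N × Vel N) :
    ∫ η, Complex.exp ((pairing l η : ℝ) * Complex.I) ∂(gaussMeasure N) =
      Complex.exp (-((‖l.1‖ : ℂ) ^ 2 + (‖l.2‖ : ℂ) ^ 2) / 2) := by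
  rw [integral_gaussMeasure]
  have := integral_prod_mul (μ := (volume : Measure (Vel N))) (ν := (volume : Measure (Vel N)))
    (fun v => (maxwellian v : ℂ) * Complex.exp ((inner ℝ l.1 v : ℝ) * Complex.I))
    (fun v => (maxwellian v : ℂ) * Complex.exp ((inner ℝ l.2 v : ℝ) * Complex.I))
  rw [integral_cexp_maxwellian, integral_cexp_maxwellian, ← Complex.exp_add] at this
  rw [neg_add, add_div, ← this]
  refine integral_congr_ae (Eventually.of_forall fun η => ?_)
  beta_reduce
  rw [gaussW, pairing, Complex.real_smul, mul_mul_mul_comm, ← Complex.exp_add]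
  push_cast
  congr 2
  ring

/-- Finite measures on `ℝᴺ × ℝᴺ` with the same characteristic function are equal. -/
theorem ext_of_integral_cexp_pairing {μ ν : Measure (Vel N × Vel N)} [IsFiniteMeasure μ]
    [IsFiniteMeasure ν] (h : ∀ l, ∫ η, Complex.exp ((pairing l η : ℝ) * Complex.I) ∂μ =
      ∫ η, Complex.exp ((pairing l η : ℝ) * Complex.I) ∂ν) : μ = ν := by
  refine Measure.ext_of_charFunDual (funext fun L => ?_)
  rw [charFunDual_apply, charFunDual_apply]
  set l : Vel N × Vel N := ((InnerProductSpace.toDual ℝ _).symm (L.comp (.inl ℝ _ _)),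
    (InnerProductSpace.toDual ℝ _).symm (L.comp (.inr ℝ _ _))) with hl
  have e : ∀ η, L η = pairing l η := by
    intro η
    rw [pairing, hl, InnerProductSpace.toDual_symm_apply, InnerProductSpace.toDual_symm_apply,
      ContinuousLinearMap.comp_apply, ContinuousLinearMap.comp_apply, ← map_add]
    simp
  simp_rw [e]
  exact h l

/-! ### Affine transport along the kinetic Ornstein-Uhlenbeck process -/

variable {N m : ℕ}

/-- The inverse of the map `(y, w) ↦ (y + (1 - q) w + ξ₁, q w + ξ₂)`. -/
def ouInv (q : ℝ) (ξ : Vel N × Vel N) (z : Phase N) : Phase N :=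
  (z.1 - torusProj ((1 - q) • q⁻¹ • (z.2 - ξ.2) + ξ.1), q⁻¹ • (z.2 - ξ.2))

/-- The map `(y, w) ↦ (y + (1 - q) w + ξ₁, q w + ξ₂)`. -/
def ouMap (q : ℝ) (ξ : Vel N × Vel N) (p : Phase N) : Phase N :=
  (p.1 + torusProj ((1 - q) • p.2 + ξ.1), q • p.2 + ξ.2)

/-- Push-forward under `(y, w) ↦ (y + (1 - q) w + ξ₁, q w + ξ₂)`. -/
def ouShift (q : ℝ) (ξ : Vel N × Vel N) : L1 N →L[ℝ] L1 N :=
  transport (q ^ N)⁻¹ (ouInv q ξ)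

/-- The noise that is left at the end when the noise `ξ'` acts before a map with decay `q`. -/
def ouPush (q : ℝ) (ξ' : Vel N × Vel N) : Vel N × Vel N := (ξ'.1 + (1 - q) • ξ'.2, q • ξ'.2)

@[fun_prop]
theorem continuous_torusProj_comp {Y : Type*} [TopologicalSpace Y] {g : Y → Vel N}
    (hg : Continuous g) : Continuous fun y => torusProj (g y) :=
  (continuous_torusProj N).comp hg

theorem continuous_ouInv (q : ℝ) (ξ : Vel N × Vel N) : Continuous (ouInv q ξ) := by
  unfold ouInv; fun_prop

@[fun_prop]
theorem continuous_ouMap (q : ℝ) : Continuous fun x : (Vel N × Vel N) × Phase N =>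
    ouMap q x.1 x.2 := by
  unfold ouMap; fun_prop

@[fun_prop]
theorem continuous_ouPush (q : ℝ) : Continuous (ouPush (N := N) q) := by
  unfold ouPush; fun_prop

theorem ouMap_ouInv {q : ℝ} (hq : q ≠ 0) (ξ : Vel N × Vel N) (z : Phase N) :
    ouMap q ξ (ouInv q ξ z) = z := by
  refine Prod.ext ?_ ?_
  · simp [ouMap, ouInv]
  · simp [ouMap, ouInv, smul_smul, hq]

theorem ouInv_ouMap {q : ℝ} (hq : q ≠ 0) (ξ : Vel N × Vel N) (z : Phase N) :
    ouInv q ξ (ouMap q ξ z) = z := by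
  simp [ouMap, ouInv, smul_smul, hq]

/-- Decays multiply and the earlier noise is carried along by the later map; for the position, (1 -
q') + (1 - q) q' = 1 - q q'. -/
theorem ouMap_ouMap (q q' : ℝ) (ξ ξ' : Vel N × Vel N) (p : Phase N) :
    ouMap q ξ (ouMap q' ξ' p) = ouMap (q * q') (ξ + ouPush q ξ') p := by
  refine Prod.ext ?_ ?_
  · simp only [ouMap, ouPush, add_assoc, ← torusProj_add, Prod.fst_add]
    congr 2
    module
  · simp only [ouMap, ouPush, Prod.snd_add]
    module

theorem isTransport_ouInv {q : ℝ} (hq : 0 < q) (ξ : Vel N × Vel N) :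
    IsTransport (q ^ N)⁻¹ (ouInv q ξ) where
  pos := by positivity
  measurable := (continuous_ouInv q ξ).measurable
  map_eq := by
    have h1 : Measure.map (fun v : Vel N => q⁻¹ • (v - ξ.2)) volume =
        ENNReal.ofReal (q ^ N) • volume := by
      have h2 : (fun v : Vel N => q⁻¹ • (v - ξ.2)) = (fun v => q⁻¹ • v) ∘ fun v => v - ξ.2 := rfl
      rw [h2, ← Measure.map_map (by fun_prop) (by fun_prop), map_sub_right_eq_self,
        Measure.map_addHaar_smul _ (inv_ne_zero hq.ne'), finrank_euclideanSpace_fin, inv_pow,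
        inv_inv, abs_of_pos (by positivity)]
    have h3 : MeasurePreserving (fun z : Vel N × Torus N =>
        (z.1, z.2 - torusProj ((1 - q) • z.1 + ξ.1))) (volume.prod volume) (volume.prod volume) :=
      (MeasurePreserving.id _).skew_product (g := fun w x => x - torusProj ((1 - q) • w + ξ.1))
        (by fun_prop) (Eventually.of_forall fun w => map_sub_right_eq_self _ _)
    -- An affine scaling of the velocity, which alone changes the measure, followed by a shear of
    -- the position.
    have h4 : ouInv q ξ = Prod.swap ∘ (fun z : Vel N × Torus N =>
        (z.1, z.2 - torusProj ((1 - q) • z.1 + ξ.1))) ∘ Prod.swap ∘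
          Prod.map id (fun v : Vel N => q⁻¹ • (v - ξ.2)) := rfl
    have h5 : Measure.map (Prod.map id (fun v : Vel N => q⁻¹ • (v - ξ.2)))
        (volume : Measure (Phase N)) = ENNReal.ofReal (q ^ N) • volume := by
      change Measure.map _ (Measure.prod volume volume) = _ • Measure.prod volume volume
      rw [← Measure.map_prod_map _ _ measurable_id (by fun_prop), h1, Measure.map_id,
        Measure.prod_smul_right]
    rw [h4, ← Measure.map_map (by fun_prop) (by fun_prop), ← Measure.map_map (by fun_prop)
      (by fun_prop), ← Measure.map_map (by fun_prop) (by fun_prop), h5, Measure.map_smul,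
      Measure.map_smul, Measure.map_smul, inv_inv]
    congr 1
    change Measure.map _ (Measure.map _ (Measure.map _ (Measure.prod volume volume))) =
      Measure.prod volume volume
    rw [Measure.prod_swap, h3.map_eq, Measure.prod_swap]

theorem norm_ouShift {q : ℝ} (hq : 0 < q) (ξ : Vel N × Vel N) (f : L1 N) :
    ‖ouShift q ξ f‖ = ‖f‖ := norm_transport (isTransport_ouInv hq ξ) f

theorem ouShift_ouShift {q q' : ℝ} (hq : 0 < q) (hq' : 0 < q') (ξ ξ' : Vel N × Vel N)
    (f : L1 N) : ouShift q ξ (ouShift q' ξ' f) = ouShift (q * q') (ξ + ouPush q ξ') f := by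
  rw [ouShift, ouShift, ouShift, transport_transport (isTransport_ouInv hq ξ)
    (isTransport_ouInv hq' ξ')]
  congr 2
  · rw [mul_pow, mul_inv]
  · funext z
    have h := ouMap_ouInv hq.ne' ξ z
    rw [← ouMap_ouInv hq'.ne' ξ' (ouInv q ξ z), ouMap_ouMap] at h
    rw [Function.comp_apply]
    conv_rhs => rw [← h]
    rw [ouInv_ouMap (by positivity)]

theorem ouShift_one_zero (f : L1 N) : ouShift 1 0 f = f := by
  have : ouInv (N := N) 1 0 = id := by
    funext z; simp [ouInv, torusProj_zero]
  rw [ouShift, this, one_pow, inv_one, transport_id]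

theorem integral_mul_ouShift {q : ℝ} (hq : 0 < q) (ξ : Vel N × Vel N) {φ : Phase N → ℝ}
    (hφ : Measurable φ) (f : L1 N) :
    ∫ z, φ z * ouShift q ξ f z = ∫ p, φ (ouMap q ξ p) * f p :=
  integral_mul_transport (isTransport_ouInv hq ξ)
    ((continuous_ouMap q).comp (by fun_prop : Continuous fun p => (ξ, p))).measurable
    (ouMap_ouInv hq.ne' ξ) hφ f

theorem tendsto_ouShift {ι : Type*} {L : Filter ι} [L.IsCountablyGenerated] {qn : ι → ℝ} {q : ℝ}
    {ξn : ι → Vel N × Vel N} {ξ : Vel N × Vel N} (hq : 0 < q) (hqn : ∀ n, 0 < qn n)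
    (hlim : Tendsto qn L (𝓝 q)) (hξ : Tendsto ξn L (𝓝 ξ)) (f : L1 N) :
    Tendsto (fun n => ouShift (qn n) (ξn n) f) L (𝓝 (ouShift q ξ f)) := by
  refine tendsto_transport (fun n => isTransport_ouInv (hqn n) _) (isTransport_ouInv hq ξ)
    ((hlim.pow N).inv₀ (by positivity)) (fun z => ?_) (fun r => ?_) f
  · have h1 : Tendsto (fun n => (qn n)⁻¹ • (z.2 - (ξn n).2)) L (𝓝 (q⁻¹ • (z.2 - ξ.2))) :=
      (hlim.inv₀ hq.ne').smul (tendsto_const_nhds.sub ((continuous_snd.tendsto ξ).comp hξ))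
    have h2 : Tendsto (fun n => (1 - qn n) • (qn n)⁻¹ • (z.2 - (ξn n).2) + (ξn n).1) L
        (𝓝 ((1 - q) • q⁻¹ • (z.2 - ξ.2) + ξ.1)) :=
      ((tendsto_const_nhds.sub hlim).smul h1).add ((continuous_fst.tendsto ξ).comp hξ)
    exact (tendsto_const_nhds.sub (((continuous_torusProj N).tendsto _).comp h2)).prodMk_nhds h1
  · refine ⟨(q + 1) * |r| + (‖ξ.2‖ + 1), ?_⟩
    have h1 : Tendsto (fun n => ‖(ξn n).2‖) L (𝓝 ‖ξ.2‖) :=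
      ((continuous_norm.comp continuous_snd).tendsto ξ).comp hξ
    filter_upwards [hlim.eventually (gt_mem_nhds (lt_add_one q)),
      h1.eventually (gt_mem_nhds (lt_add_one ‖ξ.2‖))] with n h2 h3 z hz
    have h4 : z.2 = qn n • (ouInv (qn n) (ξn n) z).2 + (ξn n).2 := by
      have := congrArg Prod.snd (ouMap_ouInv (hqn n).ne' (ξn n) z)
      exact this.symm
    rw [h4]
    refine (norm_add_le _ _).trans (add_le_add ?_ h3.le)
    rw [norm_smul, Real.norm_of_nonneg (hqn n).le]
    gcongr
    exact hz.trans (le_abs_self r)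

/-! ### Averages of the transport operators -/

/-- The noise `L_t η` accumulated up to time `t`. -/
def ouNoise (t : ℝ) (η : Vel N × Vel N) : Vel N × Vel N :=
  (ouBeta t • η.2 + ouSigma t • η.1, √(ouVar t) • η.2)

@[fun_prop]
theorem continuous_ouNoise : Continuous fun x : ℝ × (Vel N × Vel N) => ouNoise x.1 x.2 := by
  unfold ouNoise; fun_prop

theorem continuous_ouShift_noise {Y : Type*} [TopologicalSpace Y] [FirstCountableTopology Y]
    {t : Y → ℝ} {ξ : Y → Vel N × Vel N} (ht : Continuous t) (hξ : Continuous ξ) (f : L1 N) :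
    Continuous fun y => ouShift (ouDecay (t y)) (ξ y) f := by
  rw [continuous_iff_continuousAt]
  intro y
  exact tendsto_ouShift (ouDecay_pos _) (fun _ => ouDecay_pos _)
    ((continuous_ouDecay.comp ht).tendsto y) (hξ.tendsto y) f

theorem aestronglyMeasurable_smul_ouShift {w : Vel N × Vel N → ℝ} (hw : Integrable w volume)
    (t : ℝ) (f : L1 N) :
    AEStronglyMeasurable (fun η => w η • ouShift (ouDecay t) (ouNoise t η) f) volume :=
  hw.1.smul (continuous_ouShift_noise (continuous_const (y := t))
    (by fun_prop : Continuous fun η : Vel N × Vel N => ouNoise t η) f).aestronglyMeasurable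

theorem norm_smul_ouShift (w : Vel N × Vel N → ℝ) (t : ℝ) (f : L1 N) (η : Vel N × Vel N) :
    ‖w η • ouShift (ouDecay t) (ouNoise t η) f‖ = ‖w η‖ * ‖f‖ := by
  rw [norm_smul, norm_ouShift (ouDecay_pos t)]

theorem integrable_smul_ouShift {w : Vel N × Vel N → ℝ} (hw : Integrable w volume)
    (t : ℝ) (f : L1 N) :
    Integrable (fun η => w η • ouShift (ouDecay t) (ouNoise t η) f) volume :=
  (hw.norm.mul_const ‖f‖).mono' (aestronglyMeasurable_smul_ouShift hw t f)
    (Eventually.of_forall fun η => (norm_smul_ouShift w t f η).le)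

open Classical in
/-- The average of `f` transported along `L_t η`, with weight `w(η) dη`. -/
def ouAvg (w : Vel N × Vel N → ℝ) (t : ℝ) : L1 N →L[ℝ] L1 N :=
  if hw : Integrable w volume then
    LinearMap.mkContinuous
      { toFun := fun f => ∫ η, w η • ouShift (ouDecay t) (ouNoise t η) f
        map_add' := fun f g => by
          rw [← integral_add (integrable_smul_ouShift hw t f) (integrable_smul_ouShift hw t g)]
          simp only [map_add, smul_add]
        map_smul' := fun c f => by
          rw [RingHom.id_apply, ← integral_smul]
          simp only [map_smul, smul_comm c] } (∫ η, ‖w η‖) fun f => by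
      refine (norm_integral_le_integral_norm _).trans ?_
      simp_rw [norm_smul_ouShift]
      exact (integral_mul_const _ _).le
  else 0

theorem ouAvg_apply {w : Vel N × Vel N → ℝ} (hw : Integrable w volume) (t : ℝ) (f : L1 N) :
    ouAvg w t f = ∫ η, w η • ouShift (ouDecay t) (ouNoise t η) f := by
  rw [ouAvg, dif_pos hw]; rfl

theorem norm_ouAvg_le {w : Vel N × Vel N → ℝ} (hw : Integrable w volume) (t : ℝ) (f : L1 N) :
    ‖ouAvg w t f‖ ≤ (∫ η, ‖w η‖) * ‖f‖ := by
  rw [ouAvg, dif_pos hw]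
  refine (norm_integral_le_integral_norm _).trans ?_
  simp_rw [norm_smul_ouShift]
  exact (integral_mul_const _ _).le

theorem continuous_ouAvg {w : Vel N × Vel N → ℝ} (hw : Integrable w volume) (f : L1 N) :
    Continuous fun t => ouAvg w t f := by
  simp_rw [ouAvg_apply hw]
  refine continuous_of_dominated (bound := fun η => ‖w η‖ * ‖f‖)
    (fun t => aestronglyMeasurable_smul_ouShift hw t f)
    (fun t => Eventually.of_forall fun η => (norm_smul_ouShift w t f η).le)
    (hw.norm.mul_const _) (Eventually.of_forall fun η => ?_)
  exact (continuous_ouShift_noise continuous_id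
    (by fun_prop : Continuous fun t : ℝ => ouNoise t η) f).const_smul (w η)

/-! ### The Fokker-Planck semigroup -/

/-- The semigroup of the kinetic Fokker-Planck operator. -/
def ouSemigroup (t : ℝ) : L1 N →L[ℝ] L1 N := ouAvg gaussW t

theorem norm_ouSemigroup_le (t : ℝ) (f : L1 N) : ‖ouSemigroup t f‖ ≤ ‖f‖ := by
  refine (norm_ouAvg_le integrable_gaussW t f).trans (le_of_eq ?_)
  simp_rw [Real.norm_of_nonneg (gaussW_nonneg _)]
  rw [integral_gaussW, one_mul]

theorem ouSemigroup_zero (f : L1 N) : ouSemigroup 0 f = f := by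
  have h : ∀ η : Vel N × Vel N, ouNoise 0 η = 0 := fun η => by
    simp [ouNoise, ouBeta, ouSigma, ouVar, ouDet, ouDecay_zero]
  rw [ouSemigroup, ouAvg_apply integrable_gaussW]
  simp_rw [h, ouDecay_zero, ouShift_one_zero]
  rw [integral_smul_const, integral_gaussW, one_smul]

theorem pairing_ouNoise (t : ℝ) (l η : Vel N × Vel N) :
    pairing l (ouNoise t η) = pairing (ouSigma t • l.1, ouBeta t • l.1 + √(ouVar t) • l.2) η := by
  simp only [pairing, ouNoise, inner_add_right, inner_add_left, real_inner_smul_left,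
    real_inner_smul_right]
  ring

theorem pairing_ouPush (q : ℝ) (l ξ : Vel N × Vel N) :
    pairing l (ouPush q ξ) = pairing (l.1, (1 - q) • l.1 + q • l.2) ξ := by
  simp only [pairing, ouPush, inner_add_right, inner_add_left, real_inner_smul_left,
    real_inner_smul_right]
  ring

theorem pairing_add_right (ζ η η' : Vel N × Vel N) :
    pairing ζ (η + η') = pairing ζ η + pairing ζ η' := by
  simp [pairing, inner_add_right]; ring

/-- The quadratic form of the covariance of `L_t η`. -/
theorem norm_sq_ouNoise {t : ℝ} (ht : 0 ≤ t) (l : Vel N × Vel N) :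
    ‖ouSigma t • l.1‖ ^ 2 + ‖ouBeta t • l.1 + √(ouVar t) • l.2‖ ^ 2 =
      (2 * t - 3 + 4 * ouDecay t - ouDecay t ^ 2) * ‖l.1‖ ^ 2 +
        2 * (1 - ouDecay t) ^ 2 * inner ℝ l.1 l.2 + ouVar t * ‖l.2‖ ^ 2 := by
  rw [norm_add_sq_real, real_inner_smul_left, real_inner_smul_right, norm_smul, norm_smul,
    norm_smul, mul_pow, mul_pow, mul_pow, Real.norm_eq_abs, Real.norm_eq_abs, Real.norm_eq_abs,
    sq_abs, sq_abs, sq_abs, Real.sq_sqrt (ouVar_nonneg ht), ← ouBeta_sq_add ht,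
    ← ouBeta_mul_sqrt ht]
  ring

/-- Independent noises accumulated over successive intervals add up in law: both sides are centred
Gaussian, and the quadratic forms in their characteristic functions agree. The noise of duration s
acts first and is carried along over duration t. -/
theorem map_ouNoise_prod {t s : ℝ} (ht : 0 ≤ t) (hs : 0 ≤ s) :
    Measure.map (fun x : (Vel N × Vel N) × (Vel N × Vel N) =>
      ouNoise t x.1 + ouPush (ouDecay t) (ouNoise s x.2))
        ((gaussMeasure N).prod (gaussMeasure N)) =
      Measure.map (ouNoise (t + s)) (gaussMeasure N) := by
  have hc : Continuous fun x : (Vel N × Vel N) × (Vel N × Vel N) =>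
      ouNoise t x.1 + ouPush (ouDecay t) (ouNoise s x.2) := by fun_prop
  have hc' : Continuous fun η : Vel N × Vel N => ouNoise (t + s) η := by fun_prop
  have hmp := fun l : Vel N × Vel N => continuous_pairing l
  have := Measure.isProbabilityMeasure_map (μ := (gaussMeasure N).prod (gaussMeasure N))
    hc.measurable.aemeasurable
  have := Measure.isProbabilityMeasure_map (μ := gaussMeasure N) hc'.measurable.aemeasurable
  refine ext_of_integral_cexp_pairing fun l => ?_
  rw [integral_map hc.measurable.aemeasurable (by fun_prop),
    integral_map hc'.measurable.aemeasurable (by fun_prop)]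
  simp_rw [pairing_add_right, pairing_ouPush, pairing_ouNoise, Complex.ofReal_add, add_mul,
    Complex.exp_add]
  rw [integral_prod_mul (fun η => Complex.exp ((pairing _ η : ℝ) * Complex.I))
    (fun η => Complex.exp ((pairing _ η : ℝ) * Complex.I)), integral_cexp_gaussMeasure,
    integral_cexp_gaussMeasure, integral_cexp_gaussMeasure, ← Complex.exp_add]
  congr 1
  simp only [← Complex.ofReal_pow, ← Complex.ofReal_add]
  rw [norm_sq_ouNoise ht, norm_sq_ouNoise hs (l.1, (1 - ouDecay t) • l.1 + ouDecay t • l.2),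
    norm_sq_ouNoise (add_nonneg ht hs)]
  simp only []
  rw [norm_add_sq_real, inner_add_right, real_inner_smul_left, real_inner_smul_right,
    real_inner_smul_right, norm_smul, norm_smul,
    real_inner_self_eq_norm_sq, mul_pow, mul_pow, Real.norm_eq_abs, Real.norm_eq_abs, sq_abs,
    sq_abs]
  simp only [ouVar, ouDecay_add]
  push_cast
  ring

theorem ouSemigroup_eq_integral (t : ℝ) (f : L1 N) :
    ouSemigroup t f = ∫ η, ouShift (ouDecay t) (ouNoise t η) f ∂(gaussMeasure N) := by
  rw [integral_gaussMeasure, ouSemigroup, ouAvg_apply integrable_gaussW]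

theorem integrable_ouShift {Y : Type*} [TopologicalSpace Y] [SecondCountableTopology Y]
    [MeasurableSpace Y] [OpensMeasurableSpace Y] (μ : Measure Y) [IsFiniteMeasure μ] (t : ℝ)
    {ξ : Y → Vel N × Vel N} (hξ : Continuous ξ) (f : L1 N) :
    Integrable (fun y => ouShift (ouDecay t) (ξ y) f) μ :=
  (integrable_const ‖f‖).mono' (continuous_ouShift_noise continuous_const hξ f).aestronglyMeasurable
    (Eventually.of_forall fun _ => (norm_ouShift (ouDecay_pos t) _ f).le)

/-- Composition of affine transports adds the noises, so after Fubini the claim is an identity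
between the laws of the noise. -/
theorem ouSemigroup_ouSemigroup {t s : ℝ} (ht : 0 ≤ t) (hs : 0 ≤ s) (f : L1 N) :
    ouSemigroup t (ouSemigroup s f) = ouSemigroup (t + s) f := by
  have hc : Continuous fun x : (Vel N × Vel N) × (Vel N × Vel N) =>
      ouNoise t x.1 + ouPush (ouDecay t) (ouNoise s x.2) := by fun_prop
  have hc' : Continuous fun η : Vel N × Vel N => ouNoise (t + s) η := by fun_prop
  have h1 : ∀ η, ouShift (ouDecay t) (ouNoise t η) (ouSemigroup s f) =
      ∫ η', ouShift (ouDecay (t + s)) (ouNoise t η + ouPush (ouDecay t) (ouNoise s η')) f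
        ∂(gaussMeasure N) := by
    intro η
    rw [ouSemigroup_eq_integral, ← ContinuousLinearMap.integral_comp_comm _
      (integrable_ouShift _ s (by fun_prop) f)]
    simp_rw [ouShift_ouShift (ouDecay_pos _) (ouDecay_pos _), ← ouDecay_add]
  rw [ouSemigroup_eq_integral]
  simp_rw [h1]
  rw [ouSemigroup_eq_integral, integral_integral (f := fun η η' =>
      ouShift (ouDecay (t + s)) (ouNoise t η + ouPush (ouDecay t) (ouNoise s η')) f)
      (integrable_ouShift _ _ hc f),
    ← integral_map hc'.measurable.aemeasurable (f := fun ξ => ouShift (ouDecay (t + s)) ξ f)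
      (continuous_ouShift_noise continuous_const continuous_id f).aestronglyMeasurable,
    ← map_ouNoise_prod ht hs, integral_map hc.measurable.aemeasurable
      (f := fun ξ => ouShift (ouDecay (t + s)) ξ f) (continuous_ouShift_noise continuous_const continuous_id f).aestronglyMeasurable]

/-! ### The gradient of the semigroup -/

/-- The weight `⟨u, θ₁ η₁ + θ₂ η₂⟩` times the Gaussian density. -/
def gradWeight (ζ η : Vel N × Vel N) : ℝ := pairing ζ η * gaussW η

theorem integrable_gradWeight (ζ : Vel N × Vel N) : Integrable (gradWeight ζ) volume :=
  integrable_pairing_mul ζ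

/-- The derivative of the semigroup in the direction `u` of the initial velocity. -/
def ouGrad (t : ℝ) (u : Vel N) : L1 N →L[ℝ] L1 N :=
  ouAvg (gradWeight (ouTheta₁ t • u, ouTheta₂ t • u)) t

/-- Separates the coefficients that are singular at t = 0 from averages with fixed weights, which
are bounded and continuous in t. Norm bounds and measurability in t follow. -/
theorem ouGrad_eq (t : ℝ) (u : Vel N) (f : L1 N) : ouGrad t u f =
    ouTheta₁ t • ouAvg (gradWeight (u, 0)) t f + ouTheta₂ t • ouAvg (gradWeight (0, u)) t f := by
  rw [ouGrad, ouAvg_apply (integrable_gradWeight _), ouAvg_apply (integrable_gradWeight _),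
    ouAvg_apply (integrable_gradWeight _), ← integral_smul, ← integral_smul]
  refine Eq.trans ?_ (integral_add
    ((integrable_smul_ouShift (integrable_gradWeight (u, 0)) t f).smul (ouTheta₁ t))
    ((integrable_smul_ouShift (integrable_gradWeight (0, u)) t f).smul (ouTheta₂ t)))
  refine integral_congr_ae (Eventually.of_forall fun η => ?_)
  simp only [gradWeight, pairing, inner_zero_left, real_inner_smul_left]
  module

theorem ouNoise_theta {t : ℝ} (ht : 0 < t) (u : Vel N) :
    ouNoise t (ouTheta₁ t • u, ouTheta₂ t • u) = ouPush (ouDecay t) (0, u) := by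
  simp only [ouNoise, ouPush, smul_smul, ← add_smul, ouSigma_mul_theta ht,
    sqrt_ouVar_mul_theta ht, zero_add]

theorem ouNoise_add (t : ℝ) (η η' : Vel N × Vel N) :
    ouNoise t (η + η') = ouNoise t η + ouNoise t η' := by
  refine Prod.ext ?_ ?_ <;> simp only [ouNoise, Prod.fst_add, Prod.snd_add] <;> module

theorem ouNoise_smul (t h : ℝ) (η : Vel N × Vel N) : ouNoise t (h • η) = h • ouNoise t η := by
  refine Prod.ext ?_ ?_ <;> simp only [ouNoise, Prod.smul_fst, Prod.smul_snd] <;> module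

theorem ouPush_smul (q h : ℝ) (η : Vel N × Vel N) : ouPush q (h • η) = h • ouPush q η := by
  refine Prod.ext ?_ ?_ <;> simp only [ouPush, Prod.smul_fst, Prod.smul_snd] <;> module

/-- The semigroup after a translation of the velocities. -/
theorem ouSemigroup_translate {t : ℝ} (ht : 0 < t) (u : Vel N) (h : ℝ) (f : L1 N) :
    ouSemigroup t (ouShift 1 (h • (0, u)) f) =
      ∫ η, gaussW (η - h • (ouTheta₁ t • u, ouTheta₂ t • u)) •
        ouShift (ouDecay t) (ouNoise t η) f := by
  -- Since L_t θ is the image of the velocity shift at time t, translating η by h θ moves the shift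
  -- from the datum onto the Gaussian weight.
  rw [ouSemigroup, ouAvg_apply integrable_gaussW, ← integral_sub_right_eq_self
    (fun η => gaussW η • ouShift (ouDecay t) (ouNoise t η) (ouShift 1 (h • (0, u)) f))
    (h • (ouTheta₁ t • u, ouTheta₂ t • u))]
  refine integral_congr_ae (Eventually.of_forall fun η => ?_)
  beta_reduce
  rw [ouShift_ouShift (ouDecay_pos t) one_pos, mul_one, ouPush_smul, ← ouNoise_theta ht,
    ← ouNoise_smul, ← ouNoise_add, sub_add_cancel]

/-- The translation acts on the Gaussian weight and no longer on f, so one differentiates under the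
integral in L¹ with no smoothness of f. -/
theorem hasDerivAt_ouSemigroup_translate {t : ℝ} (ht : 0 < t) (u : Vel N) (f : L1 N) :
    HasDerivAt (fun h : ℝ => ouSemigroup t (ouShift 1 (h • (0, u)) f)) (ouGrad t u f) 0 := by
  simp_rw [ouSemigroup_translate ht]
  set ζ : Vel N × Vel N := (ouTheta₁ t • u, ouTheta₂ t • u)
  obtain ⟨b, hb, hb'⟩ := exists_bound_deriv_gaussW ζ
  have hmeas : AEStronglyMeasurable (fun η : Vel N × Vel N => ouShift (ouDecay t) (ouNoise t η) f)
      volume := (continuous_ouShift_noise continuous_const (by fun_prop) f).aestronglyMeasurable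
  have hF0 : Integrable (fun η => gaussW (η - (0 : ℝ) • ζ) •
      ouShift (ouDecay t) (ouNoise t η) f) volume := by
    simp only [zero_smul, sub_zero]
    exact integrable_smul_ouShift integrable_gaussW t f
  have hF' : AEStronglyMeasurable (fun η => (pairing ζ (η - (0 : ℝ) • ζ) *
      gaussW (η - (0 : ℝ) • ζ)) • ouShift (ouDecay t) (ouNoise t η) f) volume :=
    ((continuous_pairing ζ).comp (by fun_prop : Continuous fun η => η - (0 : ℝ) • ζ)).mul
      (continuous_gaussW.comp (by fun_prop)) |>.aestronglyMeasurable.smul hmeas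
  have hF : ∀ h : ℝ, AEStronglyMeasurable (fun η => gaussW (η - h • ζ) •
      ouShift (ouDecay t) (ouNoise t η) f) volume :=
    fun h => (continuous_gaussW.comp (by fun_prop : Continuous fun η => η - h • ζ)).aestronglyMeasurable.smul hmeas
  have hbound : ∀ η, ∀ h ∈ Metric.ball (0 : ℝ) 1, ‖(pairing ζ (η - h • ζ) *
      gaussW (η - h • ζ)) • ouShift (ouDecay t) (ouNoise t η) f‖ ≤ b η * ‖f‖ := by
    intro η h hh
    rw [norm_smul, norm_ouShift (ouDecay_pos t)]
    exact mul_le_mul_of_nonneg_right (hb' η h hh) (norm_nonneg _)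
  have hdiff : ∀ η, ∀ h ∈ Metric.ball (0 : ℝ) 1, HasDerivAt (fun h : ℝ => gaussW (η - h • ζ) •
      ouShift (ouDecay t) (ouNoise t η) f) ((pairing ζ (η - h • ζ) *
      gaussW (η - h • ζ)) • ouShift (ouDecay t) (ouNoise t η) f) h :=
    fun η h _ => (hasDerivAt_gaussW_sub ζ η h).smul_const _
  have h1 := (hasDerivAt_integral_of_dominated_loc_of_deriv_le
    (Metric.ball_mem_nhds (0 : ℝ) one_pos) (Eventually.of_forall hF) hF0 hF'
    (Eventually.of_forall hbound) (hb.mul_const _) (Eventually.of_forall hdiff)).2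
  refine h1.congr_deriv ?_
  rw [ouGrad, ouAvg_apply (integrable_gradWeight _)]
  simp [gradWeight, ζ]

/-- Differentiate the semigroup identity, applied to the translated datum, at h = 0; derivatives are
unique. -/
theorem ouSemigroup_ouGrad {t s : ℝ} (ht : 0 ≤ t) (hs : 0 < s) (u : Vel N) (f : L1 N) :
    ouSemigroup t (ouGrad s u f) = ouGrad (t + s) u f := by
  have h1 := (ouSemigroup t).hasFDerivAt.comp_hasDerivAt (0 : ℝ)
    (hasDerivAt_ouSemigroup_translate hs u f)
  have h2 := hasDerivAt_ouSemigroup_translate (add_pos_of_nonneg_of_pos ht hs) u f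
  refine h1.unique (h2.congr_of_eventuallyEq (Eventually.of_forall fun h => ?_))
  exact ouSemigroup_ouSemigroup ht hs.le _

theorem exists_norm_ouGrad_le (T : ℝ) (u : Vel N) : ∃ C, 0 ≤ C ∧ ∀ t, 0 < t → t ≤ T →
    ∀ f : L1 N, ‖ouGrad t u f‖ ≤ C * (√t)⁻¹ * ‖f‖ := by
  obtain ⟨C, hC0, hC⟩ := exists_ouTheta_le T
  set a := ∫ η : Vel N × Vel N, ‖gradWeight (u, 0) η‖
  set b := ∫ η : Vel N × Vel N, ‖gradWeight (0, u) η‖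
  have ha : 0 ≤ a := integral_nonneg fun _ => norm_nonneg _
  have hb : 0 ≤ b := integral_nonneg fun _ => norm_nonneg _
  refine ⟨C * (a + b), by positivity, fun t ht hT f => ?_⟩
  obtain ⟨h1, h2⟩ := hC t ht hT
  rw [ouGrad_eq]
  refine (norm_add_le _ _).trans ?_
  rw [norm_smul, norm_smul, Real.norm_eq_abs, Real.norm_eq_abs]
  calc _ ≤ C * (√t)⁻¹ * (a * ‖f‖) + C * (√t)⁻¹ * (b * ‖f‖) := by
        gcongr
        · exact norm_ouAvg_le (integrable_gradWeight _) t f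
        · exact norm_ouAvg_le (integrable_gradWeight _) t f
    _ = _ := by ring

/-! ### The Fokker-Planck equation as a forced evolution -/

variable {N m : ℕ}

theorem integrable_mul_comp_fst (g : C(Torus N, ℝ)) (f : L1 N) :
    Integrable (fun z : Phase N => g z.1 * f z) volume :=
  (L1.integrable_coeFn f).bdd_mul (c := ‖g‖)
    (g.continuous.comp continuous_fst).aestronglyMeasurable
    (Eventually.of_forall fun z => g.norm_coe_le_norm z.1)

/-- Multiplication by a continuous function of the position. -/
def mulTorus (N : ℕ) : C(Torus N, ℝ) →L[ℝ] L1 N →L[ℝ] L1 N :=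
  LinearMap.mkContinuous₂
    (LinearMap.mk₂ ℝ (fun (g : C(Torus N, ℝ)) (f : L1 N) => classOf fun z => g z.1 * f z)
      (fun g g' f => by
        refine classOf_eq_of_ae_eq ?_
        filter_upwards [classOf_ae_eq (integrable_mul_comp_fst g f),
          classOf_ae_eq (integrable_mul_comp_fst g' f), Lp.coeFn_add
            (classOf fun z => g z.1 * f z) (classOf fun z => g' z.1 * f z)] with z h1 h2 h3
        rw [h3, Pi.add_apply, h1, h2, ContinuousMap.add_apply, add_mul])
      (fun c g f => by
        refine classOf_eq_of_ae_eq ?_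
        filter_upwards [classOf_ae_eq (integrable_mul_comp_fst g f), Lp.coeFn_smul c
            (classOf fun z => g z.1 * f z)] with z h1 h2
        rw [h2, Pi.smul_apply, h1, ContinuousMap.smul_apply, smul_mul_assoc])
      (fun g f f' => by
        refine classOf_eq_of_ae_eq ?_
        filter_upwards [classOf_ae_eq (integrable_mul_comp_fst g f),
          classOf_ae_eq (integrable_mul_comp_fst g f'), Lp.coeFn_add f f', Lp.coeFn_add
            (classOf fun z => g z.1 * f z) (classOf fun z => g z.1 * f' z)] with z h1 h2 h3 h4
        rw [h4, Pi.add_apply, h1, h2, h3, Pi.add_apply, mul_add])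
      (fun c g f => by
        refine classOf_eq_of_ae_eq ?_
        filter_upwards [classOf_ae_eq (integrable_mul_comp_fst g f), Lp.coeFn_smul c f,
          Lp.coeFn_smul c (classOf fun z => g z.1 * f z)] with z h1 h2 h3
        rw [h3, Pi.smul_apply, h1, h2, Pi.smul_apply, mul_smul_comm]))
    1 fun g f => by
      rw [one_mul, L1.norm_eq_integral_norm, L1.norm_eq_integral_norm, ← integral_const_mul]
      refine integral_mono_ae (L1.integrable_coeFn _).norm
        ((L1.integrable_coeFn f).norm.const_mul _) ?_
      filter_upwards [classOf_ae_eq (integrable_mul_comp_fst g f)] with z h1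
      simp only [LinearMap.mk₂_apply]
      rw [h1, norm_mul]
      gcongr
      exact g.norm_coe_le_norm z.1

theorem mulTorus_ae_eq (g : C(Torus N, ℝ)) (f : L1 N) :
    mulTorus N g f =ᵐ[volume] fun z => g z.1 * f z :=
  classOf_ae_eq (integrable_mul_comp_fst g f)

/-- Multiplication by the `i`-th component of a force. -/
def forceMul (hm : N + 1 < m) (i : Fin N) : Force N m →L[ℝ] L1 N →L[ℝ] L1 N :=
  (mulTorus N).comp (((EuclideanSpace.proj i : Vel N →L[ℝ] ℝ).compLeftContinuous ℝ (Torus N)).comp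
    (fieldCLM hm))

theorem forceMul_ae_eq (hm : N + 1 < m) (i : Fin N) (e : Force N m) (f : L1 N) :
    forceMul hm i e f =ᵐ[volume] fun z => e.field z.1 i * f z := by
  filter_upwards [mulTorus_ae_eq (((EuclideanSpace.proj i : Vel N →L[ℝ] ℝ).compLeftContinuous ℝ
    (Torus N)) (fieldCLM hm e)) f] with z hz
  exact hz

/-- The Fokker-Planck semigroup as an evolution family. -/
def fokkerPlanckFree (_ : ℝ≥0 → Force N m) (t s : ℝ≥0) : L1 N →L[ℝ] L1 N :=
  ouSemigroup ((t : ℝ) - s)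

/-- The forcing term of the Fokker-Planck equation. -/
def fokkerPlanckGain (hm : N + 1 < m) (E : ℝ≥0 → Force N m) (t s : ℝ≥0) : L1 N →L[ℝ] L1 N :=
  ∑ i, (ouGrad ((t : ℝ) - s) (EuclideanSpace.single i 1)).comp (forceMul hm i (E s))

theorem fokkerPlanckGain_apply (hm : N + 1 < m) (E : ℝ≥0 → Force N m) (t s : ℝ≥0) (f : L1 N) :
    fokkerPlanckGain hm E t s f =
      ∑ i, ouGrad ((t : ℝ) - s) (EuclideanSpace.single i 1) (forceMul hm i (E s) f) := by
  simp [fokkerPlanckGain]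

theorem exists_norm_fokkerPlanckGain_le (hm : N + 1 < m) {B : ℝ} (T : ℝ≥0) (hB : 0 ≤ B) :
    ∃ κ, 0 ≤ κ ∧ ∀ E : ℝ≥0 → Force N m, (∀ t ≤ T, ‖E t‖ ≤ B) →
      ∀ s t, s < t → t ≤ T → ∀ x, ‖fokkerPlanckGain hm E t s x‖ ≤ κ * singWeight t s * ‖x‖ := by
  choose C hC0 hC using fun i : Fin N =>
    exists_norm_ouGrad_le (N := N) T (EuclideanSpace.single i 1)
  refine ⟨∑ i, C i * (‖forceMul hm i‖ * B), Finset.sum_nonneg fun i _ => by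
    have := hC0 i
    positivity, fun E hE s t hst ht x => ?_⟩
  have hst' : (0 : ℝ) < t - s := sub_pos.2 (NNReal.coe_lt_coe.2 hst)
  have htT : (t : ℝ) - s ≤ T := by
    have : (t : ℝ) ≤ T := ht
    have := s.coe_nonneg
    linarith
  have hw : singWeight t s = (√((t : ℝ) - s))⁻¹ := by
    rw [singWeight, Real.rpow_neg hst'.le, ← Real.sqrt_eq_rpow]
  rw [fokkerPlanckGain_apply, Finset.sum_mul, Finset.sum_mul]
  refine (norm_sum_le _ _).trans (Finset.sum_le_sum fun i _ => ?_)
  refine (hC i _ hst' htT _).trans ?_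
  have h1 : ‖forceMul hm i (E s) x‖ ≤ ‖forceMul hm i‖ * B * ‖x‖ := by
    refine ((forceMul hm i).le_opNorm₂ _ _).trans ?_
    gcongr
    exact hE s (hst.le.trans ht)
  have h2 := hC0 i
  rw [hw]
  calc _ ≤ C i * (√((t : ℝ) - s))⁻¹ * (‖forceMul hm i‖ * B * ‖x‖) := by gcongr
    _ = _ := by ring

theorem continuous_uncurry_ouAvg {w : Vel N × Vel N → ℝ} (hw : Integrable w volume) :
    Continuous fun p : ℝ × L1 N => ouAvg w p.1 p.2 :=
  continuous_apply_of_norm_le (C := ∫ η, ‖w η‖)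
    (fun f => (continuous_ouAvg hw f).comp continuous_fst)
    (fun p f => norm_ouAvg_le hw p.1 f) continuous_snd

theorem measurable_ouGrad (u : Vel N) : Measurable fun p : ℝ × L1 N => ouGrad p.1 u p.2 := by
  simp_rw [ouGrad_eq]
  have h1 : Measurable ouTheta₁ := by
    unfold ouTheta₁
    exact Measurable.div (by fun_prop) (by fun_prop)
  have h2 : Measurable ouTheta₂ := by
    unfold ouTheta₂
    exact Measurable.div (by fun_prop) (by fun_prop)
  exact ((h1.comp measurable_fst).smul
    (continuous_uncurry_ouAvg (integrable_gradWeight (u, 0))).measurable).add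
    ((h2.comp measurable_fst).smul
      (continuous_uncurry_ouAvg (integrable_gradWeight (0, u))).measurable)

theorem continuous_forceMul (hm : N + 1 < m) (i : Fin N) :
    Continuous fun p : Force N m × L1 N => forceMul hm i p.1 p.2 :=
  (forceMul hm i).continuous₂

theorem measurable_fokkerPlanckGain (hm : N + 1 < m) {E : ℝ≥0 → Force N m} (hE : IsForcing E)
    (t : ℝ≥0) {u : ℝ≥0 → L1 N} (hu : Continuous u) :
    Measurable fun s : ℝ => fokkerPlanckGain hm E t s.toNNReal (u s.toNNReal) := by
  have h1 : Measurable fun s : ℝ => E s.toNNReal := hE.measurable.comp measurable_real_toNNReal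
  have h2 : Measurable fun s : ℝ => u s.toNNReal := hu.measurable.comp measurable_real_toNNReal
  have h3 : Measurable fun s : ℝ => (t : ℝ) - (s.toNNReal : ℝ) := by fun_prop
  have h4 : Measurable fun s : ℝ => (E s.toNNReal, u s.toNNReal) := h1.prodMk h2
  have h5 : ∀ i, Measurable fun s : ℝ => ouGrad ((t : ℝ) - (s.toNNReal : ℝ))
      (EuclideanSpace.single i 1) (forceMul hm i (E s.toNNReal) (u s.toNNReal)) := by
    intro i
    have h6 := Measurable.comp (continuous_forceMul hm i).measurable h4
    have h7 := Measurable.prodMk h3 h6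
    have h8 := Measurable.comp (measurable_ouGrad (N := N) (EuclideanSpace.single i 1)) h7
    exact h8
  have h9 : (fun s : ℝ => fokkerPlanckGain hm E t s.toNNReal (u s.toNNReal)) = fun s : ℝ =>
      ∑ i, ouGrad ((t : ℝ) - (s.toNNReal : ℝ)) (EuclideanSpace.single i 1)
        (forceMul hm i (E s.toNNReal) (u s.toNNReal)) := by
    funext s
    exact fokkerPlanckGain_apply hm E t s.toNNReal _
  rw [h9]
  exact Finset.measurable_sum _ fun i _ => h5 i

theorem isEvolution_fokkerPlanck (hm : N + 1 < m) {E : ℝ≥0 → Force N m} (hE : IsForcing E) :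
    IsEvolution (fokkerPlanckFree E) (fokkerPlanckGain hm E) where
  norm_le s t _ f := norm_ouSemigroup_le _ f
  refl t f := by rw [fokkerPlanckFree, sub_self, ouSemigroup_zero]
  trans s r t hsr hrt f := by
    rw [fokkerPlanckFree, fokkerPlanckFree, fokkerPlanckFree, ouSemigroup_ouSemigroup
      (sub_nonneg.2 (NNReal.coe_le_coe.2 hrt)) (sub_nonneg.2 (NNReal.coe_le_coe.2 hsr)),
      sub_add_sub_cancel]
  trans' s r t hsr hrt f := by
    rw [fokkerPlanckGain_apply, fokkerPlanckGain_apply, map_sum]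
    refine Finset.sum_congr rfl fun i _ => ?_
    rw [fokkerPlanckFree, ouSemigroup_ouGrad (sub_nonneg.2 (NNReal.coe_le_coe.2 hrt))
      (sub_pos.2 (NNReal.coe_lt_coe.2 hsr)), sub_add_sub_cancel]
  continuousOn s f := by
    have : Continuous fun t : ℝ≥0 => (t : ℝ) - s := by fun_prop
    exact ((continuous_ouAvg integrable_gaussW f).comp this).continuousOn
  bound T := by
    obtain ⟨B, hB0, hB⟩ := hE.bounded T
    obtain ⟨κ, hκ, h⟩ := exists_norm_fokkerPlanckGain_le hm T hB0
    exact ⟨κ, hκ, h E hB⟩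
  meas t u hu := (measurable_fokkerPlanckGain hm hE t hu).aestronglyMeasurable

/-- The free part ignores the forcing, and H(t,s) sees only the value E(s), linearly. Shift rule,
uniform bound and continuous dependence follow from this. -/
theorem isForcedEvolution_fokkerPlanck (hm : N + 1 < m) :
    IsForcedEvolution (fokkerPlanckFree (N := N) (m := m)) (fokkerPlanckGain hm) where
  evolution E hE := isEvolution_fokkerPlanck hm hE
  shift E hE c t s := by
    rw [fokkerPlanckFree, fokkerPlanckFree]
    push_cast
    congr 1
    ring
  shift' E hE c t s := by
    rw [fokkerPlanckGain, fokkerPlanckGain]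
    push_cast
    simp only [add_sub_add_left_eq_sub]
  bound B T hB := by
    obtain ⟨κ, hκ, h⟩ := exists_norm_fokkerPlanckGain_le hm T hB
    exact ⟨κ, hκ, fun E _ hE => h E hE⟩
  tendsto En E B T _ _ _ _ _ hlim s t hst ht f := by
    refine ⟨tendsto_const_nhds, fun _ => ?_⟩
    simp_rw [fokkerPlanckGain_apply]
    refine tendsto_finsetSum _ fun i _ => ?_
    have h1 := ((forceMul hm i).continuous.tendsto (E s)).comp (hlim s (hst.trans ht))
    have h2 := ((ContinuousLinearMap.apply ℝ (L1 N) f).continuous.tendsto _).comp h1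
    have h3 := ((ouGrad ((t : ℝ) - s) (EuclideanSpace.single i 1)).continuous.tendsto _).comp h2
    exact h3

/-! ### Unfolding the torus -/

theorem coe_circleLift (x : UnitAddCircle) : ((circleLift x : ℝ) : UnitAddCircle) = x :=
  (AddCircle.equivIco 1 0).symm_apply_apply x

theorem circleLift_coe {r : ℝ} (hr : r ∈ Ico (0 : ℝ) 1) : circleLift (r : UnitAddCircle) = r := by
  have h : r ∈ Ico (0 : ℝ) (0 + 1) := by rwa [zero_add]
  have := (AddCircle.equivIco 1 0).apply_symm_apply ⟨r, h⟩
  exact congrArg Subtype.val this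

@[fun_prop]
theorem measurable_circleLift : Measurable circleLift :=
  measurable_subtype_coe.comp (AddCircle.measurableEquivIco 1 0).measurable

theorem volume_circleLift_preimage {s : Set ℝ} (hs : MeasurableSet s) :
    volume (circleLift ⁻¹' s) = volume (s ∩ Ico 0 1) := by
  rw [AddCircle.add_projection_respects_measure 1 0 (measurable_circleLift hs), zero_add]
  -- The measure of the circle is computed on (0,1], whereas the lift takes values in [0,1); the two
  -- cells differ by a null set.
  have h1 : volume ((QuotientAddGroup.mk : ℝ → UnitAddCircle) ⁻¹' (circleLift ⁻¹' s) ∩ Ioc 0 1) =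
      volume ((QuotientAddGroup.mk : ℝ → UnitAddCircle) ⁻¹' (circleLift ⁻¹' s) ∩ Ico 0 1) :=
    measure_congr ((ae_eq_refl _).inter Ico_ae_eq_Ioc.symm)
  rw [h1]
  congr 1
  ext r
  constructor
  · rintro ⟨h, hr⟩
    have h' : circleLift (r : UnitAddCircle) ∈ s := h
    rw [circleLift_coe hr] at h'
    exact ⟨h', hr⟩
  · rintro ⟨h, hr⟩
    refine ⟨?_, hr⟩
    change circleLift (r : UnitAddCircle) ∈ s
    rwa [circleLift_coe hr]

/-- The line is the disjoint union of the cells [k, k + 1), each a translate of the lifted circle.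
This turns sums over ℤ of integrals over the circle into integrals over ℝ. -/
theorem measurePreserving_circleLift_add :
    MeasurePreserving (fun p : UnitAddCircle × ℤ => circleLift p.1 + p.2)
      (volume.prod Measure.count) volume := by
  have hm : Measurable fun p : UnitAddCircle × ℤ => circleLift p.1 + p.2 :=
    (measurable_circleLift.comp measurable_fst).add
      ((measurable_of_countable fun k : ℤ => (k : ℝ)).comp measurable_snd)
  refine ⟨hm, Measure.ext fun s hs => ?_⟩
  rw [Measure.map_apply hm hs, Measure.prod_apply_symm (hm hs), lintegral_count]
  have h1 : ∀ k : ℤ, volume ((fun x : UnitAddCircle => (x, k)) ⁻¹'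
      ((fun p : UnitAddCircle × ℤ => circleLift p.1 + p.2) ⁻¹' s)) =
      volume (s ∩ Ico (k : ℝ) (k + 1)) := by
    intro k
    have h2 : MeasurableSet ((fun r : ℝ => r + k) ⁻¹' s) := (by fun_prop : Measurable _) hs
    have h3 := volume_circleLift_preimage h2
    have h4 : (fun r : ℝ => r + k) ⁻¹' s ∩ Ico 0 1 =
        (fun r : ℝ => r + k) ⁻¹' (s ∩ Ico (k : ℝ) (k + 1)) := by
      ext r
      simp only [mem_inter_iff, mem_preimage, mem_Ico]
      refine and_congr_right fun _ => ⟨fun h => ⟨by linarith, by linarith⟩,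
        fun h => ⟨by linarith, by linarith⟩⟩
    rw [h4, measure_preimage_add_right] at h3
    exact h3
  simp_rw [h1]
  rw [← measure_iUnion]
  · rw [← inter_iUnion, iUnion_Ico_intCast, inter_univ]
  · intro j k hjk
    exact (pairwise_disjoint_Ico_intCast ℝ hjk).mono inter_subset_right inter_subset_right
  · exact fun k => hs.inter measurableSet_Ico

variable {N m : ℕ}

/-- The lift to `ℝᴺ` of a point of the torus in the cell with index `k`. -/
def torusLift (p : Torus N × (Fin N → ℤ)) : Vel N :=
  WithLp.toLp 2 fun j => circleLift (p.1 j) + p.2 j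

theorem torusProj_torusLift (p : Torus N × (Fin N → ℤ)) : torusProj (torusLift p) = p.1 := by
  funext j
  change ((circleLift (p.1 j) + p.2 j : ℝ) : UnitAddCircle) = p.1 j
  rw [AddCircle.coe_add, coe_circleLift]
  simp

theorem measurePreserving_torusLift : MeasurePreserving (torusLift (N := N))
    (volume.prod Measure.count) volume := by
  have h1 := (measurePreserving_arrowProdEquivProdArrow UnitAddCircle ℤ (Fin N)
    (fun _ => volume) (fun _ => Measure.count)).symm
  rw [pi_count_eq_count] at h1
  have h2 := measurePreserving_pi (fun _ : Fin N =>
    (volume : Measure UnitAddCircle).prod (Measure.count : Measure ℤ)) (fun _ => volume)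
    (fun _ => measurePreserving_circleLift_add)
  exact (PiLp.volume_preserving_toLp (Fin N)).comp (h2.comp h1)

/-- The noise that leads from `p` to `z` along a lift with index `k`. -/
def noiseOf (q : ℝ) (p : Phase N) (zk : Phase N × (Fin N → ℤ)) : Vel N × Vel N :=
  (torusLift (zk.1.1 - p.1, zk.2) - (1 - q) • p.2, zk.1.2 - q • p.2)

theorem ouMap_noiseOf (q : ℝ) (p : Phase N) (zk : Phase N × (Fin N → ℤ)) :
    ouMap q (noiseOf q p zk) p = zk.1 := by
  refine Prod.ext ?_ ?_
  · simp [ouMap, noiseOf, torusProj_torusLift]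
  · simp [ouMap, noiseOf]

theorem measurable_noiseOf (q : ℝ) :
    Measurable fun x : Phase N × (Phase N × (Fin N → ℤ)) => noiseOf q x.1 x.2 := by
  have h1 : Measurable fun x : Phase N × (Phase N × (Fin N → ℤ)) =>
      (x.2.1.1 - x.1.1, x.2.2) := by fun_prop
  have h2 := measurePreserving_torusLift.measurable.comp h1
  exact (h2.sub (by fun_prop)).prodMk (by fun_prop)

/-- For a fixed starting point, an end point together with a cell index parametrizes the noise up to
translations and the unfolding of the torus, without a Jacobian. -/
theorem measurePreserving_noiseOf (q : ℝ) (p : Phase N) :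
    MeasurePreserving (noiseOf q p) (volume.prod Measure.count) volume := by
  have h1 : MeasurePreserving (fun zk : Phase N × (Fin N → ℤ) => ((zk.1.1, zk.2), zk.1.2))
      ((volume : Measure (Phase N)).prod Measure.count)
      (((volume : Measure (Torus N)).prod Measure.count).prod (volume : Measure (Vel N))) := by
    have a1 := measurePreserving_prodAssoc (volume : Measure (Torus N)) (volume : Measure (Vel N))
      (Measure.count : Measure (Fin N → ℤ))
    have a2 := (MeasurePreserving.id (volume : Measure (Torus N))).prod
      (Measure.measurePreserving_swap (μ := (volume : Measure (Vel N)))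
        (ν := (Measure.count : Measure (Fin N → ℤ))))
    have a3 := (measurePreserving_prodAssoc (volume : Measure (Torus N))
      (Measure.count : Measure (Fin N → ℤ)) (volume : Measure (Vel N))).symm
    exact a3.comp (a2.comp a1)
  have h2 : MeasurePreserving (fun x : Torus N => x - p.1) volume volume :=
    measurePreserving_sub_right volume p.1
  have h3 := measurePreserving_torusLift.comp (h2.prod (MeasurePreserving.id
    (Measure.count : Measure (Fin N → ℤ))))
  have h4 := (measurePreserving_sub_right (volume : Measure (Vel N)) ((1 - q) • p.2)).comp h3
  exact (h4.prod (measurePreserving_sub_right (volume : Measure (Vel N)) (q • p.2))).comp h1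

/-! ### Averages as integral operators -/

/-- Inverse of the noise map `L_t`. -/
def ouNoiseInv (t : ℝ) (ξ : Vel N × Vel N) : Vel N × Vel N :=
  ((ouSigma t)⁻¹ • (ξ.1 - (ouBeta t * (√(ouVar t))⁻¹) • ξ.2), (√(ouVar t))⁻¹ • ξ.2)

@[fun_prop]
theorem continuous_ouNoiseInv (t : ℝ) : Continuous (ouNoiseInv (N := N) t) := by
  unfold ouNoiseInv; fun_prop

theorem ouNoiseInv_ouNoise {t : ℝ} (ht : 0 < t) (η : Vel N × Vel N) :
    ouNoiseInv t (ouNoise t η) = η := by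
  have h1 := (ouSigma_pos ht).ne'
  have h2 := (Real.sqrt_pos.2 (ouVar_pos ht)).ne'
  refine Prod.ext ?_ ?_
  · simp [ouNoiseInv, ouNoise, smul_smul, h1, h2]
  · simp [ouNoiseInv, ouNoise, smul_smul, h2]

/-- The Jacobian of the noise map. -/
def ouJac (N : ℕ) (t : ℝ) : ℝ := (ouSigma t * √(ouVar t)) ^ N

theorem ouJac_pos {t : ℝ} (ht : 0 < t) : 0 < ouJac N t :=
  pow_pos (mul_pos (ouSigma_pos ht) (Real.sqrt_pos.2 (ouVar_pos ht))) N

/-- The noise map is a scaling of the two blocks followed by a shear, so only the scaling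
contributes to the determinant. -/
theorem map_ouNoise {t : ℝ} (ht : 0 < t) :
    Measure.map (ouNoise (N := N) t) volume = ENNReal.ofReal (ouJac N t)⁻¹ • volume := by
  have h1 := ouSigma_pos ht
  have h2 := Real.sqrt_pos.2 (ouVar_pos ht)
  have e : ouNoise (N := N) t = Prod.swap ∘
      (fun z : Vel N × Vel N => (z.1, z.2 + (ouBeta t * (√(ouVar t))⁻¹) • z.1)) ∘ Prod.swap ∘
        Prod.map (fun v => ouSigma t • v) (fun v => √(ouVar t) • v) := by
    funext η
    simp only [ouNoise, Function.comp_apply, Prod.map, Prod.swap, smul_smul]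
    rw [add_comm]
    field_simp
  have h3 : MeasurePreserving (fun z : Vel N × Vel N =>
      (z.1, z.2 + (ouBeta t * (√(ouVar t))⁻¹) • z.1)) (volume.prod volume) (volume.prod volume) :=
    (MeasurePreserving.id _).skew_product
      (g := fun w x => x + (ouBeta t * (√(ouVar t))⁻¹) • w)
      (by fun_prop) (Eventually.of_forall fun w => map_add_right_eq_self _ _)
  rw [e, ← Measure.map_map (by fun_prop) (by fun_prop), ← Measure.map_map (by fun_prop)
    (by fun_prop), ← Measure.map_map (by fun_prop) (by fun_prop)]
  change Measure.map _ (Measure.map _ (Measure.map _ (Measure.map _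
    ((volume : Measure (Vel N)).prod (volume : Measure (Vel N)))))) =
      _ • (volume : Measure (Vel N)).prod (volume : Measure (Vel N))
  rw [← Measure.map_prod_map _ _ (by fun_prop) (by fun_prop), Measure.map_addHaar_smul _ h1.ne',
    Measure.map_addHaar_smul _ h2.ne', Measure.prod_smul_left, Measure.prod_smul_right, smul_smul,
    Measure.map_smul, Measure.map_smul, Measure.map_smul, Measure.prod_swap, h3.map_eq,
    Measure.prod_swap, finrank_euclideanSpace_fin, ← ENNReal.ofReal_mul (abs_nonneg _),
    abs_of_pos (by positivity), abs_of_pos (by positivity), ← mul_inv, ← mul_pow, ouJac]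

/-- The density of `w(η) dη` transported by `L_t`. -/
def ouDensity (w : Vel N × Vel N → ℝ) (t : ℝ) (ξ : Vel N × Vel N) : ℝ :=
  (ouJac N t)⁻¹ * w (ouNoiseInv t ξ)

theorem integral_ouNoise {X : Type*} [NormedAddCommGroup X] [NormedSpace ℝ X] {t : ℝ} (ht : 0 < t)
    {w : Vel N × Vel N → ℝ} (hw : Continuous w) {F : Vel N × Vel N → X}
    (hF : AEStronglyMeasurable F volume) :
    ∫ η, w η • F (ouNoise t η) = ∫ ξ, ouDensity w t ξ • F ξ := by
  have hc : Continuous (ouNoise (N := N) t) :=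
    continuous_ouNoise.comp (by fun_prop : Continuous fun η : Vel N × Vel N => (t, η))
  have h1 : ∀ η, w η • F (ouNoise t η) =
      (fun ξ => w (ouNoiseInv t ξ) • F ξ) (ouNoise t η) := fun η => by
    beta_reduce; rw [ouNoiseInv_ouNoise ht]
  have hac : Measure.map (ouNoise (N := N) t) volume ≪ volume := by
    rw [map_ouNoise ht]; exact Measure.smul_absolutelyContinuous
  rw [integral_congr_ae (Eventually.of_forall h1), ← integral_map
    (f := fun ξ => w (ouNoiseInv t ξ) • F ξ) hc.measurable.aemeasurable
    (((hw.comp (continuous_ouNoiseInv t)).aestronglyMeasurable.smul hF).mono_ac hac),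
    map_ouNoise ht, integral_smul_measure, ENNReal.toReal_ofReal (inv_pos.2 (ouJac_pos ht)).le,
    ← integral_smul]
  simp_rw [ouDensity, mul_smul]

theorem integrable_ouDensity {t : ℝ} (ht : 0 < t) {w : Vel N × Vel N → ℝ} (hw : Continuous w)
    (hi : Integrable w volume) : Integrable (ouDensity w t) volume := by
  have hc : Continuous (ouNoise (N := N) t) :=
    continuous_ouNoise.comp (by fun_prop : Continuous fun η : Vel N × Vel N => (t, η))
  refine Integrable.const_mul ?_ _
  have h0 : ENNReal.ofReal (ouJac N t)⁻¹ ≠ 0 := by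
    simpa using ouJac_pos ht
  have h1 : Integrable (fun ξ => w (ouNoiseInv t ξ)) (Measure.map (ouNoise (N := N) t) volume) := by
    rw [integrable_map_measure (by fun_prop) hc.measurable.aemeasurable]
    refine hi.congr (Eventually.of_forall fun η => ?_)
    rw [Function.comp_apply, ouNoiseInv_ouNoise ht]
  rwa [map_ouNoise ht, integrable_smul_measure h0 ENNReal.ofReal_ne_top] at h1

/-- The integral kernel of the average with weight `w`. -/
def ouKernel (w : Vel N × Vel N → ℝ) (t : ℝ) (z p : Phase N) : ℝ :=
  ∫ k : Fin N → ℤ, ouDensity w t (noiseOf (ouDecay t) p (z, k)) ∂Measure.count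

/-- Continuous linear functionals pass through Bochner integrals with values in L¹, where pointwise
evaluation is meaningless. -/
theorem exists_clm_integral_mul {φ : Phase N → ℝ} (hφ : Measurable φ) (hφ1 : ∀ z, ‖φ z‖ ≤ 1) :
    ∃ L : L1 N →L[ℝ] ℝ, ∀ f, L f = ∫ z, φ z * f z := by
  have hi : ∀ f : L1 N, Integrable (fun z => φ z * f z) volume := fun f =>
    (L1.integrable_coeFn f).bdd_mul hφ.aestronglyMeasurable (Eventually.of_forall hφ1)
  refine ⟨LinearMap.mkContinuous
    { toFun := fun f => ∫ z, φ z * f z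
      map_add' := fun f g => by
        rw [← integral_add (hi f) (hi g)]
        refine integral_congr_ae ?_
        filter_upwards [Lp.coeFn_add f g] with z hz
        rw [hz, Pi.add_apply, mul_add]
      map_smul' := fun c f => by
        rw [RingHom.id_apply, ← integral_smul]
        refine integral_congr_ae ?_
        filter_upwards [Lp.coeFn_smul c f] with z hz
        rw [hz, Pi.smul_apply, mul_smul_comm] } 1 fun f => ?_, fun f => rfl⟩
  rw [one_mul, L1.norm_eq_integral_norm]
  refine (norm_integral_le_integral_norm _).trans
    (integral_mono (hi f).norm (L1.integrable_coeFn f).norm fun z => ?_)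
  beta_reduce
  rw [norm_mul]
  exact mul_le_of_le_one_left (norm_nonneg _) (hφ1 z)

/-- Two L¹ functions with the same integral over every measurable set agree almost everywhere.
Tested on a set, the average is an integral over starting points and noises; replacing the noise by
the end point and the cell index, and summing over cells, produces the kernel. -/
theorem ouAvg_ae_eq {t : ℝ} (ht : 0 < t) {w : Vel N × Vel N → ℝ} (hw : Continuous w)
    (hi : Integrable w volume) (g : L1 N) :
    ∀ᵐ z, Integrable (fun p => ouKernel w t z p * g p) volume ∧
      ouAvg w t g z = ∫ p, ouKernel w t z p * g p := by
  set q := ouDecay t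
  have hq : 0 < q := ouDecay_pos t
  have hΨ := integrable_ouDensity ht hw hi
  have hg := L1.integrable_coeFn g
  -- Change of variables from (start, end point, cell) to (start, noise), fibrewise over the
  -- starting point; all integrability claims are transported along it.
  have hΘ : MeasurePreserving (fun x : Phase N × (Phase N × (Fin N → ℤ)) => (x.1, noiseOf q x.1 x.2))
      ((volume : Measure (Phase N)).prod ((volume : Measure (Phase N)).prod Measure.count))
      ((volume : Measure (Phase N)).prod volume) :=
    (MeasurePreserving.id _).skew_product (measurable_noiseOf q)
      (Eventually.of_forall fun p => (measurePreserving_noiseOf q p).map_eq)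
  have : SFinite ((volume : Measure (Phase N)).prod (volume : Measure (Phase N))) :=
    Measure.prod.instSFinite
  have hA := (measurePreserving_prodAssoc (volume : Measure (Phase N)) (volume : Measure (Phase N))
    (Measure.count : Measure (Fin N → ℤ)))
  have hJ : Integrable (fun x : Phase N × (Vel N × Vel N) => g x.1 * ouDensity w t x.2)
      ((volume : Measure (Phase N)).prod volume) := hg.mul_prod hΨ
  have hH : Integrable (fun y : (Phase N × Phase N) × (Fin N → ℤ) =>
      g y.1.1 * ouDensity w t (noiseOf q y.1.1 (y.1.2, y.2)))
      (((volume : Measure (Phase N)).prod (volume : Measure (Phase N))).prod Measure.count) :=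
    (hA.integrable_comp (hΘ.integrable_comp_of_integrable hJ).1).2
      (hΘ.integrable_comp_of_integrable hJ)
  have hK : Integrable (fun y : Phase N × Phase N => ouKernel w t y.2 y.1 * g y.1)
      ((volume : Measure (Phase N)).prod (volume : Measure (Phase N))) := by
    refine hH.integral_prod_left.congr (Eventually.of_forall fun y => ?_)
    have := integral_const_mul (μ := (Measure.count : Measure (Fin N → ℤ))) (g y.1)
      fun k => ouDensity w t (noiseOf q y.1 (y.2, k))
    exact this.trans (mul_comm _ _)
  have hR : Integrable (fun z => ∫ p, ouKernel w t z p * g p) volume := hK.integral_prod_right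
  have heq : ouAvg w t g =ᵐ[volume] fun z => ∫ p, ouKernel w t z p * g p := by
    refine Integrable.ae_eq_of_forall_setIntegral_eq _ _ (L1.integrable_coeFn _) hR
      fun S hS _ => ?_
    have hφ : Measurable (S.indicator fun _ : Phase N => (1 : ℝ)) := measurable_const.indicator hS
    set φ := S.indicator fun _ : Phase N => (1 : ℝ) with hφd
    have hφ1 : ∀ z, ‖φ z‖ ≤ 1 := fun z => by
      by_cases hz : z ∈ S <;> simp [hφd, hz]
    have hind : ∀ F : Phase N → ℝ, ∫ z in S, F z = ∫ z, φ z * F z := by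
      intro F
      rw [← integral_indicator hS]
      refine integral_congr_ae (Eventually.of_forall fun z => ?_)
      by_cases hz : z ∈ S <;> simp [hφd, hz]
    obtain ⟨L, hL⟩ := exists_clm_integral_mul hφ hφ1
    have hcT : Continuous fun ξ : Vel N × Vel N => ouShift q ξ g :=
      continuous_ouShift_noise continuous_const continuous_id g
    have hiT : Integrable (fun ξ => ouDensity w t ξ • ouShift q ξ g) volume :=
      (hΨ.norm.mul_const ‖g‖).mono' (hΨ.1.smul hcT.aestronglyMeasurable)
        (Eventually.of_forall fun ξ => by rw [norm_smul, norm_ouShift hq])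
    have hM : Measurable fun x : Phase N × (Vel N × Vel N) => φ (ouMap q x.2 x.1) :=
      hφ.comp ((continuous_ouMap q).comp (by fun_prop :
        Continuous fun x : Phase N × (Vel N × Vel N) => (x.2, x.1))).measurable
    have hJ' : Integrable (fun x : Phase N × (Vel N × Vel N) =>
        φ (ouMap q x.2 x.1) * (g x.1 * ouDensity w t x.2))
        ((volume : Measure (Phase N)).prod volume) :=
      hJ.bdd_mul (c := 1) hM.aestronglyMeasurable (Eventually.of_forall fun x => hφ1 _)
    have hΘJ : Integrable (fun x : Phase N × (Phase N × (Fin N → ℤ)) =>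
        φ x.2.1 * (g x.1 * ouDensity w t (noiseOf q x.1 x.2)))
        ((volume : Measure (Phase N)).prod ((volume : Measure (Phase N)).prod Measure.count)) := by
      refine (hΘ.integrable_comp_of_integrable hJ').congr (Eventually.of_forall fun x => ?_)
      simp only [Function.comp_apply, ouMap_noiseOf]
    have hAJ : Integrable (fun y : (Phase N × Phase N) × (Fin N → ℤ) =>
        φ y.1.2 * (g y.1.1 * ouDensity w t (noiseOf q y.1.1 (y.1.2, y.2))))
        (((volume : Measure (Phase N)).prod (volume : Measure (Phase N))).prod Measure.count) :=
      hA.integrable_comp_of_integrable hΘJ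
    have hKφ : Integrable (fun y : Phase N × Phase N => φ y.2 * (ouKernel w t y.2 y.1 * g y.1))
        ((volume : Measure (Phase N)).prod (volume : Measure (Phase N))) :=
      hK.bdd_mul (c := 1) (hφ.comp measurable_snd).aestronglyMeasurable
        (Eventually.of_forall fun x => hφ1 _)
    calc ∫ z in S, ouAvg w t g z = L (ouAvg w t g) := by rw [hind, hL]
      _ = ∫ ξ, L (ouDensity w t ξ • ouShift q ξ g) := by
          rw [ouAvg_apply hi, integral_ouNoise ht hw (F := fun ξ => ouShift q ξ g)
            hcT.aestronglyMeasurable, ContinuousLinearMap.integral_comp_comm _ hiT]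
      _ = ∫ ξ, ∫ p, φ (ouMap q ξ p) * (g p * ouDensity w t ξ) := by
          refine integral_congr_ae (Eventually.of_forall fun ξ => ?_)
          beta_reduce
          rw [map_smul, hL, integral_mul_ouShift hq ξ hφ, smul_eq_mul, mul_comm,
            ← integral_mul_const]
          simp_rw [mul_assoc]
      _ = ∫ x, φ (ouMap q x.2 x.1) * (g x.1 * ouDensity w t x.2)
            ∂((volume : Measure (Phase N)).prod volume) := (integral_prod_symm _ hJ').symm
      _ = ∫ x, φ x.2.1 * (g x.1 * ouDensity w t (noiseOf q x.1 x.2))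
            ∂((volume : Measure (Phase N)).prod
              ((volume : Measure (Phase N)).prod Measure.count)) := by
          rw [← hΘ.map_eq, integral_map hΘ.measurable.aemeasurable
            (by rw [hΘ.map_eq]; exact hJ'.1)]
          simp only [ouMap_noiseOf]
      _ = ∫ y, φ y.1.2 * (g y.1.1 * ouDensity w t (noiseOf q y.1.1 (y.1.2, y.2)))
            ∂(((volume : Measure (Phase N)).prod (volume : Measure (Phase N))).prod
              Measure.count) := by
          have h1 := integral_map hA.measurable.aemeasurable (f := fun x =>
            φ x.2.1 * (g x.1 * ouDensity w t (noiseOf q x.1 x.2))) (hA.map_eq ▸ hΘJ.1)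
          rw [hA.map_eq] at h1
          exact h1
      _ = ∫ y, φ y.2 * (ouKernel w t y.2 y.1 * g y.1)
            ∂((volume : Measure (Phase N)).prod (volume : Measure (Phase N))) := by
          rw [integral_prod _ hAJ]
          refine integral_congr_ae (Eventually.of_forall fun y => ?_)
          have h1 := integral_const_mul (μ := (Measure.count : Measure (Fin N → ℤ)))
            (φ y.2 * g y.1) fun k => ouDensity w t (noiseOf q y.1 (y.2, k))
          simp only [mul_assoc] at h1
          refine h1.trans ?_
          exact congrArg (φ y.2 * ·) (mul_comm _ _)
      _ = ∫ z, ∫ p, φ z * (ouKernel w t z p * g p) := integral_prod_symm _ hKφ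
      _ = ∫ z in S, ∫ p, ouKernel w t z p * g p := by
          rw [hind]
          simp_rw [integral_const_mul]
  filter_upwards [hK.prod_left_ae, heq] with z h1 h2 using ⟨h1, h2⟩

/-! ### The one-dimensional kinetic density -/

theorem integral_eq_of_hasDerivAt {f F : ℝ → ℝ} (hf : Continuous f)
    (hF : ∀ s, HasDerivAt F (f s) s) (t : ℝ) : ∫ s in (0 : ℝ)..t, f s = F t - F 0 :=
  intervalIntegral.integral_eq_sub_of_hasDerivAt (fun s _ => hF s) (hf.intervalIntegrable _ _)

theorem hasDerivAt_exp_neg (s : ℝ) : HasDerivAt (fun s => Real.exp (-s)) (-Real.exp (-s)) s := by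
  simpa using (hasDerivAt_neg s).exp

theorem covariance_position (t : ℝ) : 2 * ∫ s in (0 : ℝ)..t, (1 - Real.exp (-s)) ^ 2 =
    2 * t - 3 + 4 * ouDecay t - ouDecay t ^ 2 := by
  rw [integral_eq_of_hasDerivAt (F := fun s => s + 2 * Real.exp (-s) - Real.exp (-s) ^ 2 / 2)
    (by fun_prop) (fun s => ?_)]
  · simp only [ouDecay, neg_zero, Real.exp_zero]; ring
  · refine (((hasDerivAt_id s).add ((hasDerivAt_exp_neg s).const_mul 2)).sub
      (((hasDerivAt_exp_neg s).pow 2).div_const 2)).congr_deriv ?_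
    simp; ring

theorem covariance_cross (t : ℝ) : 2 * ∫ s in (0 : ℝ)..t, Real.exp (-s) * (1 - Real.exp (-s)) =
    (1 - ouDecay t) ^ 2 := by
  rw [integral_eq_of_hasDerivAt (F := fun s => -Real.exp (-s) + Real.exp (-s) ^ 2 / 2)
    (by fun_prop) (fun s => ?_)]
  · simp only [ouDecay, neg_zero, Real.exp_zero]; ring
  · refine ((hasDerivAt_exp_neg s).neg.add
      (((hasDerivAt_exp_neg s).pow 2).div_const 2)).congr_deriv ?_
    simp; ring

theorem covariance_velocity (t : ℝ) : 2 * ∫ s in (0 : ℝ)..t, Real.exp (-s) ^ 2 = ouVar t := by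
  rw [integral_eq_of_hasDerivAt (F := fun s => -(Real.exp (-s) ^ 2 / 2))
    (by fun_prop) (fun s => ?_)]
  · simp only [ouVar, ouDecay, neg_zero, Real.exp_zero]; ring
  · refine (((hasDerivAt_exp_neg s).pow 2).div_const 2).neg.congr_deriv ?_
    simp; ring

/-- First normalized coordinate. -/
def normPos (t x v : ℝ) : ℝ := (ouSigma t)⁻¹ * (x - (ouBeta t * (√(ouVar t))⁻¹) * v)

/-- Second normalized coordinate. -/
def normVel (t v : ℝ) : ℝ := (√(ouVar t))⁻¹ * v

/-- The triangular square root of the covariance turns the quadratic form into a sum of squares of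
the normalized coordinates. -/
theorem kineticDensity_eq {t : ℝ} (ht : 0 < t) (w x v : ℝ) :
    kineticDensity t w x v = (2 * Real.pi * (ouSigma t * √(ouVar t)))⁻¹ *
      Real.exp (-(normPos t (x - (1 - ouDecay t) * w) (v - ouDecay t * w) ^ 2 +
        normVel t (v - ouDecay t * w) ^ 2) / 2) := by
  have h1 := ouSigma_pos ht
  have h2 := Real.sqrt_pos.2 (ouVar_pos ht)
  rw [kineticDensity, covariance_position, covariance_cross, covariance_velocity,
    ← ouBeta_sq_add ht.le, ← ouBeta_mul_sqrt ht.le, gaussian₂]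
  change _ * Real.exp (-(_ * (x - (1 - ouDecay t) * w) ^ 2 - _ * (x - (1 - ouDecay t) * w) *
    (v - ouDecay t * w) + _ * (v - ouDecay t * w) ^ 2) / _) = _
  generalize x - (1 - ouDecay t) * w = X
  generalize v - ouDecay t * w = V
  have h3 : ouVar t = √(ouVar t) ^ 2 := (Real.sq_sqrt (ouVar_pos ht).le).symm
  have h4 : (ouBeta t ^ 2 + ouSigma t ^ 2) * ouVar t - (ouBeta t * √(ouVar t)) ^ 2 =
      (ouSigma t * √(ouVar t)) ^ 2 := by
    rw [mul_pow, mul_pow, ← h3]; ring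
  rw [h4, Real.sqrt_sq (by positivity)]
  congr 2
  rw [normPos, normVel]
  generalize hc : √(ouVar t) = c at *
  rw [h3]
  field_simp
  ring

/-- The derivative of the kinetic density in the initial velocity. -/
def kineticDeriv (t w x v : ℝ) : ℝ :=
  (ouTheta₁ t * normPos t (x - (1 - ouDecay t) * w) (v - ouDecay t * w) +
    ouTheta₂ t * normVel t (v - ouDecay t * w)) * kineticDensity t w x v

theorem hasDerivAt_kineticDensity {t : ℝ} (ht : 0 < t) (w x v : ℝ) :
    HasDerivAt (fun w => kineticDensity t w x v) (kineticDeriv t w x v) w := by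
  have h1 := ouSigma_pos ht
  have h2 := Real.sqrt_pos.2 (ouVar_pos ht)
  have e1 := ouSigma_mul_theta ht
  have e2 := sqrt_ouVar_mul_theta ht
  -- The noise map sends θ to (1 - e^{-t}, e^{-t}), so the normalized coordinates move with speed -θ
  -- when w increases.
  have hn2 : HasDerivAt (fun w => normVel t (v - ouDecay t * w)) (-ouTheta₂ t) w := by
    refine ((((hasDerivAt_id w).const_mul (ouDecay t)).const_sub v).const_mul _).congr_deriv ?_
    rw [← e2]; field_simp
  have hn1 : HasDerivAt (fun w => normPos t (x - (1 - ouDecay t) * w) (v - ouDecay t * w))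
      (-ouTheta₁ t) w := by
    refine (((((hasDerivAt_id w).const_mul (1 - ouDecay t)).const_sub x).sub
      ((((hasDerivAt_id w).const_mul (ouDecay t)).const_sub v).const_mul
        (ouBeta t * (√(ouVar t))⁻¹))).const_mul (ouSigma t)⁻¹).congr_deriv ?_
    rw [← e1, ← e2]; field_simp; ring
  rw [kineticDeriv]
  simp_rw [kineticDensity_eq ht]
  refine ((((hn1.pow 2).add (hn2.pow 2)).neg.div_const 2).exp.const_mul _).congr_deriv ?_
  simp only [Nat.cast_ofNat, Pi.add_apply, Pi.pow_apply, Nat.reduceSub, pow_one, Pi.neg_apply]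
  ring

/-- The Gaussian pays for the linear factor produced by differentiation and for a quadratic factor
that becomes summable decay in the cell index. -/
theorem mul_exp_neg_sq_le (s : ℝ) : (1 + s ^ 2) * (1 + |s|) * Real.exp (-s ^ 2 / 2) ≤ 4 := by
  have h1 : 1 + s ^ 2 / 2 + (s ^ 2 / 2) ^ 2 / 2 ≤ Real.exp (s ^ 2 / 2) :=
    Real.quadratic_le_exp_of_nonneg (by positivity)
  have h2 : Real.exp (-s ^ 2 / 2) = (Real.exp (s ^ 2 / 2))⁻¹ := by
    rw [← Real.exp_neg]; congr 1; ring
  rw [h2, ← div_eq_mul_inv, div_le_iff₀ (Real.exp_pos _)]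
  have h3 : |s| ≤ 1 / 2 + s ^ 2 / 2 := by
    have := sq_nonneg (|s| - 1)
    rw [sub_sq, sq_abs] at this
    linarith
  have h4 : (1 + s ^ 2) * (1 + |s|) ≤ (1 + s ^ 2) * (1 + (1 / 2 + s ^ 2 / 2)) := by gcongr
  nlinarith [sq_nonneg s, sq_nonneg (s ^ 2)]

/-- Bounds for the density and its derivative in terms of the index of the cell. -/
theorem exists_kineticDensity_le {t : ℝ} (ht : 0 < t) (w r v : ℝ) : ∃ C, 0 ≤ C ∧
    ∀ (k : ℤ), ∀ w' ∈ Metric.ball w 1, ‖kineticDensity t w' (r + k) v‖ ≤ C * (1 + (k : ℝ) ^ 2)⁻¹ ∧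
      ‖kineticDeriv t w' (r + k) v‖ ≤ C * (1 + (k : ℝ) ^ 2)⁻¹ := by
  have hσ := ouSigma_pos ht
  have hc := Real.sqrt_pos.2 (ouVar_pos ht)
  set A := (2 * Real.pi * (ouSigma t * √(ouVar t)))⁻¹ with hA
  have hA0 : 0 < A := by positivity
  set b := ouBeta t * (√(ouVar t))⁻¹
  set q := ouDecay t
  set R := |r| + |1 - q| * (|w| + 1) + |b| * (|v| + |q| * (|w| + 1))
  have hR : 0 ≤ R := by positivity
  -- R bounds what remains of the cell index k after subtracting σ s₁, uniformly for |w' - w| < 1;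
  -- hence 1 + k² ≤ K (1 + s₁²).
  set K := 1 + 2 * R ^ 2 + 2 * ouSigma t ^ 2
  set Θ := 1 + |ouTheta₁ t| + |ouTheta₂ t|
  refine ⟨16 * A * Θ * K, by positivity, fun k w' hw' => ?_⟩
  have hw1 : |w'| ≤ |w| + 1 := by
    rw [Metric.mem_ball, Real.dist_eq] at hw'
    have := abs_sub_abs_le_abs_sub w' w
    linarith
  set s₁ := normPos t (r + k - (1 - q) * w') (v - q * w') with hs₁
  set s₂ := normVel t (v - q * w') with hs₂
  have hk : (k : ℝ) = ouSigma t * s₁ - (r - (1 - q) * w' - b * (v - q * w')) := by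
    have h0 : ouSigma t * s₁ = r + k - (1 - q) * w' - b * (v - q * w') :=
      mul_inv_cancel_left₀ hσ.ne' _
    rw [h0]; ring
  have hrem : |r - (1 - q) * w' - b * (v - q * w')| ≤ R := by
    have h1 : |(1 - q) * w'| ≤ |1 - q| * (|w| + 1) := by rw [abs_mul]; gcongr
    have h2 : |q * w'| ≤ |q| * (|w| + 1) := by rw [abs_mul]; gcongr
    have h3 : |b * (v - q * w')| ≤ |b| * (|v| + |q| * (|w| + 1)) := by
      rw [abs_mul]; gcongr; exact (abs_sub v _).trans (by gcongr)
    exact (abs_sub _ _).trans (add_le_add ((abs_sub _ _).trans (by gcongr)) h3)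
  have hK : 1 + (k : ℝ) ^ 2 ≤ K * (1 + s₁ ^ 2) := by
    set y := r - (1 - q) * w' - b * (v - q * w')
    have hy : y ^ 2 ≤ R ^ 2 := sq_le_sq' (by linarith [neg_abs_le y]) ((le_abs_self y).trans hrem)
    rw [hk]
    have h1 := sq_nonneg (ouSigma t * s₁ + y)
    have h2 := sq_nonneg s₁
    have h3 := mul_nonneg (sq_nonneg R) h2
    have h4 := sq_nonneg (ouSigma t)
    simp only [K]
    nlinarith
  have hexp : Real.exp (-(s₁ ^ 2 + s₂ ^ 2) / 2) =
      Real.exp (-s₁ ^ 2 / 2) * Real.exp (-s₂ ^ 2 / 2) := by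
    rw [← Real.exp_add]; congr 1; ring
  have hd : kineticDensity t w' (r + k) v =
      A * (Real.exp (-s₁ ^ 2 / 2) * Real.exp (-s₂ ^ 2 / 2)) := by
    rw [← hexp]; exact kineticDensity_eq ht _ _ _
  have h1 := mul_exp_neg_sq_le s₁
  have h2 := mul_exp_neg_sq_le s₂
  have key : (1 + |s₁|) * (1 + |s₂|) * (Real.exp (-s₁ ^ 2 / 2) * Real.exp (-s₂ ^ 2 / 2)) ≤
      16 * K * (1 + (k : ℝ) ^ 2)⁻¹ := by
    have h3 : (1 + |s₂|) * Real.exp (-s₂ ^ 2 / 2) ≤ 4 := by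
      refine le_trans ?_ h2
      have : 0 ≤ s₂ ^ 2 * ((1 + |s₂|) * Real.exp (-s₂ ^ 2 / 2)) := by positivity
      linarith
    have h4 : (1 + |s₁|) * Real.exp (-s₁ ^ 2 / 2) ≤ 4 * K * (1 + (k : ℝ) ^ 2)⁻¹ := by
      rw [← div_eq_mul_inv, le_div_iff₀ (by positivity)]
      calc _ ≤ (1 + |s₁|) * Real.exp (-s₁ ^ 2 / 2) * (K * (1 + s₁ ^ 2)) := by gcongr
        _ = K * ((1 + s₁ ^ 2) * (1 + |s₁|) * Real.exp (-s₁ ^ 2 / 2)) := by ring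
        _ ≤ K * 4 := by gcongr
        _ = 4 * K := by ring
    calc _ = ((1 + |s₁|) * Real.exp (-s₁ ^ 2 / 2)) * ((1 + |s₂|) * Real.exp (-s₂ ^ 2 / 2)) := by
          ring
      _ ≤ (4 * K * (1 + (k : ℝ) ^ 2)⁻¹) * 4 := by gcongr
      _ = _ := by ring
  have hΘ1 : 1 ≤ Θ := by
    have : 0 ≤ |ouTheta₁ t| := abs_nonneg _
    have : 0 ≤ |ouTheta₂ t| := abs_nonneg _
    simp only [Θ]; linarith
  set X := Real.exp (-s₁ ^ 2 / 2) * Real.exp (-s₂ ^ 2 / 2)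
  have hX : 0 ≤ X := by positivity
  have hone : 1 ≤ (1 + |s₁|) * (1 + |s₂|) :=
    one_le_mul_of_one_le_of_one_le (by linarith [abs_nonneg s₁]) (by linarith [abs_nonneg s₂])
  have hfin : Θ * A * ((1 + |s₁|) * (1 + |s₂|) * X) ≤ 16 * A * Θ * K * (1 + (k : ℝ) ^ 2)⁻¹ := by
    calc _ ≤ Θ * A * (16 * K * (1 + (k : ℝ) ^ 2)⁻¹) := by gcongr
      _ = _ := by ring
  constructor
  · rw [hd, Real.norm_of_nonneg (by positivity)]
    refine le_trans ?_ hfin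
    calc A * X = 1 * A * (1 * X) := by ring
      _ ≤ _ := by gcongr
  · rw [kineticDeriv, hd, norm_mul, Real.norm_of_nonneg (show 0 ≤ A * X by positivity),
      Real.norm_eq_abs]
    refine le_trans ?_ hfin
    have h5 : |ouTheta₁ t * s₁ + ouTheta₂ t * s₂| ≤ Θ * ((1 + |s₁|) * (1 + |s₂|)) := by
      refine (abs_add_le _ _).trans ?_
      rw [abs_mul, abs_mul]
      have a1 := abs_nonneg (ouTheta₁ t)
      have a2 := abs_nonneg (ouTheta₂ t)
      have a3 := abs_nonneg s₁
      have a4 := abs_nonneg s₂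
      have h6 : |s₁| ≤ (1 + |s₁|) * (1 + |s₂|) :=
        (by linarith : |s₁| ≤ 1 + |s₁|).trans
          (le_mul_of_one_le_right (by linarith) (by linarith))
      have h7 : |s₂| ≤ (1 + |s₁|) * (1 + |s₂|) :=
        (by linarith : |s₂| ≤ 1 + |s₂|).trans
          (le_mul_of_one_le_left (by linarith) (by linarith))
      calc _ ≤ |ouTheta₁ t| * ((1 + |s₁|) * (1 + |s₂|)) +
            |ouTheta₂ t| * ((1 + |s₁|) * (1 + |s₂|)) := by gcongr
        _ ≤ _ := by
            rw [← add_mul]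
            exact mul_le_mul_of_nonneg_right (by simp only [Θ]; linarith) (by positivity)
    calc _ ≤ Θ * ((1 + |s₁|) * (1 + |s₂|)) * (A * X) := by gcongr
      _ = _ := by ring

theorem summable_inv_one_add_sq : Summable fun k : ℤ => (1 + (k : ℝ) ^ 2)⁻¹ := by
  have h : Summable fun k : ℤ => 1 / (k : ℝ) ^ 2 := Real.summable_one_div_int_pow.2 (by norm_num)
  have h0 : Summable fun k : ℤ => if k = 0 then (1 : ℝ) else 0 :=
    summable_of_ne_finset_zero (s := {0}) fun k hk => by simp_all
  refine (h.add h0).of_nonneg_of_le (fun k => by positivity) fun k => ?_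
  by_cases hk : k = 0
  · simp [hk]
  · have : 0 < (k : ℝ) ^ 2 := by positivity
    simp only [hk, if_false, add_zero, one_div]
    gcongr
    linarith

theorem summable_kineticDensity {t : ℝ} (ht : 0 < t) (w r v : ℝ) :
    Summable fun k : ℤ => kineticDensity t w (r + k) v := by
  obtain ⟨C, -, hC⟩ := exists_kineticDensity_le ht w r v
  exact .of_norm_bounded (summable_inv_one_add_sq.mul_left C)
    fun k => (hC k w (Metric.mem_ball_self one_pos)).1

theorem summable_kineticDeriv {t : ℝ} (ht : 0 < t) (w r v : ℝ) :
    Summable fun k : ℤ => kineticDeriv t w (r + k) v := by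
  obtain ⟨C, -, hC⟩ := exists_kineticDensity_le ht w r v
  exact .of_norm_bounded (summable_inv_one_add_sq.mul_left C)
    fun k => (hC k w (Metric.mem_ball_self one_pos)).2

theorem hasDerivAt_tsum_kineticDensity {t : ℝ} (ht : 0 < t) (w r v : ℝ) :
    HasDerivAt (fun w => ∑' k : ℤ, kineticDensity t w (r + k) v)
      (∑' k : ℤ, kineticDeriv t w (r + k) v) w := by
  obtain ⟨C, -, hC⟩ := exists_kineticDensity_le ht w r v
  exact hasDerivAt_tsum_of_isPreconnected (summable_inv_one_add_sq.mul_left C)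
    Metric.isOpen_ball (convex_ball w 1).isPreconnected
    (fun k w' _ => hasDerivAt_kineticDensity ht w' (r + k) v)
    (fun k w' hw' => (hC k w' hw').2) (Metric.mem_ball_self one_pos)
    (summable_kineticDensity ht w r v) (Metric.mem_ball_self one_pos)

/-! ### Identification of the kernel -/

variable {N m : ℕ}

theorem integral_count_eq_tsum {ι : Type*} [Countable ι] [MeasurableSpace ι]
    [MeasurableSingletonClass ι] {f : ι → ℝ} (hf : Summable f) :
    ∫ k, f k ∂Measure.count = ∑' k, f k := by
  rw [integral_countable (integrable_count_iff.2 hf.norm)]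
  simp

theorem integral_count_prod {f : Fin N → ℤ → ℝ} (hf : ∀ j, Summable (f j)) :
    ∫ k : Fin N → ℤ, ∏ j, f j (k j) ∂Measure.count = ∏ j, ∑' k, f j k := by
  rw [← pi_count_eq_count, integral_fintype_prod_eq_prod]
  exact Finset.prod_congr rfl fun j _ => integral_count_eq_tsum (hf j)

theorem maxwellian_eq_prod (v : Vel N) :
    maxwellian v = ∏ j, ((√(2 * Real.pi))⁻¹ * Real.exp (-v j ^ 2 / 2)) := by
  rw [Finset.prod_mul_distrib, Finset.prod_const, Finset.card_univ, Fintype.card_fin,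
    ← Real.exp_sum, maxwellian, EuclideanSpace.real_norm_sq_eq]
  congr 1
  · rw [Real.sqrt_eq_rpow, ← Real.rpow_neg (by positivity), ← Real.rpow_natCast,
      ← Real.rpow_mul (by positivity)]
    congr 1; ring
  · congr 1
    rw [← Finset.sum_div, Finset.sum_neg_distrib]

/-- The Gaussian weight is a product over coordinates and the noise map acts on each coordinate
separately. -/
theorem ouDensity_gaussW {t : ℝ} (ht : 0 < t) (p z : Phase N) (k : Fin N → ℤ) :
    ouDensity gaussW t (noiseOf (ouDecay t) p (z, k)) =
      ∏ j, kineticDensity t (p.2 j) (circleLift (z.1 j - p.1 j) + k j) (z.2 j) := by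
  have h1 := ouSigma_pos ht
  have h2 := Real.sqrt_pos.2 (ouVar_pos ht)
  have hJ : (ouJac N t)⁻¹ = ∏ _j : Fin N, (ouSigma t * √(ouVar t))⁻¹ := by
    rw [Finset.prod_const, Finset.card_univ, Fintype.card_fin, inv_pow, ouJac]
  rw [ouDensity, gaussW, maxwellian_eq_prod, maxwellian_eq_prod, hJ, ← Finset.prod_mul_distrib,
    ← Finset.prod_mul_distrib]
  refine Finset.prod_congr rfl fun j _ => ?_
  rw [kineticDensity_eq ht]
  change (ouSigma t * √(ouVar t))⁻¹ * ((√(2 * Real.pi))⁻¹ * Real.exp (-normPos t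
    (circleLift (z.1 j - p.1 j) + k j - (1 - ouDecay t) * p.2 j) (z.2 j - ouDecay t * p.2 j) ^ 2 / 2)
    * ((√(2 * Real.pi))⁻¹ * Real.exp (-normVel t (z.2 j - ouDecay t * p.2 j) ^ 2 / 2))) = _
  have h3 : ∀ a b : ℝ, Real.exp (-(a ^ 2 + b ^ 2) / 2) =
      Real.exp (-a ^ 2 / 2) * Real.exp (-b ^ 2 / 2) := fun a b => by
    rw [← Real.exp_add]; congr 1; ring
  have h4 : (2 * Real.pi * (ouSigma t * √(ouVar t)))⁻¹ =
      (√(2 * Real.pi))⁻¹ * (√(2 * Real.pi))⁻¹ * (ouSigma t * √(ouVar t))⁻¹ := by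
    rw [← mul_inv, ← mul_inv, Real.mul_self_sqrt (by positivity)]
  rw [h3, h4]
  ring

/-- The weight of the derivative in the `i`-th direction. -/
abbrev ouGradWeight (t : ℝ) (i : Fin N) : Vel N × Vel N → ℝ :=
  gradWeight (ouTheta₁ t • EuclideanSpace.single i 1, ouTheta₂ t • EuclideanSpace.single i 1)

theorem ouDensity_gradWeight {t : ℝ} (ht : 0 < t) (i : Fin N) (p z : Phase N) (k : Fin N → ℤ) :
    ouDensity (ouGradWeight t i) t (noiseOf (ouDecay t) p (z, k)) =
      ∏ j, if j = i then kineticDeriv t (p.2 j) (circleLift (z.1 j - p.1 j) + k j) (z.2 j)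
        else kineticDensity t (p.2 j) (circleLift (z.1 j - p.1 j) + k j) (z.2 j) := by
  have h1 := ouDensity_gaussW ht p z k
  set η := ouNoiseInv t (noiseOf (ouDecay t) p (z, k)) with hη
  have h2 : pairing (ouTheta₁ t • EuclideanSpace.single i 1, ouTheta₂ t • EuclideanSpace.single i 1)
      η = ouTheta₁ t * η.1 i + ouTheta₂ t * η.2 i := by
    simp [pairing, inner_smul_left, EuclideanSpace.inner_single_left]
  rw [ouDensity, ← hη, ouGradWeight, gradWeight, h2, mul_left_comm, show (ouJac N t)⁻¹ * gaussW η = _ from h1,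
    ← Finset.mul_prod_erase _ _ (Finset.mem_univ i), ← Finset.mul_prod_erase _ (fun j => if j = i
      then kineticDeriv t (p.2 j) (circleLift (z.1 j - p.1 j) + k j) (z.2 j)
        else kineticDensity t (p.2 j) (circleLift (z.1 j - p.1 j) + k j) (z.2 j))
      (Finset.mem_univ i), ← mul_assoc, if_pos rfl]
  congr 1
  exact Finset.prod_congr rfl fun j hj => (if_neg (Finset.ne_of_mem_erase hj)).symm

theorem ouKernel_gaussW {t : ℝ} (ht : 0 < t) (z p : Phase N) :
    ouKernel gaussW t z p = kineticKernel t z p.1 p.2 := by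
  rw [ouKernel]
  simp_rw [ouDensity_gaussW ht]
  exact integral_count_prod (f := fun j k =>
    kineticDensity t (p.2 j) (circleLift (z.1 j - p.1 j) + k) (z.2 j))
    fun j => summable_kineticDensity ht _ _ _

theorem ouKernel_gradWeight {t : ℝ} (ht : 0 < t) (i : Fin N) (z p : Phase N) :
    ouKernel (ouGradWeight t i) t z p =
      (∏ j ∈ Finset.univ.erase i, ∑' k : ℤ,
        kineticDensity t (p.2 j) (circleLift (z.1 j - p.1 j) + k) (z.2 j)) *
      ∑' k : ℤ, kineticDeriv t (p.2 i) (circleLift (z.1 i - p.1 i) + k) (z.2 i) := by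
  rw [ouKernel]
  simp_rw [ouDensity_gradWeight ht]
  rw [integral_count_prod (f := fun j k => if j = i
    then kineticDeriv t (p.2 j) (circleLift (z.1 j - p.1 j) + k) (z.2 j)
    else kineticDensity t (p.2 j) (circleLift (z.1 j - p.1 j) + k) (z.2 j)) fun j => ?_,
    ← Finset.prod_erase_mul _ _ (Finset.mem_univ i)]
  · simp only [if_true]
    congr 1
    refine Finset.prod_congr rfl fun j hj => ?_
    simp only [if_neg (Finset.ne_of_mem_erase hj)]
  · by_cases hj : j = i
    · simpa only [hj, if_true] using summable_kineticDeriv ht _ _ _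
    · simpa only [hj, if_false] using summable_kineticDensity ht _ _ _

/-- Product rule: the derivative in direction i replaces the i-th factor by its differentiated sum,
which is exactly the kernel with the i-th gradient weight. -/
theorem fderiv_kineticKernel {t : ℝ} (ht : 0 < t) (z p : Phase N) (v : Vel N) :
    fderiv ℝ (fun w : Vel N => kineticKernel t z p.1 w) p.2 v =
      ∑ i, ouKernel (ouGradWeight t i) t z p * v i := by
  have h1 : ∀ j ∈ (Finset.univ : Finset (Fin N)), HasFDerivAt (fun w : Vel N => ∑' k : ℤ,
      kineticDensity t (w j) (circleLift (z.1 j - p.1 j) + k) (z.2 j))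
      ((∑' k : ℤ, kineticDeriv t (p.2 j) (circleLift (z.1 j - p.1 j) + k) (z.2 j)) •
        (EuclideanSpace.proj j : Vel N →L[ℝ] ℝ)) p.2 := fun j _ =>
    HasDerivAt.comp_hasFDerivAt (f := fun w : Vel N => w j) p.2
      (hasDerivAt_tsum_kineticDensity ht (p.2 j) (circleLift (z.1 j - p.1 j)) (z.2 j))
      (EuclideanSpace.proj j : Vel N →L[ℝ] ℝ).hasFDerivAt
  have h2 := HasFDerivAt.finsetProd h1
  have h3 : fderiv ℝ (fun w : Vel N => kineticKernel t z p.1 w) p.2 = _ := h2.fderiv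
  rw [h3, sum_apply]
  refine Finset.sum_congr rfl fun i _ => ?_
  rw [ouKernel_gradWeight ht]
  simp [mul_assoc]

theorem kineticOp_eq {t : ℝ} (ht : 0 ≤ t) (f : L1 N) : kineticOp t f = ouSemigroup t f := by
  rcases ht.eq_or_lt with rfl | ht
  · rw [kineticOp, if_pos rfl, ouSemigroup_zero]
  · rw [kineticOp, if_neg ht.ne']
    refine classOf_eq_of_ae_eq ?_
    filter_upwards [ouAvg_ae_eq ht continuous_gaussW integrable_gaussW f] with z hz
    rw [ouSemigroup, hz.2]
    simp_rw [ouKernel_gaussW ht]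

theorem gradKineticOp_eq (hm : N + 1 < m) {t : ℝ} (ht : 0 < t) (e : Force N m) (f : L1 N) :
    gradKineticOp t e f = ∑ i, ouGrad t (EuclideanSpace.single i 1) (forceMul hm i e f) := by
  refine classOf_eq_of_ae_eq ?_
  have hc : ∀ i, Continuous (ouGradWeight (N := N) t i) := fun i =>
    (continuous_pairing _).mul continuous_gaussW
  have h1 := fun i => ouAvg_ae_eq ht (hc i) (integrable_gradWeight _) (forceMul hm i e f)
  filter_upwards [ae_all_iff.2 h1, Lp.coeFn_finsetSum Finset.univ fun i =>
    ouGrad t (EuclideanSpace.single i 1) (forceMul hm i e f)] with z hz hs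
  rw [hs, Finset.sum_apply]
  have h2 : ∀ i, ouGrad t (EuclideanSpace.single i 1) (forceMul hm i e f) z =
      ∫ p, ouKernel (ouGradWeight t i) t z p * forceMul hm i e f p := fun i => (hz i).2
  simp_rw [h2]
  -- Exchanging the sum with the integral uses the integrability part of `ouAvg_ae_eq`.
  rw [← integral_finsetSum _ fun i _ => (hz i).1]
  refine integral_congr_ae ?_
  filter_upwards [ae_all_iff.2 fun i => forceMul_ae_eq hm i e f] with p hp
  rw [fderiv_kineticKernel ht, Finset.sum_mul]
  refine Finset.sum_congr rfl fun i _ => ?_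
  rw [hp i, mul_assoc]

theorem isMildFP_iff (hm : N + 1 < m) {E : ℝ≥0 → Force N m} (f : L1 N) (u : ℝ≥0 → L1 N) :
    IsMildFP E f u ↔ IsMild (fokkerPlanckFree E) (fokkerPlanckGain hm E) f u := by
  refine and_congr_right fun _ => forall_congr' fun t => ?_
  have h1 : kineticOp (t : ℝ) f = fokkerPlanckFree E t 0 f := by
    rw [kineticOp_eq (NNReal.coe_nonneg t)]
    simp [fokkerPlanckFree]
  have h2 : ∫ s in (0 : ℝ)..t, gradKineticOp (t - s) (E s.toNNReal) (u s.toNNReal) =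
      ∫ s in (0 : ℝ)..t, fokkerPlanckGain hm E t s.toNNReal (u s.toNNReal) := by
    -- The kernels are identified only for positive elapsed time, so the integrals are compared on
    -- the open interval, without the end point s = t.
    rw [intervalIntegral.integral_of_le (NNReal.coe_nonneg t),
      intervalIntegral.integral_of_le (NNReal.coe_nonneg t),
      integral_Ioc_eq_integral_Ioo, integral_Ioc_eq_integral_Ioo]
    refine setIntegral_congr_fun measurableSet_Ioo fun s hs => ?_
    rw [gradKineticOp_eq hm (sub_pos.2 hs.2), fokkerPlanckGain_apply,
      Real.coe_toNNReal _ hs.1.le]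
  rw [h1, h2]

/-! ### The Markov property on the path space -/

section MarkovFamily

variable {Ω S Y : Type*} [mΩ : MeasurableSpace Ω] [mS : MeasurableSpace S] [mY : MeasurableSpace Y]

/-- The conditional probability integrated over a past event. This set form, in extended nonnegative
reals, is the one suited to comparing measures. -/
theorem IsMarkovProcess.measure_inter {μ : Measure Ω} [IsProbabilityMeasure μ]
    {ℱ : Filtration ℝ≥0 mΩ} {X : ℝ≥0 → Ω → S} {P : ℝ≥0 → Kernel S S}
    (h : IsMarkovProcess μ ℱ X P) (t s : ℝ≥0) [IsMarkovKernel (P s)] {A : Set Ω}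
    (hA : MeasurableSet[ℱ t] A) {B : Set S} (hB : MeasurableSet B) :
    μ (A ∩ X (t + s) ⁻¹' B) = ∫⁻ ω in A, P s (X t ω) B ∂μ := by
  have hXt : Measurable (X t) := (h.adapted t).mono (ℱ.le t) le_rfl
  have hB' : MeasurableSet (X (t + s) ⁻¹' B) :=
    ((h.adapted (t + s)).mono (ℱ.le _) le_rfl) hB
  have h1 : ∫ ω in A, (P s (X t ω)).real B ∂μ = μ.real (A ∩ X (t + s) ⁻¹' B) := by
    rw [← integral_congr_ae (ae_restrict_of_ae (h.markov t s B hB)),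
      setIntegral_condExp (ℱ.le t) ((integrable_indicator_iff hB').2
        (integrable_const (1 : ℝ)).integrableOn) hA, setIntegral_indicator hB']
    simp
  have h2 : ∫ ω in A, (P s (X t ω)).real B ∂μ = (∫⁻ ω in A, P s (X t ω) B ∂μ).toReal :=
    integral_toReal (((P s).measurable_coe hB).comp hXt).aemeasurable
      (Eventually.of_forall fun ω => measure_lt_top _ _)
  have h3 : ∫⁻ ω in A, P s (X t ω) B ∂μ ≠ ∞ := by
    refine ne_top_of_le_ne_top (measure_ne_top μ A) ?_
    calc _ ≤ ∫⁻ _ in A, 1 ∂μ := lintegral_mono fun ω => prob_le_one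
      _ = μ A := by simp
  rw [h1, measureReal_def] at h2
  exact (ENNReal.toReal_eq_toReal_iff' (measure_ne_top _ _) h3).1 h2

theorem isMarkovProcess_of_measure_inter {μ : Measure Ω} [IsProbabilityMeasure μ]
    {ℱ : Filtration ℝ≥0 mΩ} {X : ℝ≥0 → Ω → S} {P : ℝ≥0 → Kernel S S}
    (hP : ∀ t, IsMarkovKernel (P t)) (hX : ∀ t, Measurable[ℱ t] (X t))
    (h : ∀ t s A B, MeasurableSet[ℱ t] A → MeasurableSet B →
      μ (A ∩ X (t + s) ⁻¹' B) = ∫⁻ ω in A, P s (X t ω) B ∂μ) : IsMarkovProcess μ ℱ X P where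
  adapted := hX
  markov t s B hB := by
    have hXt : Measurable (X t) := (hX t).mono (ℱ.le t) le_rfl
    have hB' : MeasurableSet (X (t + s) ⁻¹' B) := ((hX (t + s)).mono (ℱ.le _) le_rfl) hB
    have hm : Measurable fun ω => (P s (X t ω)).real B :=
      (((P s).measurable_coe hB).comp hXt).ennreal_toReal
    have hi : Integrable (fun ω => (P s (X t ω)).real B) μ :=
      (integrable_const (1 : ℝ)).mono' hm.aestronglyMeasurable (Eventually.of_forall fun ω => by
        rw [Real.norm_of_nonneg measureReal_nonneg]; exact measureReal_le_one)
    refine (ae_eq_condExp_of_forall_setIntegral_eq (ℱ.le t) ((integrable_indicator_iff hB').2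
        (integrable_const (1 : ℝ)).integrableOn) (fun A _ _ => hi.integrableOn) (fun A hA _ => ?_)
        ?_).symm
    · rw [setIntegral_indicator hB']
      have h2 : ∫ ω in A, (P s (X t ω)).real B ∂μ = (∫⁻ ω in A, P s (X t ω) B ∂μ).toReal :=
        integral_toReal (((P s).measurable_coe hB).comp hXt).aemeasurable
          (Eventually.of_forall fun ω => measure_lt_top _ _)
      rw [h2, ← h t s A B hA hB]
      simp [measureReal_def]
    · have h3 : Measurable[ℱ t] fun ω => (P s (X t ω)).real B :=
        (((P s).measurable_coe hB).comp (hX t)).ennreal_toReal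
      exact h3.aestronglyMeasurable

/-- The laws `Law e` of a Markov process `X` started from `e`, on a space with shifts `θ`. -/
structure IsMarkovFamily (X : ℝ≥0 → Ω → S) (θ : ℝ≥0 → Ω → Ω) (ℱ : Filtration ℝ≥0 mΩ)
    (P : ℝ≥0 → Kernel S S) (Law : Kernel S Ω) : Prop where
  gen : mΩ = ⨆ t, mS.comap (X t)
  shift : ∀ t s ω, X s (θ t ω) = X (t + s) ω
  isMarkovKernel : IsMarkovKernel Law
  transition : ∀ t, IsMarkovKernel (P t)
  start : ∀ e, ∀ᵐ ω ∂(Law e), X 0 ω = e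
  markov : ∀ e, IsMarkovProcess (Law e) ℱ X P

variable {X : ℝ≥0 → Ω → S} {θ : ℝ≥0 → Ω → Ω} {ℱ : Filtration ℝ≥0 mΩ}
  {P : ℝ≥0 → Kernel S S} {Law : Kernel S Ω}

theorem IsMarkovFamily.measurable (h : IsMarkovFamily X θ ℱ P Law) (t : ℝ≥0) :
    Measurable (X t) := by
  have h1 := h.gen
  exact measurable_iff_comap_le.2 (h1 ▸ le_iSup (fun t => mS.comap (X t)) t)

theorem IsMarkovFamily.measurable_shift (h : IsMarkovFamily X θ ℱ P Law) (t : ℝ≥0) :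
    Measurable (θ t) := by
  have h1 : ∀ s, Measurable fun ω => X s (θ t ω) := fun s => by
    simp_rw [h.shift]; exact h.measurable _
  rw [measurable_iff_comap_le]
  conv_lhs => rw [h.gen]
  rw [MeasurableSpace.comap_iSup]
  refine iSup_le fun s => ?_
  rw [MeasurableSpace.comap_comp]
  exact (h1 s).comap_le

/-- On a past event, the law of X at time t + s is the law at time t propagated by P s. Passing from
sets to functions allows the property to be iterated. -/
theorem IsMarkovFamily.lintegral_comp (h : IsMarkovFamily X θ ℱ P Law) (e : S) (t s : ℝ≥0)
    {A : Set Ω} (hA : MeasurableSet[ℱ t] A) {g : S → ℝ≥0∞} (hg : Measurable g) :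
    ∫⁻ ω in A, g (X (t + s) ω) ∂(Law e) = ∫⁻ ω in A, ∫⁻ x, g x ∂(P s (X t ω)) ∂(Law e) := by
  have := h.isMarkovKernel
  have := h.transition s
  have h1 : ((Law e).restrict A).map (X (t + s)) = (P s) ∘ₘ ((Law e).restrict A).map (X t) := by
    refine Measure.ext fun B hB => ?_
    rw [Measure.map_apply (h.measurable _) hB, Measure.restrict_apply (h.measurable _ hB),
      Measure.bind_apply hB (P s).measurable.aemeasurable,
      lintegral_map ((P s).measurable_coe hB) (h.measurable _), inter_comm]
    exact (h.markov e).measure_inter t s hA hB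
  rw [← lintegral_map hg (h.measurable _), h1, Measure.lintegral_bind (P s).measurable.aemeasurable
    hg.aemeasurable, lintegral_map hg.lintegral_kernel (h.measurable _)]

/-- Later times are integrated out first: if a is the earliest time and H' treats the later ones
from a, then H(x) is the integral of H' over B a against P (a - c) x. The point is that H depends
neither on t nor on the starting point e. -/
theorem IsMarkovFamily.exists_cylinder (h : IsMarkovFamily X θ ℱ P Law) (B : ℝ≥0 → Set S)
    (hB : ∀ r, MeasurableSet (B r)) (F : Finset ℝ≥0) : ∀ c, (∀ r ∈ F, c ≤ r) →
    ∃ H : S → ℝ≥0∞, Measurable H ∧ ∀ t e A, MeasurableSet[ℱ (t + c)] A →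
      Law e (A ∩ ⋂ r ∈ F, X (t + r) ⁻¹' B r) = ∫⁻ ω in A, H (X (t + c) ω) ∂(Law e) := by
  induction F using Finset.induction_on_min with
  | empty => exact fun c _ => ⟨fun _ => 1, measurable_const, fun t e A hA => by simp⟩
  | insert a F haF ih =>
    intro c hc
    obtain ⟨H', hH', hH⟩ := ih a fun r hr => (haF r hr).le
    have hca : c ≤ a := hc a (Finset.mem_insert_self _ _)
    have hm : Measurable ((B a).indicator H') := hH'.indicator (hB a)
    have := h.transition (a - c)
    refine ⟨fun x => ∫⁻ y, (B a).indicator H' y ∂(P (a - c) x), hm.lintegral_kernel,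
      fun t e A hA => ?_⟩
    have hta : t + c + (a - c) = t + a := by rw [add_assoc, add_tsub_cancel_of_le hca]
    have hA' : MeasurableSet[ℱ (t + a)] A := ℱ.mono (by gcongr) _ hA
    have hXa : MeasurableSet[ℱ (t + a)] (X (t + a) ⁻¹' B a) := (h.markov e).adapted _ (hB a)
    rw [← h.lintegral_comp e (t + c) (a - c) hA hm, hta, Finset.set_biInter_insert, ← inter_assoc,
      hH t e _ (hA'.inter hXa), inter_comm, ← Measure.restrict_restrict (ℱ.le _ _ hXa),
      ← lintegral_indicator (ℱ.le _ _ hXa)]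
    rfl

/-- The Markov property for the whole future: both sides are finite measures in B, so it suffices to
compare them on finite-dimensional cylinders. -/
theorem IsMarkovFamily.measure_inter_shift (h : IsMarkovFamily X θ ℱ P Law) (e : S) (t : ℝ≥0)
    {A : Set Ω} (hA : MeasurableSet[ℱ t] A) {B : Set Ω} (hB : MeasurableSet B) :
    Law e (A ∩ θ t ⁻¹' B) = ∫⁻ ω in A, Law (X t ω) B ∂(Law e) := by
  have := h.isMarkovKernel
  have h1 : ((Law e).restrict A).map (θ t) = Law ∘ₘ ((Law e).restrict A).map (X t) := by
    have hgen : mΩ = MeasurableSpace.generateFrom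
        (piiUnionInter (fun r => {s | MeasurableSet[mS.comap (X r)] s}) univ) := by
      rw [generateFrom_piiUnionInter_measurableSet (fun r => mS.comap (X r)) univ]
      simpa using h.gen
    refine ext_of_generate_finite _ hgen
      (isPiSystem_piiUnionInter _ (fun r => @MeasurableSpace.isPiSystem_measurableSet _
        (mS.comap (X r))) univ) ?_ ?_
    · rintro _ ⟨F, -, f, hf, rfl⟩
      have hf' : ∀ r, ∃ b, MeasurableSet b ∧ (r ∈ F → X r ⁻¹' b = f r) := by
        intro r
        by_cases hr : r ∈ F
        · obtain ⟨b, hb, hb'⟩ := hf r hr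
          exact ⟨b, hb, fun _ => hb'⟩
        · exact ⟨∅, MeasurableSet.empty, fun h => absurd h hr⟩
      choose b hb hbf using hf'
      have hfb : ⋂ r ∈ F, f r = ⋂ r ∈ F, X r ⁻¹' b r :=
        iInter₂_congr fun r hr => (hbf r hr).symm
      rw [hfb]
      obtain ⟨H, hHm, hH⟩ := h.exists_cylinder b hb F 0 fun _ _ => zero_le
      have hC : MeasurableSet (⋂ r ∈ F, X r ⁻¹' b r) :=
        Finset.measurableSet_biInter _ fun r _ => h.measurable r (hb r)
      -- The cylinder formula at t = 0 with the whole space as past event, where X starts from x,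
      -- identifies H with the law of the cylinder.
      have hH0 : ∀ x, Law x (⋂ r ∈ F, X r ⁻¹' b r) = H x := by
        intro x
        have h2 := hH 0 x univ MeasurableSet.univ
        simp only [zero_add, univ_inter, Measure.restrict_univ] at h2
        rw [h2, lintegral_congr_ae (g := fun _ => H x)
          ((h.start x).mono fun ω hω => by beta_reduce; rw [hω])]
        simp
      rw [Measure.map_apply (h.measurable_shift t) hC,
        Measure.restrict_apply (h.measurable_shift t hC), Measure.bind_apply hC
        Law.measurable.aemeasurable, lintegral_map (Law.measurable_coe hC) (h.measurable t)]
      simp_rw [hH0]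
      have h3 : θ t ⁻¹' (⋂ r ∈ F, X r ⁻¹' b r) = ⋂ r ∈ F, X (t + r) ⁻¹' b r := by
        simp only [preimage_iInter, ← preimage_comp]
        refine iInter₂_congr fun r _ => ?_
        congr 1
        funext ω
        exact h.shift t r ω
      have h4 := hH t e A (by rwa [add_zero])
      rw [h3, inter_comm, h4]
      simp
    · rw [Measure.map_apply (h.measurable_shift t) .univ, Measure.bind_apply .univ
        Law.measurable.aemeasurable]
      simp [Measure.map_apply (h.measurable t) .univ]
  have h2 := congrArg (fun ν => ν B) h1
  beta_reduce at h2
  rwa [Measure.map_apply (h.measurable_shift t) hB, Measure.restrict_apply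
    (h.measurable_shift t hB), Measure.bind_apply hB Law.measurable.aemeasurable,
    lintegral_map (Law.measurable_coe hB) (h.measurable t), inter_comm] at h2

/-- A variable known at time t may be frozen while the future is resampled. On rectangles the
condition on V is absorbed into the past event, and rectangles determine finite measures on a
product. -/
theorem IsMarkovFamily.measure_inter_prod (h : IsMarkovFamily X θ ℱ P Law) (e : S) (t : ℝ≥0)
    {V : Ω → Y} (hV : Measurable[ℱ t] V) {A : Set Ω} (hA : MeasurableSet[ℱ t] A)
    {B : Set (Y × Ω)} (hB : MeasurableSet B) :
    Law e (A ∩ (fun ω => (V ω, θ t ω)) ⁻¹' B) =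
      ∫⁻ ω in A, ((Kernel.id : Kernel Y Y) ∥ₖ Law) (V ω, X t ω) B ∂(Law e) := by
  have := h.isMarkovKernel
  set K := (Kernel.id : Kernel Y Y) ∥ₖ Law
  have hV' : Measurable V := hV.mono (ℱ.le t) le_rfl
  have hVθ : Measurable fun ω => (V ω, θ t ω) := hV'.prodMk (h.measurable_shift t)
  have hVX : Measurable fun ω => (V ω, X t ω) := hV'.prodMk (h.measurable t)
  have h1 : ((Law e).restrict A).map (fun ω => (V ω, θ t ω)) =
      K ∘ₘ ((Law e).restrict A).map (fun ω => (V ω, X t ω)) := by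
    refine Measure.ext_prod fun {C D} hC hD => ?_
    rw [Measure.map_apply hVθ (hC.prod hD), Measure.restrict_apply (hVθ (hC.prod hD)),
      Measure.bind_apply (hC.prod hD) K.measurable.aemeasurable,
      lintegral_map (K.measurable_coe (hC.prod hD)) hVX]
    have h2 : (fun ω => (V ω, θ t ω)) ⁻¹' C ×ˢ D ∩ A = (A ∩ V ⁻¹' C) ∩ θ t ⁻¹' D := by
      ext ω; simp [and_comm, and_left_comm]
    have hVC := hV hC
    rw [h2, h.measure_inter_shift e t (hA.inter hVC) hD, inter_comm,
      ← Measure.restrict_restrict (hV' hC), ← lintegral_indicator (hV' hC)]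
    refine lintegral_congr fun ω => ?_
    rw [Kernel.parallelComp_apply, Measure.prod_prod, Kernel.id_apply, Measure.dirac_apply' _ hC]
    by_cases hω : V ω ∈ C
    · simp [hω]
    · simp [hω]
  have h2 := congrArg (fun ν => ν B) h1
  beta_reduce at h2
  rwa [Measure.map_apply hVθ hB, Measure.restrict_apply (hVθ hB), Measure.bind_apply hB
    K.measurable.aemeasurable, lintegral_map (K.measurable_coe hB) hVX, inter_comm] at h2

/-- A process `U` driven by `X`: an adapted cocycle over the shifts. -/
structure IsDrivenCocycle (X : ℝ≥0 → Ω → S) (θ : ℝ≥0 → Ω → Ω) (ℱ : Filtration ℝ≥0 mΩ)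
    (U : ℝ≥0 → Y → Ω → Y) : Prop where
  measurable_driver : Measurable fun q : ℝ≥0 × Ω => X q.1 q.2
  measurable : Measurable fun q : ℝ≥0 × (Y × Ω) => U q.1 q.2.1 q.2.2
  adapted : ∀ t y, Measurable[ℱ t] (U t y)
  zero : ∀ y ω, U 0 y ω = y
  add : ∀ t s y ω, U (t + s) y ω = U s (U t y ω) (θ t ω)

/-- The pair of the driven process and its driver is a Markov process. -/
theorem IsMarkovFamily.exists_transition (h : IsMarkovFamily X θ ℱ P Law)
    {U : ℝ≥0 → Y → Ω → Y} (hU : IsDrivenCocycle X θ ℱ U) :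
    ∃ T : ℝ≥0 → Kernel (Y × S) (Y × S), IsTransitionFunction T ∧
      ∀ y e, IsMarkovProcess (Law e) ℱ (fun t ω => (U t y ω, X t ω)) T := by
  have := h.isMarkovKernel
  set K := (Kernel.id : Kernel Y Y) ∥ₖ Law with hK
  set Φ : ℝ≥0 → Y × Ω → Y × S := fun t q => (U t q.1 q.2, X t q.2) with hΦ
  have hΦ2 : Measurable fun p : ℝ≥0 × (Y × Ω) => Φ p.1 p.2 :=
    hU.measurable.prodMk (hU.measurable_driver.comp
      (measurable_fst.prodMk (measurable_snd.comp measurable_snd)))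
  have hΦ1 : ∀ t, Measurable (Φ t) := fun t => hΦ2.comp measurable_prodMk_left
  have hKap : ∀ y e, K (y, e) = (Law e).map (Prod.mk y) := by
    intro y e
    rw [hK, Kernel.parallelComp_apply, Kernel.id_apply, Measure.dirac_prod]
  have hTap : ∀ t y e B, MeasurableSet B → (K.map (Φ t)) (y, e) B =
      Law e {ω | (U t y ω, X t ω) ∈ B} := by
    intro t y e B hB
    rw [Kernel.map_apply' _ (hΦ1 t) _ hB, hKap,
      Measure.map_apply measurable_prodMk_left (hΦ1 t hB)]
    rfl
  -- The cocycle identity writes the pair at time t + s as `Φ s` evaluated at (U_t, shifted path),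
  -- to which the Markov property with frozen U_t applies.
  have key : ∀ t s y e A B, MeasurableSet[ℱ t] A → MeasurableSet B →
      Law e (A ∩ (fun ω => (U (t + s) y ω, X (t + s) ω)) ⁻¹' B) =
        ∫⁻ ω in A, (K.map (Φ s)) (U t y ω, X t ω) B ∂(Law e) := by
    intro t s y e A B hA hB
    have h1 : (fun ω => (U (t + s) y ω, X (t + s) ω)) =
        Φ s ∘ fun ω => (U t y ω, θ t ω) := by
      funext ω
      simp only [hΦ, Function.comp_apply, hU.add, h.shift]
    rw [h1, preimage_comp, h.measure_inter_prod e t (hU.adapted t y) hA (hΦ1 s hB)]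
    refine lintegral_congr fun ω => ?_
    rw [Kernel.map_apply' _ (hΦ1 s) _ hB]
  have hTM : ∀ t, IsMarkovKernel (K.map (Φ t)) := fun t => Kernel.IsMarkovKernel.map _ (hΦ1 t)
  refine ⟨fun t => K.map (Φ t), ⟨hTM, fun B hB => ?_, ?_, fun t s => ?_⟩, fun y e => ?_⟩
  -- T_t(x, B) is the K-measure of a section of one measurable set that includes the time variable,
  -- so it is measurable in (t, x) jointly.
  · have h1 : MeasurableSet {p : (ℝ≥0 × (Y × S)) × (Y × Ω) | Φ p.1.1 p.2 ∈ B} :=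
      (hΦ2.comp ((measurable_fst.comp measurable_fst).prodMk measurable_snd)) hB
    have h2 := Kernel.measurable_kernel_prodMk_left (κ := K.prodMkLeft ℝ≥0) h1
    have h3 : (fun q : ℝ≥0 × (Y × S) => (K.map (Φ q.1)) q.2 B) = fun q => (K.prodMkLeft ℝ≥0) q
        (Prod.mk q ⁻¹' {p : (ℝ≥0 × (Y × S)) × (Y × Ω) | Φ p.1.1 p.2 ∈ B}) := by
      funext q
      rw [Kernel.map_apply' _ (hΦ1 _) _ hB, Kernel.prodMkLeft_apply]
      rfl
    rwa [← h3] at h2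
  · refine Kernel.ext fun x => Measure.ext fun B hB => ?_
    obtain ⟨y, e⟩ := x
    rw [hTap _ _ _ _ hB, Kernel.id_apply, Measure.dirac_apply' _ hB]
    have h1 : {ω | (U 0 y ω, X 0 ω) ∈ B} =ᵐ[Law e] {_ω : Ω | (y, e) ∈ B} := by
      filter_upwards [h.start e] with ω hω
      exact propext (by change (U 0 y ω, X 0 ω) ∈ B ↔ _; rw [hU.zero, hω]; rfl)
    rw [measure_congr h1]
    by_cases hyB : (y, e) ∈ B <;> simp [hyB]
  -- Chapman-Kolmogorov is `key` with the whole space as past event.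
  · refine Kernel.ext fun x => Measure.ext fun B hB => ?_
    obtain ⟨y, e⟩ := x
    have h1 := key t s y e univ B MeasurableSet.univ hB
    rw [univ_inter, Measure.restrict_univ] at h1
    rw [hTap _ _ _ _ hB, Kernel.comp_apply' _ _ _ hB, Kernel.map_apply _ (hΦ1 t),
      lintegral_map (Kernel.measurable_coe _ hB) (hΦ1 t)]
    refine h1.trans ?_
    have hm : Measurable fun a => (K.map (Φ s)) (Φ t a) B :=
      (Kernel.measurable_coe _ hB).comp (hΦ1 t)
    rw [hKap, lintegral_map hm measurable_prodMk_left]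
  · refine isMarkovProcess_of_measure_inter hTM (fun t => ?_) fun t s A B hA hB =>
      key t s y e A B hA hB
    exact (hU.adapted t y).prodMk ((h.markov e).adapted t)

end MarkovFamily

/-! ### Càdlàg paths -/

variable {N m : ℕ}

/-- One-sided limits bound the path near every time, and compactness of [0,T] makes the bound
uniform. -/
theorem IsCadlag.exists_norm_le {X : Type*} [NormedAddCommGroup X] {ω : ℝ≥0 → X}
    (h : IsCadlag ω) (T : ℝ≥0) : ∃ B, 0 ≤ B ∧ ∀ t ≤ T, ‖ω t‖ ≤ B := by
  have key : ∃ B, ∀ t ∈ Icc 0 T, ‖ω t‖ ≤ B := by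
    refine (isCompact_Icc (a := (0 : ℝ≥0)) (b := T)).induction_on
      (p := fun s => ∃ B, ∀ t ∈ s, ‖ω t‖ ≤ B) ⟨0, by simp⟩
      (fun s s' hs ⟨B, hB⟩ => ⟨B, fun t ht => hB t (hs ht)⟩) ?_ ?_
    · rintro s s' ⟨B, hB⟩ ⟨B', hB'⟩
      refine ⟨max B B', fun t ht => ?_⟩
      rcases ht with ht | ht
      · exact (hB t ht).trans (le_max_left _ _)
      · exact (hB' t ht).trans (le_max_right _ _)
    · intro t _
      obtain ⟨h1, l, h2⟩ := h t
      have h3 : ∀ᶠ s in 𝓝[≥] t, ‖ω s‖ ≤ ‖ω t‖ + 1 :=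
        (h1.norm.eventually (gt_mem_nhds (lt_add_one _))).mono fun s hs => le_of_lt hs
      have h4 : ∀ᶠ s in 𝓝[<] t, ‖ω s‖ ≤ ‖l‖ + 1 :=
        (h2.norm.eventually (gt_mem_nhds (lt_add_one _))).mono fun s hs => le_of_lt hs
      have h5 : ∀ᶠ s in 𝓝 t, ‖ω s‖ ≤ max (‖ω t‖ + 1) (‖l‖ + 1) := by
        rw [← nhdsLT_sup_nhdsGE, eventually_sup]
        exact ⟨h4.mono fun s hs => hs.trans (le_max_right _ _),
          h3.mono fun s hs => hs.trans (le_max_left _ _)⟩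
      exact ⟨_, mem_nhdsWithin_of_mem_nhds h5, _, fun s hs => hs⟩
  obtain ⟨B, hB⟩ := key
  exact ⟨B, (norm_nonneg _).trans (hB 0 ⟨le_rfl, zero_le⟩), fun t ht => hB t ⟨zero_le, ht⟩⟩

/-- The right end of the `k`-th cell of the grid `ℕ / (n + 1)`. -/
def gridPoint (n k : ℕ) : ℝ≥0 := (k + 1) / (n + 1)

/-- The index of the cell of the grid `ℕ / (n + 1)` that contains `s`. -/
def gridIndex (n : ℕ) (s : ℝ≥0) : ℕ := ⌊(n + 1) * s⌋₊

@[fun_prop]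
theorem measurable_gridIndex (n : ℕ) : Measurable (gridIndex n) := by
  unfold gridIndex; fun_prop

theorem le_gridPoint (n : ℕ) (s : ℝ≥0) : s ≤ gridPoint n (gridIndex n s) := by
  rw [gridPoint, le_div_iff₀ (by positivity), mul_comm]
  exact (Nat.lt_floor_add_one _).le

theorem gridPoint_le (n : ℕ) (s : ℝ≥0) : gridPoint n (gridIndex n s) ≤ s + 1 / (n + 1) := by
  rw [gridPoint, add_div]
  gcongr
  rw [div_le_iff₀ (by positivity), mul_comm]
  exact Nat.floor_le zero_le

/-- Sampling at right end points approaches s from the right, where a càdlàg path is continuous. -/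
theorem tendsto_gridPoint (s : ℝ≥0) :
    Tendsto (fun n => gridPoint n (gridIndex n s)) atTop (𝓝[≥] s) := by
  refine tendsto_nhdsWithin_iff.2 ⟨?_, Eventually.of_forall fun n => le_gridPoint n s⟩
  refine tendsto_of_tendsto_of_tendsto_of_le_of_le tendsto_const_nhds ?_
    (fun n => le_gridPoint n s) (fun n => gridPoint_le n s)
  simpa using (tendsto_const_nhds (x := s)).add (tendsto_one_div_add_atTop_nhds_zero_nat (𝕜 := ℝ≥0))

/-- The last cell may end after T. Cutting sampling times off at T keeps the approximation adapted
and does not harm convergence from the right on [0,T]. -/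
theorem tendsto_min_gridPoint {s T : ℝ≥0} (h : s ≤ T) :
    Tendsto (fun n => min T (gridPoint n (gridIndex n s))) atTop (𝓝[≥] s) := by
  refine tendsto_nhdsWithin_iff.2 ⟨?_, Eventually.of_forall fun n => le_min h (le_gridPoint n s)⟩
  have h1 := (tendsto_const_nhds (x := T) (f := atTop (α := ℕ))).min
    (tendsto_nhdsWithin_iff.1 (tendsto_gridPoint s)).1
  rwa [min_eq_right h] at h1

theorem measurable_uncurry_coord :
    Measurable fun q : ℝ≥0 × PathSpace N m => coord q.1 q.2 := by
  have h1 : ∀ n : ℕ, Measurable fun q : ℝ≥0 × PathSpace N m =>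
      coord (gridPoint n (gridIndex n q.1)) q.2 := by
    intro n
    have h2 : Measurable fun q : ℕ × PathSpace N m => coord (gridPoint n q.1) q.2 :=
      measurable_from_prod_countable_right fun k =>
        measurable_coord (N := N) (m := m) (gridPoint n k)
    have h3 : Measurable fun q : ℝ≥0 × PathSpace N m => (gridIndex n q.1, q.2) :=
      ((measurable_gridIndex n).comp measurable_fst).prodMk measurable_snd
    exact h2.comp h3
  refine measurable_of_tendsto_metrizable h1 (tendsto_pi_nhds.2 fun q => ?_)
  exact (q.2.2 q.1).1.tendsto.comp (tendsto_gridPoint q.1)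

theorem isForcing_path (ω : PathSpace N m) : IsForcing ω.1 where
  measurable := measurable_uncurry_coord.comp (measurable_prodMk_right (y := ω))
  bounded := ω.2.exists_norm_le

theorem IsCadlag.comp_add {X : Type*} [TopologicalSpace X] {ω : ℝ≥0 → X} (h : IsCadlag ω)
    (c : ℝ≥0) : IsCadlag fun s => ω (c + s) := fun s => by
  have hc : Tendsto (fun s : ℝ≥0 => c + s) (𝓝 s) (𝓝 (c + s)) :=
    (by fun_prop : Continuous fun s : ℝ≥0 => c + s).tendsto s
  obtain ⟨h1, l, h2⟩ := h (c + s)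
  refine ⟨?_, l, ?_⟩
  · have h3 : Tendsto (fun s : ℝ≥0 => c + s) (𝓝[≥] s) (𝓝[≥] (c + s)) :=
      hc.inf (tendsto_principal_principal.2 fun r hr => add_le_add_right (mem_Ici.1 hr) c)
    exact h1.tendsto.comp h3
  · have h3 : Tendsto (fun s : ℝ≥0 => c + s) (𝓝[<] s) (𝓝[<] (c + s)) :=
      hc.inf (tendsto_principal_principal.2 fun r hr => add_lt_add_right (mem_Iio.1 hr) c)
    exact h2.comp h3

/-- The shift of paths. -/
def shiftPath (c : ℝ≥0) (ω : PathSpace N m) : PathSpace N m :=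
  ⟨fun s => ω.1 (c + s), ω.2.comp_add c⟩

theorem measurableSpace_pathSpace :
    (inferInstance : MeasurableSpace (PathSpace N m)) =
      ⨆ t, (inferInstance : MeasurableSpace (Force N m)).comap (coord t) := by
  have : (inferInstance : MeasurableSpace (PathSpace N m)) =
    (MeasurableSpace.pi (X := fun _ : ℝ≥0 => Force N m)).comap Subtype.val := rfl
  rw [this, MeasurableSpace.pi, MeasurableSpace.comap_iSup]
  refine iSup_congr fun t => ?_
  rw [MeasurableSpace.comap_comp]
  rfl

theorem IsMixingForceField.isMarkovFamily {Ω : Type*} [MeasurableSpace Ω] {μ : Measure Ω}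
    {Ebar : ℝ≥0 → Ω → Force N m} {P : ℝ≥0 → Kernel (Force N m) (Force N m)}
    {Law : Kernel (Force N m) (PathSpace N m)} {R : ℝ} (h : IsMixingForceField μ Ebar P Law R) :
    IsMarkovFamily coord shiftPath (pathFiltration N m) P Law where
  gen := measurableSpace_pathSpace
  shift _ _ _ := rfl
  isMarkovKernel := h.path_isMarkovKernel
  transition := h.transition.isMarkovKernel
  start := h.path_start
  markov := h.path_markov

theorem measurable_coord_pathFiltration {s t : ℝ≥0} (h : s ≤ t) :
    Measurable[pathFiltration N m t] (coord s : PathSpace N m → Force N m) := by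
  rw [measurable_iff_comap_le]
  exact le_iSup (fun r : Iic t => (inferInstance : MeasurableSpace (Force N m)).comap (coord r.1))
    ⟨s, h⟩

/-! ### The solution as a driven cocycle -/

variable {G H : (ℝ≥0 → Force N m) → ℝ≥0 → ℝ≥0 → L1 N →L[ℝ] L1 N}

theorem IsForcedEvolution.tendsto_mildSol (hGH : IsForcedEvolution G H)
    {En : ℕ → ℝ≥0 → Force N m} {E : ℝ≥0 → Force N m} {B : ℝ} {T : ℝ≥0} (hB : 0 ≤ B)
    (hE : IsForcing E) (hEn : ∀ n, IsForcing (En n)) (hBE : ∀ t ≤ T, ‖E t‖ ≤ B)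
    (hBEn : ∀ n, ∀ t ≤ T, ‖En n t‖ ≤ B)
    (hlim : ∀ t ≤ T, Tendsto (fun n => En n t) atTop (𝓝 (E t))) (f : L1 N) :
    Tendsto (fun n => mildSol (G (En n)) (H (En n)) f T) atTop (𝓝 (mildSol (G E) (H E) f T)) := by
  obtain ⟨κ, hκ, hb⟩ := hGH.bound B T hB
  have ht := hGH.tendsto En E B T hB hE hEn hBE hBEn hlim
  exact StochKinetic.tendsto_mildSol hκ (hGH.evolution E hE) (fun n => hGH.evolution _ (hEn n))
    (hb E hE hBE) (fun n => hb _ (hEn n) (hBEn n)) (fun t htT x => (ht 0 t zero_le htT x).1)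
    (fun s t hst htT x => (ht s t hst.le htT x).2 hst) f

/-- The path that is constant on the cells of the grid. -/
def gridPath (n : ℕ) (a : ℕ → Force N m) (s : ℝ≥0) : Force N m := a (gridIndex n s)

theorem gridIndex_le {n : ℕ} {s T : ℝ≥0} (h : s ≤ T) : gridIndex n s ≤ gridIndex n T :=
  Nat.floor_mono (by gcongr)

theorem norm_gridPath_le {n : ℕ} (a : ℕ → Force N m) {s T : ℝ≥0} (h : s ≤ T) :
    ‖gridPath n a s‖ ≤ ∑ k ∈ Finset.range (gridIndex n T + 1), ‖a k‖ :=
  Finset.single_le_sum (f := fun k => ‖a k‖) (fun _ _ => norm_nonneg _)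
    (Finset.mem_range.2 (Nat.lt_succ_of_le (gridIndex_le h)))

theorem isForcing_gridPath (n : ℕ) (a : ℕ → Force N m) : IsForcing (gridPath n a) where
  measurable := (measurable_of_countable a).comp (measurable_gridIndex n)
  bounded _ := ⟨_, Finset.sum_nonneg fun _ _ => norm_nonneg _, fun _ ht => norm_gridPath_le a ht⟩

theorem IsForcedEvolution.continuous_gridPath (hGH : IsForcedEvolution G H) (n : ℕ) (T : ℝ≥0)
    (f : L1 N) : Continuous fun a : ℕ → Force N m =>
      mildSol (G (gridPath n a)) (H (gridPath n a)) f T := by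
  refine SeqContinuous.continuous fun a a₀ ha => ?_
  have ha' := tendsto_pi_nhds.1 ha
  -- Only finitely many cells meet [0,T], so a coordinatewise convergent sequence gives uniformly
  -- bounded step paths.
  have h1 : Tendsto (fun j => ∑ k ∈ Finset.range (gridIndex n T + 1), ‖a j k‖) atTop
      (𝓝 (∑ k ∈ Finset.range (gridIndex n T + 1), ‖a₀ k‖)) :=
    tendsto_finsetSum _ fun k _ => (ha' k).norm
  obtain ⟨B, hB⟩ := h1.bddAbove_range
  have hB' : ∀ j, ∑ k ∈ Finset.range (gridIndex n T + 1), ‖a j k‖ ≤ B := fun j => hB ⟨j, rfl⟩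
  have hB0 := le_of_tendsto' h1 hB'
  exact hGH.tendsto_mildSol (B := B)
    ((Finset.sum_nonneg fun _ _ => norm_nonneg _).trans hB0)
    (isForcing_gridPath n a₀) (fun j => isForcing_gridPath n (a j))
    (fun t ht => (norm_gridPath_le a₀ ht).trans hB0)
    (fun j t ht => (norm_gridPath_le (a j) ht).trans (hB' j)) (fun t _ => ha' _) f

theorem measurable_comp_coord {Y : Type*} [TopologicalSpace Y] [MeasurableSpace Y] [BorelSpace Y]
    {F : (ℕ → Force N m) → Y} (hF : Continuous F) {T : ℝ≥0} {τ : ℕ → ℝ≥0} (hτ : ∀ k, τ k ≤ T) :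
    Measurable[pathFiltration N m T] fun ω : PathSpace N m => F fun k => coord (τ k) ω := by
  have h1 : Measurable[pathFiltration N m T] fun (ω : PathSpace N m) (k : ℕ) => coord (τ k) ω :=
    @measurable_pi_lambda _ _ _ (pathFiltration N m T) _ _ fun k =>
      measurable_coord_pathFiltration (hτ k)
  exact Measurable.comp hF.measurable h1

theorem measurable_of_tendsto_comp_coord {Y : Type*} [TopologicalSpace Y]
    [TopologicalSpace.PseudoMetrizableSpace Y] [MeasurableSpace Y] [BorelSpace Y]
    {F : ℕ → (ℕ → Force N m) → Y} (hF : ∀ n, Continuous (F n)) {T : ℝ≥0} {τ : ℕ → ℕ → ℝ≥0}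
    (hτ : ∀ n k, τ n k ≤ T) {V : PathSpace N m → Y}
    (hV : ∀ ω, Tendsto (fun n => F n fun k => coord (τ n k) ω) atTop (𝓝 (V ω))) :
    Measurable[pathFiltration N m T] V :=
  @measurable_of_tendsto_metrizable _ _ (pathFiltration N m T) _ _ _ _ _ _
    (fun n => measurable_comp_coord (hF n) (hτ n)) (tendsto_pi_nhds.2 hV)

theorem norm_gridPath_coord_le {ω : PathSpace N m} {B : ℝ} {T : ℝ≥0}
    (hB : ∀ t ≤ T, ‖ω.1 t‖ ≤ B) (n : ℕ) (t : ℝ≥0) :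
    ‖gridPath n (fun k => coord (min T (gridPoint n k)) ω) t‖ ≤ B :=
  hB (min T (gridPoint n (gridIndex n t))) (min_le_left _ _)

theorem tendsto_gridPath_coord (ω : PathSpace N m) {t T : ℝ≥0} (ht : t ≤ T) :
    Tendsto (fun n => gridPath n (fun k => coord (min T (gridPoint n k)) ω) t) atTop
      (𝓝 (ω.1 t)) :=
  (ω.2 t).1.tendsto.comp (tendsto_min_gridPoint ht)

theorem IsForcedEvolution.tendsto_gridPath (hGH : IsForcedEvolution G H) (T : ℝ≥0) (f : L1 N)
    (ω : PathSpace N m) : Tendsto (fun n =>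
      (fun a : ℕ → Force N m => mildSol (G (gridPath n a)) (H (gridPath n a)) f T)
        fun k => coord (min T (gridPoint n k)) ω) atTop (𝓝 (mildSol (G ω.1) (H ω.1) f T)) := by
  obtain ⟨B, hB0, hB⟩ := ω.2.exists_norm_le T
  have h1 := fun n => isForcing_gridPath n fun k => coord (min T (gridPoint n k)) ω
  have h2 : ∀ n, ∀ t ≤ T, ‖gridPath n (fun k => coord (min T (gridPoint n k)) ω) t‖ ≤ B :=
    fun n t _ => norm_gridPath_coord_le hB n t
  have h3 := fun (t : ℝ≥0) (ht : t ≤ T) => tendsto_gridPath_coord ω ht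
  exact hGH.tendsto_mildSol hB0 (isForcing_path ω) h1 hB h2 h3 f

/-- Adaptedness without a topology on the path space: the solution is a pointwise limit of
continuous functions of countably many coordinates at times at most T. -/
theorem IsForcedEvolution.measurable_mildSol_path (hGH : IsForcedEvolution G H) (T : ℝ≥0)
    (f : L1 N) : Measurable[pathFiltration N m T] fun ω : PathSpace N m =>
      mildSol (G ω.1) (H ω.1) f T :=
  measurable_of_tendsto_comp_coord (hGH.continuous_gridPath · T f)
    (τ := fun n k => min T (gridPoint n k)) (fun _ _ => min_le_left _ _)
    (hGH.tendsto_gridPath T f)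

theorem IsForcedEvolution.isDrivenCocycle (hGH : IsForcedEvolution G H) :
    IsDrivenCocycle coord shiftPath (pathFiltration N m)
      fun t f (ω : PathSpace N m) => mildSol (G ω.1) (H ω.1) f t where
  measurable_driver := measurable_uncurry_coord
  measurable := by
    have hev := fun ω : PathSpace N m => hGH.evolution ω.1 (isForcing_path ω)
    -- Joint measurability by two Carathéodory arguments: Lipschitz in the datum and measurable in
    -- the path, then continuous in time and measurable in the rest.
    have h1 : ∀ t : ℝ≥0, Measurable fun q : L1 N × PathSpace N m =>
        mildSol (G q.2.1) (H q.2.1) q.1 t := fun t =>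
      measurable_uncurry_of_continuous_of_measurable
        (u := fun (f : L1 N) (ω : PathSpace N m) => mildSol (G ω.1) (H ω.1) f t)
        (fun ω => by
          obtain ⟨C, hC⟩ := (hev ω).continuous_mildSol_datum t
          exact (LipschitzWith.of_dist_le_mul (K := C.toNNReal) fun f g => by
            rw [dist_eq_norm, dist_eq_norm]
            refine (hC t le_rfl f g).trans ?_
            gcongr
            exact Real.le_coe_toNNReal C).continuous)
        (fun f => (hGH.measurable_mildSol_path t f).mono ((pathFiltration N m).le t) le_rfl)
    exact measurable_uncurry_of_continuous_of_measurable
      (u := fun (t : ℝ≥0) (q : L1 N × PathSpace N m) => mildSol (G q.2.1) (H q.2.1) q.1 t)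
      (fun q => ((hev q.2).isMild_mildSol q.1).1) h1
  adapted t f := hGH.measurable_mildSol_path t f
  zero f ω := by
    have hG := hGH.evolution ω.1 (isForcing_path ω)
    rw [(hG.isMild_mildSol f).2 0, hG.refl]
    simp
  add t s f ω := by
    have hG := hGH.evolution ω.1 (isForcing_path ω)
    have hG' := hGH.evolution _ ((isForcing_path ω).comp_add t)
    -- The operators driven by the shifted path are the time-shifted operators, so the cocycle
    -- identity becomes the restart property of mild solutions.
    have e1 : G (shiftPath t ω).1 = fun r q => G ω.1 (t + r) (t + q) := by
      funext r q; exact hGH.shift ω.1 (isForcing_path ω) t r q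
    have e2 : H (shiftPath t ω).1 = fun r q => H ω.1 (t + r) (t + q) := by
      funext r q; exact hGH.shift' ω.1 (isForcing_path ω) t r q
    have hG'' : IsEvolution (G (shiftPath t ω).1) (H (shiftPath t ω).1) := hG'
    rw [e1, e2] at hG''
    rw [e1, e2]
    exact hG.mildSol_add f t hG'' s

theorem exists_isForcedEvolution (hm : N + 1 < m) (Q : Collision) :
    ∃ G H : (ℝ≥0 → Force N m) → ℝ≥0 → ℝ≥0 → L1 N →L[ℝ] L1 N, IsForcedEvolution G H ∧
      ∀ E, IsForcing E → ∀ f u, IsMildSolution Q E f u ↔ IsMild (G E) (H E) f u := by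
  cases Q with
  | linearBoltzmann =>
    exact ⟨_, _, isForcedEvolution_boltzmann hm, fun E hE f u => isMildLB_iff hm hE f u⟩
  | fokkerPlanck =>
    exact ⟨_, _, isForcedEvolution_fokkerPlanck hm, fun E _ f u => isMildFP_iff hm f u⟩

end StochKinetic

end

/-! ### Conclusion: well-posedness and the Markov property of the pair -/

open StochKinetic in
theorem mainTheorem5 {N m : ℕ} (hN : 0 < N) (hm : N + 1 < m)
    {Ω : Type*} [MeasurableSpace Ω] (μ : Measure Ω) (Ebar : ℝ≥0 → Ω → Force N m)
    (P : ℝ≥0 → Kernel (Force N m) (Force N m)) (Law : Kernel (Force N m) (PathSpace N m)) (R : ℝ)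
    (hE : IsMixingForceField μ Ebar P Law R) (Q : Collision) :
    (∀ (f : L1 N) (ω : PathSpace N m), ∃! u : ℝ≥0 → L1 N, IsMildSolution Q ω.1 f u) ∧
    ∃ T : ℝ≥0 → Kernel (L1 N × Force N m) (L1 N × Force N m),
      IsTransitionFunction T ∧
      ∀ (f : L1 N) (e : Force N m) (u : ℝ≥0 → PathSpace N m → L1 N),
        (∀ ω : PathSpace N m, IsMildSolution Q ω.1 f (fun t => u t ω)) →
        (∀ᵐ ω ∂(Law e), (u 0 ω, coord 0 ω) = (f, e)) ∧
        IsMarkovProcess (Law e) (pathFiltration N m) (fun t ω => (u t ω, coord t ω)) T := by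
  obtain ⟨G, H, hGH, hiff⟩ := exists_isForcedEvolution hm Q
  have hev := fun ω : PathSpace N m => hGH.evolution ω.1 (isForcing_path ω)
  have hcoc := hGH.isDrivenCocycle
  obtain ⟨T, hT, hTM⟩ := hE.isMarkovFamily.exists_transition hcoc
  refine ⟨fun f ω => ⟨mildSol (G ω.1) (H ω.1) f, (hiff ω.1 (isForcing_path ω) f _).2
    ((hev ω).isMild_mildSol f), fun u hu =>
      (hev ω).eq_mildSol ((hiff ω.1 (isForcing_path ω) f u).1 hu)⟩, T, hT, fun f e u hu => ?_⟩
  -- Uniqueness, path by path, forces u to be the constructed solution, which supplies its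
  -- adaptedness and its measurability in ω.
  have hu' : u = fun t ω => mildSol (G ω.1) (H ω.1) f t := by
    funext t ω
    exact congrFun ((hev ω).eq_mildSol ((hiff ω.1 (isForcing_path ω) f _).1 (hu ω))) t
  subst hu'
  refine ⟨?_, hTM f e⟩
  filter_upwards [hE.path_start e] with ω hω
  exact Prod.ext (hcoc.zero f ω) hω
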